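/- Conventions. A scaled simplicial set is a simplicial set with a set of thin triangles containing the degenerate ones; for a set \(S\) of triangles, \((\Delta^n,S)\) and \((\Lambda^n_i,S|)\) carry the degenerate triangles and those in \(S\) as thin triangles. The core \(X^{\mathrm{th}}\) is the simplicial subset of the simplices all of whose triangles are thin. An \(\infty\)-bicategory is a scaled simplicial set with the extension property for: (i) \((\Lambda^n_i,\{\Delta^{\{i-1,i,i+1\}}\}|)\subseteq(\Delta^n,\{\Delta^{\{i-1,i,i+1\}}\})\), \(0<i<n\); (ii) \((\Delta^4,T)\to(\Delta^4,T\cup\{\Delta^{\{0,3,4\}},\Delta^{\{0,1,4\}}\})\), where \(T=\{\Delta^{\{0,2,4\}},\Delta^{\{1,2,3\}},\Delta^{\{0,1,3\}},\Delta^{\{1,3,4\}},\Delta^{\{0,1,2\}}\}\); (iii) \((\Lambda^n_0\amalg_{\Delta^{\{0,1\}}}\Delta^0,\{\Delta^{\{0,1,n\}}\})\subseteq(\Delta^n\amalg_{\Delta^{\{0,1\}}}\Delta^0,\{\Delta^{\{0,1,n\}}\})\), \(n\ge3\). A map of scaled simplicial sets is a weak fibration if it has the right lifting property (RLP) against (i),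 against the maps in (iii) for all \(n\ge2\), with scaling on the horn \(\{\Delta^{\{0,1,n\}}\}|\), and against their duals \((\Lambda^n_n\amalg_{\Delta^{\{n-1,n\}}}\Delta^0,\{\Delta^{\{0,n-1,n\}}\}|)\subseteq(\Delta^n\amalg_{\Delta^{\{n-1,n\}}}\Delta^0,\{\Delta^{\{0,n-1,n\}}\})\), \(n\ge2\). For a map \(p\colon\mathcal E\to\mathcal B\), an edge \(e\) of \(\mathcal E\) is \(p\)-cartesian if for \(n\ge2\) all lifting problems of \((\Lambda^n_n,\{\Delta^{\{0,n-1,n\}}\}|)\subseteq(\Delta^n,\{\Delta^{\{0,n-1,n\}}\})\) against \(p\) that restrict to \(e\) on \(\Delta^{\{n-1,n\}}\) are solvable; it is \(p\)-cocartesian if \(e^{\mathrm{op}}\) is \(p^{\mathrm{op}}\)-cartesian. A triangle \(\sigma\) of \(\mathcal E\) is left \(p\)-inner, right \(p\)-inner, left \(p\)-outer, right \(p\)-outer if for all \(n\ge3\) the lifting problems against the underlying simplicial map of \(p\) of, respectively, \(\Lambda^n_{n-1},\Lambda^n_1,\Lambda^n_0,\Lambda^n_n\subseteq\Delta^n\)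 that restrict to \(\sigma\) on, respectively, \(\Delta^{\{n-2,n-1,n\}},\Delta^{\{0,1,2\}},\Delta^{\{0,1,n\}},\Delta^{\{0,n-1,n\}}\) are solvable. A weak fibration \(p\) has cartesian lifts if every edge \(b\to p(e)\) of \(\mathcal B\) is the image of a \(p\)-cartesian edge with target \(e\). It is an inner cartesian 2-fibration if it has cartesian lifts and every triangle of \(\mathcal B\) with a lift of its restriction to \(\Lambda^2_1\) has a left \(p\)-inner lift and a right \(p\)-inner lift extending the given one. It is an outer cartesian 2-fibration if it has cartesian lifts; every triangle of \(\mathcal B\) with a lift of its restriction to \(\Lambda^2_0\) (resp. \(\Lambda^2_2\)) which is \(p\)-cocartesian on \(\Delta^{\{0,1\}}\) (resp. \(p\)-cartesian on \(\Delta^{\{1,2\}}\)) has a left (resp. right) \(p\)-outer lift extending it; and for every 3-simplex of \(\mathcal E\): if its faces \(023\) and \(123\) are thin and \(012\) is left \(p\)-outer, then \(013\) is left \(p\)-outer, and if \(012\) and \(013\) are thin and \(123\) is right \(p\)-outer, then \(023\) is right \(p\)-outer. The cocartesian versions are defined by passing to \(p^{\mathrm{op}}\). Statement. Let \(p\colon\mathcal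 E\to\mathcal B\) be a map of scaled simplicial sets which has the RLP against the map (ii) (this is automatic if \(\mathcal E\) is an \(\infty\)-bicategory). 1. If \(p\) is a weak fibration, then \(p^{\mathrm{th}}\colon\mathcal E^{\mathrm{th}}\to\mathcal B^{\mathrm{th}}\) is an inner fibration of simplicial sets, every \(p\)-cartesian edge is \(p^{\mathrm{th}}\)-cartesian, and every \(p\)-cocartesian edge is \(p^{\mathrm{th}}\)-cocartesian. 2. If \(p\) is an inner or outer cartesian (resp. cocartesian) 2-fibration, then \(p^{\mathrm{th}}\) is a cartesian (resp. cocartesian) fibration of simplicial sets. 3. If \(\mathcal E\) and \(\mathcal B\) are \(\infty\)-bicategories and \(p\) is an inner or outer, cartesian or cocartesian 2-fibration, then \(p\) is a fibration in the bicategorical model structure on scaled simplicial sets, i.e. the model structure whose cofibrations are the monomorphisms and whose fibrant objects are the \(\infty\)-bicategories. -/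

import Mathlib

open CategoryTheory Simplicial Opposite MonoidalCategory

universe u

/-! ### Simplices of horns -/

namespace SSet

/-- The edge `Δ^{a,b}` of the horn `Λ[n, i]`; it lies in the horn as soon as some vertex `k ≠ i`
is different from `a` and `b`. -/
def hornEdge {n : ℕ} (i a b k : Fin (n + 1)) (hab : a ≤ b)
    (hk : k ≠ i ∧ k ≠ a ∧ k ≠ b) : (Λ[n, i] : SSet.{u}) _⦋1⦌ :=
  ⟨stdSimplex.edge n a b hab, by
    rw [mem_horn_iff_notMem_range]
    refine ⟨k, hk.1, ?_⟩
    rintro ⟨x, hx⟩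
    fin_cases x
    · exact hk.2.1 hx.symm
    · exact hk.2.2 hx.symm⟩

/-- The triangle `Δ^{a,b,c}` of the horn `Λ[n, i]`; it lies in the horn as soon as some vertex
`k ≠ i` is different from `a`, `b` and `c`. -/
def hornTriangle {n : ℕ} (i a b c k : Fin (n + 1)) (hab : a ≤ b) (hbc : b ≤ c)
    (hk : k ≠ i ∧ k ≠ a ∧ k ≠ b ∧ k ≠ c) : (Λ[n, i] : SSet.{u}) _⦋2⦌ :=
  ⟨stdSimplex.triangle a b c hab hbc, by
    rw [mem_horn_iff_notMem_range]
    refine ⟨k, hk.1, ?_⟩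
    rintro ⟨x, hx⟩
    fin_cases x
    · exact hk.2.1 hx.symm
    · exact hk.2.2.1 hx.symm
    · exact hk.2.2.2 hx.symm⟩

/-- The last edge `Δ^{n-1,n}` of the horn `Λ^n_n`, for `n = m + 2`. -/
abbrev hornLastEdge (m : ℕ) : (Λ[m + 2, Fin.last (m + 2)] : SSet.{u}) _⦋1⦌ :=
  hornEdge _ (Fin.last (m + 1)).castSucc (Fin.last (m + 2)) 0 (Fin.le_last _)
    (by simp [Fin.ext_iff])

/-- The first edge `Δ^{0,1}` of the horn `Λ^n_0`, for `n = m + 2`. -/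
abbrev hornFirstEdge (m : ℕ) : (Λ[m + 2, 0] : SSet.{u}) _⦋1⦌ :=
  hornEdge _ 0 1 (Fin.last (m + 2)) (Fin.zero_le _) (by simp [Fin.ext_iff])

/-! ### (Co)cartesian edges and (co)cartesian fibrations of simplicial sets -/

section

variable {X Y : SSet.{u}}

/-- An edge `e` of `X` is `q`-cartesian if, for all `n ≥ 2`, every lifting problem of `Λ^n_n ⊆ Δ^n`
against `q` whose restriction to `Δ^{n-1,n}` is `e` has a solution. -/
def IsCartesianEdge (q : X ⟶ Y) (e : X _⦋1⦌) : Prop :=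
  ∀ (m : ℕ) (u : (Λ[m + 2, Fin.last (m + 2)] : SSet.{u}) ⟶ X) (v : Δ[m + 2] ⟶ Y)
    (sq : CommSq u Λ[m + 2, Fin.last (m + 2)].ι q v),
    u.app _ (hornLastEdge m) = e → sq.HasLift

/-- An edge is `q`-cocartesian if the opposite edge is `q^op`-cartesian. -/
def IsCocartesianEdge (q : X ⟶ Y) (e : X _⦋1⦌) : Prop :=
  IsCartesianEdge (opFunctor.map q) (opObjEquiv.symm e)

/-- A cartesian fibration of simplicial sets: an inner fibration `q` such that every edge of the
base with target `q x` is the image of a `q`-cartesian edge with target `x`. -/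
structure IsCartesianFibration (q : X ⟶ Y) : Prop where
  innerFibration : InnerFibration q
  exists_lift (x : X _⦋0⦌) (e : Y _⦋1⦌) (he : Y.δ 0 e = q.app _ x) :
    ∃ e' : X _⦋1⦌, IsCartesianEdge q e' ∧ X.δ 0 e' = x ∧ q.app _ e' = e

/-- `q` is a cocartesian fibration if `q^op` is a cartesian fibration. -/
def IsCocartesianFibration (q : X ⟶ Y) : Prop :=
  IsCartesianFibration (opFunctor.map q)

end

end SSet

open SSet

/-! ### Scaled simplicial sets -/

/-- A scaled simplicial set: a simplicial set with a set of thin triangles which contains the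
degenerate triangles. -/
structure ScaledSSet : Type (u + 1) where
  toSSet : SSet.{u}
  thin : Set (toSSet _⦋2⦌)
  degenerate_subset_thin : toSSet.degenerate 2 ⊆ thin

namespace ScaledSSet

/-- Maps of scaled simplicial sets: maps of simplicial sets which preserve thin triangles. -/
@[ext]
structure Hom (X Y : ScaledSSet.{u}) : Type u where
  toHom : X.toSSet ⟶ Y.toSSet
  map_thin : ∀ t ∈ X.thin, toHom.app _ t ∈ Y.thin

instance : Category ScaledSSet.{u} where
  Hom := Hom
  id X := { toHom := 𝟙 _, map_thin := fun _ ht => ht }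
  comp f g :=
    { toHom := f.toHom ≫ g.toHom
      map_thin := fun t ht => g.map_thin _ (f.map_thin t ht) }

/-- The opposite scaled simplicial set, with the same thin triangles. -/
protected def op (X : ScaledSSet.{u}) : ScaledSSet.{u} where
  toSSet := X.toSSet.op
  thin := {t | opObjEquiv t ∈ X.thin}
  degenerate_subset_thin := fun t ht =>
    X.degenerate_subset_thin ((opObjEquiv_mem_degenerate_iff X.toSSet t).2 ht)

/-- The opposite of a map of scaled simplicial sets. -/
def opMap {X Y : ScaledSSet.{u}} (p : X ⟶ Y) : X.op ⟶ Y.op where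
  toHom := opFunctor.map p.toHom
  map_thin := fun t ht => p.map_thin (opObjEquiv t) ht

/-- The core `X^th`: the simplicial subset of those simplices all of whose triangles are thin. -/
def core (X : ScaledSSet.{u}) : X.toSSet.Subcomplex where
  obj n := {x | ∀ f : n ⟶ op ⦋2⦌, X.toSSet.map f x ∈ X.thin}
  map g x hx f := by
    have := hx (g ≫ f)
    rwa [X.toSSet.map_comp] at this

/-- The map `p^th : X^th ⟶ Y^th` induced on cores. -/
def coreMap {X Y : ScaledSSet.{u}} (p : X ⟶ Y) :
    (X.core : SSet.{u}) ⟶ (Y.core : SSet.{u}) :=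
  Subcomplex.lift (X.core.ι ≫ p.toHom) (by
    rintro n _ ⟨x, rfl⟩ f
    have h := p.map_thin _ (x.2 f)
    rwa [NatTrans.naturality_apply] at h)

/-- Every edge of a scaled simplicial set lies in the core. -/
lemma edge_mem_core (X : ScaledSSet.{u}) (e : X.toSSet _⦋1⦌) : e ∈ X.core.obj (op ⦋1⦌) :=
  fun f => X.degenerate_subset_thin ⟨1, by lia, f.unop, ⟨e, rfl⟩⟩

/-- An edge of `X`, considered as an edge of the core of `X`. -/
def coreEdge (X : ScaledSSet.{u}) (e : X.toSSet _⦋1⦌) : (X.core : SSet.{u}) _⦋1⦌ :=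
  ⟨e, X.edge_mem_core e⟩

/-! ### Scaled simplices and scaled horns -/

/-- The standard simplex `Δ^n` whose thin triangles are those of `S` and the degenerate ones. -/
def simplex (n : ℕ) (S : Set ((Δ[n] : SSet.{u}) _⦋2⦌)) : ScaledSSet.{u} where
  toSSet := Δ[n]
  thin := Δ[n].degenerate 2 ∪ S
  degenerate_subset_thin := Set.subset_union_left

/-- The horn `Λ^n_i` whose thin triangles are those of `S` which it contains and the degenerate
ones. -/
def horn (n : ℕ) (i : Fin (n + 1)) (S : Set ((Δ[n] : SSet.{u}) _⦋2⦌)) : ScaledSSet.{u} where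
  toSSet := Λ[n, i]
  thin := (Λ[n, i] : SSet.{u}).degenerate 2 ∪ {t | t.1 ∈ S}
  degenerate_subset_thin := Set.subset_union_left

/-- The inclusion `(Λ^n_i, S|Λ^n_i) ⊆ (Δ^n, S)`. -/
def hornι (n : ℕ) (i : Fin (n + 1)) (S : Set ((Δ[n] : SSet.{u}) _⦋2⦌)) :
    horn n i S ⟶ simplex n S where
  toHom := Λ[n, i].ι
  map_thin := by
    rintro t (ht | ht)
    · exact Or.inl (degenerate_app_apply ht Λ[n, i].ι)
    · exact Or.inr ht

/-- The map `(Δ^n, S) ⟶ (Δ^n, S')` which is the identity on simplices, for `S ⊆ S'`. -/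
def simplexRescale (n : ℕ) {S S' : Set ((Δ[n] : SSet.{u}) _⦋2⦌)} (h : S ⊆ S') :
    simplex n S ⟶ simplex n S' where
  toHom := 𝟙 _
  map_thin := fun _ ht => Set.union_subset_union_right _ h ht

/-- `{Δ^{i-1,i,i+1}}` in `Δ^n`, where `n = m + 2` and `i = j + 1`. -/
def innerTri {m : ℕ} (j : Fin (m + 1)) : Set ((Δ[m + 2] : SSet.{u}) _⦋2⦌) :=
  {stdSimplex.triangle j.castSucc.castSucc j.succ.castSucc j.succ.succ
    (by simp [Fin.le_def]) (by simp [Fin.le_def])}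

/-- `{Δ^{0,1,n}}` in `Δ^n`, where `n = m + 2`. -/
def leftTri (m : ℕ) : Set ((Δ[m + 2] : SSet.{u}) _⦋2⦌) :=
  {stdSimplex.triangle 0 1 (Fin.last (m + 2)) (Fin.zero_le _) (Fin.le_last _)}

/-- `{Δ^{0,n-1,n}}` in `Δ^n`, where `n = m + 2`. -/
def rightTri (m : ℕ) : Set ((Δ[m + 2] : SSet.{u}) _⦋2⦌) :=
  {stdSimplex.triangle 0 (Fin.last (m + 1)).castSucc (Fin.last (m + 2)) (Fin.zero_le _)
    (Fin.le_last _)}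

/-- `T = {Δ^{0,2,4}, Δ^{1,2,3}, Δ^{0,1,3}, Δ^{1,3,4}, Δ^{0,1,2}}` in `Δ^4`. -/
def satTri : Set ((Δ[4] : SSet.{u}) _⦋2⦌) :=
  {stdSimplex.triangle 0 2 4 (by decide) (by decide),
   stdSimplex.triangle 1 2 3 (by decide) (by decide),
   stdSimplex.triangle 0 1 3 (by decide) (by decide),
   stdSimplex.triangle 1 3 4 (by decide) (by decide),
   stdSimplex.triangle 0 1 2 (by decide) (by decide)}

/-- `T ∪ {Δ^{0,3,4}, Δ^{0,1,4}}` in `Δ^4`. -/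
def satTri' : Set ((Δ[4] : SSet.{u}) _⦋2⦌) :=
  satTri ∪ {stdSimplex.triangle 0 3 4 (by decide) (by decide),
    stdSimplex.triangle 0 1 4 (by decide) (by decide)}

/-- The generating scaled anodyne map `(Δ^4, T) ⟶ (Δ^4, T ∪ {Δ^{0,3,4}, Δ^{0,1,4}})`. -/
def saturationMap : simplex.{u} 4 satTri ⟶ simplex 4 satTri' :=
  simplexRescale 4 Set.subset_union_left

/-! ### `∞`-bicategories -/

/-- An `∞`-bicategory: a scaled simplicial set with the extension property for the generating
scaled anodyne maps. A map out of `Λ^n_0 ⨿_{Δ^{0,1}} Δ^0` is a map out of `Λ^n_0` which is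
degenerate on the edge `Δ^{0,1}`, and an extension of it to `Δ^n ⨿_{Δ^{0,1}} Δ^0` is an extension
to `Δ^n`. -/
structure IsInftyBicategory (C : ScaledSSet.{u}) : Prop where
  inner (m : ℕ) (j : Fin (m + 1)) (u : horn (m + 2) j.succ.castSucc (innerTri j) ⟶ C) :
    ∃ l : simplex (m + 2) (innerTri j) ⟶ C, hornι _ _ _ ≫ l = u
  saturation (u : simplex 4 satTri ⟶ C) : ∃ l : simplex 4 satTri' ⟶ C, saturationMap ≫ l = u
  outer (m : ℕ) (hm : 3 ≤ m + 2) (u : horn (m + 2) 0 (leftTri m) ⟶ C)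
    (hu : u.toHom.app _ (hornFirstEdge m) ∈ C.toSSet.degenerate 1) :
    ∃ l : simplex (m + 2) (leftTri m) ⟶ C, hornι _ _ _ ≫ l = u

/-! ### Weak fibrations, (co)cartesian edges, inner and outer triangles -/

section

variable {E B : ScaledSSet.{u}}

/-- Weak fibrations: the right lifting property with respect to
`(Λ^n_i, {Δ^{i-1,i,i+1}}|) ⊆ (Δ^n, {Δ^{i-1,i,i+1}})` for `0 < i < n`,
`(Λ^n_0 ⨿_{Δ^{0,1}} Δ^0, {Δ^{0,1,n}}|) ⊆ (Δ^n ⨿_{Δ^{0,1}} Δ^0, {Δ^{0,1,n}})` and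
`(Λ^n_n ⨿_{Δ^{n-1,n}} Δ^0, {Δ^{0,n-1,n}}|) ⊆ (Δ^n ⨿_{Δ^{n-1,n}} Δ^0, {Δ^{0,n-1,n}})`, `n ≥ 2`.
Maps out of these pushouts are maps out of the horn or the simplex which are degenerate on the
collapsed edge; for the map to `B` and for the lift this follows from the condition on the horn. -/
structure IsWeakFibration (p : E ⟶ B) : Prop where
  inner (m : ℕ) (j : Fin (m + 1)) :
    HasLiftingProperty (hornι (m + 2) j.succ.castSucc (innerTri j)) p
  left (m : ℕ) (u : horn (m + 2) 0 (leftTri m) ⟶ E) (v : simplex (m + 2) (leftTri m) ⟶ B)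
    (sq : CommSq u (hornι _ _ _) p v)
    (hu : u.toHom.app _ (hornFirstEdge m) ∈ E.toSSet.degenerate 1) : sq.HasLift
  right (m : ℕ) (u : horn (m + 2) (Fin.last (m + 2)) (rightTri m) ⟶ E)
    (v : simplex (m + 2) (rightTri m) ⟶ B) (sq : CommSq u (hornι _ _ _) p v)
    (hu : u.toHom.app _ (hornLastEdge m) ∈ E.toSSet.degenerate 1) : sq.HasLift

/-- An edge `e` of `E` is `p`-cartesian if, for all `n ≥ 2`, every lifting problem of
`(Λ^n_n, {Δ^{0,n-1,n}}|) ⊆ (Δ^n, {Δ^{0,n-1,n}})` against `p` whose restriction to `Δ^{n-1,n}` is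
`e` has a solution. -/
def IsCartesianEdge (p : E ⟶ B) (e : E.toSSet _⦋1⦌) : Prop :=
  ∀ (m : ℕ) (u : horn (m + 2) (Fin.last (m + 2)) (rightTri m) ⟶ E)
    (v : simplex (m + 2) (rightTri m) ⟶ B) (sq : CommSq u (hornι _ _ _) p v),
    u.toHom.app _ (hornLastEdge m) = e → sq.HasLift

/-- An edge is `p`-cocartesian if the opposite edge is `p^op`-cartesian. -/
def IsCocartesianEdge (p : E ⟶ B) (e : E.toSSet _⦋1⦌) : Prop :=
  IsCartesianEdge (opMap p) (opObjEquiv.symm e)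

/-- A triangle `t` of `E` is left `p`-inner if the corresponding edge of the slice `E_{/t(2)}` is
cartesian with respect to `E_{/t(2)} ⟶ E ×_B B_{/p t(2)}` (on underlying simplicial sets): for
`n ≥ 3`, the lifting problems of `Λ^n_{n-1} ⊆ Δ^n` whose restriction to `Δ^{n-2,n-1,n}` is `t` have
solutions. -/
def IsLeftInner (p : E ⟶ B) (t : E.toSSet _⦋2⦌) : Prop :=
  ∀ (m : ℕ) (u : (Λ[m + 3, (Fin.last (m + 2)).castSucc] : SSet.{u}) ⟶ E.toSSet)
    (v : Δ[m + 3] ⟶ B.toSSet) (sq : CommSq u Λ[m + 3, (Fin.last (m + 2)).castSucc].ι p.toHom v),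
    u.app _ (hornTriangle _ (Fin.last (m + 1)).castSucc.castSucc (Fin.last (m + 2)).castSucc
      (Fin.last (m + 3)) 0 (by simp [Fin.le_def]) (Fin.le_last _) (by simp [Fin.ext_iff])) = t →
    sq.HasLift

/-- A triangle `t` of `E` is right `p`-inner if the corresponding edge of the slice `E_{t(0)/}` is
cocartesian with respect to `E_{t(0)/} ⟶ E ×_B B_{p t(0)/}` (on underlying simplicial sets): for
`n ≥ 3`, the lifting problems of `Λ^n_1 ⊆ Δ^n` whose restriction to `Δ^{0,1,2}` is `t` have
solutions. -/
def IsRightInner (p : E ⟶ B) (t : E.toSSet _⦋2⦌) : Prop :=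
  ∀ (m : ℕ) (u : (Λ[m + 3, 1] : SSet.{u}) ⟶ E.toSSet)
    (v : Δ[m + 3] ⟶ B.toSSet) (sq : CommSq u Λ[m + 3, 1].ι p.toHom v),
    u.app _ (hornTriangle _ 0 1 2 (Fin.last (m + 3)) (Fin.zero_le _)
      (by simp [Fin.le_def, Nat.mod_eq_of_lt])
      (by simp [Fin.ext_iff, Nat.mod_eq_of_lt])) = t →
    sq.HasLift

/-- A triangle `t` of `E` is left `p`-outer if the corresponding edge of the slice `E_{/t(2)}` is
cocartesian with respect to `E_{/t(2)} ⟶ E ×_B B_{/p t(2)}` (on underlying simplicial sets): for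
`n ≥ 3`, the lifting problems of `Λ^n_0 ⊆ Δ^n` whose restriction to `Δ^{0,1,n}` is `t` have
solutions. -/
def IsLeftOuter (p : E ⟶ B) (t : E.toSSet _⦋2⦌) : Prop :=
  ∀ (m : ℕ) (u : (Λ[m + 3, 0] : SSet.{u}) ⟶ E.toSSet)
    (v : Δ[m + 3] ⟶ B.toSSet) (sq : CommSq u Λ[m + 3, 0].ι p.toHom v),
    u.app _ (hornTriangle _ 0 1 (Fin.last (m + 3)) 2 (Fin.zero_le _) (Fin.le_last _)
      (by simp [Fin.ext_iff, Nat.mod_eq_of_lt])) = t →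
    sq.HasLift

/-- A triangle `t` of `E` is right `p`-outer if the corresponding edge of the slice `E_{t(0)/}` is
cartesian with respect to `E_{t(0)/} ⟶ E ×_B B_{p t(0)/}` (on underlying simplicial sets): for
`n ≥ 3`, the lifting problems of `Λ^n_n ⊆ Δ^n` whose restriction to `Δ^{0,n-1,n}` is `t` have
solutions. -/
def IsRightOuter (p : E ⟶ B) (t : E.toSSet _⦋2⦌) : Prop :=
  ∀ (m : ℕ) (u : (Λ[m + 3, Fin.last (m + 3)] : SSet.{u}) ⟶ E.toSSet)
    (v : Δ[m + 3] ⟶ B.toSSet) (sq : CommSq u Λ[m + 3, Fin.last (m + 3)].ι p.toHom v),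
    u.app _ (hornTriangle _ 0 (Fin.last (m + 2)).castSucc (Fin.last (m + 3)) 1 (Fin.zero_le _)
      (Fin.le_last _) (by simp [Fin.ext_iff])) = t →
    sq.HasLift

/-! ### Inner and outer (co)cartesian 2-fibrations -/

/-- Every triangle of `B` with a lift of its restriction to `Λ^2_1` has a left `p`-inner lift. -/
def IsLeftInner2Fibration (p : E ⟶ B) : Prop :=
  ∀ (r : (Λ[2, 1] : SSet.{u}) ⟶ E.toSSet) (s : Δ[2] ⟶ B.toSSet),
    r ≫ p.toHom = Λ[2, 1].ι ≫ s →
    ∃ s' : Δ[2] ⟶ E.toSSet, IsLeftInner p (yonedaEquiv s') ∧ s' ≫ p.toHom = s ∧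
      Λ[2, 1].ι ≫ s' = r

/-- Every triangle of `B` with a lift of its restriction to `Λ^2_1` has a right `p`-inner lift. -/
def IsRightInner2Fibration (p : E ⟶ B) : Prop :=
  ∀ (r : (Λ[2, 1] : SSet.{u}) ⟶ E.toSSet) (s : Δ[2] ⟶ B.toSSet),
    r ≫ p.toHom = Λ[2, 1].ι ≫ s →
    ∃ s' : Δ[2] ⟶ E.toSSet, IsRightInner p (yonedaEquiv s') ∧ s' ≫ p.toHom = s ∧
      Λ[2, 1].ι ≫ s' = r

/-- Every triangle of `B` with a lift of its restriction to `Λ^2_0` which is `p`-cocartesian on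
`Δ^{0,1}` has a left `p`-outer lift. -/
def IsLeftOuter2Fibration (p : E ⟶ B) : Prop :=
  ∀ (r : (Λ[2, 0] : SSet.{u}) ⟶ E.toSSet) (s : Δ[2] ⟶ B.toSSet),
    r ≫ p.toHom = Λ[2, 0].ι ≫ s →
    IsCocartesianEdge p (r.app _ (hornFirstEdge 0)) →
    ∃ s' : Δ[2] ⟶ E.toSSet, IsLeftOuter p (yonedaEquiv s') ∧ s' ≫ p.toHom = s ∧
      Λ[2, 0].ι ≫ s' = r

/-- Every triangle of `B` with a lift of its restriction to `Λ^2_2` which is `p`-cartesian on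
`Δ^{1,2}` has a right `p`-outer lift. -/
def IsRightOuter2Fibration (p : E ⟶ B) : Prop :=
  ∀ (r : (Λ[2, Fin.last 2] : SSet.{u}) ⟶ E.toSSet) (s : Δ[2] ⟶ B.toSSet),
    r ≫ p.toHom = Λ[2, Fin.last 2].ι ≫ s →
    IsCartesianEdge p (r.app _ (hornLastEdge 0)) →
    ∃ s' : Δ[2] ⟶ E.toSSet, IsRightOuter p (yonedaEquiv s') ∧ s' ≫ p.toHom = s ∧
      Λ[2, Fin.last 2].ι ≫ s' = r

/-- Every edge of `B` with target `p x` is the image of a `p`-cartesian edge with target `x`. -/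
def HasCartesianLifts (p : E ⟶ B) : Prop :=
  ∀ (x : E.toSSet _⦋0⦌) (h : B.toSSet _⦋1⦌), B.toSSet.δ 0 h = p.toHom.app _ x →
    ∃ h' : E.toSSet _⦋1⦌, IsCartesianEdge p h' ∧ E.toSSet.δ 0 h' = x ∧ p.toHom.app _ h' = h

/-- Inner cartesian 2-fibrations. -/
structure IsInnerCartesian2Fibration (p : E ⟶ B) : Prop where
  weakFibration : IsWeakFibration p
  leftInner : IsLeftInner2Fibration p
  rightInner : IsRightInner2Fibration p
  hasCartesianLifts : HasCartesianLifts p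

/-- `p` is an inner cocartesian 2-fibration if `p^op` is an inner cartesian 2-fibration. -/
def IsInnerCocartesian2Fibration (p : E ⟶ B) : Prop :=
  IsInnerCartesian2Fibration (opMap p)

/-- Outer cartesian 2-fibrations. A 3-simplex `ρ` exhibits its face `d_2 ρ = Δ^{0,1,3}` as a right
whiskering of `d_3 ρ = Δ^{0,1,2}` if `d_0 ρ` and `d_1 ρ` are thin, and it exhibits `d_1 ρ` as a left
whiskering of `d_0 ρ` if `d_2 ρ` and `d_3 ρ` are thin. -/
structure IsOuterCartesian2Fibration (p : E ⟶ B) : Prop where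
  weakFibration : IsWeakFibration p
  leftOuter : IsLeftOuter2Fibration p
  rightOuter : IsRightOuter2Fibration p
  leftOuter_rightWhiskering (ρ : E.toSSet _⦋3⦌)
    (h0 : E.toSSet.δ 0 ρ ∈ E.thin) (h1 : E.toSSet.δ 1 ρ ∈ E.thin)
    (hρ : IsLeftOuter p (E.toSSet.δ 3 ρ)) : IsLeftOuter p (E.toSSet.δ 2 ρ)
  rightOuter_leftWhiskering (ρ : E.toSSet _⦋3⦌)
    (h2 : E.toSSet.δ 2 ρ ∈ E.thin) (h3 : E.toSSet.δ 3 ρ ∈ E.thin)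
    (hρ : IsRightOuter p (E.toSSet.δ 0 ρ)) : IsRightOuter p (E.toSSet.δ 1 ρ)
  hasCartesianLifts : HasCartesianLifts p

/-- `p` is an outer cocartesian 2-fibration if `p^op` is an outer cartesian 2-fibration. -/
def IsOuterCocartesian2Fibration (p : E ⟶ B) : Prop :=
  IsOuterCartesian2Fibration (opMap p)

end

/-! ### The bicategorical model structure

Its cofibrations are the monomorphisms and its fibrant objects are the `∞`-bicategories, which
determines it. For the walking isomorphism `J` (all triangles thin), the projection `X × J ⟶ X` is
a base change of `J ⟶ Δ^0`, which has the right lifting property with respect to all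
monomorphisms, and `X ⨿ X ⟶ X × J` is a monomorphism; so `X × J` is a cylinder object of `X`, and
the weak equivalences are the maps inducing bijections on `J`-homotopy classes of maps to
`∞`-bicategories. -/

/-- The cylinder `X × J`, where `J` is the nerve of the walking isomorphism with all triangles
thin. -/
noncomputable def cylinder (X : ScaledSSet.{u}) : ScaledSSet.{u} where
  toSSet := X.toSSet ⊗ coherentIso.{u}
  thin := {t | t.1 ∈ X.thin}
  degenerate_subset_thin := fun _ ht =>
    X.degenerate_subset_thin
      (degenerate_app_apply ht (CartesianMonoidalCategory.fst X.toSSet coherentIso.{u}))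

/-- The inclusion of `X × {j}` into `X × J`. -/
noncomputable def cylinderι (X : ScaledSSet.{u}) (j : coherentIso.{u} _⦋0⦌) : X ⟶ X.cylinder where
  toHom := CartesianMonoidalCategory.lift (𝟙 _) (SSet.const j)
  map_thin := fun _ ht => ht

/-- `J`-homotopic maps of scaled simplicial sets. -/
def Homotopic {X C : ScaledSSet.{u}} (f g : X ⟶ C) : Prop :=
  ∃ h : X.cylinder ⟶ C, X.cylinderι coherentIso.x₀ ≫ h = f ∧ X.cylinderι coherentIso.x₁ ≫ h = g

/-- Bicategorical equivalences: the maps `f : X ⟶ Y` such that, for every `∞`-bicategory `C`,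
composition with `f` is a bijection from homotopy classes of maps `Y ⟶ C` to homotopy classes of
maps `X ⟶ C`. -/
structure IsBicategoricalEquivalence {X Y : ScaledSSet.{u}} (f : X ⟶ Y) : Prop where
  injective (C : ScaledSSet.{u}) (hC : C.IsInftyBicategory) (g g' : Y ⟶ C)
    (h : Homotopic (f ≫ g) (f ≫ g')) : Homotopic g g'
  surjective (C : ScaledSSet.{u}) (hC : C.IsInftyBicategory) (k : X ⟶ C) :
    ∃ g : Y ⟶ C, Homotopic (f ≫ g) k

/-- The trivial cofibrations of the bicategorical model structure. -/
def trivialCofibrations : MorphismProperty ScaledSSet.{u} :=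
  fun _ _ i => Mono i ∧ IsBicategoricalEquivalence i

/-- The fibrations of the bicategorical model structure. -/
def bicategoricalFibrations : MorphismProperty ScaledSSet.{u} :=
  trivialCofibrations.rlp

end ScaledSSet

/-! Cores. In a lifting problem for `p^th` every triangle of the horn is thin, so the scaled lifting
property of `p` gives a lift, and it remains to see that all triangles of the lift are thin. A horn
of dimension at least 4 contains every triangle, and in dimension 2 the filler is thin by the
lifting property itself. What remains is the missing face of a 3-simplex. For an inner horn, (ii)
applied to a degenerate 4-simplex settles it (`thinAt_inner_left`, `thinAt_inner_right`). For
`Λ^3_3` with cartesian last edge, the face `012` is compared with a thin filler of the inner horn on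
the edges `01` and `12`: the two candidates for the edge `02` have thin composites with the same
cartesian edge, a 5-simplex relates them, and (ii) carries thinness from one triangle to the other
(`thinAt_of_liftsRight`, and `thinAt_of_liftsLeft` for cocartesian edges).

Isofibrations. Let `J` be the walking isomorphism with all triangles thin. Given an object over
`x₀`, a (co)cartesian lift of one edge of `J` is (co)cartesian in the core, and `J` arises from this
edge by filling outer horns on it. So 2-fibrations between `∞`-bicategories lift along `{x₀} ⊆ J`.
For `n > 0` the inclusion of `∂Δ^n × J ∪ Δ^n × {x₀}` in `Δ^n × J` is a composite of fillings of
scaled inner horns (`exists_lift_bottom`). Together these give the relative homotopy lifting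
property with respect to all monomorphisms (`IsIsofibration.exists_lift`). The map from an
`∞`-bicategory to the point has it too.

Fibrations. Let `i : X ⟶ Y` be a trivial cofibration and `C` an `∞`-bicategory. By homotopy
extension every map `X ⟶ C` extends strictly to `Y`. Moreover `C^K` is again an `∞`-bicategory
(`IsInftyBicategory.cotensor`), so the universal map `X ⟶ C^{Map(X, C)}` extends to `Y`; this is a
section of the restriction `Map(Y, C) ⟶ Map(X, C)`. With it, any two extensions of one map are
homotopic relative to `X`: an arbitrary homotopy between them is a loop on `X`, which the section
extends to `Y`, and composition with this extension makes the homotopy constant on `X`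
(`IsBicategoricalEquivalence.exists_rel_homotopy`). To lift `v : Y ⟶ B` with given `u : X ⟶ E`,
extend `u` to `g : Y ⟶ E`. Then `g ≫ p` and `v` extend the same map, hence are homotopic relative to
`X`, and homotopy lifting moves `g` to a lift of `v` without changing it on `X`.

Combinatorics. All anodyne extensions are given by a rule which inserts a vertex into a chain of
vertices (`Insertion`). Such a rule yields a regular pairing of the simplices outside a subcomplex;
lifts are built along it, keeping a record of the thin triangles already filled
(`Insertion.exists_scaled_lift`). -/

namespace SSet.Subcomplex

/-! ### Gluing of maps, and lifting along regular pairings. -/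

variable {X E B : SSet.{u}}

/-- Maps on an exhaustive increasing sequence of subcomplexes glue. -/
lemma exists_desc_of_iSup (F : ℕ → X.Subcomplex) (hF : Monotone F) (hF' : ⨆ j, F j = ⊤)
    (g : ∀ j, (F j : SSet.{u}) ⟶ E)
    (hg : ∀ j, homOfLE (hF (Nat.le_succ j)) ≫ g (j + 1) = g j) :
    ∃ l : X ⟶ E, ∀ j, (F j).ι ≫ l = g j := by
  have compat : ∀ i j (hij : i ≤ j) (k) (x : X.obj k) (hx : x ∈ (F i).obj k),
      (g j).app k ⟨x, hF hij k hx⟩ = (g i).app k ⟨x, hx⟩ := by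
    intro i j hij
    induction j, hij using Nat.le_induction with
    | base => intros; rfl
    | succ j hij ih =>
      intro k x hx
      rw [← ih k x hx, ← hg j]
      rfl
  have mem : ∀ k (x : X.obj k), ∃ j, x ∈ (F j).obj k := by
    intro k x
    have : x ∈ (⨆ j, F j).obj k := by rw [hF']; trivial
    simpa using this
  choose n hn using mem
  have key : ∀ k (x : X.obj k) j (hx : x ∈ (F j).obj k),
      (g (n k x)).app k ⟨x, hn k x⟩ = (g j).app k ⟨x, hx⟩ := by
    intro k x j hx
    rcases le_total (n k x) j with h | h
    · exact (compat _ _ h k x (hn k x)).symm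
    · exact compat _ _ h k x hx
  refine ⟨{ app := fun k => TypeCat.ofHom (fun x => (g (n k x)).app k ⟨x, hn k x⟩)
            naturality := ?_ }, ?_⟩
  · intro k k' f
    ext x
    have h1 := key k' (X.map f x) (n k x) ((F (n k x)).map f (hn k x))
    have h2 := NatTrans.naturality_apply (g (n k x)) f ⟨x, hn k x⟩
    exact h1.trans h2
  · intro j
    ext k x
    exact key k x.1 j x.2

/-- Maps on two subcomplexes which agree on the intersection glue. -/
lemma exists_desc_sup (A₁ A₂ : X.Subcomplex) (f₁ : (A₁ : SSet.{u}) ⟶ E) (f₂ : (A₂ : SSet.{u}) ⟶ E)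
    (h : ∀ k (x : X.obj k) (h₁ : x ∈ A₁.obj k) (h₂ : x ∈ A₂.obj k),
      f₁.app k ⟨x, h₁⟩ = f₂.app k ⟨x, h₂⟩) :
    ∃ f : ((A₁ ⊔ A₂ : X.Subcomplex) : SSet.{u}) ⟶ E,
      (∀ k (x : X.obj k) (h₁ : x ∈ A₁.obj k), f.app k ⟨x, Or.inl h₁⟩ = f₁.app k ⟨x, h₁⟩) ∧
      (∀ k (x : X.obj k) (h₂ : x ∈ A₂.obj k), f.app k ⟨x, Or.inr h₂⟩ = f₂.app k ⟨x, h₂⟩) := by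
  classical
  let φ : ∀ k (x : ((A₁ ⊔ A₂ : X.Subcomplex) : SSet.{u}).obj k), E.obj k := fun k x =>
    if h₁ : x.1 ∈ A₁.obj k then f₁.app k ⟨x.1, h₁⟩
    else f₂.app k ⟨x.1, x.2.resolve_left h₁⟩
  have φ1 : ∀ k (x : X.obj k) (h₁ : x ∈ A₁.obj k), φ k ⟨x, Or.inl h₁⟩ = f₁.app k ⟨x, h₁⟩ := by
    intro k x h₁
    simp only [φ, dif_pos h₁]
  have φ2 : ∀ k (x : X.obj k) (h₂ : x ∈ A₂.obj k), φ k ⟨x, Or.inr h₂⟩ = f₂.app k ⟨x, h₂⟩ := by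
    intro k x h₂
    by_cases h₁ : x ∈ A₁.obj k
    · simp only [φ, dif_pos h₁]; exact h k x h₁ h₂
    · simp only [φ, dif_neg h₁]
  refine ⟨{ app := fun k => TypeCat.ofHom (φ k), naturality := ?_ }, φ1, φ2⟩
  intro k k' f
  ext ⟨x, hx⟩
  rcases hx with hx | hx
  · exact (φ1 k' _ (A₁.map f hx)).trans
      ((NatTrans.naturality_apply f₁ f ⟨x, hx⟩).trans (congrArg _ (φ1 k x hx).symm))
  · exact (φ2 k' _ (A₂.map f hx)).trans
      ((NatTrans.naturality_apply f₂ f ⟨x, hx⟩).trans (congrArg _ (φ2 k x hx).symm))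

lemma homOfLE_comp_homOfLE {A₁ A₂ A₃ : X.Subcomplex} (h₁ : A₁ ≤ A₂) (h₂ : A₂ ≤ A₃)
    (h₃ : A₁ ≤ A₃) : homOfLE h₁ ≫ homOfLE h₂ = homOfLE h₃ := rfl

lemma homOfLE_comp_ι {A₁ A₂ : X.Subcomplex} (h : A₁ ≤ A₂) : homOfLE h ≫ A₂.ι = A₁.ι := rfl

lemma map_ι_injective (A : X.Subcomplex) : Function.Injective (S.map A.ι) := by
  intro a b h
  obtain ⟨n, ⟨a, ha⟩, rfl⟩ := a.mk_surjective
  obtain ⟨m, ⟨b, hb⟩, rfl⟩ := b.mk_surjective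
  obtain rfl : n = m := congrArg S.dim h
  have h' : a = b := (S.ext_iff _ _).1 h
  subst h'
  rfl

namespace Pairing

variable {A : X.Subcomplex} {P : A.Pairing}

/-- A partial lift defined on a stage of the filtration given by a rank function, which maps the
two-dimensional cells to `T`. -/
structure IsPartialLift {ι : Type*} [LinearOrder ι] (F : P.RankFunction ι) (p : E ⟶ B)
    (u : (A : SSet.{u}) ⟶ E) (v : X ⟶ B) (T : Set (E _⦋2⦌)) (j : ι)
    (f : (F.filtration j : SSet.{u}) ⟶ E) : Prop where
  restr : homOfLE (F.le_filtration j) ≫ f = u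
  comp : f ≫ p = (F.filtration j).ι ≫ v
  mem : ∀ (t : X _⦋2⦌) (ht : t ∈ (F.filtration j).obj _),
    (∃ s, F.rank s < j ∧ (P.p s).1.toS = S.mk t) → f.app _ ⟨t, ht⟩ ∈ T

/-- The lifting problems for the cells of a pairing are solvable. -/
def CellsLift (P : A.Pairing) (p : E ⟶ B) (u : (A : SSet.{u}) ⟶ E) (v : X ⟶ B)
    (T : Set (E _⦋2⦌)) : Prop :=
  ∀ (d : ℕ) (x : X _⦋d + 1⦌) (i : Fin (d + 2)) (s : P.II),
    (P.p s).1.toS = S.mk x → s.1.toS = S.mk (X.δ i x) →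
    ∀ g : (Λ[d + 1, i] : SSet.{u}) ⟶ E, g ≫ p = Λ[d + 1, i].ι ≫ yonedaEquiv.symm x ≫ v →
    (∀ (k) (y : (Λ[d + 1, i] : SSet.{u}).obj k)
      (hy : (yonedaEquiv.symm x).app _ y.1 ∈ A.obj k), g.app k y = u.app k ⟨_, hy⟩) →
    (∀ (y : (Λ[d + 1, i] : SSet.{u}) _⦋2⦌),
      (∃ s', (P.p s').1.toS = S.mk ((yonedaEquiv.symm x).app _ y.1)) → g.app _ y ∈ T) →
    ∃ l : Δ[d + 1] ⟶ E, Λ[d + 1, i].ι ≫ l = g ∧ l ≫ p = yonedaEquiv.symm x ≫ v ∧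
      -- An equality in `S` includes the dimension, so this is void unless `d + 1 = 2`.
      ∀ t : E _⦋2⦌, S.mk (yonedaEquiv l) = S.mk t → t ∈ T

/-- The next stage is a pushout of the present one along the horn inclusions of the cells of rank
`j`, so independent lifts on these cells glue. A two-dimensional cell of lower rank is covered by
`f`, one of rank `j` by the lift on that cell. -/
lemma exists_isPartialLift_succ [P.IsProper] {ι : Type*} [LinearOrder ι] [SuccOrder ι]
    [NoMaxOrder ι] (F : P.RankFunction ι) {p : E ⟶ B}
    {u : (A : SSet.{u}) ⟶ E} {v : X ⟶ B} {T : Set (E _⦋2⦌)} (H : CellsLift P p u v T)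
    {j : ι} {f : (F.filtration j : SSet.{u}) ⟶ E} (hf : IsPartialLift F p u v T j f) :
    ∃ f', homOfLE (F.filtration_monotone (Order.le_succ j)) ≫ f' = f ∧
      IsPartialLift F p u v T (Order.succ j) f' := by
  obtain ⟨hf1, hf2, hf3⟩ := hf
  have hc : ∀ c : F.Cell j, ∃ l : Δ[c.dim + 1] ⟶ E, c.horn.ι ≫ l = c.mapHorn ≫ f ∧
      l ≫ p = c.map ≫ v ∧ ∀ t : E _⦋2⦌, S.mk (yonedaEquiv l) = S.mk t → t ∈ T := by
    intro c
    refine H c.dim _ c.index c.s ?_ ?_ (c.mapHorn ≫ f) ?_ ?_ ?_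
    · exact (S.cast_eq_self (P.p c.s).1.toS (P.isUniquelyCodimOneFace c.s).dim_eq).symm
    · have := (P.isUniquelyCodimOneFace c.s).δ_index rfl
      exact congrArg S.mk this.symm
    · rw [Category.assoc, hf2]
      rfl
    · intro k y hy
      rw [← hf1]
      rfl
    · rintro y ⟨s', hs'⟩
      have hmem : (c.map.app _ y.1) ∈ (F.filtration j).obj _ := by
        have := y.2
        have h0 := le_of_eq c.preimage_filtration_map.symm
        exact h0 _ this
      refine hf3 _ hmem ⟨s', ?_, hs'⟩
      -- A cell of rank at least `j` is not contained in the stage `j`, whereas this triangle comes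
      -- from the horn.
      by_contra hlt
      refine (Subcomplex.Pairing.RankFunction.Cell.subcomplex_not_le_filtration
        (⟨s', rfl⟩ : F.Cell (F.rank s'))) ?_
      refine le_trans (P.le s') ?_
      refine le_trans ?_ (F.filtration_monotone (not_lt.1 hlt))
      have h2 : (P.p s').1.subcomplex = ofSimplex (c.map.app _ y.1) := by
        have := congrArg S.subcomplex hs'
        exact this
      change (P.p s').1.subcomplex ≤ _
      rw [h2, ofSimplex_le_iff]
      exact hmem
  choose l hl1 hl2 hl3 using hc
  have w : F.t j ≫ f = F.m j ≫ Limits.Sigma.desc l := by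
    apply Limits.Sigma.hom_ext
    intro c
    have h1 := c.ι_t_assoc f
    have h2 := Subcomplex.Pairing.RankFunction.Cell.ι_m_assoc F c (Limits.Sigma.desc l)
    refine h1.trans (Eq.trans ?_ h2.symm)
    rw [← hl1]
    simp
  refine ⟨(F.isPushout j).desc f (Limits.Sigma.desc l) w, (F.isPushout j).inl_desc _ _ w, ?_, ?_, ?_⟩
  · rw [← homOfLE_comp_homOfLE (F.le_filtration j) (F.filtration_monotone (Order.le_succ j)),
      Category.assoc, (F.isPushout j).inl_desc, hf1]
  · apply (F.isPushout j).hom_ext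
    · rw [(F.isPushout j).inl_desc_assoc, hf2, ← Category.assoc, homOfLE_comp_ι]
    · have h1 := (F.isPushout j).inr_desc_assoc f (Limits.Sigma.desc l) w p
      refine h1.trans ?_
      apply Limits.Sigma.hom_ext
      intro c
      have h3 := c.ι_b_assoc ((F.filtration (Order.succ j)).ι ≫ v)
      refine Eq.trans ?_ h3.symm
      have h4 := hl2 c
      simp only [Limits.Sigma.ι_desc_assoc]
      exact h4
  · rintro t ht ⟨s, hs, hst⟩
    rcases (Order.lt_succ_iff.1 hs).lt_or_eq with hs | hs
    · have ht' : t ∈ (F.filtration j).obj _ := by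
        have h1 := F.subcomplex_le_filtration ⟨s, rfl⟩ hs
        have h2 : (P.p s).1.subcomplex = ofSimplex t := congrArg S.subcomplex hst
        change (P.p s).1.subcomplex ≤ _ at h1
        rw [h2, ofSimplex_le_iff] at h1
        exact h1
      have := hf3 t ht' ⟨s, hs, hst⟩
      have h3 := congrArg (fun q => q.app _ ⟨t, ht'⟩)
        ((F.isPushout j).inl_desc f (Limits.Sigma.desc l) w)
      rw [← h3] at this
      exact this
    · let c : F.Cell j := ⟨s, hs⟩
      apply hl3 c
      have h5 : c.mapToSucc ≫ (F.isPushout j).desc f (Limits.Sigma.desc l) w = l c := by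
        rw [← c.ι_b, Category.assoc, (F.isPushout j).inr_desc]
        simp
      rw [← h5]
      change S.map ((F.isPushout j).desc f (Limits.Sigma.desc l) w)
        (S.mk (yonedaEquiv c.mapToSucc)) = S.map ((F.isPushout j).desc f (Limits.Sigma.desc l) w)
        (S.mk (⟨t, ht⟩ : (F.filtration (Order.succ j) : SSet.{u}) _⦋2⦌))
      refine congrArg _ (map_ι_injective _ ?_)
      change S.mk (yonedaEquiv c.map) = S.mk t
      rw [← hst]
      simp only [Equiv.apply_symm_apply]
      exact S.cast_eq_self (P.p c.s).1.toS (P.isUniquelyCodimOneFace c.s).dim_eq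

/-- Lifting along a regular pairing: the lift is built cell by cell, and may use the given partial
lift as well as the condition that the images of the previous two-dimensional cells are in `T`. -/
theorem exists_lift (P : A.Pairing) [P.IsRegular] (p : E ⟶ B)
    (u : (A : SSet.{u}) ⟶ E) (v : X ⟶ B) (huv : u ≫ p = A.ι ≫ v) (T : Set (E _⦋2⦌))
    (H : CellsLift P p u v T) :
    ∃ l : X ⟶ E, A.ι ≫ l = u ∧ l ≫ p = v ∧
      ∀ t : X _⦋2⦌, (∃ s, (P.p s).1.toS = S.mk t) → l.app _ t ∈ T := by
  -- Regularity provides ranks in `ℕ`, so the lift is a union over countably many stages.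
  obtain ⟨F⟩ : Nonempty (P.RankFunction ℕ) := inferInstance
  have step : ∀ j f, IsPartialLift F p u v T j f →
      ∃ f', homOfLE (F.filtration_monotone (Nat.le_succ j)) ≫ f' = f ∧
        IsPartialLift F p u v T (j + 1) f' := fun j f hf =>
    exists_isPartialLift_succ F H hf
  let f₀ : {f // IsPartialLift F p u v T 0 f} := ⟨homOfLE (by rw [← bot_eq_zero, F.filtration_bot]) ≫ u, by
    refine ⟨?_, ?_, ?_⟩
    · rfl
    · rw [Category.assoc, huv, ← Category.assoc, homOfLE_comp_ι]
    · rintro t ht ⟨s, hs, _⟩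
      exact absurd hs (Nat.not_lt_zero _)⟩
  choose nxt hn1 hn2 using step
  let g : ∀ j, {f // IsPartialLift F p u v T j f} := fun j => Nat.rec f₀ (fun j f => ⟨nxt j f.1 f.2, hn2 j f.1 f.2⟩) j
  obtain ⟨L, hL⟩ := exists_desc_of_iSup F.filtration F.filtration_monotone F.iSup_filtration
    (fun j => (g j).1) (fun j => hn1 j (g j).1 (g j).2)
  refine ⟨L, ?_, ?_, ?_⟩
  · rw [← (g 0).2.restr, ← hL 0, ← Category.assoc, homOfLE_comp_ι]
  · ext k x
    have hx : x ∈ (⨆ j, F.filtration j).obj k := by rw [F.iSup_filtration]; trivial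
    simp only [Subfunctor.iSup_obj, Set.mem_iUnion] at hx
    obtain ⟨j, hj⟩ := hx
    have h1 := congrArg (fun q => q.app k ⟨x, hj⟩) (g j).2.comp
    have h2 := congrArg (fun q => q.app k ⟨x, hj⟩) (hL j)
    change L.app k x = _ at h2
    change p.app k (L.app k x) = v.app k x
    rw [h2]
    exact h1
  · rintro t ⟨s, hs⟩
    have ht : t ∈ (F.filtration (F.rank s + 1)).obj _ := by
      have h1 := F.subcomplex_le_filtration ⟨s, rfl⟩ (Nat.lt_succ_self _)
      have h2 : (P.p s).1.subcomplex = ofSimplex t := congrArg S.subcomplex hs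
      change (P.p s).1.subcomplex ≤ _ at h1
      rw [h2, ofSimplex_le_iff] at h1
      exact h1
    have := (g (F.rank s + 1)).2.mem t ht ⟨s, Nat.lt_succ_self _, hs⟩
    rw [← hL] at this
    exact this

end Pairing

end SSet.Subcomplex

/-! ### Simplices as chains of vertices, and pairings given by inserting a vertex. -/

namespace SSet

/-- Identifications of the simplices of `X` with the chains of a preorder `P`. -/
structure VertexModel (X : SSet.{u}) (P : Type) [Preorder P] where
  equiv (m : ℕ) : X _⦋m⦌ ≃ (Fin (m + 1) →o P)
  equiv_map {m n : ℕ} (f : ⦋m⦌ ⟶ ⦋n⦌) (x : X _⦋n⦌) (i : Fin (m + 1)) :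
    equiv m (X.map f.op x) i = equiv n x (f.toOrderHom i)

namespace VertexModel

variable {X : SSet.{u}} {P : Type} [Preorder P] (M : VertexModel X P)

/-- The list of the vertices of a simplex. -/
def toList {m : ℕ} (x : X _⦋m⦌) : List P := List.ofFn (M.equiv m x)

@[simp]
lemma length_toList {m : ℕ} (x : X _⦋m⦌) : (M.toList x).length = m + 1 := by
  simp [toList]

lemma pairwise_toList {m : ℕ} (x : X _⦋m⦌) : (M.toList x).Pairwise (· ≤ ·) := by
  rw [toList, List.pairwise_ofFn]
  intro i j hij
  exact (M.equiv m x).monotone hij.le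

lemma toList_injective {m : ℕ} {x y : X _⦋m⦌} (h : M.toList x = M.toList y) : x = y := by
  apply (M.equiv m).injective
  ext i
  exact congrFun (List.ofFn_injective h) i

lemma exists_toList_eq {m : ℕ} {l : List P} (hl : l.length = m + 1) (hl' : l.Pairwise (· ≤ ·)) :
    ∃ x : X _⦋m⦌, M.toList x = l := by
  let f : Fin (m + 1) →o P :=
    ⟨fun i => l.get (Fin.cast hl.symm i), by
      intro i j hij
      rcases hij.lt_or_eq with h | rfl
      · exact List.pairwise_iff_get.1 hl' _ _ (by simpa using h)
      · exact le_rfl⟩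
  refine ⟨(M.equiv m).symm f, ?_⟩
  apply List.ext_get
  · simp [hl]
  · intro i h1 h2
    simp only [toList, Equiv.apply_symm_apply, List.get_eq_getElem, List.getElem_ofFn]
    rfl

lemma mk_eq_iff {m n : ℕ} (x : X _⦋m⦌) (y : X _⦋n⦌) :
    S.mk x = S.mk y ↔ M.toList x = M.toList y := by
  constructor
  · intro h
    obtain rfl : m = n := congrArg S.dim h
    obtain rfl : x = y := (S.ext_iff _ _).1 h
    rfl
  · intro h
    have h' := congrArg List.length h
    simp only [length_toList, Nat.add_right_cancel_iff] at h'
    subst h'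
    rw [M.toList_injective h]

lemma toList_δ {m : ℕ} (i : Fin (m + 2)) (x : X _⦋m + 1⦌) :
    M.toList (X.δ i x) = (M.toList x).eraseIdx i := by
  apply List.ext_get
  · rw [List.length_eraseIdx_of_lt]
    · simp
    · simp only [length_toList]
      lia
  · intro k h1 h2
    have hk : k < m + 1 := by simpa using h1
    simp only [toList, List.get_eq_getElem, List.getElem_ofFn, List.getElem_eraseIdx]
    have := M.equiv_map (SimplexCategory.δ i) x ⟨k, hk⟩
    refine (Eq.trans ?_ this).trans ?_
    · rfl
    · split_ifs with h
      · congr 1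
        exact Fin.succAbove_of_castSucc_lt _ _ h
      · congr 1
        exact Fin.succAbove_of_le_castSucc _ _ (not_lt.1 h)

lemma equiv_σ_apply {m : ℕ} (i : Fin (m + 1)) (x : X _⦋m⦌) (j : Fin (m + 2)) :
    M.equiv _ (X.σ i x) j = M.equiv _ x (i.predAbove j) :=
  M.equiv_map (SimplexCategory.σ i) x j

/-- Degenerate means that two consecutive vertices coincide. Repetitions further apart are allowed:
they occur for a preorder, as in the words `v₀ v₁ v₀` of the walking isomorphism. -/
lemma mem_nonDegenerate_iff {m : ℕ} (x : X _⦋m⦌) :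
    x ∈ X.nonDegenerate m ↔ (M.toList x).IsChain (· ≠ ·) := by
  rw [mem_nonDegenerate_iff_notMem_degenerate]
  cases m with
  | zero =>
    simp [toList]
  | succ m =>
    rw [degenerate_eq_iUnion_range_σ, toList, List.isChain_iff_getElem]
    simp only [Set.mem_iUnion, Set.mem_range, not_exists, List.length_ofFn, List.getElem_ofFn]
    constructor
    · intro h i hi heq
      have hi' : i < m + 1 := by lia
      refine h ⟨i, hi'⟩ (X.δ (Fin.castSucc ⟨i, hi'⟩) x) ?_
      apply (M.equiv _).injective
      ext j
      rw [M.equiv_σ_apply]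
      refine (M.equiv_map (SimplexCategory.δ (Fin.castSucc ⟨i, hi'⟩)) x _).trans ?_
      change M.equiv _ x (Fin.succAbove (Fin.castSucc ⟨i, hi'⟩) (Fin.predAbove ⟨i, hi'⟩ j)) = _
      by_cases hj : j = Fin.castSucc ⟨i, hi'⟩
      · subst hj
        rw [Fin.predAbove_castSucc_self, Fin.succAbove_castSucc_self]
        exact heq.symm
      · rw [Fin.succAbove_predAbove hj]
    · rintro h i y rfl
      refine h i (by lia) ?_
      rw [M.equiv_σ_apply, M.equiv_σ_apply]
      congr 1
      have h1 := Fin.predAbove_castSucc_self i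
      have h2 := Fin.predAbove_succ_self i
      exact h1.trans h2.symm

/-- For `i < j` the vertices at position `i` of the two faces are the vertices `i + 1` and `i` of
`x`, which differ. This is the uniqueness needed for a proper pairing. -/
lemma δ_injective (M : VertexModel X P) {m : ℕ} {x : X _⦋m + 1⦌} (hx : x ∈ X.nonDegenerate _) {i j : Fin (m + 2)}
    (h : X.δ i x = X.δ j x) : i = j := by
  rw [M.mem_nonDegenerate_iff, toList, List.isChain_iff_getElem] at hx
  have key : ∀ i j : Fin (m + 2), X.δ i x = X.δ j x → ¬ i < j := by
    intro i j h hij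
    have hi : i.val < m + 1 := by have := j.2; have h3 : i.val < j.val := hij; lia
    have h1 := M.equiv_map (SimplexCategory.δ i) x ⟨i, hi⟩
    have h2 := M.equiv_map (SimplexCategory.δ j) x ⟨i, hi⟩
    have h3 : M.equiv _ x (i.succAbove ⟨i, hi⟩) = M.equiv _ x (j.succAbove ⟨i, hi⟩) :=
      h1.symm.trans ((congrArg (fun z => M.equiv _ z ⟨i, hi⟩) h).trans h2)
    rw [Fin.succAbove_of_le_castSucc i ⟨i, hi⟩ (le_refl _),
      Fin.succAbove_of_castSucc_lt j ⟨i, hi⟩ hij] at h3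
    refine hx i (by simp; lia) ?_
    simp only [List.getElem_ofFn]
    exact h3.symm
  rcases lt_trichotomy i j with hij | hij | hij
  · exact absurd hij (key i j h)
  · exact hij
  · exact absurd hij (key j i h.symm)

variable (A : X.Subcomplex)

/-- The lists of vertices of the nondegenerate simplices which do not belong to `A`. -/
def Good (l : List P) : Prop :=
  ∃ (m : ℕ) (x : X _⦋m⦌), x ∈ X.nonDegenerate m ∧ x ∉ A.obj _ ∧ M.toList x = l

variable {M A}

lemma Good.isChain {l : List P} (h : M.Good A l) : l.IsChain (· ≠ ·) := by
  obtain ⟨m, x, hx, -, rfl⟩ := h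
  exact (M.mem_nonDegenerate_iff x).1 hx

lemma Good.pairwise {l : List P} (h : M.Good A l) : l.Pairwise (· ≤ ·) := by
  obtain ⟨m, x, -, -, rfl⟩ := h
  exact M.pairwise_toList x

lemma Good.length_pos {l : List P} (h : M.Good A l) : 0 < l.length := by
  obtain ⟨m, x, -, -, rfl⟩ := h
  simp

lemma Good.notMem {l : List P} (h : M.Good A l) {m : ℕ} {x : X _⦋m⦌} (hx : M.toList x = l) :
    x ∉ A.obj _ := by
  obtain ⟨m', y, -, hy, rfl⟩ := h
  have h' := congrArg List.length hx
  simp only [length_toList, Nat.add_right_cancel_iff] at h'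
  subst h'
  rwa [M.toList_injective hx]

lemma good_of_notMem {m : ℕ} {x : X _⦋m⦌} (hx : x ∉ A.obj _)
    (h : (M.toList x).IsChain (· ≠ ·)) : M.Good A (M.toList x) :=
  ⟨m, x, (M.mem_nonDegenerate_iff x).2 h, hx, rfl⟩

end VertexModel

/-- A procedure which inserts a vertex in certain chains which are not in `A`. -/
structure Insertion {X : SSet.{u}} {P : Type} [Preorder P] (M : VertexModel X P)
    (A : X.Subcomplex) where
  fst : List P → List P
  snd : List P → List P
  v : List P → P
  -- The small chains lack the vertex to be inserted. They are the type II simplices, and the chains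
  -- which are not small are those of type I.
  small : List P → Prop
  rank : List P → ℕ
  append (l : List P) : fst l ++ snd l = l
  pairwise {l : List P} (hl : M.Good A l) (hl' : small l) :
    (fst l ++ v l :: snd l).Pairwise (· ≤ ·)
  isChain {l : List P} (hl : M.Good A l) (hl' : small l) :
    (fst l ++ v l :: snd l).IsChain (· ≠ ·)
  not_small {l : List P} (hl : M.Good A l) (hl' : small l) : ¬ small (fst l ++ v l :: snd l)
  exists_small {l : List P} (hl : M.Good A l) (hl' : ¬ small l) :
    ∃ l', M.Good A l' ∧ small l' ∧ fst l' ++ v l' :: snd l' = l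
  injective {l l' : List P} (hl : M.Good A l) (hl' : M.Good A l') (h : small l) (h' : small l')
    (e : fst l ++ v l :: snd l = fst l' ++ v l' :: snd l') : l = l'
  -- Acyclicity: a small chain which is another face of the big chain of `l'` has to be treated
  -- before `l'`.
  rank_lt {l l' : List P} (hl : M.Good A l) (hl' : M.Good A l') (h : small l) (h' : small l')
    (j : ℕ) (hj : j ≠ (fst l').length) (e : l = (fst l' ++ v l' :: snd l').eraseIdx j) :
    rank l < rank l'

namespace Insertion

variable {X : SSet.{u}} {P : Type} [Preorder P] {M : VertexModel X P}
    {A : X.Subcomplex} (D : Insertion M A)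

/-- The chain obtained by inserting a vertex. -/
def ins (l : List P) : List P := D.fst l ++ D.v l :: D.snd l

lemma length_ins (l : List P) : (D.ins l).length = l.length + 1 := by
  conv_rhs => rw [← D.append l]
  simp [ins]
  lia

lemma eraseIdx_ins (l : List P) : (D.ins l).eraseIdx (D.fst l).length = l := by
  conv_rhs => rw [← D.append l]
  simp [ins, List.eraseIdx_append_of_length_le]

lemma exists_simplex {l : List P} (hl : M.Good A l) (hl' : D.small l) :
    ∃ x : X _⦋(l.length - 1) + 1⦌, M.toList x = D.ins l := by
  apply M.exists_toList_eq _ (D.pairwise hl hl')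
  change (D.ins l).length = _
  rw [length_ins]
  have := hl.length_pos
  lia

lemma fst_length_lt {l : List P} (hl : M.Good A l) : (D.fst l).length < l.length - 1 + 2 := by
  have h := congrArg List.length (D.append l)
  have := hl.length_pos
  rw [List.length_append] at h
  lia

/-- The pairing given by an insertion procedure. -/
noncomputable def pairingCore : A.PairingCore where
  ι := {l : List P // M.Good A l ∧ D.small l}
  dim s := s.1.length - 1
  simplex s := (D.exists_simplex s.2.1 s.2.2).choose
  index s := ⟨(D.fst s.1).length, D.fst_length_lt s.2.1⟩
  nonDegenerate₁ s := by
    rw [M.mem_nonDegenerate_iff, (D.exists_simplex s.2.1 s.2.2).choose_spec]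
    exact D.isChain s.2.1 s.2.2
  nonDegenerate₂ s := by
    rw [M.mem_nonDegenerate_iff, M.toList_δ, (D.exists_simplex s.2.1 s.2.2).choose_spec]
    rw [D.eraseIdx_ins]
    exact s.2.1.isChain
  notMem₁ s h := by
    refine s.2.1.notMem (x := X.δ ⟨(D.fst s.1).length, D.fst_length_lt s.2.1⟩
      (D.exists_simplex s.2.1 s.2.2).choose) ?_ (A.map _ h)
    rw [M.toList_δ, (D.exists_simplex s.2.1 s.2.2).choose_spec, D.eraseIdx_ins]
  notMem₂ s := by
    refine s.2.1.notMem ?_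
    rw [M.toList_δ, (D.exists_simplex s.2.1 s.2.2).choose_spec, D.eraseIdx_ins]
  injective_type₁' {s t} h := by
    rw [M.mk_eq_iff, (D.exists_simplex s.2.1 s.2.2).choose_spec,
      (D.exists_simplex t.2.1 t.2.2).choose_spec] at h
    exact Subtype.ext (D.injective s.2.1 t.2.1 s.2.2 t.2.2 h)
  injective_type₂' {s t} h := by
    rw [M.mk_eq_iff, M.toList_δ, M.toList_δ, (D.exists_simplex s.2.1 s.2.2).choose_spec,
      (D.exists_simplex t.2.1 t.2.2).choose_spec, D.eraseIdx_ins, D.eraseIdx_ins] at h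
    exact Subtype.ext h
  type₁_ne_type₂' s t h := by
    rw [M.mk_eq_iff, M.toList_δ, (D.exists_simplex s.2.1 s.2.2).choose_spec,
      (D.exists_simplex t.2.1 t.2.2).choose_spec, D.eraseIdx_ins] at h
    refine D.not_small s.2.1 s.2.2 ?_
    change D.small (D.ins _)
    rw [h]
    exact t.2.2
  surjective' x := by
    have hx : M.Good A (M.toList x.simplex) := ⟨_, x.simplex, x.nonDegenerate, x.notMem, rfl⟩
    by_cases h : D.small (M.toList x.simplex)
    · refine ⟨⟨_, hx, h⟩, Or.inr ?_⟩
      change S.mk x.simplex = _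
      rw [M.mk_eq_iff, M.toList_δ, (D.exists_simplex hx h).choose_spec, D.eraseIdx_ins]
    · obtain ⟨l', h1, h2, h3⟩ := D.exists_small hx h
      refine ⟨⟨l', h1, h2⟩, Or.inl ?_⟩
      change S.mk x.simplex = _
      rw [M.mk_eq_iff, (D.exists_simplex h1 h2).choose_spec]
      exact h3.symm

lemma toList_simplex (s : D.pairingCore.ι) : M.toList (D.pairingCore.simplex s) = D.ins s.1 :=
  (D.exists_simplex s.2.1 s.2.2).choose_spec

lemma toList_δ_simplex (s : D.pairingCore.ι) :
    M.toList (X.δ (D.pairingCore.index s) (D.pairingCore.simplex s)) = s.1 := by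
  rw [M.toList_δ, toList_simplex]
  exact D.eraseIdx_ins s.1

instance : D.pairingCore.IsProper where
  isUniquelyCodimOneFace s := by
    change S.IsUniquelyCodimOneFace
      (S.mk (X.δ (D.pairingCore.index s) (D.pairingCore.simplex s)))
      (S.mk (D.pairingCore.simplex s))
    rw [S.IsUniquelyCodimOneFace.iff]
    exact ⟨_, rfl, fun j hj => M.δ_injective (D.pairingCore.nonDegenerate₁ s) hj⟩

lemma _root_.SSet.VertexModel.exists_eraseIdx (M : VertexModel X P) {n m : ℕ} (x : X _⦋n⦌) (y : X _⦋m + 1⦌) (hn : n = m)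
    (f : ⦋n⦌ ⟶ ⦋m + 1⦌) (hf : Mono f) (h : X.map f.op y = x) :
    ∃ j : ℕ, M.toList x = (M.toList y).eraseIdx j := by
  subst hn
  obtain ⟨i, rfl⟩ := SimplexCategory.eq_δ_of_mono f
  refine ⟨i, ?_⟩
  rw [← h]
  exact M.toList_δ i y

/-- A weak rank function only compares simplices of equal dimension. There the ancestry relation
says that one small chain arises from another big chain by erasing one vertex, at an index other
than that of the inserted vertex; this is the situation of `rank_lt`. -/
lemma isRegular_pairingCore : D.pairingCore.IsRegular := by
  refine Subcomplex.PairingCore.WeakRankFunction.isRegular (α := ℕ)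
    ⟨fun s => D.rank s.1, fun {s t} hst hd => ?_⟩
  obtain ⟨hne, hlt⟩ := hst
  have hle := hlt.le
  rw [Subcomplex.N.le_iff, SSet.N.le_iff_exists_mono] at hle
  obtain ⟨f, hf, hfx⟩ := hle
  obtain ⟨j, hj⟩ := M.exists_eraseIdx _ _ hd f hf hfx
  change M.toList (X.δ (D.pairingCore.index s) (D.pairingCore.simplex s)) =
    (M.toList (D.pairingCore.simplex t)).eraseIdx j at hj
  rw [toList_δ_simplex, toList_simplex] at hj
  refine D.rank_lt s.2.1 t.2.1 s.2.2 t.2.2 j ?_ hj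
  rintro rfl
  rw [eraseIdx_ins] at hj
  exact hne (Subtype.ext hj)

lemma toS_p_equivII (s : D.pairingCore.ι) :
    (D.pairingCore.pairing.p (D.pairingCore.equivII s)).1.toS =
      S.mk (D.pairingCore.simplex s) :=
  congrArg (fun z => z.toS) (D.pairingCore.type₁_pairing s).symm

/-- The lifting problems for the simplices obtained by an insertion procedure are solvable. -/
def CellsLift {E B : SSet.{u}} (p : E ⟶ B) (u : (A : SSet.{u}) ⟶ E) (v : X ⟶ B)
    (T : Set (E _⦋2⦌)) : Prop :=
  ∀ (d : ℕ) (x : X _⦋d + 1⦌) (i : Fin (d + 2)) (l : List P),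
    M.Good A l → D.small l → M.toList x = D.ins l → i.val = (D.fst l).length →
    ∀ g : (Λ[d + 1, i] : SSet.{u}) ⟶ E, g ≫ p = Λ[d + 1, i].ι ≫ yonedaEquiv.symm x ≫ v →
    (∀ (k) (y : (Λ[d + 1, i] : SSet.{u}).obj k)
      (hy : (yonedaEquiv.symm x).app _ y.1 ∈ A.obj k), g.app k y = u.app k ⟨_, hy⟩) →
    (∀ (y : (Λ[d + 1, i] : SSet.{u}) _⦋2⦌),
      (∃ l', M.Good A l' ∧ D.small l' ∧ M.toList ((yonedaEquiv.symm x).app _ y.1) = D.ins l') →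
      g.app _ y ∈ T) →
    ∃ l : Δ[d + 1] ⟶ E, Λ[d + 1, i].ι ≫ l = g ∧ l ≫ p = yonedaEquiv.symm x ≫ v ∧
      ∀ t : E _⦋2⦌, S.mk (yonedaEquiv l) = S.mk t → t ∈ T

/-- Lifting along the pairing, expressed by chains. The index of the horn is recovered from the two
chains, because distinct faces of a nondegenerate simplex are different. -/
theorem exists_lift {E B : SSet.{u}} (p : E ⟶ B) (u : (A : SSet.{u}) ⟶ E) (v : X ⟶ B)
    (huv : u ≫ p = A.ι ≫ v) (T : Set (E _⦋2⦌)) (H : D.CellsLift p u v T) :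
    ∃ L : X ⟶ E, A.ι ≫ L = u ∧ L ≫ p = v ∧
      ∀ t : X _⦋2⦌, (∃ l, M.Good A l ∧ D.small l ∧ M.toList t = D.ins l) → L.app _ t ∈ T := by
  have := D.isRegular_pairingCore
  have key : ∀ (s : D.pairingCore.pairing.II), ∃ s' : D.pairingCore.ι,
      s.1.toS = S.mk (X.δ (D.pairingCore.index s') (D.pairingCore.simplex s')) ∧
      (D.pairingCore.pairing.p s).1.toS = S.mk (D.pairingCore.simplex s') := by
    intro s
    obtain ⟨s', rfl⟩ := D.pairingCore.equivII.surjective s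
    exact ⟨s', rfl, D.toS_p_equivII s'⟩
  obtain ⟨L, h1, h2, h3⟩ := D.pairingCore.pairing.exists_lift p u v huv T (by
    intro d x i s hs1 hs2 g hg hA hT
    obtain ⟨s', e1, e2⟩ := key s
    rw [e2, M.mk_eq_iff, toList_simplex] at hs1
    rw [e1, M.mk_eq_iff, toList_δ_simplex] at hs2
    refine H d x i s'.1 s'.2.1 s'.2.2 hs1.symm ?_ g hg hA ?_
    · have hx : x ∈ X.nonDegenerate _ := by
        rw [M.mem_nonDegenerate_iff, ← hs1]
        exact D.isChain s'.2.1 s'.2.2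
      have hlen : (D.ins s'.1).length = d + 2 := by rw [hs1]; simp
      have hlt : (D.fst s'.1).length < d + 2 := by
        rw [← hlen]
        simp [ins]
      have h6 : X.δ i x = X.δ ⟨(D.fst s'.1).length, hlt⟩ x := by
        apply M.toList_injective
        rw [← hs2, M.toList_δ, ← hs1]
        exact (D.eraseIdx_ins s'.1).symm
      rw [M.δ_injective hx h6]
    · rintro y ⟨l', hl1, hl2, hl3⟩
      refine hT y ⟨D.pairingCore.equivII ⟨l', hl1, hl2⟩, ?_⟩
      refine (D.toS_p_equivII ⟨l', hl1, hl2⟩).trans ?_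
      rw [M.mk_eq_iff, hl3]
      exact D.toList_simplex ⟨l', hl1, hl2⟩)
  refine ⟨L, h1, h2, ?_⟩
  rintro t ⟨l', hl1, hl2, hl3⟩
  refine h3 t ⟨D.pairingCore.equivII ⟨l', hl1, hl2⟩, ?_⟩
  refine (D.toS_p_equivII ⟨l', hl1, hl2⟩).trans ?_
  rw [M.mk_eq_iff, hl3]
  exact D.toList_simplex ⟨l', hl1, hl2⟩

end Insertion

end SSet

/-! ### Splitting a list at the first element violating a predicate. -/

namespace List

lemma takeWhile_append_of_head? {α : Type*} {q : α → Bool} {l₁ l₂ : List α}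
    (h₁ : ∀ a ∈ l₁, q a = true) (h₂ : ∀ b ∈ l₂.head?, q b = false) :
    (l₁ ++ l₂).takeWhile q = l₁ := by
  rw [List.takeWhile_append_of_pos h₁]
  cases l₂ with
  | nil => simp
  | cons b l => simp [h₂ b (by simp)]

lemma dropWhile_append_of_head? {α : Type*} {q : α → Bool} {l₁ l₂ : List α}
    (h₁ : ∀ a ∈ l₁, q a = true) (h₂ : ∀ b ∈ l₂.head?, q b = false) :
    (l₁ ++ l₂).dropWhile q = l₂ := by
  rw [List.dropWhile_append_of_pos h₁]
  cases l₂ with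
  | nil => simp
  | cons b l => simp [h₂ b (by simp)]

lemma head?_dropWhile_eq_false {α : Type*} (q : α → Bool) (l : List α) :
    ∀ b ∈ (l.dropWhile q).head?, q b = false := by
  intro b hb
  have := List.head?_dropWhile_not q l
  rw [Option.mem_def.1 hb] at this
  simpa using this

lemma mem_takeWhile_eq_true {α : Type*} {q : α → Bool} {l : List α} :
    ∀ a ∈ l.takeWhile q, q a = true := fun _ ha => List.mem_takeWhile_imp ha

lemma dropWhile_append_cons {α : Type*} {q : α → Bool} {l₁ l₂ : List α} {v : α}
    (h₁ : ∀ a ∈ l₁, q a = true) (h₂ : ∀ b ∈ l₂.head?, q b = false) (hv : q v = true) :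
    (l₁ ++ v :: l₂).dropWhile q = l₂ := by
  rw [List.dropWhile_append_of_pos h₁, List.dropWhile_cons_of_pos hv]
  exact dropWhile_append_of_head? (l₁ := []) (by simp) h₂

lemma takeWhile_append_cons {α : Type*} {q : α → Bool} {l₁ l₂ : List α} {v : α}
    (h₁ : ∀ a ∈ l₁, q a = true) (h₂ : ∀ b ∈ l₂.head?, q b = false) (hv : q v = true) :
    (l₁ ++ v :: l₂).takeWhile q = l₁ ++ [v] := by
  rw [List.takeWhile_append_of_pos h₁, List.takeWhile_cons_of_pos hv]
  have := takeWhile_append_of_head? (l₁ := []) (by simp) h₂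
  rw [List.nil_append] at this
  rw [this]

end List

/-! ### Two general insertion rules. -/

namespace SSet

namespace VertexModel

variable {X : SSet.{u}} {P : Type} [Preorder P] {M : VertexModel X P} {A : X.Subcomplex}

lemma good_of_list {l : List P} (h₀ : l ≠ []) (h₁ : l.Pairwise (· ≤ ·)) (h₂ : l.IsChain (· ≠ ·))
    (h₃ : ∀ (m : ℕ) (x : X _⦋m⦌), M.toList x = l → x ∉ A.obj _) : M.Good A l := by
  have := List.length_pos_iff.2 h₀
  obtain ⟨x, hx⟩ := M.exists_toList_eq (m := l.length - 1) (l := l) (by lia) h₁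
  have h₄ := h₃ _ x hx
  rw [← hx] at h₂ ⊢
  exact good_of_notMem h₄ h₂

end VertexModel

namespace Insertion

open VertexModel

section

variable {α : Type*} {q : α → Bool}

lemma isChain_insert {l₁ l₂ : List α} {v : α} (h : (l₁ ++ l₂).IsChain (· ≠ ·))
    (h₁ : l₁.getLast? ≠ some v) (h₂ : l₂.head? ≠ some v) : (l₁ ++ v :: l₂).IsChain (· ≠ ·) := by
  rw [List.isChain_append] at h ⊢
  refine ⟨h.1, List.isChain_cons.2 ⟨fun b hb hvb => h₂ (by rw [hvb]; exact hb), h.2.1⟩,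
    fun a ha b hb hab => h₁ ?_⟩
  obtain rfl : v = b := by simpa using hb
  rw [← hab]
  exact ha

lemma isChain_erase {l₁ l₂ : List α} {v : α} (h : (l₁ ++ v :: l₂).IsChain (· ≠ ·))
    (h₁ : ∀ a ∈ l₁, q a = true) (h₂ : ∀ b ∈ l₂.head?, q b = false) :
    (l₁ ++ l₂).IsChain (· ≠ ·) := by
  rw [List.isChain_append] at h ⊢
  refine ⟨h.1, (List.isChain_cons.1 h.2.1).2, ?_⟩
  rintro a ha b hb rfl
  have := h₁ a (List.mem_of_getLast? ha)
  rw [h₂ a hb] at this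
  contradiction

lemma head?_ne_of_isChain {l₁ l₂ : List α} {v : α} (h : (l₁ ++ v :: l₂).IsChain (· ≠ ·)) :
    l₂.head? ≠ some v := fun h' =>
  (List.isChain_cons.1 (List.isChain_append.1 h).2.1).1 v h' rfl

lemma getLast?_ne_of_isChain {l₁ l₂ : List α} {v : α} (h : (l₁ ++ v :: l₂).IsChain (· ≠ ·)) :
    l₁.getLast? ≠ some v := fun h' =>
  (List.isChain_append.1 h).2.2 v h' v (by simp) rfl

end

variable {X : SSet.{u}} {P : Type} [Preorder P] (M : VertexModel X P) (A : X.Subcomplex)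
    (q : P → Bool) (V : List P → P)

/-- Insertion of the vertex `V l₁` after the longest initial segment `l₁` satisfying `q`. -/
structure IsStart : Prop where
  pos {l : List P} (hl : M.Good A l)
    (hl' : (l.dropWhile q).head? ≠ some (V (l.takeWhile q))) :
    q (V (l.takeWhile q)) = false ∧ (∀ a ∈ l.takeWhile q, a ≤ V (l.takeWhile q)) ∧
      ∀ b ∈ l.dropWhile q, V (l.takeWhile q) ≤ b
  erase {l₁ l₂ : List P} (hl : M.Good A (l₁ ++ V l₁ :: l₂)) (h₁ : ∀ a ∈ l₁, q a = true)
    (hV : q (V l₁) = false) :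
    (∀ b ∈ l₂.head?, q b = false) ∧ l₁ ++ l₂ ≠ [] ∧
      ∀ (m : ℕ) (x : X _⦋m⦌), M.toList x = l₁ ++ l₂ → x ∉ A.obj _

/-- Insertion of the vertex `V l₂` after the longest initial segment satisfying `q`,
where `l₂` is the remainder. -/
structure IsEnd : Prop where
  pos {l : List P} (hl : M.Good A l)
    (hl' : (l.takeWhile q).getLast? ≠ some (V (l.dropWhile q))) :
    q (V (l.dropWhile q)) = true ∧ (∀ a ∈ l.takeWhile q, a ≤ V (l.dropWhile q)) ∧
      ∀ b ∈ l.dropWhile q, V (l.dropWhile q) ≤ b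
  erase {l₁ l₂ : List P} (hl : M.Good A (l₁ ++ V l₂ :: l₂)) (h₁ : ∀ a ∈ l₁, q a = true)
    (hV : q (V l₂) = true) (h₂ : ∀ b ∈ l₂.head?, q b = false) :
    l₁ ++ l₂ ≠ [] ∧ ∀ (m : ℕ) (x : X _⦋m⦌), M.toList x = l₁ ++ l₂ → x ∉ A.obj _

variable {M A q V}

lemma pairwise_insert {l₁ l₂ : List P} {v : P} (h : (l₁ ++ l₂).Pairwise (· ≤ ·))
    (h₁ : ∀ a ∈ l₁, a ≤ v) (h₂ : ∀ b ∈ l₂, v ≤ b) : (l₁ ++ v :: l₂).Pairwise (· ≤ ·) := by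
  rw [List.pairwise_append] at h ⊢
  refine ⟨h.1, List.pairwise_cons.2 ⟨h₂, h.2.1⟩, fun a ha b hb => ?_⟩
  rcases List.mem_cons.1 hb with rfl | hb
  · exact h₁ a ha
  · exact h.2.2 a ha b hb

lemma good_erase {l₁ l₂ : List P} {v : P} (h : M.Good A (l₁ ++ v :: l₂))
    (h₁ : ∀ a ∈ l₁, q a = true) (h₂ : ∀ b ∈ l₂.head?, q b = false)
    (h₀ : l₁ ++ l₂ ≠ []) (h₃ : ∀ (m : ℕ) (x : X _⦋m⦌), M.toList x = l₁ ++ l₂ → x ∉ A.obj _) :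
    M.Good A (l₁ ++ l₂) :=
  good_of_list h₀ (h.pairwise.sublist (by simp)) (isChain_erase h.isChain h₁ h₂) h₃

variable (M A q V)

/-- Insertion of the vertex `V l₁` after the longest initial segment `l₁` satisfying `q`. -/
def start (h : IsStart M A q V) : Insertion M A where
  fst l := l.takeWhile q
  snd l := l.dropWhile q
  v l := V (l.takeWhile q)
  small l := (l.dropWhile q).head? ≠ some (V (l.takeWhile q))
  rank l := (l.takeWhile q).length
  append l := List.takeWhile_append_dropWhile
  pairwise {l} hl hl' := by
    obtain ⟨-, h₁, h₂⟩ := h.pos hl hl'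
    refine pairwise_insert ?_ h₁ h₂
    rw [List.takeWhile_append_dropWhile]
    exact hl.pairwise
  isChain {l} hl hl' := by
    refine isChain_insert ?_ ?_ hl'
    · rw [List.takeWhile_append_dropWhile]
      exact hl.isChain
    · intro h'
      have := List.mem_takeWhile_eq_true _ (List.mem_of_getLast? h')
      rw [(h.pos hl hl').1] at this
      contradiction
  not_small {l} hl hl' := by
    have h₂ : ∀ b ∈ (V (l.takeWhile q) :: l.dropWhile q).head?, q b = false := by
      intro b hb
      obtain rfl : V (l.takeWhile q) = b := by simpa using hb
      exact (h.pos hl hl').1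
    rw [List.takeWhile_append_of_head? List.mem_takeWhile_eq_true h₂,
      List.dropWhile_append_of_head? List.mem_takeWhile_eq_true h₂]
    simp
  exists_small {l} hl hl' := by
    rw [not_not] at hl'
    obtain ⟨l₂, h₂⟩ : ∃ l₂, l.dropWhile q = V (l.takeWhile q) :: l₂ :=
      ⟨_, (List.cons_head?_tail hl').symm⟩
    have hl1 : l = l.takeWhile q ++ V (l.takeWhile q) :: l₂ := by
      rw [← h₂, List.takeWhile_append_dropWhile]
    have hq := List.head?_dropWhile_eq_false q l _ hl'
    generalize l.takeWhile q = l₁, List.mem_takeWhile_eq_true (q := q) (l := l) = h₁ at hl1 hq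
    subst hl1
    obtain ⟨h3, h4, h5⟩ := h.erase hl h₁ hq
    refine ⟨l₁ ++ l₂, good_erase hl h₁ h3 h4 h5, ?_, ?_⟩
    · rw [List.takeWhile_append_of_head? h₁ h3, List.dropWhile_append_of_head? h₁ h3]
      exact head?_ne_of_isChain hl.isChain
    · rw [List.takeWhile_append_of_head? h₁ h3, List.dropWhile_append_of_head? h₁ h3]
  injective {l l'} hl hl' hs hs' e := by
    have key : ∀ {l}, M.Good A l → (l.dropWhile q).head? ≠ some (V (l.takeWhile q)) →
        ∀ b ∈ (V (l.takeWhile q) :: l.dropWhile q).head?, q b = false := by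
      intro l hl hl' b hb
      obtain rfl : V (l.takeWhile q) = b := by simpa using hb
      exact (h.pos hl hl').1
    have e1 := congrArg (List.takeWhile q) e
    rw [List.takeWhile_append_of_head? List.mem_takeWhile_eq_true (key hl hs),
      List.takeWhile_append_of_head? List.mem_takeWhile_eq_true (key hl' hs')] at e1
    rw [e1] at e
    have e2 := (List.cons_eq_cons.1 (List.append_cancel_left e)).2
    rw [← List.takeWhile_append_dropWhile (p := q) (l := l), e1, e2,
      List.takeWhile_append_dropWhile]
  rank_lt {l l'} hl hl' hs hs' j hj e := by
    have hV := (h.pos hl' hs').1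
    have h₁ := List.mem_takeWhile_eq_true (q := q) (l := l')
    generalize l'.takeWhile q = l₁, l'.dropWhile q = l₂ at e hV h₁ hj
    -- Erasing a vertex before the inserted one shortens the initial segment. Erasing one after it
    -- leaves the initial segment and the inserted vertex in place, so the result would not be
    -- small.
    rcases lt_or_gt_of_ne hj with hj | hj
    · rw [List.eraseIdx_append_of_lt_length hj] at e
      subst e
      rw [List.takeWhile_append_of_head? (fun a ha => h₁ a (List.mem_of_mem_eraseIdx ha))
        (by simpa using hV), List.length_eraseIdx_of_lt hj]
      lia
    · rw [List.eraseIdx_append_of_length_le hj.le] at e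
      obtain ⟨k, hk⟩ := Nat.exists_eq_succ_of_ne_zero (Nat.sub_ne_zero_of_lt hj)
      rw [hk, List.eraseIdx_cons_succ] at e
      subst e
      refine absurd ?_ hs
      rw [List.takeWhile_append_of_head? h₁ (by simpa using hV),
        List.dropWhile_append_of_head? h₁ (by simpa using hV)]
      simp

/-- Insertion of the vertex `V l₂` after the longest initial segment satisfying `q`,
where `l₂` is the remainder. -/
def final (h : IsEnd M A q V) : Insertion M A where
  fst l := l.takeWhile q
  snd l := l.dropWhile q
  v l := V (l.dropWhile q)
  small l := (l.takeWhile q).getLast? ≠ some (V (l.dropWhile q))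
  rank l := (l.dropWhile q).length
  append l := List.takeWhile_append_dropWhile
  pairwise {l} hl hl' := by
    obtain ⟨-, h₁, h₂⟩ := h.pos hl hl'
    refine pairwise_insert ?_ h₁ h₂
    rw [List.takeWhile_append_dropWhile]
    exact hl.pairwise
  isChain {l} hl hl' := by
    refine isChain_insert ?_ hl' ?_
    · rw [List.takeWhile_append_dropWhile]
      exact hl.isChain
    · intro h'
      have := List.head?_dropWhile_eq_false _ _ _ h'
      rw [(h.pos hl hl').1] at this
      contradiction
  not_small {l} hl hl' := by
    have h₁ := List.mem_takeWhile_eq_true (q := q) (l := l)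
    have h₂ := List.head?_dropWhile_eq_false q l
    have hV := (h.pos hl hl').1
    generalize l.takeWhile q = l₁, l.dropWhile q = l₂ at h₁ h₂ hV
    rw [List.takeWhile_append_cons h₁ h₂ hV, List.dropWhile_append_cons h₁ h₂ hV]
    simp
  exists_small {l} hl hl' := by
    rw [not_not] at hl'
    have hq := List.mem_takeWhile_eq_true _ (List.mem_of_getLast? hl')
    obtain ⟨l₁, h₁⟩ := List.getLast?_eq_some_iff.1 hl'
    have h₂ := List.mem_takeWhile_eq_true (q := q) (l := l)
    have h₃ := List.head?_dropWhile_eq_false q l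
    have hl1 : l = l₁ ++ V (l.dropWhile q) :: l.dropWhile q := by
      conv_lhs => rw [← List.takeWhile_append_dropWhile (p := q) (l := l), h₁]
      simp
    rw [h₁] at h₂
    replace h₂ : ∀ a ∈ l₁, q a = true := fun a ha => h₂ a (by simp [ha])
    clear h₁ hl'
    generalize l.dropWhile q = l₂ at hl1 hq h₃
    subst hl1
    obtain ⟨h4, h5⟩ := h.erase hl h₂ hq h₃
    refine ⟨l₁ ++ l₂, good_erase hl h₂ h₃ h4 h5, ?_, ?_⟩
    · rw [List.takeWhile_append_of_head? h₂ h₃, List.dropWhile_append_of_head? h₂ h₃]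
      exact getLast?_ne_of_isChain hl.isChain
    · rw [List.takeWhile_append_of_head? h₂ h₃, List.dropWhile_append_of_head? h₂ h₃]
  injective {l l'} hl hl' hs hs' e := by
    have e1 := congrArg (List.dropWhile q) e
    rw [List.dropWhile_append_cons List.mem_takeWhile_eq_true (List.head?_dropWhile_eq_false q l)
        (h.pos hl hs).1,
      List.dropWhile_append_cons List.mem_takeWhile_eq_true (List.head?_dropWhile_eq_false q l')
        (h.pos hl' hs').1] at e1
    rw [e1] at e
    have e2 := List.append_cancel_right e
    rw [← List.takeWhile_append_dropWhile (p := q) (l := l), e1, e2,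
      List.takeWhile_append_dropWhile]
  rank_lt {l l'} hl hl' hs hs' j hj e := by
    have hV := (h.pos hl' hs').1
    have h₁ := List.mem_takeWhile_eq_true (q := q) (l := l')
    have h₂ := List.head?_dropWhile_eq_false q l'
    generalize l'.takeWhile q = l₁, l'.dropWhile q = l₂ at e hV h₁ hj h₂
    -- Here the roles are exchanged: the inserted vertex depends on the remainder, so erasing before
    -- it leaves a chain which is not small, and erasing after it shortens the remainder.
    rcases lt_or_gt_of_ne hj with hj | hj
    · rw [List.eraseIdx_append_of_lt_length hj] at e
      subst e
      refine absurd ?_ hs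
      have h₁' : ∀ a ∈ l₁.eraseIdx j, q a = true := fun a ha => h₁ a (List.mem_of_mem_eraseIdx ha)
      rw [List.takeWhile_append_cons h₁' h₂ hV, List.dropWhile_append_cons h₁' h₂ hV]
      simp
    · rw [List.eraseIdx_append_of_length_le hj.le] at e
      obtain ⟨k, hk⟩ := Nat.exists_eq_succ_of_ne_zero (Nat.sub_ne_zero_of_lt hj)
      rw [hk, List.eraseIdx_cons_succ] at e
      -- An index beyond the end erases nothing, and then the chain still ends its initial segment
      -- with the inserted vertex.
      by_cases hk' : k < l₂.length
      · subst e
        rw [List.dropWhile_append_of_pos h₁, List.dropWhile_cons_of_pos hV]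
        have h3 := (List.dropWhile_sublist q (l := l₂.eraseIdx k)).length_le
        rw [List.length_eraseIdx_of_lt hk'] at h3
        lia
      · rw [List.eraseIdx_of_length_le (by lia)] at e
        subst e
        refine absurd ?_ hs
        rw [List.takeWhile_append_cons h₁ h₂ hV, List.dropWhile_append_cons h₁ h₂ hV]
        simp

end Insertion

end SSet

/-! ### Chains of vertices in a standard simplex. -/

namespace SSet

/-- The simplices of a standard simplex are the chains of vertices. -/
def stdSimplex.vertexModel (n : ℕ) : VertexModel Δ[n] (Fin (n + 1)) where
  equiv _ := stdSimplex.objEquiv.trans SimplexCategory.homEquivOrderHom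
  equiv_map _ _ _ := rfl

namespace VertexModel

variable {X : SSet.{u}} {P : Type} [Preorder P] (M : VertexModel X P)

lemma toList_map {m n : ℕ} (f : ⦋m⦌ ⟶ ⦋n⦌) (x : X _⦋n⦌) :
    M.toList (X.map f.op x) = ((stdSimplex.vertexModel.{u} n).toList
      (stdSimplex.objEquiv.symm f)).map (M.equiv n x) := by
  simp only [toList, List.map_ofFn]
  congr 1
  ext i
  exact M.equiv_map f x i

lemma toList_yonedaEquiv_symm_app {m n : ℕ} (x : X _⦋n⦌) (y : (Δ[n] : SSet.{u}) _⦋m⦌) :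
    M.toList ((yonedaEquiv.symm x).app _ y) =
      ((stdSimplex.vertexModel n).toList y).map (M.equiv n x) := by
  obtain ⟨f, rfl⟩ := stdSimplex.objEquiv.symm.surjective y
  exact M.toList_map f x

/-- The map from a standard simplex determined by a chain of vertices. -/
def simplexMap {n : ℕ} (f : Fin (n + 1) →o P) : Δ[n] ⟶ X :=
  yonedaEquiv.symm ((M.equiv n).symm f)

lemma toList_simplexMap_app {m n : ℕ} (f : Fin (n + 1) →o P) (y : (Δ[n] : SSet.{u}) _⦋m⦌) :
    M.toList ((M.simplexMap f).app _ y) = ((stdSimplex.vertexModel n).toList y).map f := by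
  rw [simplexMap, toList_yonedaEquiv_symm_app, Equiv.apply_symm_apply]

lemma getElem?_toList {m : ℕ} (x : X _⦋m⦌) (k : Fin (m + 1)) :
    (M.toList x)[k.val]? = some (M.equiv m x k) := by
  rw [toList, List.getElem?_ofFn, dif_pos k.2]

lemma exists_eq_pair {a b : P} (h : a ≤ b) : ∃ x : X _⦋1⦌, M.toList x = [a, b] :=
  M.exists_toList_eq (by simp) (by simpa using h)

lemma le_of_toList_eq {x : X _⦋2⦌} {a b c : P} (h : M.toList x = [a, b, c]) : a ≤ b ∧ b ≤ c := by
  have := M.pairwise_toList x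
  rw [h] at this
  simp only [List.pairwise_cons, List.mem_cons, List.not_mem_nil, or_false,
    forall_eq_or_imp, forall_eq] at this
  exact ⟨this.1.1, this.2.1⟩

end VertexModel

lemma stdSimplex.toList_triangle {n : ℕ} (a b c : Fin (n + 1)) (h : a ≤ b) (h' : b ≤ c) :
    (stdSimplex.vertexModel.{u} n).toList (stdSimplex.triangle a b c h h') = [a, b, c] := rfl

lemma stdSimplex.toList_edge {n : ℕ} (a b : Fin (n + 1)) (h : a ≤ b) :
    (stdSimplex.vertexModel.{u} n).toList (stdSimplex.edge n a b h) = [a, b] := rfl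

end SSet

/-! ### Thin triangles and consequences of saturation. -/

open SSet

namespace ScaledSSet

section

variable {X : SSet.{u}} {P : Type} [Preorder P] (M : VertexModel X P) {E B : ScaledSSet.{u}}

/-- The triangle with vertices `a`, `b`, `c` is thin, if it belongs to the subcomplex `A`. -/
def ThinOn {A : X.Subcomplex} (f : (A : SSet.{u}) ⟶ E.toSSet) (a b c : P) : Prop :=
  ∀ (t : X _⦋2⦌) (ht : t ∈ A.obj _), M.toList t = [a, b, c] → f.app _ ⟨t, ht⟩ ∈ E.thin

/-- The triangle with vertices `a`, `b`, `c` is thin. -/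
def ThinAt (f : X ⟶ E.toSSet) (a b c : P) : Prop :=
  ∀ t : X _⦋2⦌, M.toList t = [a, b, c] → f.app _ t ∈ E.thin

lemma thin_of_degenerate (f : X ⟶ E.toSSet) {t : X _⦋2⦌} (ht : t ∈ X.degenerate 2) :
    f.app _ t ∈ E.thin :=
  E.degenerate_subset_thin (degenerate_app_apply ht f)

variable {M}

lemma thinAt_left (f : X ⟶ E.toSSet) (a b : P) : ThinAt M f a a b := by
  intro t ht
  by_cases h : t ∈ X.degenerate 2
  · exact thin_of_degenerate f h
  · rw [← mem_nonDegenerate_iff_notMem_degenerate, M.mem_nonDegenerate_iff, ht] at h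
    simp at h

lemma thinAt_right (f : X ⟶ E.toSSet) (a b : P) : ThinAt M f a b b := by
  intro t ht
  by_cases h : t ∈ X.degenerate 2
  · exact thin_of_degenerate f h
  · rw [← mem_nonDegenerate_iff_notMem_degenerate, M.mem_nonDegenerate_iff, ht] at h
    simp at h

lemma ThinAt.comp {f : X ⟶ E.toSSet} {a b c : P} (h : ThinAt M f a b c) (p : E ⟶ B) :
    ThinAt M (f ≫ p.toHom) a b c := fun t ht => p.map_thin _ (h t ht)

lemma ThinAt.thinOn {f : X ⟶ E.toSSet} {a b c : P} (h : ThinAt M f a b c) (A : X.Subcomplex) :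
    ThinOn M (A.ι ≫ f) a b c := fun t _ ht => h t ht

lemma ThinAt.of_thinOn {A : X.Subcomplex} {u : (A : SSet.{u}) ⟶ E.toSSet} {f : X ⟶ E.toSSet}
    (h : A.ι ≫ f = u) {a b c : P} (hu : ThinOn M u a b c)
    (hA : ∀ t : X _⦋2⦌, M.toList t = [a, b, c] → t ∈ A.obj _) : ThinAt M f a b c := by
  intro t ht
  have := hu t (hA t ht) ht
  rw [← h] at this
  exact this

lemma ThinAt.simplexMap {f : X ⟶ E.toSSet} {n : ℕ} {φ : Fin (n + 1) →o P} {i j k : Fin (n + 1)}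
    (h : ThinAt M f (φ i) (φ j) (φ k)) :
    ThinAt (stdSimplex.vertexModel n) (M.simplexMap φ ≫ f) i j k := by
  intro t ht
  refine h ((M.simplexMap φ).app _ t) ?_
  rw [M.toList_simplexMap_app, ht]
  rfl

lemma ThinAt.of_simplexMap {f : X ⟶ E.toSSet} {n : ℕ} {φ : Fin (n + 1) →o P}
    {i j k : Fin (n + 1)} (hij : i ≤ j) (hjk : j ≤ k)
    (h : ThinAt (stdSimplex.vertexModel n) (M.simplexMap φ ≫ f) i j k) :
    ThinAt M f (φ i) (φ j) (φ k) := by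
  intro t ht
  have := h _ (stdSimplex.toList_triangle i j k hij hjk)
  rw [show t = (M.simplexMap φ).app _ (stdSimplex.triangle i j k hij hjk) from ?_]
  · exact this
  · apply M.toList_injective
    rw [ht, M.toList_simplexMap_app]
    rfl

lemma ThinAt.of_simplexMap_eq {f : X ⟶ E.toSSet} {n : ℕ} {φ : Fin (n + 1) →o P}
    {g : Δ[n] ⟶ E.toSSet} (hg : M.simplexMap φ ≫ f = g)
    {i j k : Fin (n + 1)} (hij : i ≤ j) (hjk : j ≤ k)
    (h : ThinAt (stdSimplex.vertexModel n) g i j k) {a b c : P}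
    (ha : φ i = a) (hb : φ j = b) (hc : φ k = c) :
    ThinAt M f a b c := by
  subst hg ha hb hc
  exact h.of_simplexMap hij hjk

/-- Maps from a scaled simplex with the given thin triangles. -/
def simplexHom {n : ℕ} (f : Δ[n] ⟶ E.toSSet) (S : Set ((Δ[n] : SSet.{u}) _⦋2⦌))
    (h : ∀ t ∈ S, f.app _ t ∈ E.thin) : simplex n S ⟶ E where
  toHom := f
  map_thin t ht := ht.elim (fun ht => thin_of_degenerate f ht) (h t)

/-- Maps from a scaled horn with the given thin triangles. -/
def hornHom {n : ℕ} {i : Fin (n + 1)} (f : (Λ[n, i] : SSet.{u}) ⟶ E.toSSet)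
    (S : Set ((Δ[n] : SSet.{u}) _⦋2⦌))
    (h : ∀ t (ht : t ∈ Λ[n, i].obj _), t ∈ S → f.app _ ⟨t, ht⟩ ∈ E.thin) :
    horn n i S ⟶ E where
  toHom := f
  map_thin t ht := ht.elim (fun ht => thin_of_degenerate f ht) (h t.1 t.2)

/-- A chain of five elements. -/
def chain₅ {a₀ a₁ a₂ a₃ a₄ : P} (h₀ : a₀ ≤ a₁) (h₁ : a₁ ≤ a₂) (h₂ : a₂ ≤ a₃) (h₃ : a₃ ≤ a₄) :
    Fin 5 →o P :=
  ⟨![a₀, a₁, a₂, a₃, a₄], Fin.monotone_iff_le_succ.2 (by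
    intro i; fin_cases i <;> assumption)⟩

lemma thinAt_of_mem {n : ℕ} {S : Set ((Δ[n] : SSet.{u}) _⦋2⦌)} (f : simplex n S ⟶ E)
    {t : (Δ[n] : SSet.{u}) _⦋2⦌} (ht : t ∈ S) {a b c : Fin (n + 1)}
    (h : (stdSimplex.vertexModel n).toList t = [a, b, c]) :
    ThinAt (stdSimplex.vertexModel n) f.toHom a b c := by
  intro s hs
  rw [← h] at hs
  obtain rfl := (stdSimplex.vertexModel n).toList_injective hs
  exact f.map_thin _ (Or.inr ht)

/-- The five vertices may repeat, so that (ii) can be applied to degenerate 4-simplices, where some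
of the required triangles are automatically thin. -/
lemma thinAt_saturation {p : E ⟶ B} (hp : HasLiftingProperty saturationMap p)
    {f : X ⟶ E.toSSet} {a₀ a₁ a₂ a₃ a₄ : P} (h₀ : a₀ ≤ a₁) (h₁ : a₁ ≤ a₂) (h₂ : a₂ ≤ a₃)
    (h₃ : a₃ ≤ a₄) (h024 : ThinAt M f a₀ a₂ a₄) (h123 : ThinAt M f a₁ a₂ a₃)
    (h013 : ThinAt M f a₀ a₁ a₃) (h134 : ThinAt M f a₁ a₃ a₄) (h012 : ThinAt M f a₀ a₁ a₂)
    (b034 : ThinAt M (f ≫ p.toHom) a₀ a₃ a₄) (b014 : ThinAt M (f ≫ p.toHom) a₀ a₁ a₄) :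
    ThinAt M f a₀ a₃ a₄ ∧ ThinAt M f a₀ a₁ a₄ := by
  let φ := chain₅ h₀ h₁ h₂ h₃
  let u : simplex 4 satTri ⟶ E := simplexHom (M.simplexMap φ ≫ f) _ (by
    rintro t (rfl | rfl | rfl | rfl | rfl)
    · exact ThinAt.simplexMap (φ := φ) (i := 0) (j := 2) (k := 4) h024 _ rfl
    · exact ThinAt.simplexMap (φ := φ) (i := 1) (j := 2) (k := 3) h123 _ rfl
    · exact ThinAt.simplexMap (φ := φ) (i := 0) (j := 1) (k := 3) h013 _ rfl
    · exact ThinAt.simplexMap (φ := φ) (i := 1) (j := 3) (k := 4) h134 _ rfl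
    · exact ThinAt.simplexMap (φ := φ) (i := 0) (j := 1) (k := 2) h012 _ rfl)
  let v : simplex 4 satTri' ⟶ B := simplexHom (M.simplexMap φ ≫ f ≫ p.toHom) _ (by
    rintro t (ht | rfl | rfl)
    · exact p.map_thin _ (u.map_thin t (Or.inr ht))
    · exact ThinAt.simplexMap (φ := φ) (i := 0) (j := 3) (k := 4) b034 _ rfl
    · exact ThinAt.simplexMap (φ := φ) (i := 0) (j := 1) (k := 4) b014 _ rfl)
  have sq : CommSq u saturationMap p v := ⟨by
    apply Hom.ext
    rfl⟩
  obtain ⟨⟨l, hl, -⟩⟩ := hp.sq_hasLift sq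
  have hl' : M.simplexMap φ ≫ f = l.toHom := congrArg Hom.toHom hl.symm
  exact ⟨ThinAt.of_simplexMap_eq (φ := φ) (i := 0) (j := 3) (k := 4) hl' (by decide) (by decide)
      (thinAt_of_mem l (Or.inr (Or.inl rfl)) (stdSimplex.toList_triangle _ _ _ _ _)) rfl rfl rfl,
    ThinAt.of_simplexMap_eq (φ := φ) (i := 0) (j := 1) (k := 4) hl' (by decide) (by decide)
      (thinAt_of_mem l (Or.inr (Or.inr rfl)) (stdSimplex.toList_triangle _ _ _ _ _)) rfl rfl rfl⟩

/-- Saturation for the chain `a b b c d`: its triangle `034` is `a c d`, and `012`, `123` are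
degenerate. This is the missing face of `Λ^3_1`. -/
lemma thinAt_inner_left {p : E ⟶ B} (hp : HasLiftingProperty saturationMap p)
    {f : X ⟶ E.toSSet} {a b c d : P} (h₀ : a ≤ b) (h₁ : b ≤ c) (h₂ : c ≤ d)
    (hbcd : ThinAt M f b c d) (habd : ThinAt M f a b d) (habc : ThinAt M f a b c)
    (h : ThinAt M (f ≫ p.toHom) a c d) : ThinAt M f a c d :=
  (thinAt_saturation hp h₀ (le_refl b) h₁ h₂ habd (thinAt_left _ _ _) habc hbcd
    (thinAt_right _ _ _) h (habd.comp p)).1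

/-- Saturation for the chain `a b c c d`: its triangle `014` is `a b d`, and `123` is degenerate.
This is the missing face of `Λ^3_2`. -/
lemma thinAt_inner_right {p : E ⟶ B} (hp : HasLiftingProperty saturationMap p)
    {f : X ⟶ E.toSSet} {a b c d : P} (h₀ : a ≤ b) (h₁ : b ≤ c) (h₂ : c ≤ d)
    (hbcd : ThinAt M f b c d) (hacd : ThinAt M f a c d) (habc : ThinAt M f a b c)
    (h : ThinAt M (f ≫ p.toHom) a b d) : ThinAt M f a b d :=
  (thinAt_saturation hp h₀ h₁ (le_refl c) h₂ hacd (thinAt_right _ _ _) habc hbcd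
    habc (hacd.comp p) h).2

end

end ScaledSSet

/-! ### Reversal of simplices and of horns. -/

namespace SSet

namespace stdSimplex

/-- The reversal of the vertices of a simplex. -/
def reverse {n : ℕ} {k : SimplexCategoryᵒᵖ} (y : (Δ[n] : SSet.{u}).obj k) :
    (Δ[n] : SSet.{u}).obj k := opObjEquiv ((stdSimplex.opIso.{u} ⦋n⦌).inv.app k y)

lemma reverse_apply {n m : ℕ} (y : (Δ[n] : SSet.{u}) _⦋m⦌) (j : Fin (m + 1)) :
    reverse y j = (y j.rev).rev :=
  stdSimplex.opObjEquiv_opObjEquiv_symm_apply.{0} y j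

lemma reverse_map {n : ℕ} {k k' : SimplexCategoryᵒᵖ} (f : k ⟶ k')
    (y : (Δ[n] : SSet.{u}).obj k) :
    reverse ((Δ[n] : SSet.{u}).map f y) =
      (Δ[n] : SSet.{u}).map (SimplexCategory.rev.map f.unop).op (reverse y) := by
  obtain ⟨k⟩ := k
  obtain ⟨k'⟩ := k'
  induction k using SimplexCategory.rec with | _ k
  induction k' using SimplexCategory.rec with | _ k'
  refine stdSimplex.ext _ _ (fun j => ?_)
  rw [reverse_apply]
  change _ = reverse y ((f.unop.toOrderHom j.rev).rev)
  rw [reverse_apply, Fin.rev_rev]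
  rfl

lemma reverse_reverse {n : ℕ} {k : SimplexCategoryᵒᵖ} (y : (Δ[n] : SSet.{u}).obj k) :
    reverse (reverse y) = y := by
  obtain ⟨k⟩ := k
  induction k using SimplexCategory.rec with | _ k
  refine stdSimplex.ext _ _ (fun j => ?_)
  rw [reverse_apply, reverse_apply, Fin.rev_rev, Fin.rev_rev]

lemma toList_reverse {n m : ℕ} (y : (Δ[n] : SSet.{u}) _⦋m⦌) :
    (stdSimplex.vertexModel n).toList (reverse y) =
      (((stdSimplex.vertexModel n).toList y).map Fin.rev).reverse := by
  apply List.ext_get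
  · simp
  · intro i h1 h2
    simp only [VertexModel.toList, List.get_eq_getElem, List.getElem_reverse, List.getElem_map,
      List.getElem_ofFn, List.length_map, List.length_ofFn]
    refine (reverse_apply y _).trans ?_
    refine congrArg (fun z => (y z).rev) ?_
    ext
    simp

lemma reverse_mem_horn {n : ℕ} {i i' : Fin (n + 1)} (hi : i' = i.rev) {k : SimplexCategoryᵒᵖ}
    (y : (Δ[n] : SSet.{u}).obj k) : reverse y ∈ Λ[n, i].obj k ↔ y ∈ Λ[n, i'].obj k := by
  rw [hi, ← op_horn]
  rfl

end stdSimplex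

open SSet.stdSimplex

/-- A lifting problem for a horn gives a lifting problem for the opposite horn. -/
lemma exists_op_horn {X Y : SSet.{u}} (q : X ⟶ Y) {n : ℕ} {i i' : Fin (n + 1)} (hi : i' = i.rev)
    (g : (Λ[n, i] : SSet.{u}) ⟶ X) (v : Δ[n] ⟶ Y) (w : g ≫ q = Λ[n, i].ι ≫ v) :
    ∃ (g' : (Λ[n, i'] : SSet.{u}) ⟶ X.op) (v' : Δ[n] ⟶ Y.op),
      g' ≫ opFunctor.map q = Λ[n, i'].ι ≫ v' ∧
      (∀ k y hy hy', opObjEquiv (g'.app k ⟨y, hy⟩) = g.app k ⟨reverse y, hy'⟩) ∧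
      (∀ k y, opObjEquiv (v'.app k y) = v.app k (reverse y)) ∧
      ∀ l' : Δ[n] ⟶ X.op, Λ[n, i'].ι ≫ l' = g' → l' ≫ opFunctor.map q = v' →
        ∃ l : Δ[n] ⟶ X, Λ[n, i].ι ≫ l = g ∧ l ≫ q = v ∧
          ∀ k y, opObjEquiv (l'.app k y) = l.app k (reverse y) := by
  let g' : (Λ[n, i'] : SSet.{u}) ⟶ X.op :=
    { app := fun k => TypeCat.ofHom (fun y =>
        opObjEquiv.symm (g.app k ⟨reverse y.1, (reverse_mem_horn hi _).2 y.2⟩))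
      naturality := by
        intro k k' f
        ext y
        have h := NatTrans.naturality_apply g (SimplexCategory.rev.map f.unop).op
          ⟨reverse y.1, (reverse_mem_horn hi _).2 y.2⟩
        refine Eq.trans ?_ (congrArg opObjEquiv.symm h)
        refine congrArg (fun z => opObjEquiv.symm (g.app k' z)) (Subtype.ext ?_)
        exact reverse_map f y.1 }
  let v' : Δ[n] ⟶ Y.op := (stdSimplex.opIso.{u} ⦋n⦌).inv ≫ opFunctor.map v
  refine ⟨g', v', ?_, ?_, ?_, ?_⟩
  · ext k ⟨y, hy⟩
    exact congrArg (fun z => z.app k ⟨reverse y, (reverse_mem_horn hi _).2 hy⟩) w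
  · intros; rfl
  · intros; rfl
  · intro l' h1 h2
    let l : Δ[n] ⟶ X := (stdSimplex.opIso.{u} ⦋n⦌).inv ≫ opFunctor.map l' ≫
      opFunctorCompOpFunctorIso.hom.app X
    have hl : ∀ k y, opObjEquiv (l'.app k y) = l.app k (reverse y) := by
      intro k y
      change _ = opObjEquiv (l'.app k (reverse (reverse y)))
      rw [reverse_reverse]
    refine ⟨l, ?_, ?_, hl⟩
    · ext k ⟨y, hy⟩
      have hy' : reverse y ∈ Λ[n, i'].obj k := by
        rwa [← reverse_mem_horn hi, reverse_reverse]
      have h3 := congrArg (fun z => opObjEquiv (z.app k ⟨reverse y, hy'⟩)) h1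
      refine Eq.trans h3 ?_
      change g.app k ⟨reverse (reverse y), _⟩ = _
      exact congrArg (fun z => g.app k z) (Subtype.ext (reverse_reverse y))
    · ext k y
      have h3 := congrArg (fun z => opObjEquiv (z.app k (reverse y))) h2
      refine Eq.trans h3 ?_
      exact congrArg (fun z => v.app k z) (reverse_reverse y)

end SSet

/-! ### Scaled lifting properties in terms of thin triangles. -/

namespace ScaledSSet

variable {E B : ScaledSSet.{u}}

/-- The lifting property for inner horns. -/
def LiftsInner (p : E ⟶ B) : Prop :=
  ∀ (d : ℕ) (i : Fin (d + 2)) (_ : i ≠ 0) (_ : i ≠ Fin.last (d + 1))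
    (g : (Λ[d + 1, i] : SSet.{u}) ⟶ E.toSSet) (v : Δ[d + 1] ⟶ B.toSSet),
    g ≫ p.toHom = Λ[d + 1, i].ι ≫ v →
    -- Quantifying over `a` and `b` names the vertices `i - 1` and `i + 1` without subtraction or
    -- overflow in `Fin`.
    (∀ a b : Fin (d + 2), a.val + 1 = i.val → b.val = i.val + 1 →
      ThinAt (stdSimplex.vertexModel _) v a i b ∧ ThinOn (stdSimplex.vertexModel _) g a i b) →
    ∃ l : Δ[d + 1] ⟶ E.toSSet, Λ[d + 1, i].ι ≫ l = g ∧ l ≫ p.toHom = v ∧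
      ∀ a b : Fin (d + 2), a.val + 1 = i.val → b.val = i.val + 1 →
        ThinAt (stdSimplex.vertexModel _) l a i b

/-- The lifting property for horns `Λ^n_0` which are given by `e` on the first edge. -/
def LiftsLeft (p : E ⟶ B) (e : E.toSSet _⦋1⦌) : Prop :=
  ∀ (m : ℕ) (g : (Λ[m + 2, 0] : SSet.{u}) ⟶ E.toSSet) (v : Δ[m + 2] ⟶ B.toSSet),
    g ≫ p.toHom = Λ[m + 2, 0].ι ≫ v → g.app _ (hornFirstEdge m) = e →
    ThinAt (stdSimplex.vertexModel _) v 0 1 (Fin.last _) →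
    ThinOn (stdSimplex.vertexModel _) g 0 1 (Fin.last _) →
    ∃ l : Δ[m + 2] ⟶ E.toSSet, Λ[m + 2, 0].ι ≫ l = g ∧ l ≫ p.toHom = v ∧
      ThinAt (stdSimplex.vertexModel _) l 0 1 (Fin.last _)

/-- The lifting property for horns `Λ^n_n` which are given by `e` on the last edge. -/
def LiftsRight (p : E ⟶ B) (e : E.toSSet _⦋1⦌) : Prop :=
  ∀ (m : ℕ) (g : (Λ[m + 2, Fin.last (m + 2)] : SSet.{u}) ⟶ E.toSSet) (v : Δ[m + 2] ⟶ B.toSSet),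
    g ≫ p.toHom = Λ[m + 2, Fin.last (m + 2)].ι ≫ v → g.app _ (hornLastEdge m) = e →
    ThinAt (stdSimplex.vertexModel _) v 0 (Fin.last (m + 1)).castSucc (Fin.last _) →
    ThinOn (stdSimplex.vertexModel _) g 0 (Fin.last (m + 1)).castSucc (Fin.last _) →
    ∃ l : Δ[m + 2] ⟶ E.toSSet, Λ[m + 2, Fin.last (m + 2)].ι ≫ l = g ∧ l ≫ p.toHom = v ∧
      ThinAt (stdSimplex.vertexModel _) l 0 (Fin.last (m + 1)).castSucc (Fin.last _)

lemma exists_lift_of_hasLift {p : E ⟶ B} {n : ℕ} {i a b c : Fin (n + 1)} (hab : a ≤ b)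
    (hbc : b ≤ c)
    (g : (Λ[n, i] : SSet.{u}) ⟶ E.toSSet)
    (H : ∀ (u : horn n i {stdSimplex.triangle a b c hab hbc} ⟶ E)
      (v : simplex n {stdSimplex.triangle a b c hab hbc} ⟶ B) (sq : CommSq u (hornι _ _ _) p v),
      u.toHom = g → sq.HasLift)
    (v : Δ[n] ⟶ B.toSSet)
    (w : g ≫ p.toHom = Λ[n, i].ι ≫ v) (hv : ThinAt (stdSimplex.vertexModel _) v a b c)
    (hg : ThinOn (stdSimplex.vertexModel _) g a b c) :
    ∃ l : Δ[n] ⟶ E.toSSet, Λ[n, i].ι ≫ l = g ∧ l ≫ p.toHom = v ∧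
      ThinAt (stdSimplex.vertexModel _) l a b c := by
  let u' : horn n i {stdSimplex.triangle a b c hab hbc} ⟶ E := hornHom g _ (by
    rintro t ht rfl
    exact hg _ ht (stdSimplex.toList_triangle _ _ _ _ _))
  let v' : simplex n {stdSimplex.triangle a b c hab hbc} ⟶ B := simplexHom v _ (by
    rintro t rfl
    exact hv _ (stdSimplex.toList_triangle _ _ _ _ _))
  have sq : CommSq u' (hornι _ _ _) p v' := ⟨by
    apply Hom.ext
    exact w⟩
  obtain ⟨⟨l, hl, hl'⟩⟩ := H u' v' sq rfl
  exact ⟨l.toHom, congrArg Hom.toHom hl, congrArg Hom.toHom hl',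
    thinAt_of_mem l rfl (stdSimplex.toList_triangle _ _ _ _ _)⟩

lemma liftsInner_of_hasLift {p : E ⟶ B}
    (H : ∀ (m : ℕ) (j : Fin (m + 1)) (u : horn (m + 2) j.succ.castSucc (innerTri j) ⟶ E)
      (v : simplex (m + 2) (innerTri j) ⟶ B) (sq : CommSq u (hornι _ _ _) p v), sq.HasLift) :
    LiftsInner p := by
  intro d i h0 h1 g v w hT
  obtain ⟨m, rfl⟩ : ∃ m, d = m + 1 := by
    refine ⟨d - 1, ?_⟩
    by_contra hd
    obtain rfl : d = 0 := by lia
    fin_cases i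
    · exact h0 rfl
    · exact h1 rfl
  obtain ⟨i', rfl⟩ := Fin.exists_castSucc_eq.2 h1
  obtain ⟨j, rfl⟩ := Fin.exists_succ_eq.2 (show i' ≠ 0 by rintro rfl; exact h0 rfl)
  obtain ⟨l, h3, h4, h5⟩ := exists_lift_of_hasLift _ _ g (fun u v sq _ => H m j u v sq) v w
    (hT j.castSucc.castSucc j.succ.succ rfl rfl).1 (hT j.castSucc.castSucc j.succ.succ rfl rfl).2
  refine ⟨l, h3, h4, fun a b ha hb => ?_⟩
  obtain rfl : a = j.castSucc.castSucc := by
    ext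
    simpa using ha
  obtain rfl : b = j.succ.succ := by
    ext
    simpa using hb
  exact h5

lemma IsWeakFibration.liftsInner {p : E ⟶ B} (hp : IsWeakFibration p) : LiftsInner p :=
  liftsInner_of_hasLift (fun m j _ _ sq => (hp.inner m j).sq_hasLift sq)

lemma IsCartesianEdge.liftsRight {p : E ⟶ B} {e : E.toSSet _⦋1⦌} (he : IsCartesianEdge p e) :
    LiftsRight p e := by
  intro m g v w hge hv hg
  subst hge
  exact exists_lift_of_hasLift (Fin.zero_le _) (Fin.le_last _) g
    (fun u v sq hu => he m u v sq (by subst hu; rfl)) v w hv hg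

end ScaledSSet

/-! ### Scaled lifting along insertion procedures. -/

namespace ScaledSSet

/-- In dimension 2 the triangle `a b c` is the simplex itself; in any other dimension the equation
in `S` is impossible. -/
lemma thin_of_mk_eq {E : ScaledSSet.{u}} {n : ℕ} {l : Δ[n] ⟶ E.toSSet} {a b c : Fin (n + 1)}
    (h : ThinAt (stdSimplex.vertexModel n) l a b c)
    (habc : n = 2 → a.val = 0 ∧ b.val = 1 ∧ c.val = 2) (t : E.toSSet _⦋2⦌)
    (ht : S.mk (yonedaEquiv l) = S.mk t) : t ∈ E.thin := by
  obtain rfl : n = 2 := congrArg S.dim ht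
  obtain rfl : yonedaEquiv l = t := (S.ext_iff _ _).1 ht
  obtain ⟨ha, hb, hc⟩ := habc rfl
  obtain rfl : a = 0 := Fin.ext ha
  obtain rfl : b = 1 := Fin.ext hb
  obtain rfl : c = 2 := Fin.ext hc
  exact h _ rfl

end ScaledSSet

open ScaledSSet

namespace SSet.Insertion

variable {X : SSet.{u}} {P : Type} [Preorder P] {M : VertexModel X P}
    {A : X.Subcomplex} (D : Insertion M A) {E B : ScaledSSet.{u}} (p : E ⟶ B)
    (u : (A : SSet.{u}) ⟶ E.toSSet) (v : X ⟶ B.toSSet)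

/-- A triangle which is thin as far as it is defined, and otherwise has to be filled by a thin
triangle. -/
structure ThinTriangle (a b c : P) : Prop where
  base : ThinAt M v a b c
  given : ThinOn M u a b c
  mem_or (t : X _⦋2⦌) (ht : M.toList t = [a, b, c]) :
    t ∈ A.obj _ ∨ ∃ l, M.Good A l ∧ D.small l ∧ [a, b, c] = D.ins l

/-- The horns of an insertion procedure which are inner horns, or outer horns with special outer
edges. -/
def Fillable (l : List P) : Prop :=
  (∃ l₁ a b l₂, D.fst l = l₁ ++ [a] ∧ D.snd l = b :: l₂ ∧ D.ThinTriangle u v a (D.v l) b) ∨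
  (∃ b c l₂, D.fst l = [] ∧ D.snd l = b :: l₂ ∧ l₂.getLast? = some c ∧
    (∀ ε : X _⦋1⦌, M.toList ε = [D.v l, b] → ∃ h : ε ∈ A.obj _, LiftsLeft p (u.app _ ⟨ε, h⟩)) ∧
    D.ThinTriangle u v (D.v l) b c) ∨
  (∃ a c l₁, D.snd l = [] ∧ D.fst l = l₁ ++ [a] ∧ l₁.head? = some c ∧
    (∀ ε : X _⦋1⦌, M.toList ε = [a, D.v l] → ∃ h : ε ∈ A.obj _, LiftsRight p (u.app _ ⟨ε, h⟩)) ∧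
    D.ThinTriangle u v c a (D.v l))

variable {D p u v}

/-- A triangle of the horn either lies in `A`, where `u` decides, or was filled at an earlier cell,
where the record `hT` says that the filler is thin. -/
lemma ThinTriangle.thin {a b c : P} (h : D.ThinTriangle u v a b c) {d : ℕ} {x : X _⦋d + 1⦌}
    {i : Fin (d + 2)} {g : (Λ[d + 1, i] : SSet.{u}) ⟶ E.toSSet}
    (hA : ∀ (k) (y : (Λ[d + 1, i] : SSet.{u}).obj k)
      (hy : (yonedaEquiv.symm x).app _ y.1 ∈ A.obj k), g.app k y = u.app k ⟨_, hy⟩)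
    (hT : ∀ (y : (Λ[d + 1, i] : SSet.{u}) _⦋2⦌),
      (∃ l', M.Good A l' ∧ D.small l' ∧ M.toList ((yonedaEquiv.symm x).app _ y.1) = D.ins l') →
      g.app _ y ∈ E.thin)
    {j₁ j₂ j₃ : Fin (d + 2)} (h₁ : M.equiv _ x j₁ = a) (h₂ : M.equiv _ x j₂ = b)
    (h₃ : M.equiv _ x j₃ = c) :
    ThinAt (stdSimplex.vertexModel _) (yonedaEquiv.symm x ≫ v) j₁ j₂ j₃ ∧
    ThinOn (stdSimplex.vertexModel _) g j₁ j₂ j₃ := by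
  have key : ∀ t : (Δ[d + 1] : SSet.{u}) _⦋2⦌,
      (stdSimplex.vertexModel _).toList t = [j₁, j₂, j₃] →
      M.toList ((yonedaEquiv.symm x).app _ t) = [a, b, c] := by
    intro t ht
    rw [M.toList_yonedaEquiv_symm_app, ht]
    simp [h₁, h₂, h₃]
  refine ⟨fun t ht => h.base _ (key t ht), fun t ht ht' => ?_⟩
  rcases h.mem_or _ (key t ht') with hm | ⟨l, hl, hl', hl''⟩
  · rw [hA _ ⟨t, ht⟩ hm]
    exact h.given _ hm (key t ht')
  · exact hT ⟨t, ht⟩ ⟨l, hl, hl', (key t ht').trans hl''⟩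

lemma equiv_eq_of_toList {d : ℕ} {x : X _⦋d⦌} {l : List P} (hx : M.toList x = l)
    {j : Fin (d + 1)} {a : P} (h : l[j.val]? = some a) : M.equiv _ x j = a := by
  subst hx
  rw [M.getElem?_toList] at h
  simpa using h

variable (D)

/-- Lifting along an inclusion of simplicial sets, the cells of which are obtained by an insertion
procedure. -/
theorem exists_scaled_lift (hp : LiftsInner p) (huv : u ≫ p.toHom = A.ι ≫ v)
    (H : ∀ l, M.Good A l → D.small l → D.Fillable p u v l) :
    ∃ L : X ⟶ E.toSSet, A.ι ≫ L = u ∧ L ≫ p.toHom = v ∧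
      ∀ t : X _⦋2⦌, (∃ l, M.Good A l ∧ D.small l ∧ M.toList t = D.ins l) → L.app _ t ∈ E.thin := by
  refine D.exists_lift p.toHom u v huv E.thin ?_
  intro d x i l hl hl' hx hi g hg hA hT
  have hlen : d + 2 = (D.fst l).length + 1 + (D.snd l).length := by
    have := congrArg List.length hx
    simp only [VertexModel.length_toList, ins, List.length_append, List.length_cons] at this
    lia
  -- The inserted vertex is in the interior of the chain, at its beginning or at its end: an inner
  -- horn, a horn `Λ^n_0` or a horn `Λ^n_n`.
  rcases H l hl hl' with ⟨l₁, a, b, l₂, h₁, h₂, h⟩ | ⟨b, c, l₂, h₁, h₂, h₃, hε, h⟩ |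
    ⟨a, c, l₁, h₁, h₂, h₃, hε, h⟩
  · simp only [h₁, h₂, List.length_append, List.length_cons, List.length_nil] at hlen hi
    have hins : D.ins l = l₁ ++ a :: D.v l :: b :: l₂ := by simp [ins, h₁, h₂]
    rw [hins] at hx
    have hb : ∀ j : Fin (d + 2), j.val = i.val + 1 → M.equiv _ x j = b := fun j hj =>
      equiv_eq_of_toList hx (by
        rw [hj, hi, List.getElem?_append_right (by lia)]
        simp [show l₁.length + (0 + 1) + 1 - l₁.length = 2 by lia])
    have ha : ∀ j : Fin (d + 2), j.val + 1 = i.val → M.equiv _ x j = a := fun j hj =>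
      equiv_eq_of_toList hx (by
        rw [show j.val = l₁.length by lia, List.getElem?_append_right (by lia)]
        simp)
    have hv : M.equiv _ x i = D.v l :=
      equiv_eq_of_toList hx (by
        rw [hi, List.getElem?_append_right (by lia)]
        simp)
    obtain ⟨L, h3, h4, h5⟩ := hp d i (by rintro rfl; simp at hi) (by rintro rfl; simp at hi; lia)
      g _ hg (fun j j' hj hj' => h.thin hA hT (ha j hj) hv (hb j' hj'))
    refine ⟨L, h3, h4, thin_of_mk_eq (a := ⟨i.val - 1, by lia⟩) (b := i)
      (c := ⟨i.val + 1, by lia⟩) (h5 _ _ ?_ rfl) ?_⟩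
    · simp; lia
    · intro hd
      simp
      lia
  · simp only [h₁, h₂, List.length_cons, List.length_nil] at hlen hi
    have hins : D.ins l = D.v l :: b :: l₂ := by simp [ins, h₁, h₂]
    rw [hins] at hx
    have hpos : 0 < l₂.length := List.length_pos_iff.2 (by rintro rfl; simp at h₃)
    obtain ⟨m, rfl⟩ : ∃ m, d = m + 1 := ⟨d - 1, by lia⟩
    obtain rfl : i = 0 := Fin.ext hi
    have hv : M.equiv _ x 0 = D.v l := equiv_eq_of_toList hx (by simp)
    have hb : M.equiv _ x 1 = b := equiv_eq_of_toList hx (by simp)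
    have hc : M.equiv _ x (Fin.last _) = c := equiv_eq_of_toList hx (by
      rw [List.getLast?_eq_getElem?] at h₃
      rw [← h₃]
      simp only [Fin.val_last, List.getElem?_cons_succ]
      congr 1
      lia)
    obtain ⟨h3, h4⟩ := h.thin hA hT hv hb hc
    have hedge : M.toList ((yonedaEquiv.symm x).app _ (hornFirstEdge m).1) = [D.v l, b] := by
      rw [M.toList_yonedaEquiv_symm_app]
      change [M.equiv _ x 0, M.equiv _ x 1] = _
      rw [hv, hb]
    obtain ⟨hεA, hε'⟩ := hε _ hedge
    obtain ⟨L, h5, h6, h7⟩ := hε' m g _ hg (hA _ _ hεA) h3 h4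
    exact ⟨L, h5, h6, thin_of_mk_eq h7 (by
      intro hm
      obtain rfl : m = 0 := by lia
      simp)⟩
  · simp only [h₁, h₂, List.length_append, List.length_cons, List.length_nil] at hlen hi
    have hins : D.ins l = l₁ ++ [a, D.v l] := by simp [ins, h₁, h₂]
    rw [hins] at hx
    have hpos : 0 < l₁.length := List.length_pos_iff.2 (by rintro rfl; simp at h₃)
    obtain ⟨m, rfl⟩ : ∃ m, d = m + 1 := ⟨d - 1, by lia⟩
    obtain rfl : i = Fin.last (m + 2) := Fin.ext (by simp; lia)
    have hv : M.equiv _ x (Fin.last (m + 2)) = D.v l := equiv_eq_of_toList hx (by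
      rw [hi, List.getElem?_append_right (by lia)]
      simp)
    have ha : M.equiv _ x (Fin.last (m + 1)).castSucc = a := equiv_eq_of_toList hx (by
      rw [List.getElem?_append_right (by simp; lia)]
      simp [show m + 1 - l₁.length = 0 by lia])
    have hc : M.equiv _ x 0 = c := equiv_eq_of_toList hx (by
      rw [List.head?_eq_getElem?] at h₃
      rw [List.getElem?_append_left (by simpa using hpos), ← h₃]
      rfl)
    obtain ⟨h3, h4⟩ := h.thin hA hT hc ha hv
    have hedge : M.toList ((yonedaEquiv.symm x).app _ (hornLastEdge m).1) = [a, D.v l] := by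
      rw [M.toList_yonedaEquiv_symm_app]
      change [M.equiv _ x (Fin.last (m + 1)).castSucc, M.equiv _ x (Fin.last (m + 2))] = _
      rw [hv, ha]
    obtain ⟨hεA, hε'⟩ := hε _ hedge
    obtain ⟨L, h5, h6, h7⟩ := hε' m g _ hg (hA _ _ hεA) h3 h4
    exact ⟨L, h5, h6, thin_of_mk_eq h7 (by
      intro hm
      obtain rfl : m = 0 := by lia
      simp)⟩

end SSet.Insertion

/-! ### Lifting along cones in a simplex. -/

namespace SSet

open ScaledSSet

/-- Subcomplexes of a standard simplex which are cones with respect to a vertex `w`, which may lie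
in the middle. -/
structure IsCone {n : ℕ} (A : (Δ[n] : SSet.{u}).Subcomplex) (w : Fin (n + 1)) : Prop where
  mem_of_mem {m m' : ℕ} (x : (Δ[n] : SSet.{u}) _⦋m⦌) (y : (Δ[n] : SSet.{u}) _⦋m'⦌)
    (hx : x ∈ A.obj _) (h : ∀ c ∈ (stdSimplex.vertexModel n).toList y,
      c ∈ (stdSimplex.vertexModel n).toList x ∨ c = w) : y ∈ A.obj _
  mem {m : ℕ} (y : (Δ[n] : SSet.{u}) _⦋m⦌)
    (h : ∀ c ∈ (stdSimplex.vertexModel n).toList y, c = w) : y ∈ A.obj _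

namespace IsCone

variable {n : ℕ} {A : (Δ[n] : SSet.{u}).Subcomplex} {w : Fin (n + 1)}

lemma lt_of_mem_takeWhile {l : List (Fin (n + 1))} {a : Fin (n + 1)}
    (ha : a ∈ l.takeWhile (fun a => decide (a < w))) : a < w := by
  simpa using List.mem_takeWhile_imp ha

lemma le_of_mem_dropWhile {l : List (Fin (n + 1))} (hl : l.Pairwise (· ≤ ·)) {a : Fin (n + 1)}
    (ha : a ∈ l.dropWhile (fun a => decide (a < w))) : w ≤ a := by
  have h := List.head?_dropWhile_eq_false (fun a => decide (a < w)) l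
  have h' := hl.sublist (List.dropWhile_sublist (fun a => decide (a < w)))
  cases hd : l.dropWhile (fun a => decide (a < w)) with
  | nil => simp [hd] at ha
  | cons b l₂ =>
    rw [hd] at ha h h'
    have hb : w ≤ b := by simpa using h b (by simp)
    rcases List.mem_cons.1 ha with rfl | ha
    · exact hb
    · exact hb.trans ((List.pairwise_cons.1 h').1 a ha)

lemma mem_takeWhile_or_dropWhile {l : List (Fin (n + 1))} {a : Fin (n + 1)} (ha : a ∈ l) :
    a ∈ l.takeWhile (fun a => decide (a < w)) ∨ a ∈ l.dropWhile (fun a => decide (a < w)) := by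
  rw [← List.mem_append, List.takeWhile_append_dropWhile]
  exact ha

/-- For a cone, adding or removing `w` does not affect membership in `A`, so the pairing simply
toggles `w`. -/
lemma isStart (hA : IsCone A w) :
    Insertion.IsStart (stdSimplex.vertexModel n) A (fun a => decide (a < w)) (fun _ => w) where
  pos {l} hl hl' :=
    ⟨by simp, fun a ha => (lt_of_mem_takeWhile ha).le, fun b => le_of_mem_dropWhile hl.pairwise⟩
  erase {l₁ l₂} hl h₁ hV := by
    obtain ⟨m, x, -, hxA, hx⟩ := hl
    have hp := (stdSimplex.vertexModel n).pairwise_toList x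
    rw [hx, List.pairwise_append, List.pairwise_cons] at hp
    refine ⟨fun b hb => ?_, ?_, ?_⟩
    · simpa using hp.2.1.1 b (List.mem_of_mem_head? hb)
    · intro h
      obtain ⟨rfl, rfl⟩ := List.append_eq_nil_iff.1 h
      exact hxA (hA.mem x (by simp [hx]))
    · intro m' y hy hyA
      refine hxA (hA.mem_of_mem y x hyA ?_)
      rw [hx, hy]
      intro c hc
      simp only [List.mem_append, List.mem_cons] at hc ⊢
      tauto

/-- Insertion of the cone point. -/
def insertion (hA : IsCone A w) : Insertion (stdSimplex.vertexModel n) A :=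
  Insertion.start _ _ _ _ hA.isStart

variable {E B : ScaledSSet.{u}} {p : E ⟶ B} {u : (A : SSet.{u}) ⟶ E.toSSet}
  {v : Δ[n] ⟶ B.toSSet}

/-- This is the condition `mem_or` of `ThinTriangle`: if a triangle through `w` is outside `A`, then
so is the edge opposite to `w`, and the triangle is filled when `w` is inserted in that edge. -/
lemma mem_or_of_notMem (hA : IsCone A w) {l : List (Fin (n + 1))} {a b : Fin (n + 1)}
    (hl : l = hA.insertion.ins [a, b]) (hab : a ≠ b) (ha : a ≠ w) (hb : b ≠ w)
    (h : ∀ c, c ∈ l ↔ c = a ∨ c = b ∨ c = w) (hab' : a ≤ b)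
    (t : (Δ[n] : SSet.{u}) _⦋2⦌) (ht : (stdSimplex.vertexModel n).toList t = l) :
    t ∈ A.obj _ ∨ ∃ l', (stdSimplex.vertexModel n).Good A l' ∧ hA.insertion.small l' ∧
      l = hA.insertion.ins l' := by
  by_cases htA : t ∈ A.obj _
  · exact Or.inl htA
  · refine Or.inr ⟨[a, b], ?_, ?_, hl⟩
    · refine VertexModel.good_of_list (by simp) (by simpa using hab') (by simpa using hab) ?_
      intro m x hx hxA
      refine htA (hA.mem_of_mem x t hxA ?_)
      rw [ht, hx]
      intro c hc
      rw [h] at hc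
      simp only [List.mem_cons, List.not_mem_nil, or_false]
      tauto
    · intro h'
      have := List.dropWhile_sublist (fun a => decide (a < w)) (l := [a, b]) |>.subset
        (List.mem_of_mem_head? h')
      simp only [List.mem_cons, List.not_mem_nil, or_false] at this
      rcases this with h | h
      · exact ha h.symm
      · exact hb h.symm

/-- Toggling `w` pairs the simplices outside `A`. The horn is inner if there are vertices on both
sides of `w`, and outer if all other vertices are on one side. In the outer cases the two extreme
vertices other than `w` determine the special edge and the triangle which has to be thin. The last
clause holds because the nondegenerate triangles through `w` outside `A` are themselves filled by
the procedure. -/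
theorem exists_lift (hA : IsCone A w) (hp : LiftsInner p) (huv : u ≫ p.toHom = A.ι ≫ v)
    (H : ∀ (m : ℕ) (x : (Δ[n] : SSet.{u}) _⦋m⦌), x ∉ A.obj _ →
      ∀ L, (stdSimplex.vertexModel n).toList x = L →
      ((∃ a ∈ L, a < w) ∧ (∃ b ∈ L, w < b) ∧ ∀ a ∈ L, ∀ b ∈ L, a < w → w < b →
        ThinAt (stdSimplex.vertexModel n) v a w b ∧ ThinOn (stdSimplex.vertexModel n) u a w b) ∨
      ((∀ d ∈ L, w ≤ d) ∧ ∃ b ∈ L, ∃ c ∈ L, w < b ∧ b < c ∧ (∀ d ∈ L, d = w ∨ b ≤ d ∧ d ≤ c) ∧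
        (∀ ε : (Δ[n] : SSet.{u}) _⦋1⦌, (stdSimplex.vertexModel n).toList ε = [w, b] →
          ∃ h : ε ∈ A.obj _, LiftsLeft p (u.app _ ⟨ε, h⟩)) ∧
        ThinAt (stdSimplex.vertexModel n) v w b c ∧ ThinOn (stdSimplex.vertexModel n) u w b c) ∨
      ((∀ d ∈ L, d ≤ w) ∧ ∃ c ∈ L, ∃ a ∈ L, c < a ∧ a < w ∧ (∀ d ∈ L, d = w ∨ c ≤ d ∧ d ≤ a) ∧
        (∀ ε : (Δ[n] : SSet.{u}) _⦋1⦌, (stdSimplex.vertexModel n).toList ε = [a, w] →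
          ∃ h : ε ∈ A.obj _, LiftsRight p (u.app _ ⟨ε, h⟩)) ∧
        ThinAt (stdSimplex.vertexModel n) v c a w ∧ ThinOn (stdSimplex.vertexModel n) u c a w)) :
    ∃ L : Δ[n] ⟶ E.toSSet, A.ι ≫ L = u ∧ L ≫ p.toHom = v ∧
      ∀ a b c : Fin (n + 1), a < b → b < c → a = w ∨ b = w ∨ c = w →
        (∀ t : (Δ[n] : SSet.{u}) _⦋2⦌, (stdSimplex.vertexModel n).toList t = [a, b, c] →
          t ∉ A.obj _) →
        ThinAt (stdSimplex.vertexModel n) L a b c := by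
  obtain ⟨L, h1, h2, h3⟩ := hA.insertion.exists_scaled_lift (p := p) (u := u) (v := v) hp huv (by
    intro l hl hl'
    obtain ⟨m, x, -, hxA, hx⟩ := hl
    have hpw := (stdSimplex.vertexModel n).pairwise_toList x
    have hfst : hA.insertion.fst l = l.takeWhile (fun a => decide (a < w)) := rfl
    have hsnd : hA.insertion.snd l = l.dropWhile (fun a => decide (a < w)) := rfl
    replace hl' : (l.dropWhile (fun a => decide (a < w))).head? ≠ some w := hl'
    rw [hx] at hpw
    rcases H m x hxA l hx with ⟨⟨a, ha, haw⟩, ⟨b, hb, hwb⟩, hT⟩ |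
      ⟨hd, b, hb, c, hc, hwb, hbc, hbd, hε, hT⟩ | ⟨hd, c, hc, a, ha, hca, haw, hbd, hε, hT⟩
    · left
      have ha' : l.takeWhile (fun a => decide (a < w)) ≠ [] := by
        rcases mem_takeWhile_or_dropWhile ha with h | h
        · exact List.ne_nil_of_mem h
        · exact absurd (le_of_mem_dropWhile hpw h) (not_le.2 haw)
      have hb' : l.dropWhile (fun a => decide (a < w)) ≠ [] := by
        rcases mem_takeWhile_or_dropWhile hb with h | h
        · exact absurd (lt_of_mem_takeWhile h) (not_lt.2 hwb.le)
        · exact List.ne_nil_of_mem h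
      obtain ⟨l₁, a', h₁⟩ := List.eq_nil_or_concat'  _ |>.resolve_left ha'
      obtain ⟨b', l₂, h₂⟩ := List.exists_cons_of_ne_nil hb'
      have ha'' : a' < w := lt_of_mem_takeWhile (l := l) (by rw [h₁]; simp)
      have hb'' : w < b' := by
        refine lt_of_le_of_ne (le_of_mem_dropWhile hpw (by rw [h₂]; simp)) ?_
        rintro rfl
        exact hl' (by rw [h₂]; rfl)
      obtain ⟨hT1, hT2⟩ := hT a' ((List.takeWhile_sublist _).subset (by rw [h₁]; simp)) b'
        ((List.dropWhile_sublist _).subset (by rw [h₂]; simp)) ha'' hb''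
      refine ⟨l₁, a', b', l₂, h₁, h₂, hT1, hT2, hA.mem_or_of_notMem (a := a') (b := b') ?_
        (ha''.trans hb'').ne ha''.ne hb''.ne' ?_ (ha''.trans hb'').le⟩
      · simp [Insertion.ins, insertion, Insertion.start, ha'', hb''.le]
      · intro c
        change c ∈ [a', w, b'] ↔ _
        simp only [List.mem_cons, List.not_mem_nil, or_false]
        tauto
    · right; left
      have h₁ : l.takeWhile (fun a => decide (a < w)) = [] :=
        List.eq_nil_iff_forall_not_mem.2 (fun a ha => absurd (lt_of_mem_takeWhile ha)
          (not_lt.2 (hd a ((List.takeWhile_sublist _).subset ha))))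
      have h₂ : l.dropWhile (fun a => decide (a < w)) = l := by
        conv_rhs => rw [← List.takeWhile_append_dropWhile (p := fun a => decide (a < w)) (l := l),
          h₁, List.nil_append]
      rw [h₂] at hl'
      cases l with
      | nil => simp at hb
      | cons b' l₂ =>
        have hb' : b' = b := by
          rcases hbd b' (by simp) with rfl | h
          · simp at hl'
          · rcases List.mem_cons.1 hb with h' | h'
            · exact h'.symm
            · exact le_antisymm ((List.pairwise_cons.1 hpw).1 _ h') h.1
        subst hb'
        have hc' : c ∈ l₂ := by
          rcases List.mem_cons.1 hc with h | h
          · exact absurd h hbc.ne'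
          · exact h
        obtain ⟨l₃, c', rfl⟩ := List.eq_nil_or_concat' _ |>.resolve_left (List.ne_nil_of_mem hc')
        have hcc : c' = c := by
          have h5 := (List.pairwise_append.1 (List.pairwise_cons.1 hpw).2).2.2
          have hle : c ≤ c' := by
            rcases List.mem_append.1 hc' with h | h
            · exact h5 c h c' (by simp)
            · simpa using (List.mem_singleton.1 h).le
          rcases hbd c' (by simp) with rfl | h
          · exact absurd (hwb.trans hbc) (not_lt.2 hle)
          · exact le_antisymm h.2 hle
        subst hcc
        refine ⟨b', c', l₃ ++ [c'], by rw [hfst, h₁], by rw [hsnd, h₂], by simp, hε, hT.1, hT.2,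
          hA.mem_or_of_notMem (a := b') (b := c') ?_ hbc.ne hwb.ne' (hwb.trans hbc).ne' ?_ hbc.le⟩
        · simp [Insertion.ins, insertion, Insertion.start, hwb.le]
        · intro d
          change d ∈ [w, b', c'] ↔ _
          simp only [List.mem_cons, List.not_mem_nil, or_false]
          tauto
    · right; right
      have hw : w ∉ l.dropWhile (fun a => decide (a < w)) := by
        intro hw
        obtain ⟨b', l₂, h₂⟩ := List.exists_cons_of_ne_nil (List.ne_nil_of_mem hw)
        refine hl' ?_
        rw [h₂]
        refine congrArg some ?_
        exact le_antisymm (hd b' ((List.dropWhile_sublist _).subset (by rw [h₂]; simp)))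
          (le_of_mem_dropWhile hpw (by rw [h₂]; simp))
      have h₁ : l.dropWhile (fun a => decide (a < w)) = [] :=
        List.eq_nil_iff_forall_not_mem.2 (fun a ha => by
          obtain rfl := le_antisymm (le_of_mem_dropWhile hpw ha)
            (hd a ((List.dropWhile_sublist _).subset ha))
          exact hw ha)
      have h₂ : l.takeWhile (fun a => decide (a < w)) = l := by
        conv_rhs => rw [← List.takeWhile_append_dropWhile (p := fun a => decide (a < w)) (l := l),
          h₁, List.append_nil]
      have hw' : w ∉ l := by
        rw [← h₂]
        exact fun h => lt_irrefl _ (lt_of_mem_takeWhile h)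
      clear hl'
      obtain ⟨l₃, a', rfl⟩ := List.eq_nil_or_concat' _ |>.resolve_left (List.ne_nil_of_mem ha)
      have h5 := (List.pairwise_append.1 hpw).2.2
      have ha' : a' = a := by
        rcases hbd a' (by simp) with h | h
        · exact absurd (by simp [h]) hw'
        · refine le_antisymm h.2 ?_
          rcases List.mem_append.1 ha with h | h
          · exact h5 a h a' (by simp)
          · simpa using (List.mem_singleton.1 h).le
      subst ha'
      have hc' : c ∈ l₃ := by
        rcases List.mem_append.1 hc with h | h
        · exact h
        · exact absurd (List.mem_singleton.1 h) hca.ne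
      cases l₃ with
      | nil => simp at hc'
      | cons c' l₄ =>
        have hcc : c' = c := by
          rcases hbd c' (by simp) with h | h
          · exact absurd (by simp [h]) hw'
          · refine le_antisymm ?_ h.1
            rcases List.mem_cons.1 hc' with h' | h'
            · exact h'.ge
            · exact (List.pairwise_cons.1 (List.pairwise_append.1 hpw).1).1 _ h'
        subst hcc
        refine ⟨a', c', c' :: l₄, by rw [hsnd, h₁], by rw [hfst, h₂], by simp, hε, hT.1, hT.2,
          hA.mem_or_of_notMem (a := c') (b := a') ?_ hca.ne (hca.trans haw).ne haw.ne ?_ hca.le⟩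
        · simp [Insertion.ins, insertion, Insertion.start, haw, hca.trans haw]
        · intro d
          change d ∈ [c', a', w] ↔ _
          simp only [List.mem_cons, List.not_mem_nil, or_false])
  refine ⟨L, h1, h2, fun a b c hab hbc hw hA' t ht => h3 t ?_⟩
  have key : ∀ (a' b' : Fin (n + 1)), [a, b, c] = hA.insertion.ins [a', b'] → a' ≠ b' → a' ≠ w →
      b' ≠ w → (∀ d, d ∈ [a, b, c] ↔ d = a' ∨ d = b' ∨ d = w) → a' ≤ b' →
      ∃ l, (stdSimplex.vertexModel n).Good A l ∧ hA.insertion.small l ∧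
        (stdSimplex.vertexModel n).toList t = hA.insertion.ins l := by
    intro a' b' h1 h2 h3 h4 h5 h6
    have := (hA.mem_or_of_notMem h1 h2 h3 h4 h5 h6 t ht).resolve_left (hA' t ht)
    rwa [ht]
  rcases hw with rfl | rfl | rfl
  · refine key b c ?_ hbc.ne hab.ne' (hab.trans hbc).ne' ?_ hbc.le
    · simp [Insertion.ins, insertion, Insertion.start, hab.le]
    · simp; tauto
  · refine key a c ?_ (hab.trans hbc).ne hab.ne hbc.ne' ?_ (hab.trans hbc).le
    · simp [Insertion.ins, insertion, Insertion.start, hab, hbc.le]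
    · simp; tauto
  · refine key a b ?_ hab.ne (hab.trans hbc).ne hbc.ne ?_ hab.le
    · simp [Insertion.ins, insertion, Insertion.start, hbc, hab.trans hbc]
    · simp

end IsCone

end SSet

/-! ### Unions of faces of a simplex. -/

namespace SSet

lemma Subcomplex.exists_glue {X E : SSet.{u}} (A₁ A₂ : X.Subcomplex) (h₁ h₂ : X ⟶ E)
    (h : ∀ (m : ℕ) (x : X _⦋m⦌), x ∈ A₁.obj _ → x ∈ A₂.obj _ → h₁.app _ x = h₂.app _ x) :
    ∃ u : ((A₁ ⊔ A₂ : X.Subcomplex) : SSet.{u}) ⟶ E,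
      (∀ k (x : X.obj k) (hx : x ∈ (A₁ ⊔ A₂).obj k), x ∈ A₁.obj k →
        u.app k ⟨x, hx⟩ = h₁.app k x) ∧
      (∀ k (x : X.obj k) (hx : x ∈ (A₁ ⊔ A₂).obj k), x ∈ A₂.obj k →
        u.app k ⟨x, hx⟩ = h₂.app k x) ∧
      ∀ (B : SSet.{u}) (q : E ⟶ B) (v : X ⟶ B), h₁ ≫ q = v → h₂ ≫ q = v →
        u ≫ q = (A₁ ⊔ A₂).ι ≫ v := by
  obtain ⟨u, hu₁, hu₂⟩ := Subcomplex.exists_desc_sup A₁ A₂ (A₁.ι ≫ h₁) (A₂.ι ≫ h₂) (by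
    rintro ⟨k⟩ x hx₁ hx₂
    induction k using SimplexCategory.rec with | _ k
    exact h _ x hx₁ hx₂)
  refine ⟨u, fun k x _ hx => hu₁ k x hx, fun k x _ hx => hu₂ k x hx, ?_⟩
  rintro B q v rfl h₂
  ext k ⟨x, hx⟩
  rcases hx with hx | hx
  · exact congrArg (q.app k) (hu₁ k x hx)
  · refine (congrArg (q.app k) (hu₂ k x hx)).trans ?_
    exact congrArg (fun z => z.app k x) h₂

lemma stdSimplex.mem_face_iff_toList {n m : ℕ} (S : Finset (Fin (n + 1)))
    (x : (Δ[n] : SSet.{u}) _⦋m⦌) :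
    x ∈ (stdSimplex.face S).obj _ ↔ ∀ c ∈ (stdSimplex.vertexModel n).toList x, c ∈ S := by
  rw [stdSimplex.mem_face_iff, VertexModel.toList, List.forall_mem_ofFn_iff]
  rfl

lemma isCone_face {n : ℕ} {S : Finset (Fin (n + 1))} {w : Fin (n + 1)} (hw : w ∈ S) :
    IsCone (stdSimplex.face.{u} S) w where
  mem_of_mem x y hx h := by
    rw [stdSimplex.mem_face_iff_toList] at hx ⊢
    intro c hc
    rcases h c hc with h | rfl
    · exact hx c h
    · exact hw
  mem y h := by
    rw [stdSimplex.mem_face_iff_toList]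
    intro c hc
    rwa [h c hc]

lemma IsCone.sup {n : ℕ} {A A' : (Δ[n] : SSet.{u}).Subcomplex} {w : Fin (n + 1)}
    (hA : IsCone A w) (hA' : IsCone A' w) : IsCone (A ⊔ A') w where
  mem_of_mem x y hx h := hx.imp (fun hx => hA.mem_of_mem x y hx h)
    (fun hx => hA'.mem_of_mem x y hx h)
  mem y h := Or.inl (hA.mem y h)

lemma Subcomplex.mem_sup {X : SSet.{u}} {A A' : X.Subcomplex} {k : SimplexCategoryᵒᵖ}
    {x : X.obj k} : x ∈ (A ⊔ A').obj k ↔ x ∈ A.obj k ∨ x ∈ A'.obj k := Iff.rfl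

end SSet

/-! ### The remaining face of a 3-simplex on a (co)cartesian edge. -/

namespace ScaledSSet

section

variable {X : SSet.{u}} {P : Type} [Preorder P] {M : VertexModel X P} {E B : ScaledSSet.{u}}

lemma ThinAt.congr {f g : X ⟶ E.toSSet} {a b c : P} (h : ThinAt M f a b c)
    (hfg : ∀ t : X _⦋2⦌, M.toList t = [a, b, c] → g.app _ t = f.app _ t) : ThinAt M g a b c := by
  intro t ht
  exact (congrArg (· ∈ E.thin) (hfg t ht)).mpr (h t ht)

end

variable {E B : ScaledSSet.{u}} {p : E ⟶ B}

open SSet.stdSimplex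

lemma app_eq_of_ι_comp_eq {X E : SSet.{u}} {A : X.Subcomplex} {f g : X ⟶ E}
    (h : A.ι ≫ f = A.ι ≫ g) {k : SimplexCategoryᵒᵖ} {x : X.obj k} (hx : x ∈ A.obj k) :
    f.app k x = g.app k x := congrArg (fun z => z.app k ⟨x, hx⟩) h

/-- If the last edge of a 3-simplex is cartesian and three faces are thin, the remaining face
is thin. -/
lemma thinAt_of_liftsRight (hp : LiftsInner p) (hs : HasLiftingProperty saturationMap p)
    (f : Δ[3] ⟶ E.toSSet)
    (he : ∀ ε : (Δ[3] : SSet.{u}) _⦋1⦌, (vertexModel 3).toList ε = [2, 3] →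
      LiftsRight p (f.app _ ε))
    (h123 : ThinAt (vertexModel 3) f 1 2 3) (h023 : ThinAt (vertexModel 3) f 0 2 3)
    (h013 : ThinAt (vertexModel 3) f 0 1 3)
    (hB : ∀ a b c, ThinAt (vertexModel 3) (f ≫ p.toHom) a b c) :
    ThinAt (vertexModel 3) f 0 1 2 := by
  -- `f'` has the faces `123` and `013` of `f`, but its face `012` is a thin filler of the edges
  -- `01` and `12`; so its edge `02` may differ from that of `f`.
  obtain ⟨f', hf', hf'p, hf't⟩ := (IsCone.sup (isCone_face.{u} (S := {1, 2, 3}) (w := (1 : Fin 4))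
    (by decide)) (isCone_face (S := {0, 1, 3}) (by decide))).exists_lift (p := p)
    (u := Subcomplex.ι _ ≫ f) (v := f ≫ p.toHom) hp rfl (by
      intro m x hx L hL
      rw [Subcomplex.mem_sup, mem_face_iff_toList, mem_face_iff_toList, hL] at hx
      push Not at hx
      obtain ⟨⟨a, ha, ha'⟩, ⟨b, hb, hb'⟩⟩ := hx
      obtain rfl : a = 0 := by clear * - ha'; decide +revert
      obtain rfl : b = 2 := by clear * - hb'; decide +revert
      refine Or.inl ⟨⟨0, ha, by decide⟩, ⟨2, hb, by decide⟩, fun a _ b _ ha hb => ⟨hB _ _ _, ?_⟩⟩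
      obtain rfl : a = 0 := by clear * - ha; decide +revert
      obtain rfl | rfl : b = 2 ∨ b = 3 := by clear * - hb; decide +revert
      · intro t ht ht'
        rw [Subcomplex.mem_sup, mem_face_iff_toList, mem_face_iff_toList, ht'] at ht
        exact absurd ht (by decide)
      · exact h013.thinOn _)
  have hf'₁ : ∀ (m : ℕ) (x : (Δ[3] : SSet.{u}) _⦋m⦌),
      (∀ c ∈ (vertexModel 3).toList x, c ∈ ({1, 2, 3} : Finset (Fin 4))) ∨
      (∀ c ∈ (vertexModel 3).toList x, c ∈ ({0, 1, 3} : Finset (Fin 4))) →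
      f'.app _ x = f.app _ x := by
    intro m x hx
    refine app_eq_of_ι_comp_eq hf' ?_
    rwa [Subcomplex.mem_sup, mem_face_iff_toList, mem_face_iff_toList]
  have h012' : ThinAt (vertexModel 3) f' 0 1 2 := hf't _ _ _ (by decide) (by decide) (by simp) (by
    intro t ht ht'
    rw [Subcomplex.mem_sup, mem_face_iff_toList, mem_face_iff_toList, ht] at ht'
    exact absurd ht' (by decide))
  have h123' : ThinAt (vertexModel 3) f' 1 2 3 := h123.congr (fun t ht => hf'₁ _ t (by
    rw [ht]; decide))
  have h013' : ThinAt (vertexModel 3) f' 0 1 3 := h013.congr (fun t ht => hf'₁ _ t (by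
    rw [ht]; decide))
  have h023' : ThinAt (vertexModel 3) f' 0 2 3 :=
    thinAt_inner_left hs (by decide) (by decide) (by decide) h123' h013' h012' (by
      rw [hf'p]
      exact hB _ _ _)
  -- Three copies `0, 1, 2` of the vertex `0`. In the 5-simplex `g` below, the edges from `0` and
  -- `2` to `4` are the edge `02` of `f`, while that from `1` to `4` is the edge `02` of `f'`.
  let κ : Fin 6 →o Fin 4 := ⟨![0, 0, 0, 1, 2, 3], by decide⟩
  let K : Δ[5] ⟶ (Δ[3] : SSet.{u}) := (vertexModel 3).simplexMap κ
  obtain ⟨u, hu₁, hu₂, hu₃⟩ := Subcomplex.exists_glue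
    (face.{u} ({0, 2, 3, 4, 5} : Finset (Fin 6)) ⊔ face {0, 1, 2, 3, 5}) (face {1, 3, 4, 5})
    (K ≫ f) (K ≫ f') (by
      intro m x hx₁ hx₂
      rw [Subcomplex.mem_sup, mem_face_iff_toList, mem_face_iff_toList] at hx₁
      rw [mem_face_iff_toList] at hx₂
      refine (hf'₁ m (K.app _ x) ?_).symm
      rw [(vertexModel 3).toList_simplexMap_app]
      simp only [List.mem_map, forall_exists_index, and_imp, forall_apply_eq_imp_iff₂]
      refine hx₁.imp (fun h c hc => ?_) (fun h c hc => ?_)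
      · have h1 := h c hc
        have h2 := hx₂ c hc
        clear * - h1 h2
        decide +revert
      · have h1 := h c hc
        have h2 := hx₂ c hc
        clear * - h1 h2
        decide +revert)
  have hKp : (K ≫ f') ≫ p.toHom = K ≫ f ≫ p.toHom := by rw [Category.assoc, hf'p]
  have hKB : ∀ a b c, ThinAt (vertexModel 5) (K ≫ f ≫ p.toHom) a b c :=
    fun a b c => ThinAt.simplexMap (hB _ _ _)
  -- The simplices still missing contain `1`, `4` and one of `0`, `2`. Toggling the vertex `5`
  -- reduces them to right horns on the edge from `4` to `5`, which is the cartesian edge.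
  obtain ⟨g, hg, hgp, -⟩ := ((IsCone.sup (isCone_face.{u} (S := {0, 2, 3, 4, 5}) (w := (5 : Fin 6))
    (by decide)) (isCone_face (S := {0, 1, 2, 3, 5}) (by decide))).sup
      (isCone_face (S := {1, 3, 4, 5}) (by decide))).exists_lift (p := p)
    (u := u) (v := K ≫ f ≫ p.toHom) hp (hu₃ _ _ _ (Category.assoc _ _ _) hKp) (by
      intro m x hx L hL
      rw [Subcomplex.mem_sup, Subcomplex.mem_sup, mem_face_iff_toList, mem_face_iff_toList,
        mem_face_iff_toList, hL] at hx
      push Not at hx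
      obtain ⟨⟨⟨a, ha, ha'⟩, ⟨b, hb, hb'⟩⟩, ⟨c, hc, hc'⟩⟩ := hx
      obtain rfl : a = 1 := by clear * - ha'; decide +revert
      obtain rfl : b = 4 := by clear * - hb'; decide +revert
      right; right
      -- The first vertex of the horn is a copy of `0` in either case, so its special triangle is
      -- the face `023` of `f` or of `f'`, and both are thin.
      refine ⟨fun d _ => Fin.le_last d, if 0 ∈ L then 0 else 1, by split_ifs <;> assumption, 4, hb,
        by split_ifs <;> decide, by decide, ?_, ?_, hKB _ _ _, ?_⟩
      · intro d hd
        split_ifs with h0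
        · clear * -; decide +revert
        · have : d ≠ 0 := by rintro rfl; exact h0 hd
          clear * - this; decide +revert
      · intro ε hε
        have hε' : ε ∈ (face.{u} ({0, 2, 3, 4, 5} : Finset (Fin 6))).obj _ := by
          rw [mem_face_iff_toList, hε]; decide
        refine ⟨Or.inl (Or.inl hε'), ?_⟩
        refine (congrArg (LiftsRight p) (hu₁ _ ε _ (Or.inl hε'))).mpr ?_
        refine he (K.app _ ε) ?_
        rw [(vertexModel 3).toList_simplexMap_app, hε]
        rfl
      · intro t ht ht'
        rcases ht with htA | htA
        · refine (congrArg (· ∈ E.thin) (hu₁ _ t _ htA)).mpr ?_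
          refine ThinAt.simplexMap (φ := κ) ?_ t ht'
          have : κ (if 0 ∈ L then 0 else 1) = 0 := by split_ifs <;> rfl
          rw [this]
          exact h023
        · refine (congrArg (· ∈ E.thin) (hu₂ _ t _ htA)).mpr ?_
          refine ThinAt.simplexMap (φ := κ) ?_ t ht'
          have : κ (if 0 ∈ L then 0 else 1) = 0 := by split_ifs <;> rfl
          rw [this]
          exact h023')
  have hg₁ : ∀ (m : ℕ) (x : (Δ[5] : SSet.{u}) _⦋m⦌),
      (∀ c ∈ (vertexModel 5).toList x, c ∈ ({0, 2, 3, 4, 5} : Finset (Fin 6))) ∨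
      (∀ c ∈ (vertexModel 5).toList x, c ∈ ({0, 1, 2, 3, 5} : Finset (Fin 6))) →
      g.app _ x = (K ≫ f).app _ x := by
    intro m x hx
    rw [← mem_face_iff_toList, ← mem_face_iff_toList] at hx
    have := congrArg (fun z => z.app _ ⟨x, Or.inl hx⟩) hg
    exact this.trans (hu₁ _ _ _ hx)
  have hg₂ : ∀ (m : ℕ) (x : (Δ[5] : SSet.{u}) _⦋m⦌),
      (∀ c ∈ (vertexModel 5).toList x, c ∈ ({1, 3, 4, 5} : Finset (Fin 6))) →
      g.app _ x = (K ≫ f').app _ x := by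
    intro m x hx
    rw [← mem_face_iff_toList] at hx
    have := congrArg (fun z => z.app _ ⟨x, Or.inr hx⟩) hg
    exact this.trans (hu₂ _ _ _ hx)
  -- On the vertices `0` to `4`, the triangle `134` is the thin face `012` of `f'` and the other
  -- four triangles of `satTri` are degenerate. Saturation makes `034` thin, which is the face `012`
  -- of `f`.
  have h034 : ThinAt (vertexModel 5) g 0 3 4 := by
    refine (thinAt_saturation (M := vertexModel 5) hs (f := g) (a₀ := 0) (a₁ := 1) (a₂ := 2)
      (a₃ := 3) (a₄ := 4) (by decide) (by decide) (by decide) (by decide)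
      ?_ ?_ ?_ ?_ ?_ (by rw [hgp]; exact hKB _ _ _) (by rw [hgp]; exact hKB _ _ _)).1
    · exact ThinAt.congr (ThinAt.simplexMap (φ := κ) (thinAt_left f 0 2)) (fun t ht => hg₁ _ t (by
        rw [ht]; decide))
    · exact ThinAt.congr (ThinAt.simplexMap (φ := κ) (thinAt_left f 0 1)) (fun t ht => hg₁ _ t (by
        rw [ht]; decide))
    · exact ThinAt.congr (ThinAt.simplexMap (φ := κ) (thinAt_left f 0 1)) (fun t ht => hg₁ _ t (by
        rw [ht]; decide))
    · exact ThinAt.congr (ThinAt.simplexMap (φ := κ) h012') (fun t ht => hg₂ _ t (by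
        rw [ht]; decide))
    · exact ThinAt.congr (ThinAt.simplexMap (φ := κ) (thinAt_left f 0 0)) (fun t ht => hg₁ _ t (by
        rw [ht]; decide))
  refine ThinAt.of_simplexMap (φ := κ) (i := 0) (j := 3) (k := 4) (by decide) (by decide) ?_
  exact h034.congr (fun t ht => (hg₁ _ t (by rw [ht]; decide)).symm)

/-- If the first edge of a 3-simplex is cocartesian and three faces are thin, the remaining face
is thin. -/
lemma thinAt_of_liftsLeft (hp : LiftsInner p) (hs : HasLiftingProperty saturationMap p)
    (f : Δ[3] ⟶ E.toSSet)
    (he : ∀ ε : (Δ[3] : SSet.{u}) _⦋1⦌, (vertexModel 3).toList ε = [0, 1] →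
      LiftsLeft p (f.app _ ε))
    (h023 : ThinAt (vertexModel 3) f 0 2 3) (h013 : ThinAt (vertexModel 3) f 0 1 3)
    (h012 : ThinAt (vertexModel 3) f 0 1 2)
    (hB : ∀ a b c, ThinAt (vertexModel 3) (f ≫ p.toHom) a b c) :
    ThinAt (vertexModel 3) f 1 2 3 := by
  -- The saturation map is not self-dual: reversal turns the triangle `012` of `satTri` into `234`.
  -- So the argument is repeated, not dualised. Here `f'` keeps the faces `023` and `012` of `f`,
  -- and its face `123` is a thin filler, with a new edge `13`.
  obtain ⟨f', hf', hf'p, hf't⟩ := (IsCone.sup (isCone_face.{u} (S := {0, 2, 3}) (w := (2 : Fin 4))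
    (by decide)) (isCone_face (S := {0, 1, 2}) (by decide))).exists_lift (p := p)
    (u := Subcomplex.ι _ ≫ f) (v := f ≫ p.toHom) hp rfl (by
      intro m x hx L hL
      rw [Subcomplex.mem_sup, mem_face_iff_toList, mem_face_iff_toList, hL] at hx
      push Not at hx
      obtain ⟨⟨a, ha, ha'⟩, ⟨b, hb, hb'⟩⟩ := hx
      obtain rfl : a = 1 := by clear * - ha'; decide +revert
      obtain rfl : b = 3 := by clear * - hb'; decide +revert
      refine Or.inl ⟨⟨1, ha, by decide⟩, ⟨3, hb, by decide⟩, fun a _ b _ ha hb => ⟨hB _ _ _, ?_⟩⟩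
      obtain rfl : b = 3 := by clear * - hb; decide +revert
      obtain rfl | rfl : a = 0 ∨ a = 1 := by clear * - ha; decide +revert
      · exact h023.thinOn _
      · intro t ht ht'
        rw [Subcomplex.mem_sup, mem_face_iff_toList, mem_face_iff_toList, ht'] at ht
        exact absurd ht (by decide))
  have hf'₁ : ∀ (m : ℕ) (x : (Δ[3] : SSet.{u}) _⦋m⦌),
      (∀ c ∈ (vertexModel 3).toList x, c ∈ ({0, 2, 3} : Finset (Fin 4))) ∨
      (∀ c ∈ (vertexModel 3).toList x, c ∈ ({0, 1, 2} : Finset (Fin 4))) →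
      f'.app _ x = f.app _ x := by
    intro m x hx
    refine app_eq_of_ι_comp_eq hf' ?_
    rwa [Subcomplex.mem_sup, mem_face_iff_toList, mem_face_iff_toList]
  have h123' : ThinAt (vertexModel 3) f' 1 2 3 := hf't _ _ _ (by decide) (by decide) (by simp) (by
    intro t ht ht'
    rw [Subcomplex.mem_sup, mem_face_iff_toList, mem_face_iff_toList, ht] at ht'
    exact absurd ht' (by decide))
  have h023' : ThinAt (vertexModel 3) f' 0 2 3 := h023.congr (fun t ht => hf'₁ _ t (by
    rw [ht]; decide))
  have h012' : ThinAt (vertexModel 3) f' 0 1 2 := h012.congr (fun t ht => hf'₁ _ t (by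
    rw [ht]; decide))
  have h013' : ThinAt (vertexModel 3) f' 0 1 3 :=
    thinAt_inner_right hs (by decide) (by decide) (by decide) h123' h023' h012' (by
      rw [hf'p]
      exact hB _ _ _)
  -- Three copies `1, 2, 3` of the vertex `1`. In the 5-simplex `g` the edge from `2` to `5` is the
  -- edge `13` of `f'`, those from `1` and `3` are the edge `13` of `f`. The missing simplices
  -- contain `2`, `5` and one of `1`, `3`; they are left horns at the vertex `0` on the cocartesian
  -- edge.
  let κ : Fin 6 →o Fin 4 := ⟨![0, 1, 1, 1, 2, 3], by decide⟩
  let K : Δ[5] ⟶ (Δ[3] : SSet.{u}) := (vertexModel 3).simplexMap κ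
  obtain ⟨u, hu₁, hu₂, hu₃⟩ := Subcomplex.exists_glue
    (face.{u} ({0, 1, 3, 4, 5} : Finset (Fin 6)) ⊔ face {0, 1, 2, 3, 4}) (face {0, 2, 4, 5})
    (K ≫ f) (K ≫ f') (by
      intro m x hx₁ hx₂
      rw [Subcomplex.mem_sup, mem_face_iff_toList, mem_face_iff_toList] at hx₁
      rw [mem_face_iff_toList] at hx₂
      refine (hf'₁ m (K.app _ x) ?_).symm
      rw [(vertexModel 3).toList_simplexMap_app]
      simp only [List.mem_map, forall_exists_index, and_imp, forall_apply_eq_imp_iff₂]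
      refine hx₁.imp (fun h c hc => ?_) (fun h c hc => ?_)
      · have h1 := h c hc
        have h2 := hx₂ c hc
        clear * - h1 h2
        decide +revert
      · have h1 := h c hc
        have h2 := hx₂ c hc
        clear * - h1 h2
        decide +revert)
  have hKp : (K ≫ f') ≫ p.toHom = K ≫ f ≫ p.toHom := by rw [Category.assoc, hf'p]
  have hKB : ∀ a b c, ThinAt (vertexModel 5) (K ≫ f ≫ p.toHom) a b c :=
    fun a b c => ThinAt.simplexMap (hB _ _ _)
  obtain ⟨g, hg, hgp, -⟩ := ((IsCone.sup (isCone_face.{u} (S := {0, 1, 3, 4, 5}) (w := (0 : Fin 6))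
    (by decide)) (isCone_face (S := {0, 1, 2, 3, 4}) (by decide))).sup
      (isCone_face (S := {0, 2, 4, 5}) (by decide))).exists_lift (p := p)
    (u := u) (v := K ≫ f ≫ p.toHom) hp (hu₃ _ _ _ (Category.assoc _ _ _) hKp) (by
      intro m x hx L hL
      rw [Subcomplex.mem_sup, Subcomplex.mem_sup, mem_face_iff_toList, mem_face_iff_toList,
        mem_face_iff_toList, hL] at hx
      push Not at hx
      obtain ⟨⟨⟨a, ha, ha'⟩, ⟨b, hb, hb'⟩⟩, ⟨c, hc, hc'⟩⟩ := hx
      obtain rfl : a = 2 := by clear * - ha'; decide +revert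
      obtain rfl : b = 5 := by clear * - hb'; decide +revert
      right; left
      refine ⟨fun d _ => Fin.zero_le d, if 1 ∈ L then 1 else 2, by split_ifs <;> assumption, 5, hb,
        by split_ifs <;> decide, by split_ifs <;> decide, ?_, ?_, hKB _ _ _, ?_⟩
      · intro d hd
        split_ifs with h0
        · clear * -; decide +revert
        · have : d ≠ 1 := by rintro rfl; exact h0 hd
          clear * - this; decide +revert
      · intro ε hε
        have hε' : ε ∈ (face.{u} ({0, 1, 2, 3, 4} : Finset (Fin 6))).obj _ := by
          rw [mem_face_iff_toList, hε]
          split_ifs <;> decide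
        refine ⟨Or.inl (Or.inr hε'), ?_⟩
        refine (congrArg (LiftsLeft p) (hu₁ _ ε _ (Or.inr hε'))).mpr ?_
        refine he (K.app _ ε) ?_
        rw [(vertexModel 3).toList_simplexMap_app, hε]
        split_ifs <;> rfl
      · intro t ht ht'
        rcases ht with htA | htA
        · refine (congrArg (· ∈ E.thin) (hu₁ _ t _ htA)).mpr ?_
          refine ThinAt.simplexMap (φ := κ) ?_ t ht'
          have : κ (if 1 ∈ L then 1 else 2) = 1 := by split_ifs <;> rfl
          rw [this]
          exact h013
        · refine (congrArg (· ∈ E.thin) (hu₂ _ t _ htA)).mpr ?_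
          refine ThinAt.simplexMap (φ := κ) ?_ t ht'
          have : κ (if 1 ∈ L then 1 else 2) = 1 := by split_ifs <;> rfl
          rw [this]
          exact h013')
  have hg₁ : ∀ (m : ℕ) (x : (Δ[5] : SSet.{u}) _⦋m⦌),
      (∀ c ∈ (vertexModel 5).toList x, c ∈ ({0, 1, 3, 4, 5} : Finset (Fin 6))) ∨
      (∀ c ∈ (vertexModel 5).toList x, c ∈ ({0, 1, 2, 3, 4} : Finset (Fin 6))) →
      g.app _ x = (K ≫ f).app _ x := by
    intro m x hx
    rw [← mem_face_iff_toList, ← mem_face_iff_toList] at hx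
    have := congrArg (fun z => z.app _ ⟨x, Or.inl hx⟩) hg
    exact this.trans (hu₁ _ _ _ hx)
  have hg₂ : ∀ (m : ℕ) (x : (Δ[5] : SSet.{u}) _⦋m⦌),
      (∀ c ∈ (vertexModel 5).toList x, c ∈ ({0, 2, 4, 5} : Finset (Fin 6))) →
      g.app _ x = (K ≫ f').app _ x := by
    intro m x hx
    rw [← mem_face_iff_toList] at hx
    have := congrArg (fun z => z.app _ ⟨x, Or.inr hx⟩) hg
    exact this.trans (hu₂ _ _ _ hx)
  -- On the vertices `1` to `5`, the triangle `245` is the thin face `123` of `f'` and the other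
  -- triangles of `satTri` are degenerate; the conclusion concerns `145`, the face `123` of `f`.
  have h145 : ThinAt (vertexModel 5) g 1 4 5 := by
    refine (thinAt_saturation (M := vertexModel 5) hs (f := g) (a₀ := 1) (a₁ := 2) (a₂ := 3)
      (a₃ := 4) (a₄ := 5) (by decide) (by decide) (by decide) (by decide)
      ?_ ?_ ?_ ?_ ?_ (by rw [hgp]; exact hKB _ _ _) (by rw [hgp]; exact hKB _ _ _)).1
    · exact ThinAt.congr (ThinAt.simplexMap (φ := κ) (thinAt_left f 1 3)) (fun t ht => hg₁ _ t (by
        rw [ht]; decide))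
    · exact ThinAt.congr (ThinAt.simplexMap (φ := κ) (thinAt_left f 1 2)) (fun t ht => hg₁ _ t (by
        rw [ht]; decide))
    · exact ThinAt.congr (ThinAt.simplexMap (φ := κ) (thinAt_left f 1 2)) (fun t ht => hg₁ _ t (by
        rw [ht]; decide))
    · exact ThinAt.congr (ThinAt.simplexMap (φ := κ) h123') (fun t ht => hg₂ _ t (by
        rw [ht]; decide))
    · exact ThinAt.congr (ThinAt.simplexMap (φ := κ) (thinAt_left f 1 1)) (fun t ht => hg₁ _ t (by
        rw [ht]; decide))
  refine ThinAt.of_simplexMap (φ := κ) (i := 1) (j := 4) (k := 5) (by decide) (by decide) ?_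
  exact h145.congr (fun t ht => (hg₁ _ t (by rw [ht]; decide)).symm)

end ScaledSSet

/-! ### Inner fibrations and (co)cartesian edges on cores. -/

namespace ScaledSSet

open SSet.stdSimplex

variable {E B : ScaledSSet.{u}} {p : E ⟶ B}

/-- A triangle outside the horn contains every vertex other than `i`, and a triangle with a repeated
vertex is degenerate. So only a few nondegenerate triangles need to be checked. -/
lemma thin_of_thin_horn {n : ℕ} {i : Fin (n + 1)} {l : Δ[n] ⟶ E.toSSet}
    (hΛ : ∀ t : (Δ[n] : SSet.{u}) _⦋2⦌, t ∈ Λ[n, i].obj _ → l.app _ t ∈ E.thin)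
    (H : ∀ a b c : Fin (n + 1), a < b → b < c → (∀ j, j ≠ i → j = a ∨ j = b ∨ j = c) →
      ThinAt (vertexModel n) l a b c) (t : (Δ[n] : SSet.{u}) _⦋2⦌) : l.app _ t ∈ E.thin := by
  by_cases ht : t ∈ Λ[n, i].obj _
  · exact hΛ t ht
  · obtain ⟨a, b, c, habc⟩ : ∃ a b c, (vertexModel n).toList t = [a, b, c] := ⟨_, _, _, rfl⟩
    obtain ⟨hab, hbc⟩ := (vertexModel n).le_of_toList_eq habc
    rcases hab.lt_or_eq with hab | rfl
    · rcases hbc.lt_or_eq with hbc | rfl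
      · refine H a b c hab hbc (fun j hj => ?_) t habc
        rw [mem_horn_iff_notMem_range] at ht
        push Not at ht
        obtain ⟨k, hk⟩ := ht j hj
        have : j ∈ (vertexModel n).toList t := (List.mem_ofFn' _ _).2 ⟨k, hk⟩
        rw [habc] at this
        simpa using this
      · exact thinAt_right l a b t habc
    · exact thinAt_left l a c t habc

/-- The `n + 1` vertices are among `i`, `a`, `b`, `c`; hence thinness is an issue in dimensions 2
and 3 only. -/
lemma le_three_of_forall {n : ℕ} {i a b c : Fin (n + 1)}
    (h : ∀ j, j ≠ i → j = a ∨ j = b ∨ j = c) : n ≤ 3 := by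
  have h1 : (Finset.univ : Finset (Fin (n + 1))) ⊆ {i, a, b, c} := fun j _ => by
    simp only [Finset.mem_insert, Finset.mem_singleton]
    have := h j
    tauto
  have h2 := (Finset.card_le_card h1).trans Finset.card_le_four
  simp at h2
  lia

/-- Lifting problems for the map induced on cores can be solved by lifts all of whose triangles
are thin. -/
lemma exists_core_lift {n : ℕ} {i : Fin (n + 1)} {g : (Λ[n, i] : SSet.{u}) ⟶ (E.core : SSet.{u})}
    {v : Δ[n] ⟶ (B.core : SSet.{u})} (w : g ≫ coreMap p = Λ[n, i].ι ≫ v)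
    (H : ∀ (g' : (Λ[n, i] : SSet.{u}) ⟶ E.toSSet) (v' : Δ[n] ⟶ B.toSSet),
      g' ≫ p.toHom = Λ[n, i].ι ≫ v' → (∀ a b c, ThinOn (vertexModel n) g' a b c) →
      (∀ a b c, ThinAt (vertexModel n) v' a b c) → (∀ k x, g'.app k x = (g.app k x).1) →
      ∃ l : Δ[n] ⟶ E.toSSet, Λ[n, i].ι ≫ l = g' ∧ l ≫ p.toHom = v' ∧
        ∀ a b c : Fin (n + 1), a < b → b < c → (∀ j, j ≠ i → j = a ∨ j = b ∨ j = c) →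
          ThinAt (vertexModel n) l a b c) :
    ∃ l : Δ[n] ⟶ (E.core : SSet.{u}), Λ[n, i].ι ≫ l = g ∧ l ≫ coreMap p = v := by
  have hcore : ∀ {C : ScaledSSet.{u}} (x : (C.core : SSet.{u}) _⦋2⦌), x.1 ∈ C.thin := by
    intro C x
    simpa using x.2 (𝟙 _)
  obtain ⟨l, h1, h2, h3⟩ := H (g ≫ E.core.ι) (v ≫ B.core.ι)
    (congrArg (fun z => z ≫ B.core.ι) w) (fun a b c t ht _ => hcore _) (fun a b c t _ => hcore _)
    (fun k x => rfl)
  have h4 := thin_of_thin_horn (i := i) (l := l) (fun t ht => by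
    have := congrArg (fun z => z.app _ ⟨t, ht⟩) h1
    exact (congrArg (· ∈ E.thin) this).mpr (hcore _)) h3
  refine ⟨Subcomplex.lift l ?_, ?_, ?_⟩
  · rintro k _ ⟨x, rfl⟩ f
    exact (congrArg (· ∈ E.thin) (NatTrans.naturality_apply l f x).symm).mpr (h4 _)
  · rw [← cancel_mono E.core.ι]
    exact h1
  · rw [← cancel_mono B.core.ι]
    exact h2

/-- In dimension 2 the filler is thin by the scaled lifting property. In dimension 3 the missing
face is `023` or `013`, and saturation applies. -/
lemma coreMap_inner (hp : LiftsInner p) (hs : HasLiftingProperty saturationMap p) {n : ℕ}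
    (i : Fin (n + 3)) (h0 : i ≠ 0) (hn : i ≠ Fin.last _)
    (g : (Λ[n + 2, i] : SSet.{u}) ⟶ (E.core : SSet.{u}))
    (v : Δ[n + 2] ⟶ (B.core : SSet.{u})) (w : g ≫ coreMap p = Λ[n + 2, i].ι ≫ v) :
    ∃ l : Δ[n + 2] ⟶ (E.core : SSet.{u}), Λ[n + 2, i].ι ≫ l = g ∧ l ≫ coreMap p = v := by
  refine exists_core_lift w (fun g v w hg hv _ => ?_)
  obtain ⟨l, h1, h2, h3⟩ := hp (n + 1) i h0 hn g v w (fun a b _ _ => ⟨hv _ _ _, hg _ _ _⟩)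
  refine ⟨l, h1, h2, fun a b c hab hbc h => ?_⟩
  have hΛ : ∀ (a b c j : Fin (n + 3)), j ≠ i → j ≠ a → j ≠ b → j ≠ c →
      ThinAt (vertexModel (n + 2)) l a b c := by
    intro a b c j hj ha hb hc
    refine ThinAt.of_thinOn h1 (hg a b c) (fun t ht => ?_)
    rw [mem_horn_iff_notMem_range]
    refine ⟨j, hj, ?_⟩
    rintro ⟨k, rfl⟩
    have : t k ∈ (vertexModel (n + 2)).toList t := (List.mem_ofFn' _ _).2 ⟨k, rfl⟩
    rw [ht] at this
    simp [ha, hb, hc] at this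
  have hn3 := le_three_of_forall h
  obtain rfl | rfl : n = 0 ∨ n = 1 := by lia
  · obtain rfl : i = 1 := by clear * - h0 hn; decide +revert
    obtain ⟨rfl, rfl, rfl⟩ : a = 0 ∧ b = 1 ∧ c = 2 := by clear * - hab hbc; decide +revert
    exact h3 0 2 rfl rfl
  · have hB : ∀ a b c, ThinAt (vertexModel 3) (l ≫ p.toHom) a b c := by rw [h2]; exact hv
    obtain rfl | rfl : i = 1 ∨ i = 2 := by clear * - h0 hn; decide +revert
    · obtain ⟨rfl, rfl, rfl⟩ : a = 0 ∧ b = 2 ∧ c = 3 := by clear * - hab hbc h; decide +revert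
      exact thinAt_inner_left hs (b := 1) (by decide) (by decide) (by decide)
        (hΛ _ _ _ 0 (by decide) (by decide) (by decide) (by decide))
        (hΛ _ _ _ 2 (by decide) (by decide) (by decide) (by decide)) (h3 0 2 rfl rfl) (hB _ _ _)
    · obtain ⟨rfl, rfl, rfl⟩ : a = 0 ∧ b = 1 ∧ c = 3 := by clear * - hab hbc h; decide +revert
      exact thinAt_inner_right hs (c := 2) (by decide) (by decide) (by decide) (h3 1 3 rfl rfl)
        (hΛ _ _ _ 1 (by decide) (by decide) (by decide) (by decide))
        (hΛ _ _ _ 3 (by decide) (by decide) (by decide) (by decide)) (hB _ _ _)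

lemma innerFibration_coreMap (hp : LiftsInner p) (hs : HasLiftingProperty saturationMap p) :
    InnerFibration (coreMap p) where
  mem := by
    rintro _ _ _ ⟨i, h0, hn⟩
    refine ⟨fun {g v} sq => ?_⟩
    obtain ⟨l, h1, h2⟩ := coreMap_inner hp hs i h0.ne' hn.ne g v sq.w
    exact ⟨⟨l, h1, h2⟩⟩

/-- The essential case is the horn `Λ^3_3`, whose missing face `012` is not the triangle controlled
by `LiftsRight`; `thinAt_of_liftsRight` shows that it is thin. -/
lemma isCartesianEdge_coreMap (hp : LiftsInner p) (hs : HasLiftingProperty saturationMap p)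
    {e : E.toSSet _⦋1⦌} (he : LiftsRight p e) :
    SSet.IsCartesianEdge (coreMap p) (E.coreEdge e) := by
  intro m g v sq hge
  obtain ⟨l, h1, h2⟩ := exists_core_lift sq.w (fun g' v w hg hv hgg => by
    have hedge : g'.app _ (hornLastEdge m) = e := by
      rw [hgg, hge]
      rfl
    obtain ⟨l, h1, h2, h3⟩ := he m g' v w hedge (hv _ _ _) (hg _ _ _)
    refine ⟨l, h1, h2, fun a b c hab hbc h => ?_⟩
    have hΛ : ∀ (a b c j : Fin (m + 3)), j ≠ Fin.last _ → j ≠ a → j ≠ b → j ≠ c →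
        ThinAt (vertexModel (m + 2)) l a b c := by
      intro a b c j hj ha hb hc
      refine ThinAt.of_thinOn h1 (hg a b c) (fun t ht => ?_)
      rw [mem_horn_iff_notMem_range]
      refine ⟨j, hj, ?_⟩
      rintro ⟨k, rfl⟩
      have : t k ∈ (vertexModel (m + 2)).toList t := (List.mem_ofFn' _ _).2 ⟨k, rfl⟩
      rw [ht] at this
      simp [ha, hb, hc] at this
    have hn3 := le_three_of_forall h
    obtain rfl | rfl : m = 0 ∨ m = 1 := by lia
    · obtain ⟨rfl, rfl, rfl⟩ : a = 0 ∧ b = 1 ∧ c = 2 := by clear * - hab hbc; decide +revert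
      exact h3
    · have hB : ∀ a b c, ThinAt (vertexModel 3) (l ≫ p.toHom) a b c := by rw [h2]; exact hv
      obtain ⟨rfl, rfl, rfl⟩ : a = 0 ∧ b = 1 ∧ c = 2 := by clear * - hab hbc h; decide +revert
      refine thinAt_of_liftsRight hp hs l ?_
        (hΛ _ _ _ 0 (by decide) (by decide) (by decide) (by decide)) h3
        (hΛ _ _ _ 2 (by decide) (by decide) (by decide) (by decide)) hB
      intro ε hε
      obtain rfl : ε = (hornLastEdge 1).1 := (vertexModel 3).toList_injective hε
      have h4 := congrArg (fun z => z.app _ (hornLastEdge 1)) h1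
      exact (congrArg (LiftsRight p) (h4.trans hedge)).mpr he)
  exact ⟨⟨l, h1, h2⟩⟩

/-- The property of cocartesian edges is first established for horns `Λ^n_0` without opposites,
because the saturation condition does not dualise; the translation to opposites is
`isCocartesianEdge_coreMap`. -/
lemma exists_lift_coreMap_of_liftsLeft (hp : LiftsInner p)
    (hs : HasLiftingProperty saturationMap p) {e : E.toSSet _⦋1⦌} (he : LiftsLeft p e) (m : ℕ)
    (g : (Λ[m + 2, 0] : SSet.{u}) ⟶ (E.core : SSet.{u})) (v : Δ[m + 2] ⟶ (B.core : SSet.{u}))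
    (w : g ≫ coreMap p = Λ[m + 2, 0].ι ≫ v) (hge : g.app _ (hornFirstEdge m) = E.coreEdge e) :
    ∃ l : Δ[m + 2] ⟶ (E.core : SSet.{u}), Λ[m + 2, 0].ι ≫ l = g ∧ l ≫ coreMap p = v :=
  exists_core_lift w (fun g' v w hg hv hgg => by
    have hedge : g'.app _ (hornFirstEdge m) = e := by
      rw [hgg, hge]
      rfl
    obtain ⟨l, h1, h2, h3⟩ := he m g' v w hedge (hv _ _ _) (hg _ _ _)
    refine ⟨l, h1, h2, fun a b c hab hbc h => ?_⟩
    have hΛ : ∀ (a b c j : Fin (m + 3)), j ≠ 0 → j ≠ a → j ≠ b → j ≠ c →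
        ThinAt (vertexModel (m + 2)) l a b c := by
      intro a b c j hj ha hb hc
      refine ThinAt.of_thinOn h1 (hg a b c) (fun t ht => ?_)
      rw [mem_horn_iff_notMem_range]
      refine ⟨j, hj, ?_⟩
      rintro ⟨k, rfl⟩
      have : t k ∈ (vertexModel (m + 2)).toList t := (List.mem_ofFn' _ _).2 ⟨k, rfl⟩
      rw [ht] at this
      simp [ha, hb, hc] at this
    have hn3 := le_three_of_forall h
    obtain rfl | rfl : m = 0 ∨ m = 1 := by lia
    · obtain ⟨rfl, rfl, rfl⟩ : a = 0 ∧ b = 1 ∧ c = 2 := by clear * - hab hbc; decide +revert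
      exact h3
    · have hB : ∀ a b c, ThinAt (vertexModel 3) (l ≫ p.toHom) a b c := by rw [h2]; exact hv
      obtain ⟨rfl, rfl, rfl⟩ : a = 1 ∧ b = 2 ∧ c = 3 := by clear * - hab hbc h; decide +revert
      refine thinAt_of_liftsLeft hp hs l ?_
        (hΛ _ _ _ 1 (by decide) (by decide) (by decide) (by decide)) h3
        (hΛ _ _ _ 3 (by decide) (by decide) (by decide) (by decide)) hB
      intro ε hε
      obtain rfl : ε = (hornFirstEdge 1).1 := (vertexModel 3).toList_injective hε
      have h4 := congrArg (fun z => z.app _ (hornFirstEdge 1)) h1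
      exact (congrArg (LiftsLeft p) (h4.trans hedge)).mpr he)

end ScaledSSet

/-! ### Duality. -/

namespace SSet

open SSet.stdSimplex

/-- A lifting problem for a horn in an opposite simplicial set gives a lifting problem for the
opposite horn. -/
lemma exists_unop_horn {X Y : SSet.{u}} (q : X ⟶ Y) {n : ℕ} {i i' : Fin (n + 1)} (hi : i' = i.rev)
    (g : (Λ[n, i] : SSet.{u}) ⟶ X.op) (v : Δ[n] ⟶ Y.op)
    (w : g ≫ opFunctor.map q = Λ[n, i].ι ≫ v) :
    ∃ (g' : (Λ[n, i'] : SSet.{u}) ⟶ X) (v' : Δ[n] ⟶ Y), g' ≫ q = Λ[n, i'].ι ≫ v' ∧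
      (∀ k y hy hy', g'.app k ⟨y, hy⟩ = opObjEquiv (g.app k ⟨reverse y, hy'⟩)) ∧
      ∀ l' : Δ[n] ⟶ X, Λ[n, i'].ι ≫ l' = g' → l' ≫ q = v' →
        ∃ l : Δ[n] ⟶ X.op, Λ[n, i].ι ≫ l = g ∧ l ≫ opFunctor.map q = v := by
  -- Reversing the problem leads to the double opposites of `X` and `Y`, which are identified with
  -- `X` and `Y`.
  obtain ⟨g', v', h1, h2, -, h3⟩ := exists_op_horn (opFunctor.map q) hi g v w
  let eX := opFunctorCompOpFunctorIso.app X
  let eY := opFunctorCompOpFunctorIso.app Y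
  have hq : opFunctor.map (opFunctor.map q) ≫ eY.hom = eX.hom ≫ q :=
    opFunctorCompOpFunctorIso.hom.naturality q
  have hq' : eX.inv ≫ opFunctor.map (opFunctor.map q) = q ≫ eY.inv :=
    (opFunctorCompOpFunctorIso.inv.naturality q).symm
  refine ⟨g' ≫ eX.hom, v' ≫ eY.hom, ?_, ?_, ?_⟩
  · rw [Category.assoc, ← hq, ← Category.assoc, h1, Category.assoc]
  · intro k y hy hy'
    exact congrArg opObjEquiv (h2 k y hy hy')
  · intro l' h4 h5
    obtain ⟨l, h6, h7, -⟩ := h3 (l' ≫ eX.inv)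
      (by rw [← Category.assoc, h4, Category.assoc, Iso.hom_inv_id, Category.comp_id])
      (by rw [Category.assoc, hq', ← Category.assoc, h5, Category.assoc, Iso.hom_inv_id,
        Category.comp_id])
    exact ⟨l, h6, h7⟩

lemma innerFibration_opFunctor_map {X Y : SSet.{u}} (q : X ⟶ Y) [InnerFibration q] :
    InnerFibration (opFunctor.map q) where
  mem := by
    rintro _ _ _ ⟨i, h0, hn⟩
    refine ⟨fun {g v} sq => ?_⟩
    obtain ⟨g', v', w', -, h⟩ := exists_unop_horn q rfl g v sq.w
    have := InnerFibration.mem (q := q) _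
      (horn_ι_mem_innerHornInclusions (i := i.rev) (by
        rw [Fin.pos_iff_ne_zero, Ne, Fin.rev_eq_iff, Fin.rev_zero]
        exact hn.ne)
        (by
        rw [Fin.lt_last_iff_ne_last, Ne, Fin.rev_eq_iff, Fin.rev_last]
        exact h0.ne'))
    have sq' : CommSq g' Λ[_, i.rev].ι q v' := ⟨w'⟩
    obtain ⟨l, h1, h2⟩ := h sq'.lift sq'.fac_left sq'.fac_right
    exact ⟨⟨l, h1, h2⟩⟩

lemma stdSimplex.toList_reverse_of_eq {n : ℕ} {t : (Δ[n] : SSet.{u}) _⦋2⦌} {a b c : Fin (n + 1)}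
    (h : (vertexModel n).toList t = [a, b, c]) :
    (vertexModel n).toList (reverse t) = [c.rev, b.rev, a.rev] := by
  rw [toList_reverse, h]
  rfl

lemma stdSimplex.reverse_hornFirstEdge (m : ℕ) :
    reverse (hornFirstEdge.{u} m).1 = (hornLastEdge m).1 := by
  apply (vertexModel _).toList_injective
  rw [toList_reverse]
  change [Fin.rev 1, Fin.rev 0] = [_, _]
  simp only [Fin.rev_zero]
  congr 1

end SSet

namespace ScaledSSet

open SSet.stdSimplex

variable {E B : ScaledSSet.{u}} {p : E ⟶ B}

lemma isCocartesianEdge_coreMap (hp : LiftsInner p) (hs : HasLiftingProperty saturationMap p)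
    {e : E.toSSet _⦋1⦌} (he : LiftsLeft p e) :
    SSet.IsCocartesianEdge (coreMap p) (E.coreEdge e) := by
  intro m g v sq hge
  obtain ⟨g', v', w', hg', h⟩ := exists_unop_horn (coreMap p) (i' := 0) (by simp) g v sq.w
  obtain ⟨l', h1, h2⟩ := exists_lift_coreMap_of_liftsLeft hp hs he m g' v' w' (by
    refine (hg' _ _ _ ((reverse_mem_horn (by simp) _).2 (hornFirstEdge m).2)).trans ?_
    refine Eq.trans ?_ (congrArg opObjEquiv hge)
    exact congrArg (fun z => opObjEquiv (g.app _ z)) (Subtype.ext (reverse_hornFirstEdge m)))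
  obtain ⟨l, h3, h4⟩ := h l' h1 h2
  exact ⟨⟨l, h3, h4⟩⟩

/-- Reversal exchanges the horns at `0` and at the last vertex, and the triangles `{0, 1, n}` and
`{0, n-1, n}`. -/
lemma liftsLeft_of_op {e : E.toSSet _⦋1⦌} (he : LiftsRight (opMap p) (opObjEquiv.symm e)) :
    LiftsLeft p e := by
  intro m g v w hge hv hg
  obtain ⟨g', v', w', hg', hv', h⟩ := exists_op_horn p.toHom (i' := Fin.last _) (by simp) g v w
  have hrev : ∀ t : (Δ[m + 2] : SSet.{u}) _⦋2⦌,
      (vertexModel _).toList t = [0, (Fin.last (m + 1)).castSucc, Fin.last (m + 2)] →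
      (vertexModel _).toList (reverse t) = [0, 1, Fin.last (m + 2)] := by
    intro t ht
    rw [toList_reverse_of_eq ht]
    congr 1
    · simp
    · congr 1
      · ext; simp [Fin.val_rev]
  have hlast : reverse (hornLastEdge.{u} m).1 = (hornFirstEdge m).1 := by
    rw [← reverse_hornFirstEdge, reverse_reverse]
  obtain ⟨l', h1, h2, h3⟩ := he m g' v' w' (by
      refine opObjEquiv.injective ?_
      refine (hg' _ _ _ ((reverse_mem_horn (by simp) _).2 (hornLastEdge m).2)).trans ?_
      refine Eq.trans ?_ hge
      exact congrArg (fun z => g.app _ z) (Subtype.ext hlast))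
    (fun t ht => (congrArg (· ∈ B.thin) (hv' _ t)).mpr (hv _ (hrev t ht)))
    (fun t htΛ ht => by
      have htΛ' : reverse t ∈ Λ[m + 2, 0].obj _ := (reverse_mem_horn (by simp) t).2 htΛ
      exact (congrArg (· ∈ E.thin) (hg' _ t htΛ htΛ')).mpr (hg _ htΛ' (hrev t ht)))
  obtain ⟨l, h4, h5, h6⟩ := h l' h1 h2
  refine ⟨l, h4, h5, fun t ht => ?_⟩
  have h7 := h3 (reverse t) (by
    rw [toList_reverse_of_eq ht]
    congr 1
    simp)
  have h8 := h6 _ (reverse t)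
  rw [reverse_reverse] at h8
  exact (congrArg (· ∈ E.thin) h8).mp h7

lemma IsCocartesianEdge.liftsLeft {e : E.toSSet _⦋1⦌} (he : IsCocartesianEdge p e) :
    LiftsLeft p e :=
  liftsLeft_of_op (IsCartesianEdge.liftsRight he)

/-- The cocartesian notions provide a weak fibration `p^op`. Inner horns and their triangles `{i-1,
i, i+1}` are preserved by reversal, so the lifting property returns to `p`. -/
lemma liftsInner_of_op (hp : LiftsInner (opMap p)) : LiftsInner p := by
  intro d i h0 h1 g v w hT
  obtain ⟨g', v', w', hg', hv', h⟩ := exists_op_horn p.toHom rfl g v w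
  have hrev : ∀ {a b : Fin (d + 2)} (t : (Δ[d + 1] : SSet.{u}) _⦋2⦌),
      (vertexModel _).toList t = [a, i.rev, b] →
      (vertexModel _).toList (reverse t) = [b.rev, i, a.rev] := by
    intro a b t ht
    rw [toList_reverse_of_eq ht, Fin.rev_rev]
  obtain ⟨l', h2, h3, h4⟩ := hp d i.rev (by simpa [Fin.rev_eq_iff] using h1)
    (by simpa [Fin.rev_eq_iff] using h0) g' v' w' (fun a b ha hb => by
      have hT' := hT b.rev a.rev
        (by simp only [Fin.val_rev] at ha hb ⊢; lia)
        (by simp only [Fin.val_rev] at ha hb ⊢; lia)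
      refine ⟨fun t ht => (congrArg (· ∈ B.thin) (hv' _ t)).mpr (hT'.1 _ (hrev t ht)),
        fun t htΛ ht => ?_⟩
      have htΛ' : reverse t ∈ Λ[d + 1, i].obj _ := (reverse_mem_horn rfl t).2 htΛ
      exact (congrArg (· ∈ E.thin) (hg' _ t htΛ htΛ')).mpr (hT'.2 _ htΛ' (hrev t ht)))
  obtain ⟨l, h5, h6, h7⟩ := h l' h2 h3
  refine ⟨l, h5, h6, fun a b ha hb t ht => ?_⟩
  have h8 := h4 b.rev a.rev (by simp only [Fin.val_rev]; lia) (by simp only [Fin.val_rev]; lia)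
    (reverse t) (toList_reverse_of_eq ht)
  have h9 := h7 _ (reverse t)
  rw [reverse_reverse] at h9
  exact (congrArg (· ∈ E.thin) h9).mp h8

/-- A map with (co)cartesian lifts and the lifting properties of weak fibrations induces a
cartesian fibration of the cores. -/
lemma isCartesianFibration_coreMap (hp : LiftsInner p) (hs : HasLiftingProperty saturationMap p)
    (hl : HasCartesianLifts p) : SSet.IsCartesianFibration (coreMap p) where
  innerFibration := innerFibration_coreMap hp hs
  exists_lift x e he := by
    obtain ⟨e', h1, h2, h3⟩ := hl x.1 e.1 (congrArg Subtype.val he)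
    exact ⟨E.coreEdge e', isCartesianEdge_coreMap hp hs h1.liftsRight, Subtype.ext h2,
      Subtype.ext h3⟩

lemma isCocartesianFibration_coreMap (hp : LiftsInner p) (hs : HasLiftingProperty saturationMap p)
    (hl : HasCartesianLifts (opMap p)) : SSet.IsCocartesianFibration (coreMap p) where
  innerFibration := by
    have := innerFibration_coreMap hp hs
    exact innerFibration_opFunctor_map _
  exists_lift x e he := by
    obtain ⟨e', h1, h2, h3⟩ := hl (opObjEquiv.symm (opObjEquiv x).1)
      (opObjEquiv.symm (opObjEquiv e).1) (by
        exact congrArg (fun z : (B.core : SSet.{u}) _⦋0⦌ => z.1) he)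
    refine ⟨opObjEquiv.symm (E.coreEdge (opObjEquiv e')),
      isCocartesianEdge_coreMap hp hs (IsCocartesianEdge.liftsLeft h1), ?_, ?_⟩
    · exact opObjEquiv.injective (Subtype.ext h2)
    · exact opObjEquiv.injective (Subtype.ext h3)

end ScaledSSet

/-! ### The walking isomorphism and its words. -/

namespace SSet.coherentIso

/-- The vertices of the nerve of the walking isomorphism, any two of which are related. -/
def Vertex : Type := Bool

instance : DecidableEq Vertex := inferInstanceAs (DecidableEq Bool)

instance : Preorder Vertex where
  le _ _ := True
  le_refl _ := trivial
  le_trans _ _ _ _ _ := trivial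

lemma vertex_le (a b : Vertex) : a ≤ b := trivial

/-- The two vertices. -/
def v₀ : Vertex := false
def v₁ : Vertex := true

lemma eq_v₀_or_v₁ (a : Vertex) : a = v₀ ∨ a = v₁ := by
  cases a
  · exact Or.inl rfl
  · exact Or.inr rfl

lemma v₀_ne_v₁ : v₀ ≠ v₁ := Bool.false_ne_true

/-- The simplices of the nerve of the walking isomorphism are words in the two vertices. -/
def vertexModel : VertexModel coherentIso.{u} Vertex where
  equiv _ := Codiscrete.equivFun.trans
    { toFun f := ⟨fun i => (f i).down, fun _ _ _ => trivial⟩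
      invFun f i := ⟨f i⟩
      left_inv _ := rfl
      right_inv _ := rfl }
  equiv_map _ _ _ := rfl

lemma toList_x₀ : vertexModel.{u}.toList x₀ = [v₀] := rfl

end SSet.coherentIso

/-! ### Unscaled lifting problems as scaled ones. -/

namespace ScaledSSet

open SSet.coherentIso

/-- The scaled simplicial set in which all triangles are thin. -/
def sharp (X : SSet.{u}) : ScaledSSet.{u} where
  toSSet := X
  thin := Set.univ
  degenerate_subset_thin := Set.subset_univ _

/-- A map of simplicial sets, considered as a map of scaled simplicial sets in which all
triangles are thin. -/
def sharpMap {X Y : SSet.{u}} (q : X ⟶ Y) : sharp X ⟶ sharp Y where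
  toHom := q
  map_thin _ _ := trivial

lemma liftsInner_sharpMap {X Y : SSet.{u}} {q : X ⟶ Y} (hq : InnerFibration q) :
    LiftsInner (sharpMap q) := by
  intro d i h0 h1 g v w _
  obtain _ | d := d
  · have : ∀ i : Fin 2, i ≠ 0 → i ≠ 1 → False := by decide
    exact (this i h0 h1).elim
  have := hq.mem _ (horn_ι_mem_innerHornInclusions (Fin.pos_iff_ne_zero.2 h0)
    (Fin.lt_last_iff_ne_last.2 h1))
  obtain ⟨⟨l, h1, h2⟩⟩ := this.sq_hasLift (f := g) (g := v) ⟨w⟩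
  exact ⟨l, h1, h2, fun _ _ _ _ _ _ => trivial⟩

lemma liftsRight_sharpMap {X Y : SSet.{u}} {q : X ⟶ Y} {e : X _⦋1⦌}
    (he : SSet.IsCartesianEdge q e) : LiftsRight (sharpMap q) e := by
  intro m g v w hge _ _
  obtain ⟨⟨l, h1, h2⟩⟩ := he m g v ⟨w⟩ hge
  exact ⟨l, h1, h2, fun _ _ => trivial⟩

lemma liftsLeft_sharpMap_coreMap {E B : ScaledSSet.{u}} {p : E ⟶ B} (hp : LiftsInner p)
    (hs : HasLiftingProperty saturationMap p) {e : E.toSSet _⦋1⦌} (he : LiftsLeft p e) :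
    LiftsLeft (sharpMap (coreMap p)) (E.coreEdge e) := by
  intro m g v w hge _ _
  obtain ⟨l, h1, h2⟩ := exists_lift_coreMap_of_liftsLeft hp hs he m g v w hge
  exact ⟨l, h1, h2, fun _ _ => trivial⟩

lemma thinAt_sharp {X Y : SSet.{u}} {P : Type} [Preorder P] (M : VertexModel X P)
    (f : X ⟶ (sharp Y).toSSet) (a b c : P) : ThinAt M f a b c := fun _ _ => trivial

lemma thinOn_sharp {X Y : SSet.{u}} {P : Type} [Preorder P] (M : VertexModel X P)
    {A : X.Subcomplex} (f : (A : SSet.{u}) ⟶ (sharp Y).toSSet) (a b c : P) :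
    ThinOn M f a b c := fun _ _ _ => trivial

end ScaledSSet

/-! ### Extending a (co)cartesian edge to the walking isomorphism. -/

namespace SSet.coherentIso

open ScaledSSet

/-- The edge from `a` to `b`, as a subcomplex of the nerve of the walking isomorphism. -/
def edgeMap (a b : Vertex) : Δ[1] ⟶ coherentIso.{u} :=
  vertexModel.simplexMap ⟨![a, b], fun _ _ _ => trivial⟩

lemma mem_range_edgeMap {a b : Vertex} {m : ℕ} (x : coherentIso.{u} _⦋m⦌) :
    x ∈ (Subcomplex.range (edgeMap.{u} a b)).obj _ ↔
      ∃ l : List (Fin 2), l.Pairwise (· ≤ ·) ∧ vertexModel.toList x = l.map ![a, b] := by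
  constructor
  · rintro ⟨y, rfl⟩
    exact ⟨_, (stdSimplex.vertexModel 1).pairwise_toList y, vertexModel.toList_simplexMap_app _ y⟩
  · rintro ⟨l, hl, h⟩
    obtain ⟨y, hy⟩ := (stdSimplex.vertexModel.{u} 1).exists_toList_eq (m := m) (l := l)
      (by simpa using (congrArg List.length h).symm) hl
    refine ⟨y, vertexModel.toList_injective ?_⟩
    rw [h, ← hy]
    exact vertexModel.toList_simplexMap_app _ y

lemma edgeMap_injective {a b : Vertex} (hab : a ≠ b) (k : SimplexCategoryᵒᵖ) :
    Function.Injective ((edgeMap.{u} a b).app k) := by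
  obtain ⟨k⟩ := k
  induction k using SimplexCategory.rec with | _ k
  intro x y h
  apply (stdSimplex.vertexModel 1).toList_injective
  have h' := congrArg vertexModel.toList h
  rw [edgeMap, vertexModel.toList_simplexMap_app, vertexModel.toList_simplexMap_app] at h'
  refine List.map_injective_iff.2 ?_ h'
  intro i j hij
  by_contra hij'
  obtain ⟨rfl, rfl⟩ | ⟨rfl, rfl⟩ : i = 0 ∧ j = 1 ∨ i = 1 ∧ j = 0 := by
    clear * - hij'
    decide +revert
  · exact hab hij
  · exact hab hij.symm

instance mono_edgeMap : Mono (edgeMap.{u} v₁ v₀) := by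
  have := fun k => (mono_iff_injective _).2 (edgeMap_injective.{u} v₀_ne_v₁.symm k)
  exact NatTrans.mono_of_mono_app _

instance mono_edgeMap' : Mono (edgeMap.{u} v₀ v₁) := by
  have := fun k => (mono_iff_injective _).2 (edgeMap_injective.{u} v₀_ne_v₁ k)
  exact NatTrans.mono_of_mono_app _

lemma mem_range_edgeMap_of_pair {a b : Vertex} {x : coherentIso.{u} _⦋1⦌}
    (hx : vertexModel.toList x = [a, b]) : x ∈ (Subcomplex.range (edgeMap.{u} a b)).obj _ := by
  rw [mem_range_edgeMap]
  exact ⟨[0, 1], by decide, hx⟩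

/-- Words outside the edge `v₁ v₀` are paired by appending `v₀`; the constantly true predicate puts
the insertion at the end. Removing the final `v₀` cannot lead into the edge, since adding `v₀` to a
word of the edge gives a word of the edge. -/
lemma isEnd : Insertion.IsEnd vertexModel.{u} (Subcomplex.range (edgeMap v₁ v₀))
    (fun _ => true) (fun _ => v₀) where
  pos hl hl' := ⟨rfl, fun _ _ => trivial, fun _ _ => trivial⟩
  erase {l₁ l₂} hl h₁ hV h₂ := by
    obtain rfl : l₂ = [] := by
      cases l₂ with
      | nil => rfl
      | cons b l => exact absurd (h₂ b (by simp)) (by simp)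
    obtain ⟨m, x, -, hxA, hx⟩ := hl
    rw [mem_range_edgeMap] at hxA
    rw [List.append_nil]
    refine ⟨?_, fun m' y hy hyA => ?_⟩
    · rintro rfl
      exact hxA ⟨[1], by simp, hx⟩
    · obtain ⟨l, hl, hl'⟩ := (mem_range_edgeMap y).1 hyA
      refine hxA ⟨l ++ [1], ?_, ?_⟩
      · rw [List.pairwise_append]
        exact ⟨hl, by simp, fun a _ b hb => by
          rw [List.mem_singleton.1 hb]
          exact Fin.le_last a⟩
      · rw [hx, List.map_append, ← hl', hy]
        rfl

/-- Words outside the edge `v₀ v₁` are paired by prepending `v₀`; the constantly false predicate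
puts the insertion at the beginning. -/
lemma isStart : Insertion.IsStart vertexModel.{u}
    (Subcomplex.range (edgeMap v₀ v₁)) (fun _ => false) (fun _ => v₀) where
  pos hl hl' := ⟨rfl, fun _ _ => trivial, fun _ _ => trivial⟩
  erase {l₁ l₂} hl h₁ hV := by
    obtain rfl : l₁ = [] := by
      cases l₁ with
      | nil => rfl
      | cons b l => exact absurd (h₁ b (by simp)) (by simp)
    obtain ⟨m, x, -, hxA, hx⟩ := hl
    rw [mem_range_edgeMap] at hxA
    rw [List.nil_append] at hx ⊢
    refine ⟨fun _ _ => rfl, ?_, fun m' y hy hyA => ?_⟩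
    · rintro rfl
      exact hxA ⟨[0], by simp, hx⟩
    · obtain ⟨l, hl, hl'⟩ := (mem_range_edgeMap y).1 hyA
      refine hxA ⟨0 :: l, ?_, ?_⟩
      · rw [List.pairwise_cons]
        exact ⟨fun a _ => Fin.zero_le a, hl⟩
      · rw [hx, List.map_cons, ← hl', hy]
        rfl

lemma notMem_range_edgeMap {a b : Vertex} (hab : a ≠ b) {m : ℕ} {x : coherentIso.{u} _⦋m⦌}
    (hx : vertexModel.toList x = [b, a]) :
    x ∉ (Subcomplex.range (edgeMap.{u} a b)).obj _ := by
  rw [mem_range_edgeMap]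
  rintro ⟨l, hl, hl'⟩
  obtain ⟨i, j, rfl⟩ : ∃ i j, l = [i, j] := by
    have := congrArg List.length (hx.symm.trans hl')
    rw [List.length_map] at this
    exact List.length_eq_two.1 this.symm
  rw [hx] at hl'
  simp only [List.map_cons, List.map_nil, List.cons.injEq, and_true] at hl'
  obtain rfl : i = 1 := by
    by_contra h
    obtain rfl : i = 0 := by clear * - h; decide +revert
    exact hab hl'.1.symm
  obtain rfl : j = 0 := by
    by_contra h
    obtain rfl : j = 1 := by clear * - h; decide +revert
    exact hab hl'.2
  exact absurd hl (by decide)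

lemma good_pair {a b : Vertex} (hab : a ≠ b) :
    vertexModel.{u}.Good (Subcomplex.range (edgeMap a b)) [b, a] :=
  VertexModel.good_of_list (by simp) (by simpa using vertex_le b a) (by simpa using hab.symm)
    (fun _ _ hx => notMem_range_edgeMap hab hx)

variable {X Y : SSet.{u}} {q : X ⟶ Y}

lemma exists_range_map (a b : Vertex) [Mono (edgeMap.{u} a b)] (v : coherentIso.{u} ⟶ Y)
    (e : X _⦋1⦌)
    (he : ∀ ε : coherentIso.{u} _⦋1⦌, vertexModel.toList ε = [a, b] → v.app _ ε = q.app _ e) :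
    ∃ u : ((Subcomplex.range (edgeMap.{u} a b)) : SSet.{u}) ⟶ X,
      u ≫ q = (Subcomplex.range (edgeMap.{u} a b)).ι ≫ v ∧
      ∀ (ε : coherentIso.{u} _⦋1⦌) hε, vertexModel.toList ε = [a, b] → u.app _ ⟨ε, hε⟩ = e := by
  have h1 : (yonedaEquiv.symm e).app _ (stdSimplex.objEquiv.symm (𝟙 ⦋1⦌)) = e :=
    yonedaEquiv.apply_symm_apply e
  have h2 : ∀ (ε : coherentIso.{u} _⦋1⦌) hε, vertexModel.toList ε = [a, b] →
      (⟨ε, hε⟩ : (Subcomplex.range (edgeMap.{u} a b) : SSet.{u}) _⦋1⦌) =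
        (Subcomplex.toRange (edgeMap a b)).app _ (stdSimplex.objEquiv.symm (𝟙 ⦋1⦌)) := by
    intro ε hε h
    refine Subtype.ext (vertexModel.toList_injective (h.trans ?_))
    exact (vertexModel.{u}.toList_simplexMap_app ⟨![a, b], fun _ _ _ => trivial⟩
      (stdSimplex.objEquiv.symm (𝟙 ⦋1⦌))).symm
  refine ⟨CategoryTheory.inv (Subcomplex.toRange (edgeMap a b)) ≫ yonedaEquiv.symm e, ?_, ?_⟩
  · rw [Category.assoc, IsIso.inv_comp_eq]
    apply yonedaEquiv.injective
    refine (congrArg (q.app _) h1).trans (he ((edgeMap a b).app _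
      (stdSimplex.objEquiv.symm (𝟙 ⦋1⦌))) ?_).symm
    exact vertexModel.toList_simplexMap_app _ _
  · intro ε hε h
    rw [h2 ε hε h]
    refine Eq.trans ?_ h1
    have h3 := IsIso.hom_inv_id (Subcomplex.toRange (edgeMap.{u} a b))
    exact congrArg (fun z => (yonedaEquiv.symm e).app _ (z.app _
      (stdSimplex.objEquiv.symm (𝟙 ⦋1⦌)))) h3

/-- Lifting along the inclusion of an edge with a cartesian lift. -/
lemma exists_lift_of_liftsRight (hq : LiftsInner (sharpMap q)) (v : coherentIso.{u} ⟶ Y)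
    (e : X _⦋1⦌) (hqe : LiftsRight (sharpMap q) e)
    (he : ∀ ε : coherentIso.{u} _⦋1⦌, vertexModel.toList ε = [v₁, v₀] → v.app _ ε = q.app _ e) :
    ∃ L : coherentIso.{u} ⟶ X, L ≫ q = v ∧
      ∀ (ε : coherentIso.{u} _⦋1⦌), vertexModel.toList ε = [v₁, v₀] → L.app _ ε = e := by
  obtain ⟨u, hu, hue⟩ := exists_range_map v₁ v₀ v e he
  obtain ⟨L, h1, h2, -⟩ := (Insertion.final _ _ _ _ isEnd.{u}).exists_scaled_lift
    (p := sharpMap q) (u := u) (v := v) hq hu (by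
      intro l hl hl'
      have hfst : l.takeWhile (fun _ => true) = l := List.takeWhile_eq_self_iff.2 (by simp)
      have hsnd : l.dropWhile (fun _ => true) = [] := List.dropWhile_eq_nil_iff.2 (by simp)
      replace hl' : (l.takeWhile (fun _ => true)).getLast? ≠ some v₀ := hl'
      rw [hfst] at hl'
      right; right
      -- A small word ends in `v₁`, so appending `v₀` gives a horn `Λ^n_n` on the cartesian edge.
      -- The word `v₁` alone lies in the edge already, so the horn has dimension at least 2.
      obtain ⟨l₁, a, rfl⟩ := List.eq_nil_or_concat' l |>.resolve_left
        (List.ne_nil_of_length_pos hl.length_pos)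
      obtain rfl : a = v₁ := (eq_v₀_or_v₁ a).resolve_left (by rintro rfl; simp at hl')
      obtain _ | ⟨c, l₂⟩ := l₁
      · obtain ⟨m, x, -, hxA, hx⟩ := hl
        refine absurd ?_ hxA
        rw [mem_range_edgeMap]
        exact ⟨[0], by simp, hx⟩
      refine ⟨v₁, c, c :: l₂, hsnd, hfst, rfl, fun ε hε => ?_, ⟨thinAt_sharp _ _ _ _ _,
        thinOn_sharp _ _ _ _ _, fun t ht => ?_⟩⟩
      · have hεA := mem_range_edgeMap_of_pair hε
        refine ⟨hεA, ?_⟩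
        exact (congrArg (LiftsRight (sharpMap q)) (hue ε hεA hε)).mpr hqe
      · rcases eq_v₀_or_v₁ c with rfl | rfl
        · exact Or.inr ⟨[v₀, v₁], good_pair v₀_ne_v₁.symm, by
            change ¬ ([v₀, v₁].takeWhile (fun _ => true)).getLast? = some v₀
            simpa using v₀_ne_v₁.symm, rfl⟩
        · refine Or.inl ?_
          rw [mem_range_edgeMap]
          exact ⟨[0, 0, 1], by simp, ht⟩)
  refine ⟨L, h2, fun ε hε => ?_⟩
  have hεA := mem_range_edgeMap_of_pair hε
  exact (congrArg (fun z => z.app _ ⟨ε, hεA⟩) h1).trans (hue ε hεA hε)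

/-- Lifting along the inclusion of an edge with a cocartesian lift. -/
lemma exists_lift_of_liftsLeft (hq : LiftsInner (sharpMap q)) (v : coherentIso.{u} ⟶ Y)
    (e : X _⦋1⦌) (hqe : LiftsLeft (sharpMap q) e)
    (he : ∀ ε : coherentIso.{u} _⦋1⦌, vertexModel.toList ε = [v₀, v₁] → v.app _ ε = q.app _ e) :
    ∃ L : coherentIso.{u} ⟶ X, L ≫ q = v ∧
      ∀ (ε : coherentIso.{u} _⦋1⦌), vertexModel.toList ε = [v₀, v₁] → L.app _ ε = e := by
  obtain ⟨u, hu, hue⟩ := exists_range_map v₀ v₁ v e he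
  obtain ⟨L, h1, h2, -⟩ := (Insertion.start _ _ _ _ isStart.{u}).exists_scaled_lift
    (p := sharpMap q) (u := u) (v := v) hq hu (by
      intro l hl hl'
      have hfst : l.takeWhile (fun _ => false) = [] := by cases l <;> simp
      have hsnd : l.dropWhile (fun _ => false) = l := by cases l <;> simp
      replace hl' : (l.dropWhile (fun _ => false)).head? ≠ some v₀ := hl'
      rw [hsnd] at hl'
      right; left
      obtain ⟨a, l₁, rfl⟩ := List.exists_cons_of_ne_nil (List.ne_nil_of_length_pos hl.length_pos)
      obtain rfl : a = v₁ := (eq_v₀_or_v₁ a).resolve_left (by rintro rfl; simp at hl')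
      obtain rfl | ⟨l₂, c, rfl⟩ := List.eq_nil_or_concat' l₁
      · obtain ⟨m, x, -, hxA, hx⟩ := hl
        refine absurd ?_ hxA
        rw [mem_range_edgeMap]
        exact ⟨[1], by simp, hx⟩
      refine ⟨v₁, c, l₂ ++ [c], hfst, hsnd, by simp, fun ε hε => ?_, ⟨thinAt_sharp _ _ _ _ _,
        thinOn_sharp _ _ _ _ _, fun t ht => ?_⟩⟩
      · have hεA := mem_range_edgeMap_of_pair hε
        refine ⟨hεA, ?_⟩
        exact (congrArg (LiftsLeft (sharpMap q)) (hue ε hεA hε)).mpr hqe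
      · rcases eq_v₀_or_v₁ c with rfl | rfl
        · exact Or.inr ⟨[v₁, v₀], good_pair v₀_ne_v₁, by
            change ¬ ([v₁, v₀].dropWhile (fun _ => false)).head? = some v₀
            simpa using v₀_ne_v₁.symm, rfl⟩
        · refine Or.inl ?_
          rw [mem_range_edgeMap]
          exact ⟨[0, 1, 1], by simp, ht⟩)
  refine ⟨L, h2, fun ε hε => ?_⟩
  have hεA := mem_range_edgeMap_of_pair hε
  exact (congrArg (fun z => z.app _ ⟨ε, hεA⟩) h1).trans (hue ε hεA hε)

end SSet.coherentIso

/-! ### Isofibrations. -/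

namespace ScaledSSet

open SSet.coherentIso

variable {E B : ScaledSSet.{u}}

/-- The lifting property with respect to the inclusion of the vertex `x₀` in the nerve of the
walking isomorphism all of whose triangles are thin. -/
def LiftsCoherentIso (p : E ⟶ B) : Prop :=
  ∀ (x : E.toSSet _⦋0⦌) (v : coherentIso.{u} ⟶ B.toSSet), (∀ t, v.app _ t ∈ B.thin) →
    v.app _ x₀ = p.toHom.app _ x →
    ∃ l : coherentIso.{u} ⟶ E.toSSet, (∀ t, l.app _ t ∈ E.thin) ∧ l.app _ x₀ = x ∧
      l ≫ p.toHom = v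

/-- The lifting properties used to lift homotopies. -/
structure IsIsofibration (p : E ⟶ B) : Prop where
  liftsInner : LiftsInner p
  saturation : HasLiftingProperty saturationMap p
  liftsCoherentIso : LiftsCoherentIso p

variable {p : E ⟶ B}

lemma thin_of_mem_core {X : ScaledSSet.{u}} (x : (X.core : SSet.{u}) _⦋2⦌) : x.1 ∈ X.thin := by
  simpa using x.2 (𝟙 _)

lemma exists_core_lift_of_thin {X : SSet.{u}} (v : X ⟶ B.toSSet) (hv : ∀ t, v.app _ t ∈ B.thin) :
    ∃ v' : X ⟶ (B.core : SSet.{u}), v' ≫ B.core.ι = v :=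
  ⟨Subcomplex.lift v (by
    rintro k _ ⟨x, rfl⟩ f
    exact (congrArg (· ∈ B.thin) (NatTrans.naturality_apply v f x).symm).mpr (hv _)), rfl⟩

/-- The map `v` lands in the core of `B`. The edge from `v₁` to `v₀` ends at `x₀`, so it has a
cartesian lift ending at `x`. This edge remains cartesian for the cores, and the rest of the walking
isomorphism is lifted there, where thinness is automatic. -/
lemma liftsCoherentIso_of_hasCartesianLifts (hp : LiftsInner p)
    (hs : HasLiftingProperty saturationMap p) (hl : HasCartesianLifts p) :
    LiftsCoherentIso p := by
  intro x v hv hx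
  obtain ⟨v', rfl⟩ := exists_core_lift_of_thin v hv
  obtain ⟨ε, hε⟩ := vertexModel.{u}.exists_eq_pair (vertex_le v₁ v₀)
  have hε₀ : coherentIso.{u}.δ 0 ε = x₀ := vertexModel.toList_injective (by
    rw [vertexModel.toList_δ, hε, toList_x₀]
    rfl)
  obtain ⟨e, he, he₀, hpe⟩ := hl x ((v' ≫ B.core.ι).app _ ε) (by
    rw [← hx, ← hε₀]
    exact (NatTrans.naturality_apply (v' ≫ B.core.ι) (SimplexCategory.δ 0).op ε).symm)
  obtain ⟨L, hL, hLe⟩ := exists_lift_of_liftsRight (q := coreMap p)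
    (liftsInner_sharpMap (innerFibration_coreMap hp hs)) v' (E.coreEdge e)
    (liftsRight_sharpMap (isCartesianEdge_coreMap hp hs he.liftsRight)) (by
      intro ε' hε'
      obtain rfl := vertexModel.toList_injective (hε'.trans hε.symm)
      exact Subtype.ext hpe.symm)
  refine ⟨L ≫ E.core.ι, fun t => thin_of_mem_core _, ?_, ?_⟩
  · rw [← hε₀, ← he₀]
    refine (NatTrans.naturality_apply (L ≫ E.core.ι) (SimplexCategory.δ 0).op ε).trans ?_
    exact congrArg (fun z => E.toSSet.δ 0 z.1) (hLe ε hε)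
  · rw [← hL]
    rfl

/-- With cocartesian lifts one uses the edge from `v₀` to `v₁`, which starts at `x₀`. -/
lemma liftsCoherentIso_of_hasCartesianLifts_op (hp : LiftsInner p)
    (hs : HasLiftingProperty saturationMap p) (hl : HasCartesianLifts (opMap p)) :
    LiftsCoherentIso p := by
  intro x v hv hx
  obtain ⟨v', rfl⟩ := exists_core_lift_of_thin v hv
  obtain ⟨ε, hε⟩ := vertexModel.{u}.exists_eq_pair (vertex_le v₀ v₁)
  have hε₀ : coherentIso.{u}.δ 1 ε = x₀ := vertexModel.toList_injective (by
    rw [vertexModel.toList_δ, hε, toList_x₀]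
    rfl)
  obtain ⟨e', he, he₀, hpe⟩ := hl (opObjEquiv.symm x)
    (opObjEquiv.symm ((v' ≫ B.core.ι).app _ ε)) (by
      refine (SSet.op_δ B.toSSet 0 _).trans (congrArg opObjEquiv.symm ?_)
      refine Eq.trans ?_ hx
      rw [← hε₀]
      exact (NatTrans.naturality_apply (v' ≫ B.core.ι) (SimplexCategory.δ 1).op ε).symm)
  obtain ⟨e, rfl⟩ := opObjEquiv.symm.surjective e'
  obtain ⟨L, hL, hLe⟩ := exists_lift_of_liftsLeft (q := coreMap p)
    (liftsInner_sharpMap (innerFibration_coreMap hp hs)) v' (E.coreEdge e)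
    (liftsLeft_sharpMap_coreMap hp hs (IsCocartesianEdge.liftsLeft he)) (by
      intro ε' hε'
      obtain rfl := vertexModel.toList_injective (hε'.trans hε.symm)
      exact Subtype.ext (congrArg opObjEquiv hpe).symm)
  refine ⟨L ≫ E.core.ι, fun t => thin_of_mem_core _, ?_, ?_⟩
  · rw [← hε₀]
    refine (NatTrans.naturality_apply (L ≫ E.core.ι) (SimplexCategory.δ 1).op ε).trans ?_
    refine (congrArg (fun z => E.toSSet.δ 1 z.1) (hLe ε hε)).trans ?_
    exact congrArg opObjEquiv ((SSet.op_δ E.toSSet 0 (opObjEquiv.symm e)).symm.trans he₀)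
  · rw [← hL]
    rfl

/-- The saturation map is the identity on simplices, so an extension to `E` is automatically
compatible with the map to `B`. -/
lemma IsInftyBicategory.hasLiftingProperty_saturationMap (hE : E.IsInftyBicategory) (p : E ⟶ B) :
    HasLiftingProperty saturationMap p where
  sq_hasLift {u v} sq := by
    obtain ⟨l, hl⟩ := hE.saturation u
    refine ⟨⟨l, hl, ?_⟩⟩
    apply Hom.ext
    have h1 := congrArg Hom.toHom sq.w
    have h2 := congrArg Hom.toHom hl
    refine Eq.trans ?_ h1
    exact congrArg (fun z => z ≫ p.toHom) h2

/-- 2-fibrations between `∞`-bicategories are isofibrations. -/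
lemma isIsofibration_of_2fibration (hE : E.IsInftyBicategory)
    (h : IsInnerCartesian2Fibration p ∨ IsOuterCartesian2Fibration p ∨
      IsInnerCocartesian2Fibration p ∨ IsOuterCocartesian2Fibration p) : IsIsofibration p := by
  have hs := hE.hasLiftingProperty_saturationMap p
  have key : LiftsInner p ∧ LiftsCoherentIso p := by
    rcases h with h | h | h | h
    · exact ⟨h.weakFibration.liftsInner,
        liftsCoherentIso_of_hasCartesianLifts h.weakFibration.liftsInner hs h.hasCartesianLifts⟩
    · exact ⟨h.weakFibration.liftsInner,
        liftsCoherentIso_of_hasCartesianLifts h.weakFibration.liftsInner hs h.hasCartesianLifts⟩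
    · have h1 := liftsInner_of_op h.weakFibration.liftsInner
      exact ⟨h1, liftsCoherentIso_of_hasCartesianLifts_op h1 hs h.hasCartesianLifts⟩
    · have h1 := liftsInner_of_op h.weakFibration.liftsInner
      exact ⟨h1, liftsCoherentIso_of_hasCartesianLifts_op h1 hs h.hasCartesianLifts⟩
  exact ⟨key.1, hs, key.2⟩

end ScaledSSet

/-! ### Products, mapping spaces and cotensors. -/

namespace ScaledSSet

/-- The product of a scaled simplicial set and of a simplicial set all of whose triangles are
thin. -/
def tensor (X : ScaledSSet.{u}) (K : SSet.{u}) : ScaledSSet.{u} where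
  toSSet := X.toSSet ⊗ K
  thin := {t | t.1 ∈ X.thin}
  degenerate_subset_thin := fun _ ht =>
    X.degenerate_subset_thin
      (degenerate_app_apply ht (CartesianMonoidalCategory.fst X.toSSet K))

/-- Functoriality of the product. -/
def tensorMap {X Y : ScaledSSet.{u}} {K L : SSet.{u}} (f : X ⟶ Y) (g : K ⟶ L) :
    X.tensor K ⟶ Y.tensor L where
  toHom := f.toHom ⊗ₘ g
  map_thin t ht := f.map_thin t.1 ht

lemma hom_ext_app {X Y : ScaledSSet.{u}} {f g : X ⟶ Y}
    (h : ∀ k (x : X.toSSet.obj k), f.toHom.app k x = g.toHom.app k x) : f = g := by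
  apply Hom.ext
  ext k x
  exact h k x

lemma tensorMap_stdSimplex_map_comp (X : ScaledSSet.{u}) {k l m : SimplexCategory} (f : k ⟶ l)
    (g : l ⟶ m) : tensorMap (𝟙 X) (SSet.stdSimplex.map (f ≫ g)) =
      tensorMap (𝟙 X) (SSet.stdSimplex.map f) ≫ tensorMap (𝟙 X) (SSet.stdSimplex.map g) :=
  congrArg (tensorMap (𝟙 X)) (SSet.stdSimplex.map_comp f g)

/-- The simplicial set of maps from `X` to `C`. -/
def mapping (X C : ScaledSSet.{u}) : SSet.{u} where
  obj k := X.tensor (SSet.stdSimplex.obj k.unop) ⟶ C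
  map f := TypeCat.ofHom (fun h => tensorMap (𝟙 X) (SSet.stdSimplex.map f.unop) ≫ h)
  map_id k := by
    ext h
    change tensorMap (𝟙 X) (SSet.stdSimplex.map (𝟙 k.unop)) ≫ h = h
    refine (congrArg (fun z => tensorMap (𝟙 X) z ≫ h) (SSet.stdSimplex.map_id k.unop)).trans ?_
    exact Category.id_comp h
  map_comp f g := by
    ext h
    exact (congrArg (· ≫ h) (tensorMap_stdSimplex_map_comp X g.unop f.unop)).trans
      (Category.assoc _ _ _)

/-- The tautological simplex of a standard simplex. -/
abbrev topSimplex (k : SimplexCategoryᵒᵖ) : (SSet.stdSimplex.{u}.obj k.unop).obj k :=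
  SSet.stdSimplex.objEquiv.symm (𝟙 k.unop)

lemma yonedaEquiv_symm_topSimplex {K : SSet.{u}} {k : SimplexCategoryᵒᵖ} (y : K.obj k) :
    ((yonedaEquiv (n := k.unop)).symm y).app k (topSimplex k) = y :=
  (yonedaEquiv (n := k.unop)).apply_symm_apply y

lemma map_topSimplex {k l : SimplexCategoryᵒᵖ} (f : k ⟶ l) :
    (SSet.stdSimplex.{u}.obj k.unop).map f (topSimplex k) =
      (SSet.stdSimplex.map f.unop).app l (topSimplex l) := by
  apply SSet.stdSimplex.objEquiv.injective
  exact (Category.comp_id f.unop).trans (Category.id_comp f.unop).symm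

lemma exists_eq_map_topSimplex {k : SimplexCategory} {l : SimplexCategoryᵒᵖ}
    (s : (SSet.stdSimplex.{u}.obj k).obj l) :
    ∃ f : op k ⟶ l, s = (SSet.stdSimplex.map f.unop).app l (topSimplex l) ∧
      s = (SSet.stdSimplex.obj k).map f (topSimplex (op k)) := by
  refine ⟨(SSet.stdSimplex.objEquiv s).op, ?_, ?_⟩
  · apply SSet.stdSimplex.objEquiv.injective
    exact (Category.id_comp _).symm
  · apply SSet.stdSimplex.objEquiv.injective
    exact (Category.comp_id _).symm

lemma yonedaEquiv_symm_map {K : SSet.{u}} {k l : SimplexCategoryᵒᵖ} (f : k ⟶ l) (y : K.obj k) :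
    (yonedaEquiv (n := l.unop)).symm (K.map f y) =
      SSet.stdSimplex.map f.unop ≫ (yonedaEquiv (n := k.unop)).symm y := by
  apply (yonedaEquiv (n := l.unop)).injective
  rw [Equiv.apply_symm_apply]
  refine (congrArg (fun z => K.map z.op y) (Category.id_comp f.unop)).symm.trans ?_
  rfl

variable {X Y C D : ScaledSSet.{u}} {K L : SSet.{u}}

/-- The map to the simplicial set of maps which corresponds to a map from a product. -/
def toMapping (g : X.tensor K ⟶ C) : K ⟶ mapping X C where
  app k := TypeCat.ofHom (fun y => tensorMap (𝟙 X) ((yonedaEquiv (n := k.unop)).symm y) ≫ g)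
  naturality k l f := by
    ext y
    change tensorMap (𝟙 X) ((yonedaEquiv (n := l.unop)).symm (K.map f y)) ≫ g = _
    rw [yonedaEquiv_symm_map]
    rfl

/-- The map from a product which corresponds to a map to the simplicial set of maps. -/
def ofMapping (φ : K ⟶ mapping X C) : X.tensor K ⟶ C where
  toHom :=
    { app k := TypeCat.ofHom (fun z => (φ.app k z.2).toHom.app k (z.1, topSimplex k))
      naturality k l f := by
        ext ⟨x, y⟩
        have h1 := NatTrans.naturality_apply φ f y
        have h2 := NatTrans.naturality_apply (φ.app k y).toHom f
          (show (X.tensor (SSet.stdSimplex.obj k.unop)).toSSet.obj k from (x, topSimplex k))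
        refine Eq.trans ?_ h2
        refine (congrArg (fun z : X.tensor (SSet.stdSimplex.obj l.unop) ⟶ C =>
          z.toHom.app l (X.toSSet.map f x, topSimplex l)) h1).trans ?_
        exact congrArg (fun z => Hom.toHom (φ.app k y) |>.app l (X.toSSet.map f x, z))
          (map_topSimplex f).symm }
  map_thin t ht := (φ.app _ t.2).map_thin (t.1, topSimplex _) ht

lemma ofMapping_toMapping (g : X.tensor K ⟶ C) : ofMapping (toMapping g) = g := by
  refine hom_ext_app (fun k z => ?_)
  exact congrArg (fun w => g.toHom.app k (z.1, w)) (yonedaEquiv_symm_topSimplex z.2)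

lemma comp_ofMapping (f : L ⟶ K) (φ : K ⟶ mapping X C) :
    ofMapping (f ≫ φ) = tensorMap (𝟙 X) f ≫ ofMapping φ := rfl

lemma toMapping_comp (f : L ⟶ K) (g : X.tensor K ⟶ C) :
    toMapping (tensorMap (𝟙 X) f ≫ g) = f ≫ toMapping g := by
  ext k y
  refine congrArg (fun z => tensorMap (𝟙 X) z ≫ g) (a₁ := (yonedaEquiv (n := k.unop)).symm y ≫ f) ?_
  rw [yonedaEquiv_symm_comp]
  rfl

lemma toMapping_ofMapping (φ : K ⟶ mapping X C) : toMapping (ofMapping φ) = φ := by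
  ext k y
  refine hom_ext_app (fun l => ?_)
  rintro ⟨x, s⟩
  obtain ⟨f, rfl, hf⟩ := exists_eq_map_topSimplex s
  refine Eq.trans ?_ (congrArg (fun z : X.tensor (SSet.stdSimplex.obj l.unop) ⟶ C =>
    z.toHom.app l (x, topSimplex l)) (NatTrans.naturality_apply φ f y))
  refine congrArg (fun z => Hom.toHom (φ.app l z) |>.app l (x, topSimplex l)) ?_
  refine (congrArg (((yonedaEquiv (n := k.unop)).symm y).app l) hf).trans ?_
  refine (NatTrans.naturality_apply ((yonedaEquiv (n := k.unop)).symm y) f _).trans ?_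
  exact congrArg (K.map f) (yonedaEquiv_symm_topSimplex y)

/-- Functoriality of the simplicial set of maps in the source. -/
def mappingMap (j : X ⟶ Y) (C : ScaledSSet.{u}) : mapping Y C ⟶ mapping X C where
  app _ := TypeCat.ofHom (fun h => tensorMap j (𝟙 _) ≫ h)
  naturality _ _ _ := rfl

lemma ofMapping_comp_mappingMap (j : X ⟶ Y) (φ : K ⟶ mapping Y C) :
    ofMapping (φ ≫ mappingMap j C) = tensorMap j (𝟙 K) ≫ ofMapping φ := rfl

/-- The standard simplex in which only the degenerate triangles are thin. -/
abbrev flat (k : SimplexCategoryᵒᵖ) : ScaledSSet.{u} where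
  toSSet := SSet.stdSimplex.obj k.unop
  thin := SSet.degenerate _ 2
  degenerate_subset_thin := subset_rfl

/-- Functoriality of the standard simplices. -/
def flatMap {k l : SimplexCategoryᵒᵖ} (f : k ⟶ l) : flat.{u} l ⟶ flat k where
  toHom := SSet.stdSimplex.map f.unop
  map_thin _ ht := degenerate_app_apply ht _

/-- A simplex of a scaled simplicial set, as a map. -/
def flatHom {k : SimplexCategoryᵒᵖ} (x : X.toSSet.obj k) : flat.{u} k ⟶ X where
  toHom := (yonedaEquiv (n := k.unop)).symm x
  map_thin _ ht := X.degenerate_subset_thin (degenerate_app_apply ht _)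

lemma flatHom_map {k l : SimplexCategoryᵒᵖ} (f : k ⟶ l) (x : X.toSSet.obj k) :
    flatHom (X.toSSet.map f x) = flatMap f ≫ flatHom x := by
  apply Hom.ext
  exact yonedaEquiv_symm_map f x

lemma tensorMap_flatHom_map {k l : SimplexCategoryᵒᵖ} (f : k ⟶ l) (x : X.toSSet.obj k)
    (K : SSet.{u}) : tensorMap (flatHom (X.toSSet.map f x)) (𝟙 K) =
      tensorMap (flatMap f) (𝟙 K) ≫ tensorMap (flatHom x) (𝟙 K) :=
  congrArg (fun z => tensorMap z (𝟙 K)) (flatHom_map f x)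

lemma flatMap_id (k : SimplexCategoryᵒᵖ) : flatMap.{u} (𝟙 k) = 𝟙 _ := by
  apply Hom.ext
  exact SSet.stdSimplex.map_id k.unop

lemma flatMap_comp {k l m : SimplexCategoryᵒᵖ} (f : k ⟶ l) (g : l ⟶ m) :
    flatMap.{u} (f ≫ g) = flatMap g ≫ flatMap f := by
  apply Hom.ext
  exact SSet.stdSimplex.map_comp g.unop f.unop

lemma tensorMap_flatMap_comp {k l m : SimplexCategoryᵒᵖ} (f : k ⟶ l) (g : l ⟶ m)
    (K : SSet.{u}) : tensorMap (flatMap (f ≫ g)) (𝟙 K) =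
      tensorMap (flatMap g) (𝟙 K) ≫ tensorMap (flatMap f) (𝟙 K) :=
  congrArg (fun z => tensorMap z (𝟙 K)) (flatMap_comp f g)

lemma mem_degenerate_or_eq {k : ℕ} (hk : k ≤ 2) (t : (Δ[k] : SSet.{u}) _⦋2⦌) :
    t ∈ (Δ[k] : SSet.{u}).degenerate 2 ∨
      k = 2 ∧ (stdSimplex.vertexModel k).toList t = List.ofFn id := by
  by_cases h : t ∈ (Δ[k] : SSet.{u}).degenerate 2
  · exact Or.inl h
  · refine Or.inr ?_
    obtain ⟨a, b, c, habc⟩ : ∃ a b c, (stdSimplex.vertexModel k).toList t = [a, b, c] :=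
      ⟨_, _, _, rfl⟩
    obtain ⟨hab, hbc⟩ := (stdSimplex.vertexModel k).le_of_toList_eq habc
    rw [← mem_nonDegenerate_iff_notMem_degenerate, (stdSimplex.vertexModel k).mem_nonDegenerate_iff,
      habc] at h
    simp only [List.isChain_cons_cons, List.isChain_singleton, and_true, ne_eq] at h
    rw [Fin.le_def] at hab hbc
    rw [Fin.ext_iff, Fin.ext_iff] at h
    obtain rfl : k = 2 := by lia
    obtain ⟨rfl, rfl, rfl⟩ : a = 0 ∧ b = 1 ∧ c = 2 := by
      clear * - hab hbc h
      decide +revert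
    exact ⟨rfl, habc⟩

/-- The scaled simplicial set of maps from `K` to `C`. -/
def cotensor (C : ScaledSSet.{u}) (K : SSet.{u}) : ScaledSSet.{u} where
  toSSet :=
    { obj k := (flat k).tensor K ⟶ C
      map f := TypeCat.ofHom (fun h => tensorMap (flatMap f) (𝟙 K) ≫ h)
      map_id k := by
        ext h
        refine (congrArg (fun z => tensorMap z (𝟙 K) ≫ h) (flatMap_id k)).trans ?_
        exact Category.id_comp h
      map_comp f g := by
        ext h
        exact (congrArg (· ≫ h) (tensorMap_flatMap_comp f g K)).trans (Category.assoc _ _ _) }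
  -- These are the `h` which remain maps of scaled simplicial sets when the 2-simplex is given the
  -- maximal scaling.
  thin := {h | ∀ t, h.toHom.app _ t ∈ C.thin}
  degenerate_subset_thin := by
    rintro _ ⟨m, hm, f, h, rfl⟩ t
    -- The triangle factors through a simplex of dimension less than 2, all of whose triangles are
    -- degenerate.
    exact h.map_thin _ ((mem_degenerate_or_eq hm.le _).resolve_right (fun h' => hm.ne h'.1))

/-- The map to the scaled simplicial set of maps from `K` which corresponds to a map from a
product. -/
def toCotensor (g : X.tensor K ⟶ C) : X ⟶ C.cotensor K where
  toHom :=
    { app k := TypeCat.ofHom (fun x => tensorMap (flatHom x) (𝟙 K) ≫ g)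
      naturality k l f := by
        ext x
        exact (congrArg (· ≫ g) (tensorMap_flatHom_map f x K)).trans (Category.assoc _ _ _) }
  map_thin x hx t := by
    refine g.map_thin _ ?_
    rcases mem_degenerate_or_eq le_rfl t.1 with h | ⟨-, h⟩
    · exact (flatHom x).map_thin t.1 h
    · have h' : t.1 = topSimplex (op ⦋2⦌) := (stdSimplex.vertexModel 2).toList_injective h
      refine (congrArg (· ∈ X.thin) ?_).mpr hx
      exact (congrArg ((flatHom x).toHom.app _) h').trans (yonedaEquiv_symm_topSimplex x)

/-- The map from a product which corresponds to a map to the scaled simplicial set of maps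
from `K`. -/
def ofCotensor (φ : X ⟶ C.cotensor K) : X.tensor K ⟶ C where
  toHom :=
    { app k := TypeCat.ofHom (fun z => Hom.toHom (φ.toHom.app k z.1) |>.app k (topSimplex k, z.2))
      naturality k l f := by
        ext ⟨x, y⟩
        have h1 := NatTrans.naturality_apply φ.toHom f x
        have h2 := NatTrans.naturality_apply (Hom.toHom (φ.toHom.app k x)) f
          (show ((flat k).tensor K).toSSet.obj k from (topSimplex k, y))
        refine Eq.trans ?_ h2
        refine (congrArg (fun z : (flat l).tensor K ⟶ C =>
          z.toHom.app l (topSimplex l, K.map f y)) h1).trans ?_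
        exact congrArg (fun z => Hom.toHom (φ.toHom.app k x) |>.app l (z, K.map f y))
          (map_topSimplex f).symm }
  map_thin t ht := φ.map_thin t.1 ht (topSimplex _, t.2)

lemma ofCotensor_toCotensor (g : X.tensor K ⟶ C) : ofCotensor (toCotensor g) = g := by
  refine hom_ext_app (fun k z => ?_)
  exact congrArg (fun w => g.toHom.app k (w, z.2)) (yonedaEquiv_symm_topSimplex z.1)

lemma toCotensor_ofCotensor (φ : X ⟶ C.cotensor K) : toCotensor (ofCotensor φ) = φ := by
  apply Hom.ext
  ext k x
  refine hom_ext_app (fun l => ?_)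
  rintro ⟨s, y⟩
  obtain ⟨f, rfl, hf⟩ := exists_eq_map_topSimplex s
  refine Eq.trans ?_ (congrArg (fun z : (flat l).tensor K ⟶ C =>
    z.toHom.app l (topSimplex l, y)) (NatTrans.naturality_apply φ.toHom f x))
  refine congrArg (fun z => Hom.toHom (φ.toHom.app l z) |>.app l (topSimplex l, y)) ?_
  refine (congrArg (((yonedaEquiv (n := k.unop)).symm x).app l) hf).trans ?_
  refine (NatTrans.naturality_apply ((yonedaEquiv (n := k.unop)).symm x) f _).trans ?_
  exact congrArg (X.toSSet.map f) (yonedaEquiv_symm_topSimplex x)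

lemma comp_toCotensor (j : X ⟶ Y) (g : Y.tensor K ⟶ C) :
    toCotensor (tensorMap j (𝟙 K) ≫ g) = j ≫ toCotensor g := by
  apply Hom.ext
  ext k x
  refine congrArg (fun z => tensorMap z (𝟙 K) ≫ g) (a₁ := flatHom x ≫ j) ?_
  apply Hom.ext
  exact yonedaEquiv_symm_comp (n := k.unop) x j.toHom

lemma comp_ofCotensor (j : X ⟶ Y) (φ : Y ⟶ C.cotensor K) :
    ofCotensor (j ≫ φ) = tensorMap j (𝟙 K) ≫ ofCotensor φ := rfl

/-- Functoriality of the scaled simplicial set of maps in the target. -/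
def cotensorMap (q : C ⟶ D) (K : SSet.{u}) : C.cotensor K ⟶ D.cotensor K where
  toHom :=
    { app _ := TypeCat.ofHom (fun h => h ≫ q)
      naturality _ _ _ := rfl }
  map_thin _ ht t := q.map_thin _ (ht t)

end ScaledSSet

/-! ### Vertices of products, and composites of insertion procedures. -/

namespace SSet

/-- The simplices of a product. -/
def VertexModel.prod {X Y : SSet.{u}} {P Q : Type} [Preorder P] [Preorder Q]
    (M : VertexModel X P) (N : VertexModel Y Q) : VertexModel (X ⊗ Y) (P × Q) where
  equiv m :=
    { toFun z := (M.equiv m z.1).prod (N.equiv m z.2)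
      invFun f := ((M.equiv m).symm (OrderHom.fst.comp f), (N.equiv m).symm (OrderHom.snd.comp f))
      left_inv z := Prod.ext ((M.equiv m).symm_apply_apply z.1) ((N.equiv m).symm_apply_apply z.2)
      right_inv f := by
        ext i <;> simp }
  equiv_map f z i := Prod.ext (M.equiv_map f z.1 i) (N.equiv_map f z.2 i)

namespace VertexModel

variable {X Y : SSet.{u}} {P Q : Type} [Preorder P] [Preorder Q]
    (M : VertexModel X P) (N : VertexModel Y Q)

lemma map_fst_toList_prod {m : ℕ} (z : (X ⊗ Y : SSet.{u}) _⦋m⦌) :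
    ((M.prod N).toList z).map Prod.fst = M.toList z.1 := by
  rw [toList, List.map_ofFn]
  rfl

lemma map_snd_toList_prod {m : ℕ} (z : (X ⊗ Y : SSet.{u}) _⦋m⦌) :
    ((M.prod N).toList z).map Prod.snd = N.toList z.2 := by
  rw [toList, List.map_ofFn]
  rfl

lemma fst_mem_degenerate_iff {t : (X ⊗ Y : SSet.{u}) _⦋2⦌} {a b c : P × Q}
    (ht : (M.prod N).toList t = [a, b, c]) :
    t.1 ∈ X.degenerate 2 ↔ a.1 = b.1 ∨ b.1 = c.1 := by
  have h1 := M.mem_nonDegenerate_iff t.1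
  rw [← M.map_fst_toList_prod N, mem_nonDegenerate_iff_notMem_degenerate, ht] at h1
  rw [← not_iff_not, h1]
  simp

end VertexModel

lemma stdSimplex.mem_boundary_iff_toList {n m : ℕ} (x : (Δ[n] : SSet.{u}) _⦋m⦌) :
    x ∈ ∂Δ[n].obj _ ↔ ∃ j, j ∉ (stdSimplex.vertexModel n).toList x := by
  rw [mem_boundary_iff_notMem_range]
  refine exists_congr (fun j => not_congr ?_)
  rw [VertexModel.toList, List.mem_ofFn']
  rfl

lemma stdSimplex.mem_horn_iff_toList {n m : ℕ} {i : Fin (n + 1)} (x : (Δ[n] : SSet.{u}) _⦋m⦌) :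
    x ∈ Λ[n, i].obj _ ↔ ∃ j, j ≠ i ∧ j ∉ (stdSimplex.vertexModel n).toList x := by
  rw [mem_horn_iff_notMem_range]
  simp only [exists_prop]
  refine exists_congr (fun j => and_congr_right (fun _ => not_congr ?_))
  rw [VertexModel.toList, List.mem_ofFn']
  rfl

namespace VertexModel

variable {X : SSet.{u}} {P : Type} [Preorder P] (M : VertexModel X P)

/-- The lists of vertices of the simplices of a subcomplex. -/
def Mem (A : X.Subcomplex) (l : List P) : Prop :=
  ∃ (m : ℕ) (x : X _⦋m⦌), x ∈ A.obj _ ∧ M.toList x = l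

variable {M} {A A₁ : X.Subcomplex}

lemma mem_iff {m : ℕ} {x : X _⦋m⦌} {l : List P} (hx : M.toList x = l) :
    M.Mem A l ↔ x ∈ A.obj _ := by
  constructor
  · rintro ⟨m', y, hy, hyl⟩
    have h' := congrArg List.length (hx.trans hyl.symm)
    simp only [length_toList, Nat.add_right_cancel_iff] at h'
    subst h'
    rwa [M.toList_injective (hx.trans hyl.symm)]
  · intro h
    exact ⟨m, x, h, hx⟩

lemma Good.of_le (hA : A ≤ A₁) {l : List P} (hl : M.Good A₁ l) : M.Good A l := by
  obtain ⟨m, x, h1, h2, h3⟩ := hl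
  exact ⟨m, x, h1, fun h => h2 (hA _ h), h3⟩

lemma Good.good_of_not_mem {l : List P} (hl : M.Good A l) (h : ¬ M.Mem A₁ l) : M.Good A₁ l := by
  obtain ⟨m, x, h1, h2, h3⟩ := hl
  exact ⟨m, x, h1, fun hx => h ⟨m, x, hx, h3⟩, h3⟩

lemma Good.not_mem {l : List P} (hl : M.Good A₁ l) : ¬ M.Mem A₁ l := by
  obtain ⟨m, x, h1, h2, h3⟩ := hl
  rwa [mem_iff h3]

lemma Mem.of_sublist {l l' : List P} (hl : M.Mem A l) (h : l'.Sublist l) (h' : l' ≠ []) :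
    M.Mem A l' := by
  obtain ⟨m, x, hx, rfl⟩ := hl
  obtain ⟨f, hf⟩ := List.sublist_iff_exists_fin_orderEmbedding_get_eq.1 h
  obtain ⟨k, hk⟩ : ∃ k, l'.length = k + 1 :=
    Nat.exists_eq_succ_of_ne_zero (by simpa using h')
  let g : ⦋k⦌ ⟶ ⦋m⦌ := SimplexCategory.mkHom
    ⟨fun i => Fin.cast (M.length_toList x) (f (Fin.cast hk.symm i)), fun i j hij => by
      exact f.monotone (show Fin.cast hk.symm i ≤ Fin.cast hk.symm j from hij)⟩
  refine ⟨k, X.map g.op x, A.map _ hx, ?_⟩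
  apply List.ext_get
  · simp [hk]
  · intro i h1 h2
    rw [hf]
    simp only [toList, List.get_eq_getElem, List.getElem_ofFn]
    exact M.equiv_map g x _

end VertexModel

namespace Insertion

open VertexModel

variable {X : SSet.{u}} {P : Type} [Preorder P] {M : VertexModel X P} {A A₁ : X.Subcomplex}

variable (D : Insertion M A) (D₁ : Insertion M A₁)

lemma sublist_ins (l : List P) : l.Sublist (D.ins l) := by
  conv_lhs => rw [← D.append l]
  simp [ins]

lemma length_of_eq_eraseIdx_ins {l l' : List P} (hl' : M.Good A l') (h : D.small l)
    (h' : D.small l') {j : ℕ} (e : l = (D.ins l').eraseIdx j) : l.length = l'.length := by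
  by_cases hj : j < (D.ins l').length
  · rw [e, List.length_eraseIdx_of_lt hj, length_ins]
    rfl
  · rw [List.eraseIdx_of_length_le (by lia)] at e
    subst e
    exact absurd h (D.not_small hl' h')

open Classical in
/-- The combination of an insertion procedure for the simplices of a subcomplex and of an
insertion procedure for the other simplices. -/
noncomputable def sum (hA : A ≤ A₁)
    (h : ∀ l, M.Good A l → D.small l → M.Mem A₁ l → M.Mem A₁ (D.ins l))
    (hr : ∀ l, D.rank l ≤ l.length) : Insertion M A where
  fst l := if M.Mem A₁ l then D.fst l else D₁.fst l
  snd l := if M.Mem A₁ l then D.snd l else D₁.snd l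
  v l := if M.Mem A₁ l then D.v l else D₁.v l
  small l := if M.Mem A₁ l then D.small l else D₁.small l
  -- Chains in `A₁` come first: a face of the big chain of `l'` has at most `l'.length + 1`
  -- vertices, and `D.rank` is bounded by the length, so the summand 2 ensures the strict
  -- inequality. Two chains outside `A₁` that are compared have the same length, so there `D₁.rank`
  -- decides.
  rank l := if M.Mem A₁ l then D.rank l else l.length + 2 + D₁.rank l
  append l := by
    split_ifs
    · exact D.append l
    · exact D₁.append l
  pairwise {l} hl hl' := by
    split_ifs at hl' ⊢ with hA₁
    · exact D.pairwise hl hl'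
    · exact D₁.pairwise (hl.good_of_not_mem hA₁) hl'
  isChain {l} hl hl' := by
    split_ifs at hl' ⊢ with hA₁
    · exact D.isChain hl hl'
    · exact D₁.isChain (hl.good_of_not_mem hA₁) hl'
  not_small {l} hl hl' := by
    split_ifs at hl' ⊢ with hA₁ h2 h2
    · exact D.not_small hl hl'
    · exact absurd (h l hl hl' hA₁) h2
    · exact absurd (h2.of_sublist (D₁.sublist_ins l) (List.length_pos_iff.1 hl.length_pos)) hA₁
    · exact D₁.not_small (hl.good_of_not_mem hA₁) hl'
  exists_small {l} hl hl' := by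
    split_ifs at hl' with hA₁
    · obtain ⟨l', h1, h2, h3⟩ := D.exists_small hl hl'
      have h4 : M.Mem A₁ l' := (h3 ▸ hA₁).of_sublist (D.sublist_ins l')
        (List.length_pos_iff.1 h1.length_pos)
      refine ⟨l', h1, ?_, ?_⟩
      · rwa [if_pos h4]
      · rwa [if_pos h4, if_pos h4, if_pos h4]
    · obtain ⟨l', h1, h2, h3⟩ := D₁.exists_small (hl.good_of_not_mem hA₁) hl'
      refine ⟨l', h1.of_le hA, ?_, ?_⟩
      · rwa [if_neg h1.not_mem]
      · rwa [if_neg h1.not_mem, if_neg h1.not_mem, if_neg h1.not_mem]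
  injective {l l'} hl hl' hs hs' e := by
    split_ifs at hs hs' e with h1 h2 h2
    · exact D.injective hl hl' hs hs' e
    · exact absurd ((h l hl hs h1).of_sublist
        (by rw [show D.ins l = D₁.ins l' from e]; exact D₁.sublist_ins l') (List.length_pos_iff.1 hl'.length_pos)) h2
    · exact absurd ((h l' hl' hs' h2).of_sublist
        (by rw [← show D₁.ins l = D.ins l' from e]; exact D₁.sublist_ins l) (List.length_pos_iff.1 hl.length_pos)) h1
    · exact D₁.injective (hl.good_of_not_mem h1) (hl'.good_of_not_mem h2) hs hs' e
  rank_lt {l l'} hl hl' hs hs' j hj e := by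
    split_ifs at hs hs' hj e ⊢ with h1 h2 h2
    · exact D.rank_lt hl hl' hs hs' j hj e
    · have h3 := congrArg List.length e
      have h4 := hr l
      have h5 := (List.eraseIdx_sublist (D₁.ins l') j).length_le
      rw [length_ins] at h5
      change l.length = ((D₁.ins l').eraseIdx j).length at h3
      lia
    · exact absurd ((h l' hl' hs' h2).of_sublist (e ▸ List.eraseIdx_sublist _ j)
        (List.length_pos_iff.1 hl.length_pos)) h1
    · have h3 := D₁.rank_lt (hl.good_of_not_mem h1) (hl'.good_of_not_mem h2) hs hs' j hj e
      have h4 := D₁.length_of_eq_eraseIdx_ins (hl'.good_of_not_mem h2) hs hs' e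
      lia

section

variable (hA : A ≤ A₁)
    (h : ∀ l, M.Good A l → D.small l → M.Mem A₁ l → M.Mem A₁ (D.ins l))
    (hr : ∀ l, D.rank l ≤ l.length) {l : List P}

lemma sum_of_mem (hl : M.Mem A₁ l) :
    (D.sum D₁ hA h hr).fst l = D.fst l ∧ (D.sum D₁ hA h hr).snd l = D.snd l ∧
      (D.sum D₁ hA h hr).v l = D.v l ∧ ((D.sum D₁ hA h hr).small l ↔ D.small l) :=
  ⟨if_pos hl, if_pos hl, if_pos hl, iff_of_eq (if_pos hl)⟩

lemma sum_of_not_mem (hl : ¬ M.Mem A₁ l) :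
    (D.sum D₁ hA h hr).fst l = D₁.fst l ∧ (D.sum D₁ hA h hr).snd l = D₁.snd l ∧
      (D.sum D₁ hA h hr).v l = D₁.v l ∧ ((D.sum D₁ hA h hr).small l ↔ D₁.small l) :=
  ⟨if_neg hl, if_neg hl, if_neg hl, iff_of_eq (if_neg hl)⟩

end

end Insertion

end SSet

/-! ### The cylinder on a simplex, built from its boundary and one end. -/

namespace SSet.VertexModel

variable {X : SSet.{u}} {P : Type} [Preorder P] (M : VertexModel X P)

/-- The simplices with vertices in a given set. -/
def full (S : Set P) : X.Subcomplex where
  obj k := {x | ∀ f : k ⟶ op ⦋0⦌, M.equiv 0 (X.map f x) 0 ∈ S}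
  map g x hx f := by
    have := hx (g ≫ f)
    rwa [X.map_comp] at this

lemma mem_full {S : Set P} {m : ℕ} (x : X _⦋m⦌) :
    x ∈ (M.full S).obj _ ↔ ∀ a ∈ M.toList x, a ∈ S := by
  simp only [toList, List.mem_ofFn', Set.forall_mem_range]
  constructor
  · intro h i
    have := h (SimplexCategory.const ⦋0⦌ ⦋m⦌ i).op
    rwa [M.equiv_map] at this
  · intro h f
    have := M.equiv_map f.unop x 0
    exact (congrArg (· ∈ S) this).mpr (h _)

variable {M}

lemma good_iff {A : X.Subcomplex} {Q : List P → Prop}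
    (hQ : ∀ {m : ℕ} (x : X _⦋m⦌), x ∈ A.obj _ ↔ Q (M.toList x)) {l : List P} :
    M.Good A l ↔ l ≠ [] ∧ l.Pairwise (· ≤ ·) ∧ l.IsChain (· ≠ ·) ∧ ¬ Q l := by
  constructor
  · intro h
    refine ⟨List.length_pos_iff.1 h.length_pos, h.pairwise, h.isChain, ?_⟩
    obtain ⟨m, x, -, h2, rfl⟩ := h
    rwa [← hQ]
  · rintro ⟨h1, h2, h3, h4⟩
    refine good_of_list h1 h2 h3 (fun m x hx => ?_)
    rwa [hQ, hx]

lemma mem_iff_of_mem_iff {A : X.Subcomplex} {Q : List P → Prop}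
    (hQ : ∀ {m : ℕ} (x : X _⦋m⦌), x ∈ A.obj _ ↔ Q (M.toList x)) {l : List P} (h₀ : l ≠ [])
    (h : l.Pairwise (· ≤ ·)) : M.Mem A l ↔ Q l := by
  obtain ⟨m, hm⟩ := Nat.exists_eq_succ_of_ne_zero (mt List.length_eq_zero_iff.1 h₀)
  obtain ⟨x, rfl⟩ := M.exists_toList_eq hm h
  rw [mem_iff rfl, hQ]

end SSet.VertexModel

namespace SSet.coherentIso

open VertexModel

/-- The vertices of the product of a simplex and the walking isomorphism. -/
abbrev ProdVertex (n : ℕ) : Type := Fin (n + 1) × Vertex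

/-- The simplices of the product of a simplex and the walking isomorphism. -/
def prodModel (n : ℕ) : VertexModel (Δ[n] ⊗ coherentIso.{u}) (ProdVertex n) :=
  (stdSimplex.vertexModel n).prod vertexModel

/-- The vertex `x₀` and its degeneracies. -/
def base : coherentIso.{u}.Subcomplex := vertexModel.full {v₀}

/-- The subcomplex `∂Δ[n] ⊗ coherentIso ∪ Δ[n] ⊗ x₀`. -/
abbrev bottom (n : ℕ) : (Δ[n] ⊗ coherentIso.{u}).Subcomplex := Subcomplex.unionProd ∂Δ[n] base

/-- The chains of the subcomplex `bottom n`. -/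
def BottomList (n : ℕ) (l : List (ProdVertex n)) : Prop :=
  (∃ j, ∀ a ∈ l, a.1 ≠ j) ∨ ∀ a ∈ l, a.2 = v₀

lemma mem_bottom_iff {n m : ℕ} (x : (Δ[n] ⊗ coherentIso.{u} : SSet.{u}) _⦋m⦌) :
    x ∈ (bottom n).obj _ ↔ BottomList n ((prodModel n).toList x) := by
  have h1 := mem_full vertexModel (S := {v₀}) x.2
  have h2 := stdSimplex.mem_boundary_iff_toList x.1
  rw [← map_fst_toList_prod _ vertexModel] at h2
  rw [← map_snd_toList_prod (stdSimplex.vertexModel n)] at h1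
  refine (Subcomplex.mem_unionProd_iff ∂Δ[n] base _).trans ((or_comm.trans
    (or_congr h2 h1)).trans ?_)
  rw [List.forall_mem_map]
  simp only [List.mem_map, not_exists, not_and, Set.mem_singleton_iff]
  rfl

/-- The chains in `bottom n` and those which do not contain the vertex `(0, x₁)`. -/
def MiddleList (n : ℕ) (l : List (ProdVertex n)) : Prop :=
  BottomList n l ∨ ∀ a ∈ l, a.1 = 0 → a.2 = v₀

/-- The subcomplex of `Δ[n] ⊗ coherentIso` generated by `bottom n` and the simplices which do not
contain the vertex `(0, x₁)`. -/
def middle (n : ℕ) : (Δ[n] ⊗ coherentIso.{u}).Subcomplex :=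
  bottom n ⊔ (prodModel n).full {a | a.1 = 0 → a.2 = v₀}

lemma mem_middle_iff {n m : ℕ} (x : (Δ[n] ⊗ coherentIso.{u} : SSet.{u}) _⦋m⦌) :
    x ∈ (middle n).obj _ ↔ MiddleList n ((prodModel n).toList x) :=
  or_congr (mem_bottom_iff x) (mem_full _ x)

/-- Insertion of the vertex `(a, x₀)`, if `(a, x₁)` is the first vertex over `x₁`. -/
def newVertex {n : ℕ} (l : List (ProdVertex n)) : ProdVertex n :=
  -- The argument is the part of the chain beginning with its first vertex over `x₁`. The default
  -- value is immaterial, as a chain outside `bottom` contains such a vertex.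
  ((l.head?.map Prod.fst).getD 0, v₀)

lemma exists_of_not_bottomList {n : ℕ} {l : List (ProdVertex n)} (h : ¬ BottomList n l) :
    (∀ j, ∃ a ∈ l, a.1 = j) ∧ ∃ a ∈ l, a.2 = v₁ := by
  simp only [BottomList, not_or, not_exists, not_forall, not_not] at h
  obtain ⟨h1, a, ha, h2⟩ := h
  refine ⟨fun j => ?_, a, ha, (eq_v₀_or_v₁ _).resolve_left h2⟩
  obtain ⟨b, hb, hb'⟩ := h1 j
  exact ⟨b, hb, hb'⟩

/-- The inserted `(a, x₀)` is followed by `(a, x₁)`. Removing it therefore loses neither the value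
`a` nor the vertices over `x₁`, and the chain stays outside `bottom`. -/
lemma isEnd_bottom (n : ℕ) : Insertion.IsEnd (prodModel.{u} n) (bottom n)
    (fun a => decide (a.2 = v₀)) newVertex where
  pos {l} hl hl' := by
    obtain ⟨-, h2, -, h4⟩ := (good_iff mem_bottom_iff).1 hl
    obtain ⟨-, a, ha, hav⟩ := exists_of_not_bottomList h4
    refine ⟨by simp [newVertex], ?_⟩
    rw [← List.takeWhile_append_dropWhile (p := fun a : ProdVertex n => decide (a.2 = v₀)) (l := l),
      List.pairwise_append] at h2
    have h5 := List.mem_takeWhile_eq_true (q := fun a : ProdVertex n => decide (a.2 = v₀)) (l := l)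
    obtain ⟨b, l₂, hb⟩ : ∃ b l₂, l.dropWhile (fun a => decide (a.2 = v₀)) = b :: l₂ := by
      refine List.exists_cons_of_ne_nil (fun h => ?_)
      have h6 := List.takeWhile_append_dropWhile (p := fun a : ProdVertex n => decide (a.2 = v₀))
        (l := l)
      rw [h, List.append_nil] at h6
      rw [h6] at h5
      have := h5 a ha
      rw [hav] at this
      simp [v₀_ne_v₁.symm] at this
    rw [hb] at h2 ⊢
    refine ⟨fun c hc => ⟨(h2.2.2 c hc b (by simp)).1, vertex_le _ _⟩, fun c hc => ?_⟩
    refine ⟨?_, vertex_le _ _⟩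
    rcases List.mem_cons.1 hc with rfl | hc
    · exact le_rfl
    · exact (List.rel_of_pairwise_cons h2.2.1 hc).1
  erase {l₁ l₂} hl h₁ hV h₂ := by
    obtain ⟨-, h2, -, h4⟩ := (good_iff mem_bottom_iff).1 hl
    obtain ⟨h5, a, ha, hav⟩ := exists_of_not_bottomList h4
    have key : ¬ BottomList n (l₁ ++ l₂) := by
      have ha' : a ∈ l₁ ++ l₂ := by
        simp only [List.mem_append, List.mem_cons] at ha ⊢
        rcases ha with ha | rfl | ha
        · exact Or.inl ha
        · exact absurd hav v₀_ne_v₁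
        · exact Or.inr ha
      rintro (⟨j, hj⟩ | hj)
      · obtain ⟨b, hb, hbj⟩ := h5 j
        simp only [List.mem_append, List.mem_cons] at hb hj ha'
        rcases hb with hb | rfl | hb
        · exact hj b (Or.inl hb) hbj
        · obtain _ | ⟨c, l₂⟩ := l₂
          · rcases ha' with ha' | ha'
            · have := h₁ a ha'
              rw [hav] at this
              simp [v₀_ne_v₁.symm] at this
            · simp at ha'
          · exact hj c (Or.inr (by simp)) hbj
        · exact hj b (Or.inr hb) hbj
      · exact v₀_ne_v₁ ((hj a ha').symm.trans hav)
    refine ⟨fun h => ?_, fun m x hx => by rwa [mem_bottom_iff, hx]⟩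
    rw [h] at key
    exact key (Or.inr (by simp))

lemma exists_of_not_middleList {n : ℕ} {l : List (ProdVertex n)} (h : ¬ MiddleList n l) :
    (∀ j, ∃ a ∈ l, a.1 = j) ∧ (0, v₁) ∈ l := by
  simp only [MiddleList, not_or, not_forall] at h
  obtain ⟨h1, ⟨a, b⟩, ha, h2, h3⟩ := h
  obtain rfl := h2
  obtain rfl := (eq_v₀_or_v₁ _).resolve_left h3
  exact ⟨(exists_of_not_bottomList h1).1, ha⟩

lemma not_middleList {n : ℕ} {l : List (ProdVertex n)} (h : ∀ j, ∃ a ∈ l, a.1 = j)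
    (h' : (0, v₁) ∈ l) : ¬ MiddleList n l := by
  rintro ((⟨j, hj⟩ | h1) | h1)
  · obtain ⟨a, ha, haj⟩ := h j
    exact hj a ha haj
  · exact v₀_ne_v₁ (h1 _ h').symm
  · exact v₀_ne_v₁ (h1 _ h' rfl).symm

/-- A chain outside `middle` contains `(0, x₁)`, which still covers the vertex `0` after `(0, x₀)`
is removed. -/
lemma isEnd_middle (n : ℕ) : Insertion.IsEnd (prodModel.{u} n) (middle n)
    (fun a => decide (a.1 = 0)) (fun _ => (0, v₀)) where
  pos {l} hl hl' := by
    refine ⟨by simp, fun a ha => ⟨?_, vertex_le _ _⟩, fun a ha => ⟨Fin.zero_le _, vertex_le _ _⟩⟩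
    have := List.mem_takeWhile_eq_true a ha
    simp only [decide_eq_true_eq] at this
    exact this.le
  erase {l₁ l₂} hl h₁ hV h₂ := by
    obtain ⟨-, h2, -, h4⟩ := (good_iff mem_middle_iff).1 hl
    obtain ⟨h5, ha⟩ := exists_of_not_middleList h4
    have ha' : (0, v₁) ∈ l₁ ++ l₂ := by
      simp only [List.mem_append, List.mem_cons] at ha ⊢
      rcases ha with ha | ha | ha
      · exact Or.inl ha
      · exact absurd (congrArg Prod.snd ha) v₀_ne_v₁.symm
      · exact Or.inr ha
    refine ⟨List.ne_nil_of_mem ha', fun m x hx => ?_⟩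
    rw [mem_middle_iff, hx]
    refine not_middleList (fun j => ?_) ha'
    obtain ⟨b, hb, hbj⟩ := h5 j
    simp only [List.mem_append, List.mem_cons] at hb
    rcases hb with hb | rfl | hb
    · exact ⟨b, List.mem_append_left _ hb, hbj⟩
    · exact ⟨_, ha', hbj⟩
    · exact ⟨b, List.mem_append_right _ hb, hbj⟩

/-- The inserted vertex lies over `x₀`, so no vertex `(0, x₁)` is created. Hence the two procedures
can be performed one after the other. -/
lemma mem_middle_ins {n : ℕ} (l : List (ProdVertex n)) (hl : (prodModel.{u} n).Good (bottom n) l)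
    (h : (Insertion.final _ _ _ _ (isEnd_bottom.{u} n)).small l)
    (h' : (prodModel.{u} n).Mem (middle n) l) :
    (prodModel.{u} n).Mem (middle n) ((Insertion.final _ _ _ _ (isEnd_bottom.{u} n)).ins l) := by
  have h1 := (good_iff mem_bottom_iff).1 hl
  rw [mem_iff_of_mem_iff mem_middle_iff h1.1 h1.2.1] at h'
  refine (mem_iff_of_mem_iff mem_middle_iff (by simp)
    (Insertion.pairwise _ hl h)).2 ?_
  refine Or.inr (fun a ha ha0 => ?_)
  rcases List.mem_append.1 ha with ha | ha
  · exact h'.resolve_left h1.2.2.2 a ((List.takeWhile_sublist _).mem ha) ha0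
  · rcases List.mem_cons.1 ha with rfl | ha
    · rfl
    · exact h'.resolve_left h1.2.2.2 a ((List.dropWhile_sublist _).mem ha) ha0

/-- The insertion procedure for the inclusion of `bottom n`. -/
noncomputable def insertion (n : ℕ) : Insertion (prodModel.{u} n) (bottom n) :=
  Insertion.sum (Insertion.final _ _ _ _ (isEnd_bottom.{u} n))
    (Insertion.final _ _ _ _ (isEnd_middle.{u} n)) le_sup_left mem_middle_ins
    (fun _ => (List.dropWhile_sublist _).length_le)

lemma insertion_of_mem {n : ℕ} {l : List (ProdVertex n)}
    (hl : (prodModel.{u} n).Mem (middle n) l) :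
    (insertion.{u} n).fst l = l.takeWhile (fun a => decide (a.2 = v₀)) ∧
    (insertion.{u} n).snd l = l.dropWhile (fun a => decide (a.2 = v₀)) ∧
    (insertion.{u} n).v l = newVertex (l.dropWhile (fun a => decide (a.2 = v₀))) ∧
    ((insertion.{u} n).small l ↔ (l.takeWhile (fun a => decide (a.2 = v₀))).getLast? ≠
      some (newVertex (l.dropWhile (fun a => decide (a.2 = v₀))))) :=
  Insertion.sum_of_mem _ _ _ _ _ hl

lemma insertion_of_not_mem {n : ℕ} {l : List (ProdVertex n)}
    (hl : ¬ (prodModel.{u} n).Mem (middle n) l) :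
    (insertion.{u} n).fst l = l.takeWhile (fun a => decide (a.1 = 0)) ∧
    (insertion.{u} n).snd l = l.dropWhile (fun a => decide (a.1 = 0)) ∧
    (insertion.{u} n).v l = (0, v₀) ∧
    ((insertion.{u} n).small l ↔ (l.takeWhile (fun a => decide (a.1 = 0))).getLast? ≠
      some (0, v₀)) :=
  Insertion.sum_of_not_mem _ _ _ _ _ hl

end SSet.coherentIso

/-! ### Lifting from the bottom of the cylinder on a simplex. -/

namespace ScaledSSet

open SSet.coherentIso VertexModel

variable {E B : ScaledSSet.{u}} {p : E ⟶ B}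

/-- All horns are inner. In `middle` the special triangle is `(c, x₀), (a, x₀), (a, x₁)`, afterwards
it is `(0, x₁), (0, x₀), (b, y)`; both are degenerate in the direction of `Δ[n]`, hence have to be
thin. The assumption `n ≠ 0` provides a vertex `b ≠ 0` after those over `0`. The other triangles
with degenerate projection are not filled as special triangles, and their thinness follows by
saturation. -/
lemma exists_lift_bottom (hp : LiftsInner p) (hs : HasLiftingProperty saturationMap p) {n : ℕ}
    (hn : n ≠ 0) (f : (bottom.{u} n : SSet.{u}) ⟶ E.toSSet) (g : Δ[n] ⊗ coherentIso ⟶ B.toSSet)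
    (w : f ≫ p.toHom = (bottom n).ι ≫ g)
    (hf : ∀ (t : (Δ[n] ⊗ coherentIso.{u} : SSet.{u}) _⦋2⦌) (ht : t ∈ (bottom n).obj _),
      t.1 ∈ (Δ[n] : SSet.{u}).degenerate 2 → f.app _ ⟨t, ht⟩ ∈ E.thin)
    (hg : ∀ t : (Δ[n] ⊗ coherentIso.{u} : SSet.{u}) _⦋2⦌,
      t.1 ∈ (Δ[n] : SSet.{u}).degenerate 2 → g.app _ t ∈ B.thin) :
    ∃ L : Δ[n] ⊗ coherentIso ⟶ E.toSSet, (bottom n).ι ≫ L = f ∧ L ≫ p.toHom = g ∧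
      ∀ t : (Δ[n] ⊗ coherentIso.{u} : SSet.{u}) _⦋2⦌,
        t.1 ∈ (Δ[n] : SSet.{u}).degenerate 2 → L.app _ t ∈ E.thin := by
  have hdeg : ∀ (t : (Δ[n] ⊗ coherentIso.{u} : SSet.{u}) _⦋2⦌) (a b c : ProdVertex n),
      (prodModel n).toList t = [a, b, c] →
      (t.1 ∈ (Δ[n] : SSet.{u}).degenerate 2 ↔ a.1 = b.1 ∨ b.1 = c.1) := fun _ _ _ _ =>
    VertexModel.fst_mem_degenerate_iff _ _
  have base : ∀ a b c : ProdVertex n, a.1 = b.1 ∨ b.1 = c.1 →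
      ThinAt (prodModel n) g a b c := fun a b c h t ht => hg t ((hdeg t a b c ht).2 h)
  have given : ∀ a b c : ProdVertex n, a.1 = b.1 ∨ b.1 = c.1 →
      ThinOn (prodModel n) f a b c := fun a b c h t ht' ht => hf t ht' ((hdeg t a b c ht).2 h)
  -- Unless it is already in `bottom`, this triangle is filled by inserting `(a, v₀)` in the edge
  -- from `(c, v₀)` to `(a, v₁)`; `big₂` is the analogue for the second procedure.
  have big₁ : ∀ (t : (Δ[n] ⊗ coherentIso.{u} : SSet.{u}) _⦋2⦌) (a c : Fin (n + 1)), c < a →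
      (prodModel n).toList t = [(c, v₀), (a, v₀), (a, v₁)] → t ∈ (bottom n).obj _ ∨
      ∃ l, (prodModel n).Good (bottom n) l ∧ (insertion n).small l ∧
        [(c, v₀), (a, v₀), (a, v₁)] = (insertion n).ins l := by
    intro t a c hca ht
    by_cases htA : t ∈ (bottom n).obj _
    · exact Or.inl htA
    rw [mem_bottom_iff, ht] at htA
    have h1 : ¬ BottomList n [(c, v₀), (a, v₁)] := by
      simpa [BottomList] using htA
    have h2 : (prodModel n).Good (bottom n) [(c, v₀), (a, v₁)] := by
      rw [good_iff mem_bottom_iff]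
      refine ⟨by simp, ?_, ?_, h1⟩
      · simpa using ⟨hca.le, vertex_le _ _⟩
      · simpa using fun h => absurd h hca.ne
    have h3 : (prodModel n).Mem (middle n) [(c, v₀), (a, v₁)] := by
      rw [mem_iff_of_mem_iff mem_middle_iff (by simp) h2.pairwise]
      refine Or.inr ?_
      simpa using fun h => absurd h (Fin.zero_le c |>.trans_lt hca).ne'
    obtain ⟨h4, h5, h6, h7⟩ := insertion_of_mem h3
    refine Or.inr ⟨_, h2, h7.2 ?_, ?_⟩
    · simpa [List.takeWhile_cons, List.dropWhile_cons, newVertex, v₀_ne_v₁.symm] using hca.ne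
    · rw [Insertion.ins, h4, h5, h6]
      simp [newVertex, v₀_ne_v₁.symm]
  have big₂ : ∀ (t : (Δ[n] ⊗ coherentIso.{u} : SSet.{u}) _⦋2⦌) (b : Fin (n + 1)) (y : Vertex),
      b ≠ 0 →
      (prodModel n).toList t = [(0, v₁), (0, v₀), (b, y)] → t ∈ (bottom n).obj _ ∨
      ∃ l, (prodModel n).Good (bottom n) l ∧ (insertion n).small l ∧
        [(0, v₁), (0, v₀), (b, y)] = (insertion n).ins l := by
    intro t b y hb ht
    by_cases htA : t ∈ (bottom n).obj _
    · exact Or.inl htA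
    rw [mem_bottom_iff, ht] at htA
    have h1 : ¬ MiddleList n [(0, v₁), (b, y)] := by
      refine not_middleList (fun j => ?_) (by simp)
      obtain ⟨a, ha, rfl⟩ := (exists_of_not_bottomList htA).1 j
      simp only [List.mem_cons, List.not_mem_nil, or_false] at ha
      rcases ha with rfl | rfl | rfl
      · simp
      · simp
      · simp
    have h2 : (prodModel n).Good (middle n) [(0, v₁), (b, y)] := by
      rw [good_iff mem_middle_iff]
      refine ⟨by simp, ?_, ?_, h1⟩
      · simpa using vertex_le _ _
      · simpa using fun h => absurd h.symm hb
    obtain ⟨h4, h5, h6, h7⟩ := insertion_of_not_mem h2.not_mem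
    refine Or.inr ⟨_, h2.of_le le_sup_left, h7.2 ?_, ?_⟩
    · simpa [List.takeWhile_cons, List.dropWhile_cons, hb] using v₀_ne_v₁.symm
    · rw [Insertion.ins, h4, h5, h6]
      simp [hb]
  obtain ⟨L, h1, h2, h3⟩ := (insertion n).exists_scaled_lift hp w (by
    intro l hl hl'
    obtain ⟨g1, g2, g3, g4⟩ := (good_iff mem_bottom_iff).1 hl
    have hsurj := (exists_of_not_bottomList g4).1
    obtain ⟨d, hd, hdv⟩ := (exists_of_not_bottomList g4).2
    refine Or.inl ?_
    by_cases hm : (prodModel n).Mem (middle n) l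
    · obtain ⟨h4, h5, h6, h7⟩ := insertion_of_mem hm
      rw [mem_iff_of_mem_iff mem_middle_iff g1 g2] at hm
      replace hm := hm.resolve_left g4
      rw [h7] at hl'
      rw [h4, h5, h6]
      have e1 := List.mem_takeWhile_eq_true (q := fun a : ProdVertex n => decide (a.2 = v₀)) (l := l)
      have e2 := List.head?_dropWhile_eq_false (fun a : ProdVertex n => decide (a.2 = v₀)) l
      have e3 := List.takeWhile_append_dropWhile (p := fun a : ProdVertex n => decide (a.2 = v₀))
        (l := l)
      generalize l.takeWhile (fun a : ProdVertex n => decide (a.2 = v₀)) = l₁,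
        l.dropWhile (fun a : ProdVertex n => decide (a.2 = v₀)) = l₂ at *
      subst e3
      obtain _ | ⟨⟨a, e⟩, l₂⟩ := l₂
      · have := e1 d (by simpa using hd)
        rw [hdv] at this
        simp [v₀_ne_v₁.symm] at this
      obtain rfl : e = v₁ := (eq_v₀_or_v₁ e).resolve_left (by simpa using e2)
      obtain rfl | ⟨l₁, ⟨c, e⟩, rfl⟩ := List.eq_nil_or_concat' l₁
      -- If there were no initial vertex over `v₀`, the first vertex would be `(0, v₁)`, which is
      -- excluded in `middle`. So the horn is inner.
      · obtain ⟨b, hb, hb0⟩ := hsurj 0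
        refine absurd (hm (a, v₁) (by simp) ?_) v₀_ne_v₁.symm
        rw [List.nil_append] at hb g2
        rcases List.mem_cons.1 hb with rfl | hb
        · exact hb0
        · exact Fin.le_zero_iff.1 (hb0 ▸ (List.rel_of_pairwise_cons g2 hb).1)
      obtain rfl : e = v₀ := by simpa using e1 (c, e) (by simp)
      have hca : c < a := by
        refine lt_of_le_of_ne ((List.pairwise_append.1 g2).2.2 (c, v₀) (by simp) (a, v₁)
          (by simp)).1 ?_
        simpa [newVertex] using hl'
      refine ⟨l₁, (c, v₀), (a, v₁), l₂, rfl, rfl, ?_, ?_, ?_⟩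
      · exact base _ _ _ (Or.inr rfl)
      · exact given _ _ _ (Or.inr rfl)
      · exact fun t ht => big₁ t a c hca ht
    · obtain ⟨h4, h5, h6, h7⟩ := insertion_of_not_mem hm
      rw [mem_iff_of_mem_iff mem_middle_iff g1 g2] at hm
      obtain ⟨-, hd⟩ := exists_of_not_middleList hm
      rw [h7] at hl'
      rw [h4, h5, h6]
      have e1 := List.mem_takeWhile_eq_true (q := fun a : ProdVertex n => decide (a.1 = 0)) (l := l)
      have e2 := List.head?_dropWhile_eq_false (fun a : ProdVertex n => decide (a.1 = 0)) l
      have e3 := List.takeWhile_append_dropWhile (p := fun a : ProdVertex n => decide (a.1 = 0))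
        (l := l)
      generalize l.takeWhile (fun a : ProdVertex n => decide (a.1 = 0)) = l₁,
        l.dropWhile (fun a : ProdVertex n => decide (a.1 = 0)) = l₂ at *
      subst e3
      obtain _ | ⟨⟨b, y⟩, l₂⟩ := l₂
      · obtain ⟨c, hc, hc'⟩ := hsurj (Fin.last n)
        have := e1 c (by simpa using hc)
        rw [hc'] at this
        simp only [decide_eq_true_eq, Fin.ext_iff, Fin.val_last, Fin.val_zero] at this
        exact absurd this hn
      have hb : b ≠ 0 := by simpa using e2
      obtain rfl | ⟨l₁, ⟨c, e⟩, rfl⟩ := List.eq_nil_or_concat' l₁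
      · refine absurd ?_ hb
        rw [List.nil_append] at hd g2
        rcases List.mem_cons.1 hd with hd | hd
        · exact (congrArg Prod.fst hd).symm
        · exact Fin.le_zero_iff.1 (List.rel_of_pairwise_cons g2 hd).1
      obtain rfl : c = 0 := by simpa using e1 (c, e) (by simp)
      obtain rfl : e = v₁ := (eq_v₀_or_v₁ e).resolve_left (by simpa using hl')
      refine ⟨l₁, (0, v₁), (b, y), l₂, rfl, rfl, ?_, ?_, ?_⟩
      · exact base _ _ _ (Or.inl rfl)
      · exact given _ _ _ (Or.inl rfl)
      · exact fun t ht => big₂ t b y hb ht)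
  refine ⟨L, h1, h2, ?_⟩
  subst h2
  have inA : ∀ (t : (Δ[n] ⊗ coherentIso.{u} : SSet.{u}) _⦋2⦌),
      t.1 ∈ (Δ[n] : SSet.{u}).degenerate 2 → t ∈ (bottom n).obj _ → L.app _ t ∈ E.thin := by
    intro t ht htA
    have := hf t htA ht
    rw [← h1] at this
    exact this
  -- Triangles over a single vertex of `Δ[n]` lie over its boundary, since `n ≠ 0`.
  have const : ∀ (a : Fin (n + 1)) (x y z : Vertex),
      ThinAt (prodModel n) L (a, x) (a, y) (a, z) := by
    intro a x y z t ht
    refine inA t ((hdeg t _ _ _ ht).2 (Or.inl rfl)) ?_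
    rw [mem_bottom_iff, ht]
    have : Nontrivial (Fin (n + 1)) := Fin.nontrivial_iff_two_le.2 (by lia)
    obtain ⟨j, hj⟩ := exists_ne a
    exact Or.inl ⟨j, by simpa using hj.symm⟩
  have t₁ : ∀ (b : Fin (n + 1)) (y : Vertex), b ≠ 0 →
      ThinAt (prodModel n) L (0, v₁) (0, v₀) (b, y) := by
    intro b y hb t ht
    rcases big₂ t b y hb ht with h | ⟨l, h4, h5, h6⟩
    · exact inA t ((hdeg t _ _ _ ht).2 (Or.inl rfl)) h
    · exact h3 t ⟨l, h4, h5, ht.trans h6⟩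
  have t₂ : ∀ (b : Fin (n + 1)), b ≠ 0 →
      ThinAt (prodModel n) L (0, v₀) (b, v₀) (b, v₁) := by
    intro b hb t ht
    rcases big₁ t b 0 (Fin.pos_iff_ne_zero.2 hb) ht with h | ⟨l, h4, h5, h6⟩
    · exact inA t ((hdeg t _ _ _ ht).2 (Or.inr rfl)) h
    · exact h3 t ⟨l, h4, h5, ht.trans h6⟩
  have le : ∀ {a b : Fin (n + 1)} (h : a ≤ b) (x y : Vertex), (a, x) ≤ (b, y) :=
    fun h x y => ⟨h, vertex_le x y⟩
  have t₃ : ∀ (b : Fin (n + 1)) (x y z : Vertex), b ≠ 0 →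
      ThinAt (prodModel n) L (0, x) (0, y) (b, z) := by
    intro b x y z hb
    rcases eq_v₀_or_v₁ x with rfl | rfl <;> rcases eq_v₀_or_v₁ y with rfl | rfl
    · exact thinAt_left _ _ _
    · exact thinAt_inner_right hs (c := (0, v₀)) (le le_rfl _ _) (le le_rfl _ _)
        (le (Fin.zero_le _) _ _) (t₁ b z hb) (thinAt_left _ _ _) (const _ _ _ _)
        (base _ _ _ (Or.inl rfl))
    · exact t₁ b z hb
    · exact thinAt_left _ _ _
  have t₄ : ∀ (b : Fin (n + 1)) (y z : Vertex), b ≠ 0 →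
      ThinAt (prodModel n) L (0, v₀) (b, y) (b, z) := by
    intro b y z hb
    rcases eq_v₀_or_v₁ y with rfl | rfl <;> rcases eq_v₀_or_v₁ z with rfl | rfl
    · exact thinAt_right _ _ _
    · exact t₂ b hb
    · exact thinAt_inner_left hs (b := (b, v₀)) (le (Fin.zero_le _) _ _) (le le_rfl _ _)
        (le le_rfl _ _) (const _ _ _ _) (thinAt_right _ _ _) (t₂ b hb)
        (base _ _ _ (Or.inr rfl))
    · exact thinAt_right _ _ _
  have t₅ : ∀ (b : Fin (n + 1)) (x y z : Vertex), b ≠ 0 →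
      ThinAt (prodModel n) L (0, x) (b, y) (b, z) := by
    intro b x y z hb
    exact thinAt_inner_left hs (b := (0, v₀)) (le le_rfl _ _) (le (Fin.zero_le _) _ _)
      (le le_rfl _ _) (t₄ b y z hb) (t₃ b _ _ _ hb) (t₃ b _ _ _ hb) (base _ _ _ (Or.inr rfl))
  -- A triangle outside `bottom` meets both `0` and `n`; if its projection is degenerate, it lies
  -- over the edge `0 n` and is covered by `t₃` or `t₅`.
  intro t ht
  by_cases htA : t ∈ (bottom n).obj _
  · exact inA t ht htA
  obtain ⟨a, b, c, habc⟩ : ∃ a b c, (prodModel n).toList t = [a, b, c] := ⟨_, _, _, rfl⟩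
  obtain ⟨hab, hbc⟩ := (prodModel n).le_of_toList_eq habc
  rw [mem_bottom_iff, habc] at htA
  have hsurj := (exists_of_not_bottomList htA).1
  have ha : a.1 = 0 := by
    obtain ⟨d, hd, hd0⟩ := hsurj 0
    rw [← Fin.le_zero_iff, ← hd0]
    simp only [List.mem_cons, List.not_mem_nil, or_false] at hd
    rcases hd with rfl | rfl | rfl
    · exact le_rfl
    · exact hab.1
    · exact hab.1.trans hbc.1
  have hc : c.1 ≠ 0 := by
    intro hc
    obtain ⟨d, hd, hd0⟩ := hsurj (Fin.last n)
    have : d.1 ≤ 0 := by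
      rw [← hc]
      simp only [List.mem_cons, List.not_mem_nil, or_false] at hd
      rcases hd with rfl | rfl | rfl
      · exact hab.1.trans hbc.1
      · exact hbc.1
      · exact le_rfl
    rw [hd0, Fin.le_def] at this
    simp at this
    exact hn this
  obtain ⟨a, x⟩ := a
  obtain ⟨b, y⟩ := b
  obtain ⟨c, z⟩ := c
  obtain rfl : a = 0 := ha
  rcases (hdeg t _ _ _ habc).1 ht with h | h
  · obtain rfl : 0 = b := h
    exact t₃ _ _ _ _ hc _ habc
  · obtain rfl : b = c := h
    exact t₅ _ _ _ _ hc _ habc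

end ScaledSSet

/-! ### The homotopy lifting property. -/

namespace SSet

lemma Subcomplex.exists_desc_unionProd {X Y Z : SSet.{u}} (S : X.Subcomplex) (T : Y.Subcomplex)
    (f : (S : SSet.{u}) ⊗ Y ⟶ Z) (g : X ⊗ (T : SSet.{u}) ⟶ Z)
    (h : ∀ k (x : X.obj k) (y : Y.obj k) (hx : x ∈ S.obj k) (hy : y ∈ T.obj k),
      f.app k (⟨x, hx⟩, y) = g.app k (x, ⟨y, hy⟩)) :
    ∃ φ : (S.unionProd T : SSet.{u}) ⟶ Z,
      (∀ k (x : (X ⊗ Y : SSet.{u}).obj k) (hx : x ∈ (S.unionProd T).obj k) (hx' : x.1 ∈ S.obj k),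
        φ.app k ⟨x, hx⟩ = f.app k (⟨x.1, hx'⟩, x.2)) ∧
      (∀ k (x : (X ⊗ Y : SSet.{u}).obj k) (hx : x ∈ (S.unionProd T).obj k) (hx' : x.2 ∈ T.obj k),
        φ.app k ⟨x, hx⟩ = g.app k (x.1, ⟨x.2, hx'⟩)) := by
  obtain ⟨φ, h₁, h₂⟩ := exists_desc_sup ((⊤ : X.Subcomplex).prod T) (S.prod ⊤)
    { app k := TypeCat.ofHom (fun x => g.app k
        (show (X ⊗ (T : SSet.{u})).obj k from (x.1.1, ⟨x.1.2, x.2.2⟩)))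
      naturality k k' α := by
        ext x
        exact NatTrans.naturality_apply g α
          (show (X ⊗ (T : SSet.{u})).obj k from (x.1.1, ⟨x.1.2, x.2.2⟩)) }
    { app k := TypeCat.ofHom (fun x => f.app k
        (show ((S : SSet.{u}) ⊗ Y).obj k from (⟨x.1.1, x.2.1⟩, x.1.2)))
      naturality k k' α := by
        ext x
        exact NatTrans.naturality_apply f α
          (show ((S : SSet.{u}) ⊗ Y).obj k from (⟨x.1.1, x.2.1⟩, x.1.2)) }
    (fun k x h₁ h₂ => (h k x.1 x.2 h₂.1 h₁.2).symm)
  exact ⟨φ, fun k x hx hx' => h₂ k x ⟨hx', trivial⟩, fun k x hx hx' => h₁ k x ⟨trivial, hx'⟩⟩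

end SSet

namespace ScaledSSet

open SSet.coherentIso VertexModel CategoryTheory.Limits

/-- The scaled simplicial set in which only the degenerate triangles are thin. -/
def flatten (K : SSet.{u}) : ScaledSSet.{u} where
  toSSet := K
  thin := K.degenerate 2
  degenerate_subset_thin := subset_rfl

/-- Maps from a scaled simplicial set in which only the degenerate triangles are thin. -/
def flattenHom {K : SSet.{u}} {C : ScaledSSet.{u}} (f : K ⟶ C.toSSet) : flatten K ⟶ C where
  toHom := f
  map_thin _ ht := thin_of_degenerate f ht

variable {E B C L : ScaledSSet.{u}} {p : E ⟶ B}

/-- The inclusion of the base in the cylinder. -/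
noncomputable def tensorι₀ (X : ScaledSSet.{u}) : X ⟶ X.tensor coherentIso := X.cylinderι x₀

lemma eq_of_mem_base {k : SimplexCategoryᵒᵖ} {y : coherentIso.{u}.obj k} (hy : y ∈ base.obj k)
    {X : SSet.{u}} (x : X.obj k) : y = (SSet.const (X := X) x₀).app k x := by
  obtain ⟨k⟩ := k
  induction k using SimplexCategory.rec with | _ k
  apply vertexModel.toList_injective
  rw [base, mem_full] at hy
  have h2 : ∀ a ∈ vertexModel.toList ((SSet.const (X := X) (x₀.{u})).app (op ⦋k⦌) x), a = v₀ := by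
    simp only [toList, List.mem_ofFn', Set.forall_mem_range]
    intro i
    rfl
  rw [List.eq_replicate_of_mem hy, List.eq_replicate_of_mem h2, length_toList, length_toList]

lemma const_mem_base {k : SimplexCategoryᵒᵖ} {X : SSet.{u}} (x : X.obj k) :
    (SSet.const (X := X) x₀).app k x ∈ base.{u}.obj k := by
  obtain ⟨k⟩ := k
  induction k using SimplexCategory.rec with | _ k
  rw [base, mem_full]
  simp only [toList, List.mem_ofFn', Set.forall_mem_range]
  intro i
  rfl

/-- Evaluation at `x₀`. -/
noncomputable def evalCotensor (C : ScaledSSet.{u}) : C.cotensor coherentIso ⟶ C :=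
  tensorι₀ _ ≫ ofCotensor (𝟙 _)

/-- The lifting of maps from cells along an isofibration. -/
lemma IsIsofibration.exists_lift_boundary (hp : IsIsofibration p) (n : ℕ)
    (f : (flatten (∂Δ[n] : SSet.{u})).tensor coherentIso ⟶ E) (b : flatten Δ[n] ⟶ E)
    (v : (flatten Δ[n]).tensor coherentIso ⟶ B)
    (hfb : tensorι₀ _ ≫ f = flattenHom ∂Δ[n].ι ≫ b)
    (hfv : f ≫ p = tensorMap (flattenHom ∂Δ[n].ι) (𝟙 _) ≫ v)
    (hbv : b ≫ p = tensorι₀ _ ≫ v) :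
    ∃ H : (flatten Δ[n]).tensor coherentIso ⟶ E,
      tensorMap (flattenHom ∂Δ[n].ι) (𝟙 _) ≫ H = f ∧ tensorι₀ _ ≫ H = b ∧ H ≫ p = v := by
  -- For `n = 0` the boundary is empty, and the problem is the lifting property for `x₀` in the
  -- walking isomorphism. The other cases need only inner horns and saturation.
  obtain rfl | hn := eq_or_ne n 0
  · have hb0 : ∀ k, (∂Δ[0] : SSet.{u}).obj k → False := fun k x =>
      (congrArg (fun z => x.1 ∈ z.obj k) (boundary_zero.{u})).mp x.2
    have h0 : ∀ {k} (x y : (Δ[0] : SSet.{u}).obj k), x = y := by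
      intro k x y
      obtain ⟨k⟩ := k
      induction k using SimplexCategory.rec with | _ k
      apply (stdSimplex.vertexModel 0).toList_injective
      apply List.ext_get
      · simp
      · intros
        exact Subsingleton.elim (α := Fin 1) _ _
    have hx₀ : x₀.{u} ∈ base.obj _ := (mem_full _ _).2 (by simp [toList_x₀])
    obtain ⟨l, h₁, h₂, h₃⟩ := hp.liftsCoherentIso (b.toHom.app _ (topSimplex (op ⦋0⦌)))
      (CartesianMonoidalCategory.lift (SSet.const (topSimplex (op ⦋0⦌))) (𝟙 _) ≫ v.toHom)
      (fun t => v.map_thin _ ((mem_degenerate_or_eq (by lia) _).resolve_right (by simp))) (by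
        refine Eq.trans ?_ (congrArg (fun z => (Hom.toHom z).app _ (topSimplex (op ⦋0⦌))) hbv).symm
        exact congrArg (v.toHom.app _) (Prod.ext (h0 _ _)
          (eq_of_mem_base hx₀ (X := Δ[0]) (topSimplex (op ⦋0⦌)))))
    refine ⟨⟨CartesianMonoidalCategory.snd _ _ ≫ l, fun t _ => h₁ t.2⟩, ?_, ?_, ?_⟩
    · exact hom_ext_app (fun k x => (hb0 k x.1).elim)
    · refine hom_ext_app (fun k x => ?_)
      obtain ⟨f, -, rfl⟩ := exists_eq_map_topSimplex (k := ⦋0⦌) x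
      refine Eq.trans ?_ ((congrArg (E.toSSet.map f) h₂).trans
        (NatTrans.naturality_apply b.toHom f (topSimplex (op ⦋0⦌))).symm)
      refine Eq.trans ?_ (NatTrans.naturality_apply l f x₀)
      exact congrArg (l.app k) (eq_of_mem_base (base.map f hx₀) (X := Δ[0])
        ((Δ[0] : SSet.{u}).map f (topSimplex (op ⦋0⦌)))).symm
    · refine hom_ext_app (fun k x => ?_)
      refine (congrArg (fun z => z.app k x.2) h₃).trans ?_
      exact congrArg (v.toHom.app k) (Prod.ext (h0 _ _) rfl)
  · obtain ⟨φ, h₁, h₂⟩ := Subcomplex.exists_desc_unionProd ∂Δ[n] base f.toHom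
      (CartesianMonoidalCategory.fst _ _ ≫ b.toHom) (by
        intro k x y hx hy
        have h := congrArg (fun z => (Hom.toHom z).app k
          (show (flatten (∂Δ[n] : SSet.{u})).toSSet.obj k from ⟨x, hx⟩)) hfb
        refine Eq.trans ?_ h
        exact congrArg (fun z => f.toHom.app k (show
          ((flatten (∂Δ[n] : SSet.{u})).tensor coherentIso).toSSet.obj k from (⟨x, hx⟩, z)))
          (eq_of_mem_base hy (X := (∂Δ[n] : SSet.{u})) ⟨x, hx⟩))
    have key : ∀ k (x : ((flatten Δ[n]).tensor coherentIso).toSSet.obj k)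
        (hx : x ∈ (bottom n).obj k), p.toHom.app k (φ.app k ⟨x, hx⟩) = v.toHom.app k x := by
      intro k x hx
      rcases (Subcomplex.mem_unionProd_iff ∂Δ[n] base _).1 hx with h | h
      · refine (congrArg (p.toHom.app k) (h₂ k x hx h)).trans ?_
        refine (congrArg (fun z => (Hom.toHom z).app k x.1) hbv).trans ?_
        exact congrArg (fun z => v.toHom.app k (x.1, z)) (eq_of_mem_base h x.1).symm
      · refine (congrArg (p.toHom.app k) (h₁ k x hx h)).trans ?_
        exact congrArg (fun z => (Hom.toHom z).app k
          (show ((flatten (∂Δ[n] : SSet.{u})).tensor coherentIso).toSSet.obj k from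
            (⟨x.1, h⟩, x.2))) hfv
    obtain ⟨H, h₃, h₄, h₅⟩ := exists_lift_bottom hp.liftsInner hp.saturation hn φ v.toHom (by
        ext k x
        exact key k x.1 x.2) (by
        intro t ht htd
        rcases (Subcomplex.mem_unionProd_iff ∂Δ[n] base _).1 ht with h | h
        · refine (congrArg (· ∈ E.thin) (h₂ _ t ht h)).mpr ?_
          exact b.map_thin _ htd
        · refine (congrArg (· ∈ E.thin) (h₁ _ t ht h)).mpr ?_
          exact f.map_thin _ ((Subcomplex.mem_degenerate_iff _ _).2 htd)) (fun t ht => v.map_thin t ht)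
    refine ⟨⟨H, fun t ht => h₅ t ht⟩, ?_, ?_, Hom.ext h₄⟩
    · refine hom_ext_app (fun k x => ?_)
      have hx : ((x.1.1, x.2) : ((flatten Δ[n]).tensor coherentIso).toSSet.obj k) ∈
        (bottom n).obj k := Or.inr ⟨x.1.2, trivial⟩
      refine (congrArg (fun z => z.app k ⟨_, hx⟩) h₃).trans ?_
      exact h₁ k _ hx x.1.2
    · refine hom_ext_app (fun k x => ?_)
      have hx : (tensorι₀ (flatten Δ[n])).toHom.app k x ∈ (bottom n).obj k :=
        Or.inl ⟨trivial, const_mem_base (X := Δ[n]) x⟩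
      refine (congrArg (fun z => z.app k ⟨_, hx⟩) h₃).trans ?_
      exact h₂ k _ hx (const_mem_base (X := Δ[n]) x)

/-- The map comparing the lifting of cylinders with its base. -/
noncomputable def gap (p : E ⟶ B) : (E.cotensor coherentIso).toSSet ⟶
    pullback (evalCotensor B).toHom p.toHom :=
  pullback.lift (cotensorMap p coherentIso).toHom (evalCotensor E).toHom rfl

lemma gap_fst (p : E ⟶ B) : gap p ≫ pullback.fst _ _ = (cotensorMap p coherentIso).toHom :=
  pullback.lift_fst _ _ _

lemma gap_snd (p : E ⟶ B) : gap p ≫ pullback.snd _ _ = (evalCotensor E).toHom :=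
  pullback.lift_snd _ _ _

/-- By adjunction, boundary problems for `gap p` are the problems of `exists_lift_boundary`, and
boundary inclusions suffice for all monomorphisms. The scaling of the source is ignored here and is
recovered by `thin_of_thin_base`. -/
lemma IsIsofibration.rlp_gap (hp : IsIsofibration p) :
    (MorphismProperty.monomorphisms SSet.{u}).rlp (gap p) := by
  rw [rlp_monomorphisms]
  rintro _ _ _ ⟨n⟩
  refine ⟨fun {f g} sq => ?_⟩
  have w₁ : f ≫ (cotensorMap p coherentIso).toHom = ∂Δ[n].ι ≫ g ≫ pullback.fst _ _ := by
    rw [← gap_fst, ← Category.assoc, sq.w, Category.assoc]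
  have w₂ : f ≫ (evalCotensor E).toHom = ∂Δ[n].ι ≫ g ≫ pullback.snd _ _ := by
    rw [← gap_snd, ← Category.assoc, sq.w, Category.assoc]
  have w₃ : (g ≫ pullback.fst _ _) ≫ (evalCotensor B).toHom = (g ≫ pullback.snd _ _) ≫ p.toHom := by
    simp only [Category.assoc, pullback.condition]
  obtain ⟨H, h₁, h₂, h₃⟩ := hp.exists_lift_boundary n (ofCotensor (flattenHom f))
    (flattenHom (g ≫ pullback.snd _ _)) (ofCotensor (flattenHom (g ≫ pullback.fst _ _)))
    (Hom.ext w₂) (congrArg (fun z => ofCotensor (flattenHom z)) w₁) (Hom.ext w₃.symm)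
  refine ⟨⟨(toCotensor H).toHom, ?_, ?_⟩⟩
  · exact (congrArg Hom.toHom (comp_toCotensor _ _)).symm.trans
      ((congrArg (fun z => (toCotensor z).toHom) h₁).trans
      (congrArg Hom.toHom (toCotensor_ofCotensor _)))
  · apply pullback.hom_ext
    · refine (Category.assoc _ _ _).trans ((congrArg ((toCotensor H).toHom ≫ ·)
        (gap_fst p)).trans ?_)
      exact (congrArg (fun z => (toCotensor z).toHom) h₃).trans
        (congrArg Hom.toHom (toCotensor_ofCotensor (flattenHom (g ≫ pullback.fst _ _))))
    · refine (Category.assoc _ _ _).trans ((congrArg ((toCotensor H).toHom ≫ ·)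
        (gap_snd p)).trans ?_)
      refine Eq.trans ?_ (congrArg Hom.toHom h₂)
      exact congrArg (fun z => (tensorι₀ _ ≫ z).toHom) (ofCotensor_toCotensor H)

lemma yonedaEquiv_symm_app_of_toList {X : SSet.{u}} (t : X _⦋2⦌) {s : (Δ[2] : SSet.{u}) _⦋2⦌}
    (hs : (stdSimplex.vertexModel 2).toList s = List.ofFn id) :
    (yonedaEquiv.symm t).app _ s = t := by
  have h' : s = topSimplex (op ⦋2⦌) := (stdSimplex.vertexModel 2).toList_injective hs
  exact (congrArg ((yonedaEquiv.symm t).app _) h').trans (yonedaEquiv_symm_topSimplex t)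

lemma yonedaEquiv_symm_app_thin {t : L.toSSet _⦋2⦌} (ht : t ∈ L.thin)
    (s : (Δ[2] : SSet.{u}) _⦋2⦌) : (yonedaEquiv.symm t).app _ s ∈ L.thin := by
  rcases mem_degenerate_or_eq le_rfl s with h | ⟨-, h⟩
  · exact thin_of_degenerate _ h
  · exact (congrArg (· ∈ L.thin) (yonedaEquiv_symm_app_of_toList t h)).mpr ht

/-- Restrict to the product of one thin triangle with the walking isomorphism. Triangles there with
degenerate projection are thin. So saturation transports thinness from the triangle over `x₀`,
changing the second coordinates of its vertices one at a time, beginning with the last vertex. -/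
lemma thin_of_thin_base (hs : HasLiftingProperty saturationMap p)
    (H : (flatten L.toSSet).tensor coherentIso ⟶ E) (v : L.tensor coherentIso ⟶ B)
    (hv : H.toHom ≫ p.toHom = v.toHom)
    (hH : ∀ t ∈ L.thin, H.toHom.app _ ((tensorι₀ L).toHom.app _ t) ∈ E.thin) :
    ∀ t ∈ (L.tensor coherentIso).thin, H.toHom.app _ t ∈ E.thin := by
  rintro ⟨t, w⟩ ht
  let F : (Δ[2] ⊗ coherentIso : SSet.{u}) ⟶ E.toSSet :=
    (tensorMap (flattenHom (yonedaEquiv.symm t)) (𝟙 coherentIso)).toHom ≫ H.toHom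
  have hdeg : ∀ a b c : ProdVertex 2, a.1 = b.1 ∨ b.1 = c.1 → ThinAt (prodModel 2) F a b c := by
    intro a b c h t' ht'
    exact H.map_thin _
      (degenerate_app_apply ((VertexModel.fst_mem_degenerate_iff _ _ ht').2 h) (yonedaEquiv.symm t))
  have hbase : ∀ a b c : ProdVertex 2, ThinAt (prodModel 2) (F ≫ p.toHom) a b c := by
    intro a b c t' ht'
    refine (congrArg (fun z => z.app _ ((tensorMap (flattenHom (yonedaEquiv.symm t))
      (𝟙 coherentIso)).toHom.app _ t') ∈ B.thin) hv).mpr ?_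
    exact v.map_thin _ (yonedaEquiv_symm_app_thin ht _)
  have h0 : ThinAt (prodModel 2) F (0, v₀) (1, v₀) (2, v₀) := by
    intro t' ht'
    have e₁ := (map_fst_toList_prod (stdSimplex.vertexModel 2) vertexModel t').symm.trans
      (congrArg (List.map Prod.fst) ht')
    have e₂ := (map_snd_toList_prod (stdSimplex.vertexModel 2) vertexModel t').symm.trans
      (congrArg (List.map Prod.snd) ht')
    have e₃ : t'.2 ∈ base.obj _ := by
      rw [base, mem_full, e₂]
      simp
    exact (congrArg (fun z => H.toHom.app _ z ∈ E.thin) (Prod.ext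
      (yonedaEquiv_symm_app_of_toList t e₁) (eq_of_mem_base e₃ (X := L.toSSet) t))).mpr (hH t ht)
  have le : ∀ {a b : Fin 3} (h : a ≤ b) (x y : Vertex), (a, x) ≤ (b, y) :=
    fun h x y => ⟨h, vertex_le x y⟩
  have h1 : ∀ d, ThinAt (prodModel 2) F (0, v₀) (1, v₀) (2, d) := fun d =>
    thinAt_inner_right hs (c := (2, v₀)) (le (by simp) _ _) (le (by simp) _ _) (le le_rfl _ _)
      (hdeg _ _ _ (Or.inr rfl)) (hdeg _ _ _ (Or.inr rfl)) h0 (hbase _ _ _)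
  have h2 : ∀ c d, ThinAt (prodModel 2) F (0, v₀) (1, c) (2, d) := fun c d =>
    thinAt_inner_left hs (b := (1, v₀)) (le (by simp) _ _) (le le_rfl _ _) (le (by simp) _ _)
      (hdeg _ _ _ (Or.inl rfl)) (h1 d) (hdeg _ _ _ (Or.inr rfl)) (hbase _ _ _)
  have h3 : ∀ b c d, ThinAt (prodModel 2) F (0, b) (1, c) (2, d) := fun b c d =>
    thinAt_inner_left hs (b := (0, v₀)) (le le_rfl _ _) (le (by simp) _ _) (le (by simp) _ _)
      (h2 c d) (hdeg _ _ _ (Or.inl rfl)) (hdeg _ _ _ (Or.inl rfl)) (hbase _ _ _)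
  obtain ⟨a, b, c, habc⟩ : ∃ a b c, (prodModel 2).toList (show (Δ[2] ⊗ coherentIso : SSet.{u}) _⦋2⦌
      from (topSimplex (op ⦋2⦌), w)) = [(0, a), (1, b), (2, c)] :=
    ⟨vertexModel.equiv _ w 0, vertexModel.equiv _ w 1, vertexModel.equiv _ w 2, rfl⟩
  have := h3 a b c _ habc
  exact (congrArg (fun z => H.toHom.app _ (show ((flatten L.toSSet).tensor
    coherentIso).toSSet.obj _ from (z, w)) ∈ E.thin) (yonedaEquiv_symm_topSimplex t)).mp this

/-- The homotopy lifting property of isofibrations. -/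
theorem IsIsofibration.exists_lift (hp : IsIsofibration p) {K : SSet.{u}} (j : K ⟶ L.toSSet)
    [Mono j] (a : (flatten K).tensor coherentIso ⟶ E) (b : L ⟶ E) (v : L.tensor coherentIso ⟶ B)
    (hab : tensorι₀ _ ≫ a = flattenHom j ≫ b) (hav : a ≫ p = tensorMap (flattenHom j) (𝟙 _) ≫ v)
    (hbv : b ≫ p = tensorι₀ _ ≫ v) :
    ∃ H : L.tensor coherentIso ⟶ E, tensorMap (flattenHom j) (𝟙 _) ≫ H = a ∧
      tensorι₀ _ ≫ H = b ∧ H ≫ p = v := by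
  have hv : (toCotensor v).toHom ≫ (evalCotensor B).toHom = b.toHom ≫ p.toHom :=
    (congrArg (fun z => (tensorι₀ L ≫ z).toHom) (ofCotensor_toCotensor v)).trans
      (congrArg Hom.toHom hbv.symm)
  have w : (show K ⟶ (E.cotensor coherentIso).toSSet from (toCotensor a).toHom) ≫ gap p = j ≫ pullback.lift (toCotensor v).toHom b.toHom hv := by
    apply pullback.hom_ext
    · rw [Category.assoc, gap_fst, Category.assoc, pullback.lift_fst]
      exact (congrArg (fun z => (toCotensor z).toHom) hav).trans
        (congrArg Hom.toHom (comp_toCotensor (flattenHom j) v))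
    · rw [Category.assoc, gap_snd, Category.assoc, pullback.lift_snd]
      exact (congrArg (fun z => (tensorι₀ _ ≫ z).toHom) (ofCotensor_toCotensor a)).trans
        (congrArg Hom.toHom hab)
  obtain ⟨⟨l, h₁, h₂⟩⟩ := (hp.rlp_gap _ (MorphismProperty.monomorphisms.infer_property j)).sq_hasLift
    ⟨w⟩
  have h₃ : l ≫ (cotensorMap p coherentIso).toHom = (toCotensor v).toHom := by
    rw [← gap_fst, ← Category.assoc, h₂, pullback.lift_fst]
  have h₄ : l ≫ (evalCotensor E).toHom = b.toHom := by
    rw [← gap_snd, ← Category.assoc, h₂, pullback.lift_snd]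
  have h₅ : (ofCotensor (flattenHom l)).toHom ≫ p.toHom = v.toHom :=
    (congrArg (fun z => (ofCotensor (flattenHom z)).toHom) h₃).trans
      (congrArg Hom.toHom (ofCotensor_toCotensor v))
  have h₆ : (tensorι₀ L).toHom ≫ (ofCotensor (flattenHom l)).toHom = b.toHom := h₄
  -- The lift on underlying simplicial sets restricts to `b` over `x₀`, hence it is thin there and
  -- then on all thin triangles of the cylinder.
  refine ⟨⟨(ofCotensor (flattenHom l)).toHom, thin_of_thin_base hp.saturation _ v h₅ ?_⟩, ?_,
    Hom.ext h₆, Hom.ext h₅⟩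
  · intro t ht
    exact (congrArg (fun z => z.app _ t ∈ E.thin) h₆).mpr (b.map_thin t ht)
  · apply Hom.ext
    exact (congrArg (fun z => (ofCotensor (flattenHom z)).toHom) h₁).trans
      (congrArg Hom.toHom (ofCotensor_toCotensor a))

end ScaledSSet

/-! ### Reduction of extension problems for cotensors to products of simplices. -/

namespace SSet

open CategoryTheory.Limits

/-- Lifting along a map which has the lifting property for those boundary inclusions for which
the simplex belongs to a subcomplex. -/
lemma exists_lift_of_boundary {M' M : SSet.{u}} (q : M' ⟶ M) (P : M.Subcomplex)
    (H : ∀ (k : ℕ) (f : (∂Δ[k] : SSet.{u}) ⟶ M') (g : Δ[k] ⟶ M), f ≫ q = ∂Δ[k].ι ≫ g →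
      (∀ m x, g.app m x ∈ P.obj m) → ∃ l : Δ[k] ⟶ M', ∂Δ[k].ι ≫ l = f ∧ l ≫ q = g)
    {K : SSet.{u}} (φ : K ⟶ M) (hφ : ∀ m x, φ.app m x ∈ P.obj m) :
    ∃ ψ : K ⟶ M', ψ ≫ q = φ := by
  -- After base change to `P`, the hypothesis is the lifting property for all boundary inclusions,
  -- hence for all monomorphisms, in particular for the empty subcomplex of `K`.
  have hr : (MorphismProperty.monomorphisms SSet.{u}).rlp (pullback.snd q P.ι) := by
    rw [rlp_monomorphisms]
    rintro _ _ _ ⟨k⟩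
    refine ⟨fun {f g} sq => ?_⟩
    have w : (f ≫ pullback.fst q P.ι) ≫ q = ∂Δ[k].ι ≫ g ≫ P.ι := by
      rw [Category.assoc, pullback.condition, ← Category.assoc, sq.w, Category.assoc]
    obtain ⟨l, h₁, h₂⟩ := H k _ _ w (fun m x => (g.app m x).2)
    refine ⟨⟨pullback.lift l g h₂, ?_, ?_⟩⟩
    · apply pullback.hom_ext
      · refine (Category.assoc _ _ _).trans ?_
        exact (congrArg (∂Δ[k].ι ≫ ·) (pullback.lift_fst l g h₂)).trans h₁
      · refine (Category.assoc _ _ _).trans ?_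
        exact (congrArg (∂Δ[k].ι ≫ ·) (pullback.lift_snd l g h₂)).trans sq.w.symm
    · exact pullback.lift_snd l g h₂
  let φ' : K ⟶ (P : SSet.{u}) := Subcomplex.lift φ (by
    rintro m _ ⟨x, rfl⟩
    exact hφ m x)
  let e : ((⊥ : K.Subcomplex) : SSet.{u}) ⟶ pullback q P.ι :=
    { app _ := TypeCat.ofHom (fun x => x.2.elim)
      naturality _ _ _ := ConcreteCategory.hom_ext _ _
        (fun x : ((⊥ : K.Subcomplex) : SSet.{u}).obj _ => x.2.elim) }
  have sq : CommSq e (⊥ : K.Subcomplex).ι (pullback.snd q P.ι) φ' := ⟨NatTrans.ext (funext fun _ => ConcreteCategory.hom_ext _ _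
    (fun x : ((⊥ : K.Subcomplex) : SSet.{u}).obj _ => x.2.elim))⟩
  obtain ⟨⟨l, -, h⟩⟩ := (hr _ (MorphismProperty.monomorphisms.infer_property _)).sq_hasLift sq
  refine ⟨l ≫ pullback.fst _ _, ?_⟩
  rw [Category.assoc, pullback.condition, ← Category.assoc, h]
  rfl

end SSet

namespace ScaledSSet

open VertexModel

lemma yonedaEquiv_symm_topSimplex' (k : ℕ) :
    yonedaEquiv.symm (topSimplex.{u} (op ⦋k⦌)) = 𝟙 Δ[k] := by
  apply yonedaEquiv.injective
  rw [Equiv.apply_symm_apply]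
  rfl

variable {C : ScaledSSet.{u}}

lemma thin_horn_of_thin_simplex {n : ℕ} {i : Fin (n + 1)} {S : Set ((Δ[n] : SSet.{u}) _⦋2⦌)}
    {t : (Δ[n] : SSet.{u}) _⦋2⦌} (ht : t ∈ (simplex n S).thin) (h : t ∈ Λ[n, i].obj _) :
    (⟨t, h⟩ : (Λ[n, i] : SSet.{u}) _⦋2⦌) ∈ (horn n i S).thin :=
  ht.imp (fun ht => (Subcomplex.mem_degenerate_iff _ _).2 ht) id

/-- A criterion for the extension of maps to scaled simplicial sets of maps along horns. -/
lemma exists_cotensor_extension {n : ℕ} {i : Fin (n + 1)} {S : Set ((Δ[n] : SSet.{u}) _⦋2⦌)}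
    (D : Set ((Λ[n, i] : SSet.{u}) _⦋1⦌))
    (H : ∀ (k : ℕ) (f : (Λ[n, i].unionProd ∂Δ[k] : SSet.{u}) ⟶ C.toSSet),
      (∀ (t : (Δ[n] ⊗ Δ[k] : SSet.{u}) _⦋2⦌) (ht : t ∈ (Λ[n, i].unionProd ∂Δ[k]).obj _),
        t.1 ∈ (simplex n S).thin → f.app _ ⟨t, ht⟩ ∈ C.thin) →
      (∀ (ε : (Δ[n] ⊗ Δ[k] : SSet.{u}) _⦋1⦌) (hε : ε ∈ (Λ[n, i].unionProd ∂Δ[k]).obj _)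
        (hε' : ε.1 ∈ Λ[n, i].obj _), ⟨ε.1, hε'⟩ ∈ D → ε.2 ∈ (Δ[k] : SSet.{u}).degenerate 1 →
        f.app _ ⟨ε, hε⟩ ∈ C.toSSet.degenerate 1) →
      ∃ F : Δ[n] ⊗ Δ[k] ⟶ C.toSSet, (Λ[n, i].unionProd ∂Δ[k]).ι ≫ F = f ∧
        ∀ t : (Δ[n] ⊗ Δ[k] : SSet.{u}) _⦋2⦌, t.1 ∈ (simplex n S).thin → F.app _ t ∈ C.thin)
    {K : SSet.{u}} (u : horn n i S ⟶ C.cotensor K)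
    (hu : ∀ ε ∈ D, u.toHom.app _ ε ∈ (C.cotensor K).toSSet.degenerate 1) :
    ∃ l : simplex n S ⟶ C.cotensor K, hornι n i S ≫ l = u := by
  -- For outer horns the extension exists only if the special edge is degenerate. `P` expresses this
  -- condition on the simplices of the mapping space, so that it is available in each boundary
  -- problem.
  let P : (mapping (horn n i S) C).Subcomplex :=
    { obj m := Set.ofPred (fun h : (horn n i S).tensor (SSet.stdSimplex.obj m.unop) ⟶ C =>
        ∀ ε ∈ D, ∀ y ∈ SSet.degenerate (SSet.stdSimplex.obj m.unop) 1,
          h.toHom.app (op ⦋1⦌) (ε, y) ∈ C.toSSet.degenerate 1)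
      map {m m'} α h hh ε hε y hy := hh ε hε _
        (degenerate_app_apply hy (SSet.stdSimplex.map α.unop)) }
  -- By adjunction `u` is a map from `K` to the mapping space of the horn, to be lifted to that of
  -- the simplex. A boundary problem for this is an extension from `Λ^n_i × Δ^k ∪ Δ^n × ∂Δ^k`, as in
  -- `H`.
  obtain ⟨ψ, hψ⟩ := exists_lift_of_boundary (mappingMap (hornι n i S) C) P (by
    intro k f g w hg
    have hw : ∀ m (x : (simplex n S).toSSet.obj m) (y : (Δ[k] : SSet.{u}).obj m)
        (hx : x ∈ Λ[n, i].obj m) (hy : y ∈ ∂Δ[k].obj m),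
        (ofMapping f).toHom.app m (x, ⟨y, hy⟩) = (ofMapping g).toHom.app m (⟨x, hx⟩, y) := by
      intro m x y hx hy
      exact congrArg (fun z => (ofMapping z).toHom.app m (show
        ((horn n i S).tensor (∂Δ[k] : SSet.{u})).toSSet.obj m from (⟨x, hx⟩, ⟨y, hy⟩))) w
    obtain ⟨φ, h₁, h₂⟩ := Subcomplex.exists_desc_unionProd Λ[n, i] ∂Δ[k] (ofMapping g).toHom
      (ofMapping f).toHom (fun m x y hx hy => (hw m x y hx hy).symm)
    obtain ⟨F, h₃, h₄⟩ := H k φ (by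
      intro t ht htS
      rcases (Subcomplex.mem_unionProd_iff Λ[n, i] ∂Δ[k] _).1 ht with h | h
      · exact (congrArg (· ∈ C.thin) (h₂ _ t ht h)).mpr ((ofMapping f).map_thin _ htS)
      · exact (congrArg (· ∈ C.thin) (h₁ _ t ht h)).mpr
          ((ofMapping g).map_thin _ (thin_horn_of_thin_simplex htS h))) (by
      intro ε hε hε' hεD hd
      refine (congrArg (· ∈ C.toSSet.degenerate 1) (h₁ _ ε hε hε')).mpr ?_
      have h := hg (op ⦋k⦌) (topSimplex (op ⦋k⦌))
      rw [← toMapping_ofMapping g] at h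
      have h' := h _ hεD _ hd
      refine (congrArg (fun z => (ofMapping g).toHom.app _ (show
        ((horn n i S).tensor Δ[k]).toSSet.obj _ from (⟨ε.1, hε'⟩, z)) ∈ C.toSSet.degenerate 1)
        ?_).mpr h'
      exact congrArg (fun z : Δ[k] ⟶ Δ[k] => z.app (op ⦋1⦌) ε.2) (yonedaEquiv_symm_topSimplex' k).symm)
    have hF : tensorMap (𝟙 (simplex n S)) ∂Δ[k].ι ≫ Hom.mk F h₄ = ofMapping f := by
      refine hom_ext_app (fun m x => ?_)
      have hx : ((x.1, x.2.1) : (Δ[n] ⊗ Δ[k] : SSet.{u}).obj m) ∈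
        (Λ[n, i].unionProd ∂Δ[k]).obj m := Or.inl ⟨trivial, x.2.2⟩
      exact (congrArg (fun z => z.app m ⟨_, hx⟩) h₃).trans (h₂ m _ hx x.2.2)
    have hF' : tensorMap (hornι n i S) (𝟙 Δ[k]) ≫ Hom.mk F h₄ = ofMapping g := by
      refine hom_ext_app (fun m x => ?_)
      have hx : ((x.1.1, x.2) : (Δ[n] ⊗ Δ[k] : SSet.{u}).obj m) ∈
        (Λ[n, i].unionProd ∂Δ[k]).obj m := Or.inr ⟨x.1.2, trivial⟩
      exact (congrArg (fun z => z.app m ⟨_, hx⟩) h₃).trans (h₁ m _ hx x.1.2)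
    refine ⟨toMapping ⟨F, h₄⟩, ?_, ?_⟩
    · rw [← toMapping_comp, hF, toMapping_ofMapping]
    · refine Eq.trans ?_ (toMapping_ofMapping g)
      rw [← hF']
      rfl) (toMapping (ofCotensor u)) (by
    intro m x ε hε y hy
    have hy' := degenerate_app_apply hy ((yonedaEquiv (n := m.unop)).symm x)
    obtain ⟨d, hd, f, a, ha⟩ := hu ε hε
    obtain rfl : d = 0 := by lia
    obtain ⟨d, hd', f', b, hb⟩ := hy'
    obtain rfl : d = 0 := by lia
    -- Both edges are degenerate along the unique map to `⦋0⦌`, hence so is the pair, and therefore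
    -- its image.
    obtain rfl : f = f' := Subsingleton.elim _ _
    refine ⟨0, hd, f, Hom.toHom a |>.app _ (topSimplex (op ⦋0⦌), b), ?_⟩
    refine (NatTrans.naturality_apply (Hom.toHom a) f.op
      (show ((flat (op ⦋0⦌)).tensor K).toSSet.obj _ from (topSimplex (op ⦋0⦌), b))).symm.trans ?_
    have e₁ : ∀ z, (Hom.toHom a).app _ (show ((flat (op ⦋0⦌)).tensor K).toSSet.obj _ from
        ((flat (op ⦋0⦌)).toSSet.map f.op (topSimplex (op ⦋0⦌)), z)) =
        (Hom.toHom (u.toHom.app _ ε)).app _ (topSimplex (op ⦋1⦌), z) := by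
      intro z
      rw [← ha]
      exact congrArg (fun w => (Hom.toHom a).app _ (show
        ((flat (op ⦋0⦌)).tensor K).toSSet.obj _ from (w, z))) (map_topSimplex f.op)
    refine (e₁ _).trans ?_
    exact congrArg (fun w => (Hom.toHom (u.toHom.app _ ε)).app _ (show
        ((flat (op ⦋1⦌)).tensor K).toSSet.obj _ from (topSimplex (op ⦋1⦌), w))) hb)
  refine ⟨toCotensor (ofMapping ψ), ?_⟩
  rw [← comp_toCotensor, ← ofMapping_comp_mappingMap, hψ, ofMapping_toMapping,
    toCotensor_ofCotensor]

end ScaledSSet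

/-! ### Cotensors of `∞`-bicategories: inner horns. -/

namespace ScaledSSet

open VertexModel

variable {C : ScaledSSet.{u}}

/-- The terminal scaled simplicial set. -/
abbrev point : ScaledSSet.{u} := sharp Δ[0]

/-- The map of simplicial sets to the terminal scaled simplicial set. -/
noncomputable def toPointHom (X : SSet.{u}) : X ⟶ point.{u}.toSSet :=
  SSet.stdSimplex.isTerminalObj₀.from X

/-- The map to the terminal scaled simplicial set. -/
noncomputable def toPoint (C : ScaledSSet.{u}) : C ⟶ point where
  toHom := toPointHom _
  map_thin _ _ := trivial

lemma point_hom_ext {X : SSet.{u}} (f g : X ⟶ point.{u}.toSSet) : f = g :=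
  SSet.stdSimplex.isTerminalObj₀.hom_ext f g

lemma IsInftyBicategory.liftsInner (hC : C.IsInftyBicategory) : LiftsInner (toPoint C) := by
  refine liftsInner_of_hasLift (fun m j u v sq => ?_)
  obtain ⟨l, hl⟩ := hC.inner m j u
  exact ⟨⟨l, hl, Hom.ext (point_hom_ext _ _)⟩⟩

/-- For `n ≥ 3` this is the extension property (iii). For `n = 2`, as the edge `01` is degenerate,
the degenerate triangle `σ 0` of the edge `02` fills the horn. -/
lemma IsInftyBicategory.liftsLeft (hC : C.IsInftyBicategory) {e : C.toSSet _⦋1⦌}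
    (he : e ∈ C.toSSet.degenerate 1) : LiftsLeft (toPoint C) e := by
  intro m g v w hge hv hg
  subst hge
  obtain _ | m := m
  · have h₁ : (1 : Fin 3) ≠ 0 := by decide
    have h₂ : (2 : Fin 3) ≠ 0 := by decide
    obtain ⟨x, hx⟩ : ∃ x : C.toSSet _⦋0⦌, C.toSSet.σ 0 x = g.app _ (hornFirstEdge 0) := by
      obtain ⟨d, hd, f, x, hx⟩ := he
      obtain rfl : d = 0 := by lia
      obtain rfl : f = SimplexCategory.σ 0 := Subsingleton.elim _ _
      exact ⟨x, hx⟩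
    have e₂ : horn.ι 0 2 h₂ ≫ g = SSet.stdSimplex.σ 0 ≫ yonedaEquiv.symm x := by
      apply yonedaEquiv.injective
      have e₁ : yonedaEquiv (horn.ι.{u} 0 2 h₂) = hornFirstEdge 0 := by
        refine Subtype.ext ((stdSimplex.vertexModel 2).toList_injective ?_)
        rfl
      rw [SSet.yonedaEquiv_comp, e₁, ← hx, ← Equiv.apply_symm_apply yonedaEquiv x]
      rfl
    have e₃ : (SSet.stdSimplex.δ 1 : Δ[0] ⟶ Δ[1]) ≫ horn.ι 0 1 h₁ =
        (SSet.stdSimplex.δ 1 : Δ[0] ⟶ Δ[1]) ≫ horn.ι.{u} 0 2 h₂ := by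
      rw [← cancel_mono Λ[2, 0].ι, Category.assoc, Category.assoc, horn.ι_ι, horn.ι_ι]
      exact CosimplicialObject.δ_comp_δ_self _ (i := 1)
    refine ⟨SSet.stdSimplex.σ 0 ≫ horn.ι 0 1 h₁ ≫ g, ?_, point_hom_ext _ _, ?_⟩
    · refine horn.hom_ext' (fun j hj => ?_)
      obtain rfl | rfl : j = 1 ∨ j = 2 := by
        clear * - hj
        decide +revert
      · rw [← Category.assoc, horn.ι_ι, ← Category.assoc]
        exact (congrArg (· ≫ horn.ι 0 1 h₁ ≫ g)
          (CosimplicialObject.δ_comp_σ_succ stdSimplex (i := (0 : Fin 2)))).trans (Category.id_comp _)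
      · rw [← Category.assoc, horn.ι_ι, ← Category.assoc]
        refine (congrArg (· ≫ horn.ι 0 1 h₁ ≫ g)
          (CosimplicialObject.δ_comp_σ_of_gt stdSimplex (i := (1 : Fin 2)) (j := (0 : Fin 1))
            (by decide))).trans ?_
        refine (Category.assoc _ _ _).trans ?_
        have e₄ : (SSet.stdSimplex.δ 1 : Δ[0] ⟶ Δ[1]) ≫ horn.ι.{u} 0 1 h₁ ≫ g =
            yonedaEquiv.symm x := by
          rw [← Category.assoc, e₃, Category.assoc, e₂, ← Category.assoc]
          exact (congrArg (· ≫ yonedaEquiv.symm x)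
            (CosimplicialObject.δ_comp_σ_succ stdSimplex (i := (0 : Fin 1)))).trans
              (Category.id_comp _)
        exact (congrArg (SSet.stdSimplex.σ 0 ≫ ·) e₄).trans e₂.symm
    · intro t ht
      refine C.degenerate_subset_thin ?_
      have := degenerate_app_apply (X := Δ[1]) (n := 2)
        (x := (SSet.stdSimplex.σ 0 : Δ[2] ⟶ Δ[1]).app _ t) ?_ (horn.ι 0 1 h₁ ≫ g)
      · exact this
      · exact (degenerate_eq_univ_of_hasDimensionLT Δ[1] 2 2 (by lia)) ▸ trivial
  · exact exists_lift_of_hasLift (Fin.zero_le _) (Fin.le_last _) g (fun u v sq hu => by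
      obtain ⟨l, hl⟩ := hC.outer (m + 1) (by lia) u (by rwa [hu])
      exact ⟨⟨l, hl, Hom.ext (point_hom_ext _ _)⟩⟩) v w hv hg

lemma IsInftyBicategory.isIsofibration (hC : C.IsInftyBicategory) : IsIsofibration (toPoint C) where
  liftsInner := hC.liftsInner
  saturation := hC.hasLiftingProperty_saturationMap _
  liftsCoherentIso x v hv hx := by
    refine ⟨SSet.const x, fun t => ?_, ?_, point_hom_ext _ _⟩
    · exact C.degenerate_subset_thin ⟨0, by lia, SimplexCategory.const _ _ 0, x, rfl⟩
    · refine (congrArg (fun z => C.toSSet.map (Quiver.Hom.op z) x) (Subsingleton.elim _ (𝟙 _))).trans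
        (C.toSSet.map_id_apply _ x)

/-- The vertices of the product of two simplices. -/
abbrev SimplexVertex (n k : ℕ) : Type := Fin (n + 1) × Fin (k + 1)

/-- The simplices of the product of two simplices. -/
def simplexModel (n k : ℕ) : VertexModel (Δ[n] ⊗ Δ[k] : SSet.{u}) (SimplexVertex n k) :=
  (stdSimplex.vertexModel n).prod (stdSimplex.vertexModel k)

/-- The chains of the subcomplex `Λ[n, i] ⊗ Δ[k] ∪ Δ[n] ⊗ ∂Δ[k]`. -/
def HornList {n k : ℕ} (i : Fin (n + 1)) (l : List (SimplexVertex n k)) : Prop :=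
  (∃ j, j ≠ i ∧ ∀ a ∈ l, a.1 ≠ j) ∨ ∃ j, ∀ a ∈ l, a.2 ≠ j

lemma mem_horn_unionProd_iff {n k m : ℕ} {i : Fin (n + 1)}
    (x : (Δ[n] ⊗ Δ[k] : SSet.{u}) _⦋m⦌) :
    x ∈ (Λ[n, i].unionProd ∂Δ[k]).obj _ ↔ HornList i ((simplexModel n k).toList x) := by
  have h1 := stdSimplex.mem_horn_iff_toList (i := i) x.1
  have h2 := stdSimplex.mem_boundary_iff_toList x.2
  rw [← map_fst_toList_prod _ (stdSimplex.vertexModel k)] at h1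
  rw [← map_snd_toList_prod (stdSimplex.vertexModel n)] at h2
  refine (Subcomplex.mem_unionProd_iff Λ[n, i] ∂Δ[k] _).trans ((or_comm.trans
    (or_congr h1 h2)).trans ?_)
  simp only [List.mem_map, not_exists, not_and]
  rfl

lemma fst_mem_thin_iff {n k : ℕ} {p q r : Fin (n + 1)} {hpq : p ≤ q} {hqr : q ≤ r}
    {t : (Δ[n] ⊗ Δ[k] : SSet.{u}) _⦋2⦌} {a b c : SimplexVertex n k}
    (ht : (simplexModel n k).toList t = [a, b, c]) :
    t.1 ∈ (simplex n {stdSimplex.triangle p q r hpq hqr}).thin ↔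
      (a.1 = b.1 ∨ b.1 = c.1) ∨ a.1 = p ∧ b.1 = q ∧ c.1 = r := by
  refine or_congr (VertexModel.fst_mem_degenerate_iff _ _ ht) ?_
  have h := (map_fst_toList_prod (stdSimplex.vertexModel n) (stdSimplex.vertexModel k) t).symm.trans
    (congrArg (List.map Prod.fst) ht)
  constructor
  · intro h'
    rw [Set.mem_singleton_iff.1 h', stdSimplex.toList_triangle] at h
    simpa using h.symm
  · rintro ⟨rfl, rfl, rfl⟩
    exact (stdSimplex.vertexModel n).toList_injective h

lemma hornList_iff {n k : ℕ} {i : Fin (n + 1)} {l : List (SimplexVertex n k)} :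
    ¬ HornList i l ↔ (∀ j, j ≠ i → ∃ a ∈ l, a.1 = j) ∧ ∀ j, ∃ a ∈ l, a.2 = j := by
  simp [HornList]

end ScaledSSet

namespace ScaledSSet

open VertexModel

variable {C : ScaledSSet.{u}}

lemma good_horn_iff {n k : ℕ} {i : Fin (n + 1)} {l : List (SimplexVertex n k)} (hn : 1 < n) :
    (simplexModel.{u} n k).Good (Λ[n, i].unionProd ∂Δ[k]) l ↔
      l.Pairwise (· ≤ ·) ∧ l.IsChain (· ≠ ·) ∧ ¬ HornList i l := by
  rw [good_iff mem_horn_unionProd_iff]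
  refine ⟨fun h => h.2, fun h => ⟨?_, h⟩⟩
  rintro rfl
  have : Nontrivial (Fin (n + 1)) := Fin.nontrivial_iff_two_le.2 (by lia)
  obtain ⟨j, hj⟩ := exists_ne i
  exact h.2.2 (Or.inl ⟨j, hj, by simp⟩)

/-- A chain outside the subcomplex takes all values other than `i` in the first coordinate. So the
last vertex before `i` lies over `i - 1`, and the next vertex over `i` or `i + 1`. -/
lemma exists_split_of_not_hornList {n k : ℕ} {i : Fin (n + 1)} (hi : 0 < i) (hi' : i < Fin.last n)
    {l : List (SimplexVertex n k)} (hl : l.Pairwise (· ≤ ·)) (hs : ¬ HornList i l) :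
    ∃ l₁ a b l₂, l.takeWhile (fun a => decide (a.1 < i)) = l₁ ++ [a] ∧
      l.dropWhile (fun a => decide (a.1 < i)) = b :: l₂ ∧
      (∀ c ∈ l₁ ++ [a], c ≤ a) ∧ (∀ c ∈ b :: l₂, b ≤ c) ∧ a ≤ b ∧ a.1.val + 1 = i.val ∧
      i ≤ b.1 ∧ b.1.val ≤ i.val + 1 := by
  rw [hornList_iff] at hs
  have e1 := List.mem_takeWhile_eq_true (q := fun a : SimplexVertex n k => decide (a.1 < i)) (l := l)
  have e2 := List.head?_dropWhile_eq_false (fun a : SimplexVertex n k => decide (a.1 < i)) l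
  have e3 := List.takeWhile_append_dropWhile (p := fun a : SimplexVertex n k => decide (a.1 < i))
    (l := l)
  generalize l.takeWhile (fun a : SimplexVertex n k => decide (a.1 < i)) = l₁,
    l.dropWhile (fun a : SimplexVertex n k => decide (a.1 < i)) = l₂ at *
  subst e3
  obtain ⟨g1, g2, g3⟩ := List.pairwise_append.1 hl
  obtain _ | ⟨b, l₂⟩ := l₂
  · obtain ⟨c, hc, hc'⟩ := hs.1 _ hi'.ne'
    have := e1 c (by simpa using hc)
    rw [decide_eq_true_eq, hc'] at this
    exact absurd (this.trans hi') (lt_irrefl _)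
  have hb : i ≤ b.1 := by simpa using e2
  have hbl : ∀ c ∈ b :: l₂, b ≤ c := by
    intro c hc
    rcases List.mem_cons.1 hc with rfl | hc
    · exact le_rfl
    · exact List.rel_of_pairwise_cons g2 hc
  obtain rfl | ⟨l₁, a, rfl⟩ := List.eq_nil_or_concat' l₁
  · obtain ⟨c, hc, hc'⟩ := hs.1 _ hi.ne
    have := hb.trans (hbl c hc).1
    rw [hc'] at this
    exact absurd (hi.trans_le this) (lt_irrefl _)
  have ha : a.1 < i := by simpa using e1 a (by simp)
  have hla : ∀ c ∈ l₁ ++ [a], c ≤ a := by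
    intro c hc
    rcases List.mem_append.1 hc with hc | hc
    · exact (List.pairwise_append.1 g1).2.2 c hc a (by simp)
    · exact (List.mem_singleton.1 hc).le
  refine ⟨l₁, a, b, l₂, rfl, rfl, hla, hbl, g3 a (by simp) b (by simp), ?_, hb, ?_⟩
  · by_contra h
    obtain ⟨c, hc, hc'⟩ := hs.1 ⟨i.val - 1, by lia⟩ (by simp [Fin.ext_iff]; lia)
    have hcv : c.1.val = i.val - 1 := congrArg Fin.val hc'
    rcases List.mem_append.1 hc with hc | hc
    · have := (hla c hc).1
      lia
    · have := (hbl c hc).1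
      lia
  · by_contra h
    obtain ⟨c, hc, hc'⟩ := hs.1 ⟨i.val + 1, by lia⟩ (by simp [Fin.ext_iff])
    have hcv : c.1.val = i.val + 1 := congrArg Fin.val hc'
    rcases List.mem_append.1 hc with hc | hc
    · have h3 := e1 c hc
      simp only [decide_eq_true_eq] at h3
      lia
    · have := (hbl c hc).1
      lia

/-- The vertex over `i` and the last vertex of a list. -/
def innerVertex {n k : ℕ} (i : Fin (n + 1)) (l : List (SimplexVertex n k)) : SimplexVertex n k :=
  (i, (l.getLast?.map Prod.snd).getD 0)

/-- The inserted vertex lies over `i`, a value which a chain outside the subcomplex need not take,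
and has the second coordinate of its predecessor. Removing it thus leaves the chain outside the
subcomplex. -/
lemma isStart_horn {n k : ℕ} {i : Fin (n + 1)} (hi : 0 < i) (hi' : i < Fin.last n) :
    Insertion.IsStart (simplexModel.{u} n k) (Λ[n, i].unionProd ∂Δ[k])
      (fun a => decide (a.1 < i)) (innerVertex i) where
  pos {l} hl hl' := by
    obtain ⟨g1, -, g2⟩ := (good_horn_iff (by rw [Fin.lt_def] at hi hi'; simp at hi hi'; lia)).1 hl
    obtain ⟨l₁, a, b, l₂, h1, h2, h3, h4, h5, h6, h7, h8⟩ :=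
      exists_split_of_not_hornList hi hi' g1 g2
    rw [h1, h2]
    have hV : innerVertex i (l₁ ++ [a]) = (i, a.2) := by simp [innerVertex]
    rw [hV]
    refine ⟨by simp, fun c hc => ⟨(h3 c hc).1.trans (by rw [Fin.le_def]; simp; lia), (h3 c hc).2⟩,
      fun c hc => ⟨h7.trans (h4 c hc).1, h5.2.trans (h4 c hc).2⟩⟩
  erase {l₁ l₂} hl h₁ hV := by
    obtain ⟨g1, -, g2⟩ := (good_horn_iff (by rw [Fin.lt_def] at hi hi'; simp at hi hi'; lia)).1 hl
    rw [hornList_iff] at g2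
    have g3 := List.pairwise_append.1 g1
    have key : ¬ HornList i (l₁ ++ l₂) := by
      rw [hornList_iff]
      refine ⟨fun j hj => ?_, fun j => ?_⟩
      · obtain ⟨c, hc, hc'⟩ := g2.1 j hj
        refine ⟨c, ?_, hc'⟩
        simp only [List.mem_append, List.mem_cons] at hc ⊢
        rcases hc with hc | rfl | hc
        · exact Or.inl hc
        · exact absurd hc' hj.symm
        · exact Or.inr hc
      · obtain ⟨c, hc, hc'⟩ := g2.2 j
        simp only [List.mem_append, List.mem_cons] at hc
        rcases hc with hc | rfl | hc
        · exact ⟨c, by simp [hc], hc'⟩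
        · obtain rfl | ⟨l₁, a, rfl⟩ := List.eq_nil_or_concat' l₁
          · obtain ⟨d, hd, hd'⟩ := g2.1 _ hi.ne
            rw [List.nil_append] at hd g1
            exfalso
            rcases List.mem_cons.1 hd with rfl | hd
            · exact hi.ne hd'.symm
            · have := (List.rel_of_pairwise_cons g1 hd).1
              rw [hd'] at this
              exact absurd (hi.trans_le this) (lt_irrefl _)
          · exact ⟨a, by simp, by simpa [innerVertex] using hc'⟩
        · exact ⟨c, by simp [hc], hc'⟩
    refine ⟨fun b hb => ?_, ?_, fun m x hx => by rwa [mem_horn_unionProd_iff, hx]⟩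
    · have := (List.rel_of_pairwise_cons g3.2.1 (List.mem_of_head? hb)).1
      simpa [innerVertex] using this
    · intro h
      rw [h] at key
      exact key (Or.inl ⟨0, hi.ne, by simp⟩)

/-- Inserting `(i, y)` after the last vertex `(i - 1, y)` before `i` gives inner horns. The
projection of the special triangle is degenerate or equal to `{i-1, i, i+1}`, so it is thin. The
thinness of further new triangles is an issue for `n = 2` only, and follows by saturation. -/
lemma IsInftyBicategory.exists_inner_extension (hC : C.IsInftyBicategory) {n k : ℕ}
    {i₀ i i₂ : Fin (n + 1)} (h₀' : i₀ ≤ i) (h₂' : i ≤ i₂) (hsc : i₀.val + 1 = i.val)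
    (hss : i₂.val = i.val + 1)
    (f : (Λ[n, i].unionProd ∂Δ[k] : SSet.{u}) ⟶ C.toSSet)
    (hf : ∀ (t : (Δ[n] ⊗ Δ[k] : SSet.{u}) _⦋2⦌)
      (ht : t ∈ (Λ[n, i].unionProd ∂Δ[k]).obj _),
      t.1 ∈ (simplex n {stdSimplex.triangle i₀ i i₂ h₀' h₂'}).thin → f.app _ ⟨t, ht⟩ ∈ C.thin) :
    ∃ F : Δ[n] ⊗ Δ[k] ⟶ C.toSSet,
      (Λ[n, i].unionProd ∂Δ[k]).ι ≫ F = f ∧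
        ∀ t : (Δ[n] ⊗ Δ[k] : SSet.{u}) _⦋2⦌,
          t.1 ∈ (simplex n {stdSimplex.triangle i₀ i i₂ h₀' h₂'}).thin → F.app _ t ∈ C.thin := by
  have hi : 0 < i := by
    rw [Fin.lt_def]
    simp
    lia
  have hi' : i < Fin.last n := by
    rw [Fin.lt_def]
    simp
    lia
  have hn : 1 < n := by lia
  have hthin : ∀ (t : (Δ[n] ⊗ Δ[k] : SSet.{u}) _⦋2⦌) (a b c : SimplexVertex n k),
      (simplexModel _ _).toList t = [a, b, c] →
      (t.1 ∈ (simplex n {stdSimplex.triangle i₀ i i₂ h₀' h₂'}).thin ↔ (a.1 = b.1 ∨ b.1 = c.1) ∨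
        a.1 = i₀ ∧ b.1 = i ∧ c.1 = i₂) :=
    fun t a b c ht => fst_mem_thin_iff ht
  let D := Insertion.start _ _ _ _ (isStart_horn.{u} (k := k) hi hi')
  let p := toPoint C
  have base : ∀ (f : Δ[n] ⊗ Δ[k] ⟶ point.toSSet) (a b c : SimplexVertex (n) k),
      ThinAt (E := point) (simplexModel (n) k) f a b c := fun _ _ _ _ _ _ => trivial
  have big : ∀ (t : (Δ[n] ⊗ Δ[k] : SSet.{u}) _⦋2⦌) (a b : SimplexVertex (n) k),
      a.1 < i → i ≤ b.1 → b ≠ (i, a.2) →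
      (simplexModel _ _).toList t = [a, (i, a.2), b] →
      t ∈ (Λ[n, i].unionProd ∂Δ[k]).obj _ ∨
      ∃ l, (simplexModel.{u} _ _).Good (Λ[n, i].unionProd ∂Δ[k]) l ∧
        D.small l ∧ [a, (i, a.2), b] = D.ins l := by
    intro t a b ha hb hne ht
    by_cases htA : t ∈ (Λ[n, i].unionProd ∂Δ[k]).obj _
    · exact Or.inl htA
    rw [mem_horn_unionProd_iff, ht, hornList_iff] at htA
    obtain ⟨hab, hbc⟩ := (simplexModel _ _).le_of_toList_eq ht
    have h2 : (simplexModel.{u} _ _).Good (Λ[n, i].unionProd ∂Δ[k]) [a, b] := by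
      rw [good_horn_iff hn, hornList_iff]
      refine ⟨by simpa using hab.trans hbc, ?_, fun j' hj' => ?_, fun j' => ?_⟩
      · simpa using fun h : a = b => absurd (ha.trans_le (h ▸ hb)) (lt_irrefl _)
      · have := htA.1 j' hj'
        simpa [hj'.symm] using this
      · have := htA.2 j'
        simpa using this
    refine Or.inr ⟨_, h2, ?_, ?_⟩
    · simpa [D, Insertion.start, ha, hb.not_gt, innerVertex] using hne
    · simp [D, Insertion.start, Insertion.ins, ha, hb.not_gt, innerVertex]
  obtain ⟨F, h1, -, h3⟩ := D.exists_scaled_lift (p := p) (v := toPointHom _) hC.liftsInner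
    (point_hom_ext _ _) (u := f) (by
    intro l hl hl'
    obtain ⟨g1, -, g2⟩ := (good_horn_iff hn).1 hl
    obtain ⟨l₁, a, b, l₂, e1, e2, e3, e4, e5, e6, e7, e8⟩ :=
      exists_split_of_not_hornList hi hi' g1 g2
    have hV : D.v l = (i, a.2) := by
      change innerVertex _ (l.takeWhile _) = _
      rw [e1]
      simp [innerVertex]
    refine Or.inl ⟨l₁, a, b, l₂, e1, e2, ?_⟩
    rw [hV]
    refine ⟨base _ _ _ _, ?_, fun t ht => big t a b ?_ e7 ?_ ht⟩
    · intro t ht ht'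
      refine hf t ht ((hthin t _ _ _ ht').2 ?_)
      simp only [Fin.ext_iff]
      lia
    · rw [Fin.lt_def]
      lia
    · rintro rfl
      refine hl' ?_
      change (l.dropWhile _).head? = some (D.v l)
      rw [hV, e2]
      rfl)
  refine ⟨F, h1, ?_⟩
  have inA : ∀ (t : (Δ[n] ⊗ Δ[k] : SSet.{u}) _⦋2⦌),
      t.1 ∈ (simplex n {stdSimplex.triangle i₀ i i₂ h₀' h₂'}).thin →
      t ∈ (Λ[n, i].unionProd ∂Δ[k]).obj _ → F.app _ t ∈ C.thin := by
    intro t ht htA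
    have := hf t htA ht
    rw [← h1] at this
    exact this
  intro t ht
  by_cases htA : t ∈ (Λ[n, i].unionProd ∂Δ[k]).obj _
  · exact inA t ht htA
  obtain ⟨a, b, c, habc⟩ : ∃ a b c, (simplexModel _ _).toList t = [a, b, c] := ⟨_, _, _, rfl⟩
  obtain ⟨hab, hbc⟩ := (simplexModel _ _).le_of_toList_eq habc
  rw [mem_horn_unionProd_iff, habc, hornList_iff] at htA
  have hh := (hthin _ _ _ _ habc).1 ht
  simp only [List.mem_cons, List.not_mem_nil, or_false, exists_eq_or_imp, exists_eq_left] at htA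
  have ha : a.1.val = 0 := by
    have := htA.1 0 hi.ne
    have := hab.1
    have := hbc.1
    simp only [Fin.ext_iff, Fin.le_def, Fin.val_zero] at *
    lia
  have hc : c.1.val = n := by
    have := htA.1 _ hi'.ne'
    have := hab.1
    have := hbc.1
    have := c.1.2
    simp only [Fin.ext_iff, Fin.le_def, Fin.val_last] at *
    lia
  -- The projection has to contain all vertices other than `i`. If `n > 2`, this is incompatible
  -- with being degenerate or equal to `{i-1, i, i+1}`.
  obtain rfl : n = 2 := by
    by_contra hm
    by_cases hj : i.val = 1
    · have := htA.1 ⟨2, by lia⟩ (by simp [Fin.ext_iff, hj])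
      simp only [Fin.ext_iff] at *
      lia
    · have := htA.1 ⟨1, by lia⟩ (by simp [Fin.ext_iff]; lia)
      simp only [Fin.ext_iff] at *
      lia
  obtain rfl : i = 1 := Fin.ext (by rw [Fin.lt_def] at hi hi'; simp at hi hi' ⊢; lia)
  obtain rfl : i₀ = 0 := Fin.ext (by simp at hsc; lia)
  obtain rfl : i₂ = 2 := Fin.ext (by simp at hss; lia)
  obtain ⟨a, w₀⟩ := a
  obtain ⟨b, w₁⟩ := b
  obtain ⟨c, w₂⟩ := c
  obtain rfl : a = 0 := Fin.ext ha
  obtain rfl : c = 2 := Fin.ext hc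
  have hw₀ : w₀ ≤ w₁ := hab.2
  have hw₁ : w₁ ≤ w₂ := hbc.2
  have hs := hC.hasLiftingProperty_saturationMap p
  have le : ∀ {a b : Fin 3} {x y : Fin (k + 1)} (h : a ≤ b) (h' : x ≤ y), (a, x) ≤ (b, y) :=
    fun h h' => ⟨h, h'⟩
  -- These are the triangles filled directly. `t₂` concerns triangles over a proper face of `Δ[2]`
  -- in the horn, and saturation combines the two for all other triangles.
  have t₁ : ∀ x y : Fin (k + 1), ThinAt (simplexModel 2 k) F (0, x) (1, x) (2, y) := by
    intro x y t ht
    rcases big t (0, x) (2, y) (show (0 : Fin 3) < 1 by decide)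
      (show (1 : Fin 3) ≤ 2 by decide) (by simp [Fin.ext_iff]) ht with h | ⟨l, h4, h5, h6⟩
    · exact inA t ((hthin t _ _ _ ht).2 (Or.inr ⟨rfl, rfl, rfl⟩)) h
    · exact h3 t ⟨l, h4, h5, ht.trans h6⟩
  have t₂ : ∀ (a b c : Fin 3) (x y z : Fin (k + 1)), (a = b ∨ b = c) → (∀ s : Fin 3, s = 0 ∨ s = 2 →
      a ≠ s ∧ b ≠ s ∧ c ≠ s → ThinAt (simplexModel 2 k) F (a, x) (b, y) (c, z)) := by
    intro a b c x y z h s hs hs' t ht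
    refine inA t ((hthin t _ _ _ ht).2 (Or.inl h)) ?_
    rw [mem_horn_unionProd_iff, ht]
    refine Or.inl ⟨s, ?_, by simpa using hs'⟩
    rcases hs with rfl | rfl <;> decide
  have t₃ : ThinAt (simplexModel 2 k) F (0, w₀) (1, w₁) (2, w₂) :=
    thinAt_inner_left hs (b := (1, w₀)) (le (by decide) le_rfl) (le le_rfl hw₀)
      (le (by decide) hw₁) (t₂ _ _ _ _ _ _ (by simp) 0 (by simp) (by decide)) (t₁ _ _)
      (t₂ _ _ _ _ _ _ (by simp) 2 (by simp) (by decide)) (base _ _ _ _)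
  obtain rfl | rfl | rfl : b = 0 ∨ b = 1 ∨ b = 2 := by
    clear * -
    decide +revert
  · exact thinAt_inner_right hs (c := (1, w₁)) (le le_rfl hw₀) (le (by decide) le_rfl)
      (le (by decide) hw₁) (t₁ _ _) t₃ (t₂ _ _ _ _ _ _ (by simp) 2 (by simp) (by decide))
      (base _ _ _ _) t habc
  · exact t₃ t habc
  · exact thinAt_inner_left hs (b := (1, w₀)) (le (by decide) le_rfl) (le (by decide) hw₀)
      (le le_rfl hw₁) (t₂ _ _ _ _ _ _ (by simp) 0 (by simp) (by decide)) (t₁ _ _) (t₁ _ _)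
      (base _ _ _ _) t habc

end ScaledSSet

/-! ### Cotensors of `∞`-bicategories: outer horns and saturation. -/

namespace ScaledSSet

open VertexModel

variable {C : ScaledSSet.{u}}

/-- The vertex over `0` and the first vertex of a list. -/
def outerVertex {n k : ℕ} (l : List (SimplexVertex n k)) : SimplexVertex n k :=
  (0, (l.head?.map Prod.snd).getD 0)

lemma exists_cons_of_not_hornList {m k : ℕ} {l : List (SimplexVertex (m + 2) k)}
    (hl : l.Pairwise (· ≤ ·)) (hs : ¬ HornList 0 l) :
    ∃ b l₂, l.dropWhile (fun a => decide (a.1 = 0)) = b :: l₂ ∧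
      (∀ c ∈ l.takeWhile (fun a => decide (a.1 = 0)), c.1 = 0 ∧ c ≤ b) ∧
      (∀ c ∈ b :: l₂, b ≤ c) ∧ b.1 = 1 := by
  rw [hornList_iff] at hs
  have e1 := List.mem_takeWhile_eq_true (q := fun a : SimplexVertex (m + 2) k => decide (a.1 = 0))
    (l := l)
  have e2 := List.head?_dropWhile_eq_false (fun a : SimplexVertex (m + 2) k => decide (a.1 = 0)) l
  have e3 := List.takeWhile_append_dropWhile
    (p := fun a : SimplexVertex (m + 2) k => decide (a.1 = 0)) (l := l)
  generalize l.takeWhile (fun a : SimplexVertex (m + 2) k => decide (a.1 = 0)) = l₁,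
    l.dropWhile (fun a : SimplexVertex (m + 2) k => decide (a.1 = 0)) = l₂ at *
  subst e3
  obtain ⟨g1, g2, g3⟩ := List.pairwise_append.1 hl
  have h1 : (1 : Fin (m + 2 + 1)) ≠ 0 := by simp
  obtain ⟨c, hc, hc'⟩ := hs.1 _ h1
  have hc₂ : c ∈ l₂ := (List.mem_append.1 hc).resolve_left (fun h => by
    have := e1 c h
    rw [hc'] at this
    simp at this)
  obtain _ | ⟨b, l₂⟩ := l₂
  · simp at hc₂
  have hbl : ∀ c ∈ b :: l₂, b ≤ c := by
    intro c hc
    rcases List.mem_cons.1 hc with rfl | hc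
    · exact le_rfl
    · exact List.rel_of_pairwise_cons g2 hc
  refine ⟨b, l₂, rfl, fun c hc => ⟨by simpa using e1 c hc, g3 c hc b (by simp)⟩, hbl, ?_⟩
  have hb : b.1 ≠ 0 := by simpa using e2
  have := (hbl c hc₂).1
  rw [hc'] at this
  simp only [Fin.le_def, Fin.ext_iff, ne_eq, Fin.val_one, Fin.val_zero] at *
  lia

/-- The inserted vertex lies over `0`, which a chain outside the subcomplex need not meet, and has
the second coordinate of its successor. -/
lemma isEnd_horn (m k : ℕ) :
    Insertion.IsEnd (simplexModel.{u} (m + 2) k) (Λ[m + 2, 0].unionProd ∂Δ[k])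
      (fun a => decide (a.1 = 0)) outerVertex where
  pos {l} hl hl' := by
    obtain ⟨g1, -, g2⟩ := (good_horn_iff (by lia)).1 hl
    obtain ⟨b, l₂, h1, h2, h3, h4⟩ := exists_cons_of_not_hornList g1 g2
    rw [h1]
    refine ⟨by simp [outerVertex], fun c hc => ⟨(h2 c hc).1.le, ?_⟩,
      fun c hc => ⟨Fin.zero_le _, ?_⟩⟩
    · simpa [outerVertex] using (h2 c hc).2.2
    · simpa [outerVertex] using (h3 c hc).2
  erase {l₁ l₂} hl h₁ hV h₂ := by
    obtain ⟨g1, -, g2⟩ := (good_horn_iff (by lia)).1 hl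
    rw [hornList_iff] at g2
    have h01 : (1 : Fin (m + 2 + 1)) ≠ 0 := by simp
    have key : ¬ HornList 0 (l₁ ++ l₂) := by
      rw [hornList_iff]
      refine ⟨fun j hj => ?_, fun j => ?_⟩
      · obtain ⟨c, hc, hc'⟩ := g2.1 j hj
        refine ⟨c, ?_, hc'⟩
        simp only [List.mem_append, List.mem_cons] at hc ⊢
        rcases hc with hc | rfl | hc
        · exact Or.inl hc
        · exact absurd hc' hj.symm
        · exact Or.inr hc
      · obtain ⟨c, hc, hc'⟩ := g2.2 j
        simp only [List.mem_append, List.mem_cons] at hc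
        rcases hc with hc | rfl | hc
        · exact ⟨c, by simp [hc], hc'⟩
        · obtain _ | ⟨b, l₂⟩ := l₂
          · obtain ⟨d, hd, hd'⟩ := g2.1 _ h01
            exfalso
            rcases List.mem_append.1 hd with hd | hd
            · have := h₁ d hd
              rw [hd'] at this
              simp at this
            · rw [List.mem_singleton.1 hd] at hd'
              exact h01 hd'.symm
          · exact ⟨b, by simp, by simpa [outerVertex] using hc'⟩
        · exact ⟨c, by simp [hc], hc'⟩
    refine ⟨fun h => ?_, fun m x hx => by rwa [mem_horn_unionProd_iff, hx]⟩
    rw [h] at key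
    exact key (Or.inl ⟨1, h01, by simp⟩)

/-- The vertex `(0, y)` is inserted before the first vertex `(1, y)` not over `0`. If there are
other vertices over `0`, the horn is inner, with a special triangle of degenerate projection.
Otherwise it is a horn at `0` whose first edge lies over `{0, 1}` and over a degenerate edge of
`Δ[k]`, hence is degenerate in `C`, and `liftsLeft` applies. -/
lemma IsInftyBicategory.exists_outer_extension (hC : C.IsInftyBicategory) {m k : ℕ} (hm : 1 ≤ m)
    (f : (Λ[m + 2, 0].unionProd ∂Δ[k] : SSet.{u}) ⟶ C.toSSet)
    (hf : ∀ (t : (Δ[m + 2] ⊗ Δ[k] : SSet.{u}) _⦋2⦌)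
      (ht : t ∈ (Λ[m + 2, 0].unionProd ∂Δ[k]).obj _),
      t.1 ∈ (simplex (m + 2) (leftTri m)).thin → f.app _ ⟨t, ht⟩ ∈ C.thin)
    (he : ∀ (ε : (Δ[m + 2] ⊗ Δ[k] : SSet.{u}) _⦋1⦌)
      (hε : ε ∈ (Λ[m + 2, 0].unionProd ∂Δ[k]).obj _),
      ε.1 = stdSimplex.edge (m + 2) 0 1 (Fin.zero_le _) →
      ε.2 ∈ (Δ[k] : SSet.{u}).degenerate 1 → f.app _ ⟨ε, hε⟩ ∈ C.toSSet.degenerate 1) :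
    ∃ F : Δ[m + 2] ⊗ Δ[k] ⟶ C.toSSet,
      (Λ[m + 2, 0].unionProd ∂Δ[k]).ι ≫ F = f ∧
        ∀ t : (Δ[m + 2] ⊗ Δ[k] : SSet.{u}) _⦋2⦌,
          t.1 ∈ (simplex (m + 2) (leftTri m)).thin → F.app _ t ∈ C.thin := by
  have hthin : ∀ (t : (Δ[m + 2] ⊗ Δ[k] : SSet.{u}) _⦋2⦌) (a b c : SimplexVertex (m + 2) k),
      (simplexModel _ _).toList t = [a, b, c] →
      (t.1 ∈ (simplex (m + 2) (leftTri m)).thin ↔ (a.1 = b.1 ∨ b.1 = c.1) ∨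
        a.1 = 0 ∧ b.1 = 1 ∧ c.1 = Fin.last (m + 2)) :=
    fun t a b c ht => fst_mem_thin_iff ht
  let D := Insertion.final _ _ _ _ (isEnd_horn.{u} m k)
  let p := toPoint C
  have base : ∀ (f : Δ[m + 2] ⊗ Δ[k] ⟶ point.toSSet) (a b c : SimplexVertex (m + 2) k),
      ThinAt (E := point) (simplexModel (m + 2) k) f a b c := fun _ _ _ _ _ _ => trivial
  obtain ⟨F, h1, -, -⟩ := D.exists_scaled_lift (p := p) (v := toPointHom _) hC.liftsInner
    (point_hom_ext _ _) (u := f) (by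
    intro l hl hl'
    obtain ⟨g1, -, g2⟩ := (good_horn_iff (by lia)).1 hl
    obtain ⟨b, l₂, e1, e2, e3, e4⟩ := exists_cons_of_not_hornList g1 g2
    have hV : D.v l = (0, b.2) := by
      change outerVertex (l.dropWhile _) = _
      rw [e1]
      simp [outerVertex]
    have e5 := List.takeWhile_append_dropWhile
      (p := fun a : SimplexVertex (m + 2) k => decide (a.1 = 0)) (l := l)
    have e6 : D.fst l = l.takeWhile (fun a : SimplexVertex (m + 2) k => decide (a.1 = 0)) := rfl
    rw [← e6] at e2 e5
    rw [e1] at e5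
    obtain h | ⟨l₁, a, h⟩ := List.eq_nil_or_concat' (D.fst l)
    · rw [h, List.nil_append] at e5
      rw [hornList_iff] at g2
      obtain ⟨c, hc⟩ : ∃ c, l₂.getLast? = some c := by
        rw [← Option.isSome_iff_exists, List.getLast?_isSome]
        rintro rfl
        obtain ⟨d, hd, hd'⟩ := g2.1 (Fin.last _) (by simp [Fin.ext_iff])
        rw [← e5, List.mem_singleton] at hd
        rw [hd, e4] at hd'
        simp [Fin.ext_iff] at hd'
      have hcl : c.1 = Fin.last (m + 2) := by
        obtain ⟨l₂, rfl⟩ := List.getLast?_eq_some_iff.1 hc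
        obtain ⟨d, hd, hd'⟩ := g2.1 (Fin.last _) (by simp [Fin.ext_iff])
        refine le_antisymm (Fin.le_last _) (hd'.symm.le.trans ?_)
        rw [← e5, ← List.cons_append] at hd g1
        rcases List.mem_append.1 hd with hd | hd
        · exact ((List.pairwise_append.1 g1).2.2 d hd c (by simp)).1
        · rw [List.mem_singleton.1 hd]
      refine Or.inr (Or.inl ⟨b, c, l₂, h, e1, hc, fun ε hε => ?_, ?_⟩)
      · rw [hV] at hε
        have hεA : ε ∈ (Λ[m + 2, 0].unionProd ∂Δ[k]).obj _ := by
          rw [mem_horn_unionProd_iff, hε]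
          refine Or.inl ⟨⟨2, by lia⟩, ?_, ?_⟩
          · simp [Fin.ext_iff]
          · simp [e4, Fin.ext_iff]
        refine ⟨hεA, hC.liftsLeft (he ε hεA ?_ ?_)⟩
        · apply (stdSimplex.vertexModel _).toList_injective
          rw [stdSimplex.toList_edge]
          refine (map_fst_toList_prod (stdSimplex.vertexModel _) (stdSimplex.vertexModel _)
            ε).symm.trans ((congrArg (List.map Prod.fst) hε).trans ?_)
          simp [e4]
        · have h' := (map_snd_toList_prod (stdSimplex.vertexModel (m + 2)) (stdSimplex.vertexModel k)
            ε).symm.trans (congrArg (List.map Prod.snd) hε)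
          by_contra h''
          rw [← mem_nonDegenerate_iff_notMem_degenerate,
            (stdSimplex.vertexModel k).mem_nonDegenerate_iff, h'] at h''
          simp at h''
      · rw [hV]
        refine ⟨base _ _ _ _, fun t ht ht' => hf t ht ((hthin t _ _ _ ht').2 ?_), fun t ht => ?_⟩
        · exact Or.inr ⟨rfl, e4, hcl⟩
        · refine Or.inl ?_
          rw [mem_horn_unionProd_iff, ht]
          refine Or.inl ⟨⟨2, by lia⟩, ?_, ?_⟩
          · simp [Fin.ext_iff]
          · simp only [List.mem_cons, List.not_mem_nil, or_false, forall_eq_or_imp, forall_eq,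
              e4, hcl, ne_eq, Fin.ext_iff, Fin.val_last, Fin.val_one, Fin.val_zero]
            lia
    · refine Or.inl ⟨l₁, a, b, l₂, h, e1, ?_⟩
      have ha := (e2 a (by simp [h])).1
      rw [hV]
      refine ⟨base _ _ _ _, fun t ht ht' => hf t ht ((hthin t _ _ _ ht').2 ?_), fun t ht => ?_⟩
      · exact Or.inl (Or.inl ha)
      · refine Or.inl ?_
        rw [mem_horn_unionProd_iff, ht]
        refine Or.inl ⟨⟨2, by lia⟩, ?_, ?_⟩
        · simp [Fin.ext_iff]
        · simp [e4, ha, Fin.ext_iff])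
  refine ⟨F, h1, fun t ht => ?_⟩
  -- No new triangle has to be made thin: one outside the subcomplex projects onto `1`, `2` and `m +
  -- 2 ≥ 3`. This forces `m = 1` and the projection `{1, 2, 3}`, which is not thin.
  have htA : t ∈ (Λ[m + 2, 0].unionProd ∂Δ[k]).obj _ := by
    by_contra htA
    obtain ⟨a, b, c, habc⟩ : ∃ a b c, (simplexModel _ _).toList t = [a, b, c] := ⟨_, _, _, rfl⟩
    rw [mem_horn_unionProd_iff, habc, hornList_iff] at htA
    have hh := (hthin _ _ _ _ habc).1 ht
    simp only [List.mem_cons, List.not_mem_nil, or_false, exists_eq_or_imp, exists_eq_left] at htA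
    have q1 := htA.1 1 (by simp)
    have q2 := htA.1 ⟨2, by lia⟩ (by simp [Fin.ext_iff])
    have q3 := htA.1 (Fin.last _) (by simp [Fin.ext_iff])
    simp only [Fin.ext_iff, Fin.val_last, Fin.val_one, Fin.val_zero] at hh q1 q2 q3
    lia
  have := hf t htA ht
  rw [← h1] at this
  exact this

/-- The map on simplices does not change, so only thinness is at stake. It is checked on the
triangle `(a, 0), (b, 1), (c, 2)` of `Δ[4] × Δ[2]`; every triangle over one of `satTri` is thin,
whatever its second coordinates. -/
lemma IsInftyBicategory.exists_saturation_extension (hC : C.IsInftyBicategory) {K : SSet.{u}}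
    (u : simplex 4 satTri ⟶ C.cotensor K) :
    ∃ l : simplex 4 satTri' ⟶ C.cotensor K, saturationMap ≫ l = u := by
  obtain ⟨v, rfl⟩ : ∃ v, toCotensor v = u := ⟨_, toCotensor_ofCotensor u⟩
  have key : ∀ (t : (Δ[4] : SSet.{u}) _⦋2⦌) (w : K _⦋2⦌), t ∈ satTri' →
      v.toHom.app _ (show ((simplex 4 satTri).tensor K).toSSet.obj _ from (t, w)) ∈ C.thin := by
    intro t w ht
    let f : Δ[4] ⊗ Δ[2] ⟶ C.toSSet :=
      (tensorMap (𝟙 (simplex 4 satTri)) (yonedaEquiv.symm w) ≫ v).toHom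
    have hf : ∀ (t₀ : (Δ[4] : SSet.{u}) _⦋2⦌), t₀ ∈ satTri → ∀ (a b c : SimplexVertex 4 2),
        (stdSimplex.vertexModel 4).toList t₀ = [a.1, b.1, c.1] →
        ThinAt (simplexModel 4 2) f a b c := by
      intro t₀ ht₀ a b c h s hs
      refine Hom.map_thin (tensorMap (𝟙 (simplex 4 satTri)) (yonedaEquiv.symm w) ≫ v) s (Or.inr ?_)
      have h' := (map_fst_toList_prod (stdSimplex.vertexModel 4) (stdSimplex.vertexModel 2)
        s).symm.trans (congrArg (List.map Prod.fst) hs)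
      rwa [(stdSimplex.vertexModel 4).toList_injective (h'.trans h.symm)]
    have hs := hC.hasLiftingProperty_saturationMap (toPoint C)
    have base : ∀ a b c : SimplexVertex 4 2,
        ThinAt (simplexModel 4 2) (f ≫ (toPoint C).toHom) a b c := fun _ _ _ _ _ => trivial
    have t024 := hf _ (Or.inl rfl)
    have t123 := hf _ (Or.inr (Or.inl rfl))
    have t013 := hf _ (Or.inr (Or.inr (Or.inl rfl)))
    have t134 := hf _ (Or.inr (Or.inr (Or.inr (Or.inl rfl))))
    have t012 := hf _ (Or.inr (Or.inr (Or.inr (Or.inr rfl))))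
    have le : ∀ {a b : Fin 5} {x y : Fin 3} (h : a ≤ b) (h' : x ≤ y), (a, x) ≤ (b, y) :=
      fun h h' => ⟨h, h'⟩
    have hw : ∀ (t₀ : (Δ[4] : SSet.{u}) _⦋2⦌) (a b c : Fin 5),
        (stdSimplex.vertexModel 4).toList t₀ = [a, b, c] →
        ThinAt (simplexModel 4 2) f (a, 0) (b, 1) (c, 2) →
        v.toHom.app _ (show ((simplex 4 satTri).tensor K).toSSet.obj _ from (t₀, w)) ∈ C.thin := by
      intro t₀ a b c ht₀ h
      have h' := h (t₀, topSimplex (op ⦋2⦌)) (by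
        have h₁ : (stdSimplex.vertexModel 4).equiv 2 t₀ 0 = a := (List.cons.inj ht₀).1
        have h₂ : (stdSimplex.vertexModel 4).equiv 2 t₀ 1 = b :=
          (List.cons.inj (List.cons.inj ht₀).2).1
        have h₃ : (stdSimplex.vertexModel 4).equiv 2 t₀ 2 = c :=
          (List.cons.inj (List.cons.inj (List.cons.inj ht₀).2).2).1
        subst h₁ h₂ h₃
        rfl)
      refine (congrArg (fun z => v.toHom.app _ (show ((simplex 4 satTri).tensor K).toSSet.obj _ from
        (t₀, z)) ∈ C.thin) ?_).mpr h'
      exact (yonedaEquiv_symm_topSimplex w).symm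
    rcases ht with ht | rfl | rfl
    · exact v.map_thin _ (Or.inr ht)
    -- The second coordinates of the chain may be any monotone extension of the prescribed ones:
    -- here `0, 0, 0, 1, 2`, and `0, 1, 1, 1, 2` for the triangle `014`.
    · exact hw _ 0 3 4 rfl (thinAt_saturation hs (a₁ := (1, 0)) (a₂ := (2, 0))
        (le (by decide) (by decide)) (le (by decide) (by decide)) (le (by decide) (by decide))
        (le (by decide) (by decide)) (t024 _ _ _ rfl) (t123 _ _ _ rfl) (t013 _ _ _ rfl)
        (t134 _ _ _ rfl) (t012 _ _ _ rfl) (base _ _ _) (base _ _ _)).1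
    · exact hw _ 0 1 4 rfl (thinAt_saturation hs (a₂ := (2, 1)) (a₃ := (3, 1))
        (le (by decide) (by decide)) (le (by decide) (by decide)) (le (by decide) (by decide))
        (le (by decide) (by decide)) (t024 _ _ _ rfl) (t123 _ _ _ rfl) (t013 _ _ _ rfl)
        (t134 _ _ _ rfl) (t012 _ _ _ rfl) (base _ _ _) (base _ _ _)).2
  refine ⟨toCotensor ⟨v.toHom, ?_⟩, ?_⟩
  · rintro ⟨t, w⟩ (ht | ht)
    · exact v.map_thin _ (Or.inl ht)
    · exact key t w ht
  · rw [← comp_toCotensor]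
    rfl

lemma IsInftyBicategory.cotensor (hC : C.IsInftyBicategory) (K : SSet.{u}) :
    (C.cotensor K).IsInftyBicategory where
  inner m j u := exists_cotensor_extension ∅ (fun k f hf _ =>
    hC.exists_inner_extension _ _ (by simp) (by simp) f hf) u (by simp)
  saturation u := hC.exists_saturation_extension u
  outer m hm u hu := exists_cotensor_extension {hornFirstEdge m} (fun k f hf he =>
    hC.exists_outer_extension (by lia) f hf (fun ε hε h => he ε hε
      (congrArg (· ∈ Λ[m + 2, 0].obj _) h ▸ (hornFirstEdge m).2) (Subtype.ext h))) u (by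
    rintro _ rfl
    exact hu)

end ScaledSSet

/-! ### Reversal and maximum on the walking isomorphism. -/

namespace SSet.coherentIso

open VertexModel

/-- The map to the walking isomorphism which is given on vertices by a function. -/
def ofVertexMap {X : SSet.{u}} {P : Type} [Preorder P] (M : VertexModel X P) (φ : P → Vertex) :
    X ⟶ coherentIso.{u} where
  app k := TypeCat.ofHom (fun x => (vertexModel.equiv k.unop.len).symm
    ⟨fun i => φ (M.equiv k.unop.len x i), fun _ _ _ => trivial⟩)
  naturality k k' f := by
    refine ConcreteCategory.hom_ext _ _ (fun x => ?_)
    obtain ⟨k⟩ := k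
    obtain ⟨k'⟩ := k'
    induction k using SimplexCategory.rec with | _ k
    induction k' using SimplexCategory.rec with | _ k'
    apply (vertexModel.equiv k').injective
    ext i
    exact congrArg φ (M.equiv_map f.unop x i)

lemma equiv_ofVertexMap {X : SSet.{u}} {P : Type} [Preorder P] (M : VertexModel X P)
    (φ : P → Vertex) {m : ℕ} (x : X _⦋m⦌) (i : Fin (m + 1)) :
    vertexModel.equiv m ((ofVertexMap M φ).app _ x) i = φ (M.equiv m x i) := rfl

/-- The map which interchanges the vertices. -/
def swap : coherentIso.{u} ⟶ coherentIso.{u} :=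
  ofVertexMap vertexModel (fun a => if a = v₀ then v₁ else v₀)

/-- The map which is the maximum on the vertices. -/
def join : coherentIso.{u} ⊗ coherentIso.{u} ⟶ coherentIso.{u} :=
  ofVertexMap (vertexModel.prod vertexModel) (fun a => if a.1 = v₀ then a.2 else v₁)

variable {X : SSet.{u}} {k : SimplexCategoryᵒᵖ} (x : X.obj k) (t : coherentIso.{u}.obj k)

lemma swap_const_x₀ : swap.app k ((SSet.const (X := X) x₀).app k x) =
    (SSet.const (X := X) x₁).app k x := by
  obtain ⟨k⟩ := k
  induction k using SimplexCategory.rec with | _ k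
  apply (vertexModel.equiv k).injective
  ext i
  rfl

lemma swap_const_x₁ : swap.app k ((SSet.const (X := X) x₁).app k x) =
    (SSet.const (X := X) x₀).app k x := by
  obtain ⟨k⟩ := k
  induction k using SimplexCategory.rec with | _ k
  apply (vertexModel.equiv k).injective
  ext i
  rfl

lemma join_const_x₀_left : join.app k ((SSet.const (X := X) x₀).app k x, t) = t := by
  obtain ⟨k⟩ := k
  induction k using SimplexCategory.rec with | _ k
  apply (vertexModel.equiv k).injective
  ext i
  rfl

lemma join_const_x₀_right : join.app k (t, (SSet.const (X := X) x₀).app k x) = t := by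
  obtain ⟨k⟩ := k
  induction k using SimplexCategory.rec with | _ k
  apply (vertexModel.equiv k).injective
  ext i
  refine (equiv_ofVertexMap _ _ _ _).trans ?_
  change (if vertexModel.equiv k t i = v₀ then v₀ else v₁) = _
  rcases eq_v₀_or_v₁ (vertexModel.equiv k t i) with h | h
  · rw [h, if_pos rfl]
  · rw [h, if_neg v₀_ne_v₁.symm]

lemma join_const_x₁_left : join.app k ((SSet.const (X := X) x₁).app k x, t) =
    (SSet.const (X := X) x₁).app k x := by
  obtain ⟨k⟩ := k
  induction k using SimplexCategory.rec with | _ k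
  apply (vertexModel.equiv k).injective
  ext i
  rfl

lemma join_const_x₁_right : join.app k (t, (SSet.const (X := X) x₁).app k x) =
    (SSet.const (X := X) x₁).app k x := by
  obtain ⟨k⟩ := k
  induction k using SimplexCategory.rec with | _ k
  apply (vertexModel.equiv k).injective
  ext i
  refine (equiv_ofVertexMap _ _ _ _).trans ?_
  change (if vertexModel.equiv k t i = v₀ then v₁ else v₁) = _
  rw [ite_self]
  rfl

/-- The vertex `x₁` and its degeneracies. -/
def top : coherentIso.{u}.Subcomplex := vertexModel.full {v₁}

variable {t}

lemma eq_of_mem_top (ht : t ∈ top.obj k) : t = (SSet.const (X := X) x₁).app k x := by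
  obtain ⟨k⟩ := k
  induction k using SimplexCategory.rec with | _ k
  apply vertexModel.toList_injective
  rw [top, mem_full] at ht
  have h2 : ∀ a ∈ vertexModel.toList ((SSet.const (X := X) (x₁.{u})).app (op ⦋k⦌) x), a = v₁ := by
    simp only [toList, List.mem_ofFn', Set.forall_mem_range]
    intro i
    rfl
  rw [List.eq_replicate_of_mem ht, List.eq_replicate_of_mem h2, length_toList, length_toList]

lemma const_mem_top : (SSet.const (X := X) x₁).app k x ∈ top.{u}.obj k := by
  obtain ⟨k⟩ := k
  induction k using SimplexCategory.rec with | _ k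
  rw [top, mem_full]
  simp only [toList, List.mem_ofFn', Set.forall_mem_range]
  intro i
  rfl

lemma notMem_top_of_mem_base (h : t ∈ base.obj k) : t ∉ top.obj k := by
  obtain ⟨k⟩ := k
  induction k using SimplexCategory.rec with | _ k
  intro h'
  rw [top, mem_full] at h'
  rw [base, mem_full] at h
  have hm : vertexModel.equiv k t 0 ∈ vertexModel.toList t := by
    simp [toList]
  exact v₀_ne_v₁ ((h _ hm).symm.trans (h' _ hm))

end SSet.coherentIso

/-! ### Composition of homotopies relative to a subobject. -/

namespace ScaledSSet

open SSet.coherentIso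

variable {X Y C : ScaledSSet.{u}}

/-- The inclusion of the end in the cylinder. -/
noncomputable def tensorι₁ (X : ScaledSSet.{u}) : X ⟶ X.tensor coherentIso := X.cylinderι x₁

/-- The projection. -/
def tensorFst (X : ScaledSSet.{u}) (K : SSet.{u}) : X.tensor K ⟶ X where
  toHom := CartesianMonoidalCategory.fst _ _
  map_thin _ ht := ht

/-- The map which is given by the maximum in the direction of the walking isomorphism. -/
def tensorJoin (X : ScaledSSet.{u}) :
    (X.tensor coherentIso).tensor coherentIso ⟶ X.tensor coherentIso where
  toHom := (α_ _ _ _).hom ≫ X.toSSet ◁ join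
  map_thin _ ht := ht

/-- The subcomplex of the cylinder generated by the cylinder on the image of a map and by both
ends. -/
abbrev cylinderBoundary (i : X ⟶ Y) : (Y.toSSet ⊗ coherentIso.{u}).Subcomplex :=
  (Subcomplex.range i.toHom).prod ⊤ ⊔
    ((⊤ : Y.toSSet.Subcomplex).prod base ⊔ (⊤ : Y.toSSet.Subcomplex).prod SSet.coherentIso.top)

lemma exists_desc_cylinderBoundary {Z : SSet.{u}} (i : X ⟶ Y) [Mono i.toHom]
    (f : X.toSSet ⊗ coherentIso ⟶ Z) (P Q : Y.toSSet ⟶ Z)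
    (hP : (tensorι₀ X).toHom ≫ f = i.toHom ≫ P) (hQ : (tensorι₁ X).toHom ≫ f = i.toHom ≫ Q) :
    ∃ φ : (cylinderBoundary i : SSet.{u}) ⟶ Z,
      (∀ k x t h, φ.app k ⟨(i.toHom.app k x, t), h⟩ = f.app k (x, t)) ∧
      (∀ k y t h, t ∈ base.obj k → φ.app k ⟨(y, t), h⟩ = P.app k y) ∧
      (∀ k y t h, t ∈ SSet.coherentIso.top.obj k → φ.app k ⟨(y, t), h⟩ = Q.app k y) := by
  let e := inv (Subcomplex.toRange i.toHom)
  have he : ∀ k x (h : i.toHom.app k x ∈ (Subcomplex.range i.toHom).obj k),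
      e.app k ⟨i.toHom.app k x, h⟩ = x := fun k x h =>
    congrArg (fun z => z.app k x) (IsIso.hom_inv_id (Subcomplex.toRange i.toHom))
  let w : ((Subcomplex.range i.toHom).prod (⊤ : coherentIso.{u}.Subcomplex) : SSet.{u}) ⟶
      X.toSSet ⊗ coherentIso :=
    CartesianMonoidalCategory.lift
      (Subcomplex.lift (Subcomplex.ι _ ≫ CartesianMonoidalCategory.fst _ _) (by
        rintro k _ ⟨z, rfl⟩
        exact z.2.1) ≫ e) (Subcomplex.ι _ ≫ CartesianMonoidalCategory.snd _ _)
  obtain ⟨ψ, h₁, h₂⟩ := Subcomplex.exists_desc_sup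
    ((⊤ : Y.toSSet.Subcomplex).prod base.{u}) ((⊤ : Y.toSSet.Subcomplex).prod SSet.coherentIso.top)
    (Subcomplex.ι _ ≫ CartesianMonoidalCategory.fst _ _ ≫ P)
    (Subcomplex.ι _ ≫ CartesianMonoidalCategory.fst _ _ ≫ Q)
    (fun k z h₁ h₂ => absurd h₂.2 (notMem_top_of_mem_base h₁.2))
  obtain ⟨φ, h₃, h₄⟩ := Subcomplex.exists_desc_sup
    ((Subcomplex.range i.toHom).prod (⊤ : coherentIso.{u}.Subcomplex)) _ (w ≫ f) ψ (by
    rintro k ⟨y, t⟩ ⟨⟨x, hx⟩, -⟩ h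
    obtain rfl : i.toHom.app k x = y := hx
    refine (congrArg (fun z => f.app k (show (X.toSSet ⊗ coherentIso).obj k from (z, t)))
      (he k x _)).trans ?_
    rcases h with h | h
    · refine Eq.trans ?_ (h₁ k _ h).symm
      obtain rfl := eq_of_mem_base (show t ∈ base.obj k from h.2) x
      exact congrArg (fun z => z.app k x) hP
    · refine Eq.trans ?_ (h₂ k _ h).symm
      obtain rfl := eq_of_mem_top x (show t ∈ SSet.coherentIso.top.obj k from h.2)
      exact congrArg (fun z => z.app k x) hQ)
  refine ⟨φ, fun k x t h => ?_, fun k y t h ht => ?_, fun k y t h ht => ?_⟩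
  · refine (h₃ k _ ⟨⟨x, rfl⟩, trivial⟩).trans ?_
    exact congrArg (fun z => f.app k (show (X.toSSet ⊗ coherentIso).obj k from (z, t)))
      (he k x _)
  · exact (h₄ k _ (Or.inl ⟨trivial, ht⟩)).trans (h₁ k _ ⟨trivial, ht⟩)
  · exact (h₄ k _ (Or.inr ⟨trivial, ht⟩)).trans (h₂ k _ ⟨trivial, ht⟩)

/-- The result is the reverse of `g` followed by `h`; on `X` both homotopies cancel. Consider the
square with directions `t` and `r`: the side `r = x₀` is `h(y, t)`, the side `t = x₀` is `g(y, r)`,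
the side `t = x₁` is constant at `h(y, x₁)`, and on `X` the square is `h(x, max(t, r))`. Homotopy
extension in the direction `r` yields the side `r = x₁`, where the maximum makes the homotopy
constant on `X`. -/
lemma IsInftyBicategory.exists_rel_homotopy (hC : C.IsInftyBicategory) (i : X ⟶ Y) [Mono i.toHom]
    (h g : Y.tensor coherentIso ⟶ C)
    (hg : tensorMap i (𝟙 _) ≫ h = tensorMap i (𝟙 _) ≫ g) (h₀ : tensorι₀ Y ≫ h = tensorι₀ Y ≫ g) :
    ∃ H : Y.tensor coherentIso ⟶ C,
      tensorMap i (𝟙 _) ≫ H = tensorFst X _ ≫ i ≫ tensorι₁ Y ≫ h ∧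
      tensorι₀ Y ≫ H = tensorι₁ Y ≫ g ∧ tensorι₁ Y ≫ H = tensorι₁ Y ≫ h := by
  have hg' : ∀ k x t, h.toHom.app k (show (Y.tensor coherentIso).toSSet.obj k from
      (i.toHom.app k x, t)) = g.toHom.app k (show (Y.tensor coherentIso).toSSet.obj k from
      (i.toHom.app k x, t)) := fun k x t =>
    congrArg (fun z => z.toHom.app k (show (X.tensor coherentIso).toSSet.obj k from (x, t))) hg
  let a := tensorJoin X ≫ tensorMap i (𝟙 _) ≫ h
  have ha : ∀ k x t r, a.toHom.app k
      (show ((X.tensor coherentIso).tensor coherentIso).toSSet.obj k from ((x, t), r)) =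
      h.toHom.app k (show (Y.tensor coherentIso).toSSet.obj k from
        (i.toHom.app k x, join.app k (t, r))) := fun _ _ _ _ => rfl
  let q := tensorFst Y coherentIso ≫ tensorι₁ Y ≫ h
  have hP : tensorι₀ X ≫ toCotensor a = i ≫ toCotensor g := by
    rw [← comp_toCotensor, ← comp_toCotensor]
    refine congrArg toCotensor (hom_ext_app (fun k z => ?_))
    refine Eq.trans ?_ (hg' k z.1 z.2)
    exact congrArg (fun w => h.toHom.app k (show (Y.tensor coherentIso).toSSet.obj k from
      (i.toHom.app k z.1, w))) (join_const_x₀_left z.1 z.2)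
  have hQ : tensorι₁ X ≫ toCotensor a = i ≫ toCotensor q := by
    rw [← comp_toCotensor, ← comp_toCotensor]
    refine congrArg toCotensor (hom_ext_app (fun k z => ?_))
    exact congrArg (fun w => h.toHom.app k (show (Y.tensor coherentIso).toSSet.obj k from
      (i.toHom.app k z.1, w))) (join_const_x₁_left z.1 z.2)
  obtain ⟨φ, h₁, h₂, h₃⟩ := exists_desc_cylinderBoundary i (toCotensor a).toHom
    (toCotensor g).toHom (toCotensor q).toHom (congrArg Hom.toHom hP) (congrArg Hom.toHom hQ)
  let φ' : flatten (cylinderBoundary i : SSet.{u}) ⟶ C.cotensor coherentIso := flattenHom φ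
  have e₁ : ∀ k x t hz r, (ofCotensor φ').toHom.app k
      (show ((flatten (cylinderBoundary i : SSet.{u})).tensor coherentIso).toSSet.obj k from
        (⟨(i.toHom.app k x, t), hz⟩, r)) = h.toHom.app k
        (show (Y.tensor coherentIso).toSSet.obj k from
        (i.toHom.app k x, join.app k (t, r))) := by
    intro k x t hz r
    refine (congrArg (fun z : (flat k).tensor coherentIso ⟶ C => z.toHom.app k
      (show ((flat k).tensor coherentIso).toSSet.obj k from (topSimplex k, r)))
      (h₁ k x t hz)).trans ?_
    exact congrArg (fun z => z.toHom.app k (show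
      ((X.tensor coherentIso).tensor coherentIso).toSSet.obj k from ((x, t), r)))
      (ofCotensor_toCotensor a)
  have e₂ : ∀ k y t hz r, t ∈ base.obj k → (ofCotensor φ').toHom.app k
      (show ((flatten (cylinderBoundary i : SSet.{u})).tensor coherentIso).toSSet.obj k from
        (⟨(y, t), hz⟩, r)) = g.toHom.app k
        (show (Y.tensor coherentIso).toSSet.obj k from (y, r)) := by
    intro k y t hz r ht
    refine (congrArg (fun z : (flat k).tensor coherentIso ⟶ C => z.toHom.app k
      (show ((flat k).tensor coherentIso).toSSet.obj k from (topSimplex k, r)))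
      (h₂ k y t hz ht)).trans ?_
    exact congrArg (fun z => z.toHom.app k (show (Y.tensor coherentIso).toSSet.obj k from (y, r)))
      (ofCotensor_toCotensor g)
  have e₃ : ∀ k y t hz r, t ∈ SSet.coherentIso.top.obj k → (ofCotensor φ').toHom.app k
      (show ((flatten (cylinderBoundary i : SSet.{u})).tensor coherentIso).toSSet.obj k from
        (⟨(y, t), hz⟩, r)) = (tensorι₁ Y ≫ h).toHom.app k y := by
    intro k y t hz r ht
    refine (congrArg (fun z : (flat k).tensor coherentIso ⟶ C => z.toHom.app k
      (show ((flat k).tensor coherentIso).toSSet.obj k from (topSimplex k, r)))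
      (h₃ k y t hz ht)).trans ?_
    exact congrArg (fun z => z.toHom.app k (show (Y.tensor coherentIso).toSSet.obj k from (y, r)))
      (ofCotensor_toCotensor q)
  let ι' : (cylinderBoundary i : SSet.{u}) ⟶ (Y.tensor coherentIso).toSSet :=
    (cylinderBoundary i).ι
  have : Mono ι' := inferInstanceAs (Mono (cylinderBoundary i).ι)
  obtain ⟨H, h₄, -, -⟩ := hC.isIsofibration.exists_lift (L := Y.tensor coherentIso)
    ι' (ofCotensor φ') h (toPoint _) (by
      refine hom_ext_app (fun k => ?_)
      rintro ⟨⟨y, t⟩, hz⟩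
      have hz' := hz
      rcases hz' with ⟨⟨x, hx⟩, -⟩ | ⟨-, ht⟩ | ⟨-, ht⟩
      · obtain rfl : i.toHom.app k x = y := hx
        refine (e₁ k x t hz _).trans ?_
        exact congrArg (fun w => h.toHom.app k (show (Y.tensor coherentIso).toSSet.obj k from
          (i.toHom.app k x, w))) (join_const_x₀_right x t)
      · obtain rfl := eq_of_mem_base (show t ∈ base.obj k from ht) y
        refine (e₂ k y _ hz _ ht).trans ?_
        exact congrArg (fun z => z.toHom.app k y) h₀.symm
      · obtain rfl := eq_of_mem_top y (show t ∈ SSet.coherentIso.top.obj k from ht)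
        exact e₃ k y _ hz _ ht)
    (Hom.ext (point_hom_ext _ _)) (Hom.ext (point_hom_ext _ _))
  have h₅ : ∀ k z hz, H.toHom.app k (show
      ((Y.tensor coherentIso).tensor coherentIso).toSSet.obj k from
        (z, (SSet.const (X := (Y.tensor coherentIso).toSSet) x₁).app k z)) =
      (ofCotensor φ').toHom.app k
        (show ((flatten (cylinderBoundary i : SSet.{u})).tensor coherentIso).toSSet.obj k from
        (⟨z, hz⟩, (SSet.const (X := (Y.tensor coherentIso).toSSet) x₁).app k z)) :=
    fun k z hz => congrArg (fun w => w.toHom.app k (show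
      ((flatten (cylinderBoundary i : SSet.{u})).tensor coherentIso).toSSet.obj k from
        (⟨z, hz⟩, (SSet.const (X := (Y.tensor coherentIso).toSSet) x₁).app k z))) h₄
  refine ⟨tensorι₁ _ ≫ H, hom_ext_app (fun k => ?_), hom_ext_app (fun k y => ?_),
    hom_ext_app (fun k y => ?_)⟩
  · rintro ⟨x, t⟩
    have hz : (show (Y.toSSet ⊗ coherentIso).obj k from (i.toHom.app k x, t)) ∈
      (cylinderBoundary i).obj k := Or.inl ⟨⟨x, rfl⟩, trivial⟩
    refine (h₅ k _ hz).trans ((e₁ k x t hz _).trans ?_)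
    exact congrArg (fun w => h.toHom.app k (show (Y.tensor coherentIso).toSSet.obj k from
      (i.toHom.app k x, w))) (join_const_x₁_right x t)
  · have ht := const_mem_base y
    have hz : (show (Y.toSSet ⊗ coherentIso).obj k from (y, (SSet.const x₀).app k y)) ∈
      (cylinderBoundary i).obj k := Or.inr (Or.inl ⟨trivial, ht⟩)
    exact (h₅ k _ hz).trans (e₂ k y _ hz _ ht)
  · have ht := const_mem_top y
    have hz : (show (Y.toSSet ⊗ coherentIso).obj k from (y, (SSet.const x₁).app k y)) ∈
      (cylinderBoundary i).obj k := Or.inr (Or.inr ⟨trivial, ht⟩)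
    exact (h₅ k _ hz).trans (e₃ k y _ hz _ ht)

end ScaledSSet

/-! ### Isofibrations are fibrations of the bicategorical model structure. -/

namespace ScaledSSet

open SSet.coherentIso

variable {X Y C E B : ScaledSSet.{u}} {p : E ⟶ B}

lemma mono_toHom (i : X ⟶ Y) [Mono i] : Mono i.toHom := by
  have : ∀ k, Mono (i.toHom.app k) := fun k => by
    rw [mono_iff_injective]
    intro x y h
    have h' : flatHom x ≫ i = flatHom y ≫ i := by
      apply Hom.ext
      apply (yonedaEquiv (n := k.unop)).injective
      refine (congrArg (i.toHom.app k) (yonedaEquiv_symm_topSimplex x)).trans (h.trans ?_)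
      exact (congrArg (i.toHom.app k) (yonedaEquiv_symm_topSimplex y)).symm
    rw [cancel_mono] at h'
    exact (yonedaEquiv (n := k.unop)).symm.injective (congrArg Hom.toHom h')
  exact NatTrans.mono_of_mono_app _

lemma IsIsofibration.exists_homotopy_lift (hp : IsIsofibration p) (i : X ⟶ Y) [Mono i.toHom]
    (a : X.tensor coherentIso ⟶ E) (b : Y ⟶ E) (v : Y.tensor coherentIso ⟶ B)
    (hab : tensorι₀ X ≫ a = i ≫ b) (hav : a ≫ p = tensorMap i (𝟙 _) ≫ v)
    (hbv : b ≫ p = tensorι₀ Y ≫ v) :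
    ∃ H : Y.tensor coherentIso ⟶ E,
      tensorMap i (𝟙 _) ≫ H = a ∧ tensorι₀ Y ≫ H = b ∧ H ≫ p = v := by
  let q : flatten X.toSSet ⟶ X := flattenHom (𝟙 _)
  obtain ⟨H, h₁, h₂, h₃⟩ := hp.exists_lift i.toHom (tensorMap q (𝟙 _) ≫ a) b v
    (hom_ext_app (fun k x => congrArg (fun z => z.toHom.app k x) hab))
    (hom_ext_app (fun k x => congrArg (fun z => z.toHom.app k x) hav)) hbv
  exact ⟨H, hom_ext_app (fun k x => congrArg (fun z => z.toHom.app k x) h₁), h₂, h₃⟩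

/-- Surjectivity on homotopy classes gives an extension up to homotopy, and homotopy extension along
`i` makes it strict. -/
lemma IsBicategoricalEquivalence.exists_extension {i : X ⟶ Y} [Mono i.toHom]
    (hi : IsBicategoricalEquivalence i) (hC : C.IsInftyBicategory) (f : X ⟶ C) :
    ∃ g : Y ⟶ C, i ≫ g = f := by
  obtain ⟨g, h, h₀, h₁⟩ := hi.surjective C hC f
  obtain ⟨H, h₂, -, -⟩ := hC.isIsofibration.exists_homotopy_lift i h g (toPoint _) h₀
    (Hom.ext (point_hom_ext _ _)) (Hom.ext (point_hom_ext _ _))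
  refine ⟨tensorι₁ Y ≫ H, ?_⟩
  rw [← h₁, ← h₂]
  rfl

/-- It suffices to extend the universal map, for `K = mapping X C`; its adjoint takes values in a
cotensor, which is an `∞`-bicategory. Every other extension is pulled back from this one, whence the
naturality in `K`. -/
lemma IsBicategoricalEquivalence.exists_section {i : X ⟶ Y} [Mono i.toHom]
    (hi : IsBicategoricalEquivalence i) (hC : C.IsInftyBicategory) :
    ∃ s : ∀ {K : SSet.{u}}, (X.tensor K ⟶ C) → (Y.tensor K ⟶ C),
      (∀ {K : SSet.{u}} (h : X.tensor K ⟶ C), tensorMap i (𝟙 K) ≫ s h = h) ∧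
      ∀ {K L : SSet.{u}} (f : L ⟶ K) (h : X.tensor K ⟶ C),
        s (tensorMap (𝟙 X) f ≫ h) = tensorMap (𝟙 Y) f ≫ s h := by
  obtain ⟨S, hS⟩ := hi.exists_extension (hC.cotensor (mapping X C))
    (toCotensor (ofMapping (𝟙 _)))
  refine ⟨fun h => tensorMap (𝟙 Y) (toMapping h) ≫ ofCotensor S, fun {K} h => ?_,
    fun f h => ?_⟩
  · have h₁ : tensorMap i (𝟙 _) ≫ ofCotensor S = ofMapping (𝟙 _) := by
      rw [← comp_ofCotensor, hS, ofCotensor_toCotensor]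
    have h₂ : tensorMap i (𝟙 K) ≫ tensorMap (𝟙 Y) (toMapping h) ≫ ofCotensor S =
        tensorMap (𝟙 X) (toMapping h) ≫ tensorMap i (𝟙 _) ≫ ofCotensor S := rfl
    rw [h₂, h₁, ← comp_ofMapping, Category.comp_id, ofMapping_toMapping]
  · dsimp only
    rw [toMapping_comp]
    rfl

/-- Extensions along `i` are unique up to homotopy relative to `X`: one extension `σ` serves as a
centre, to which all others are connected. -/
lemma IsBicategoricalEquivalence.exists_rel_homotopy {i : X ⟶ Y} [Mono i.toHom]
    (hi : IsBicategoricalEquivalence i) (hC : C.IsInftyBicategory) (f : X ⟶ C) :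
    ∃ σ : Y ⟶ C, ∀ α : Y ⟶ C, i ≫ α = f → ∃ H : Y.tensor coherentIso ⟶ C,
      tensorMap i (𝟙 _) ≫ H = tensorFst X _ ≫ f ∧ tensorι₀ Y ≫ H = σ ∧ tensorι₁ Y ≫ H = α := by
  obtain ⟨s, hs, hs'⟩ := hi.exists_section hC
  -- Defining `σ` through the constant homotopy allows naturality of `s` along the constant maps at
  -- `x₀` and `x₁` to identify both ends of `s a` below with `σ`.
  let σ : Y ⟶ C := tensorι₀ Y ≫ s (tensorFst X coherentIso ≫ f)
  have hσ : i ≫ σ = f := congrArg (tensorι₀ X ≫ ·) (hs (tensorFst X coherentIso ≫ f))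
  refine ⟨σ, fun α hα => ?_⟩
  -- This homotopy need not be constant on `X`: it restricts to a loop `a` at `f`. Its extension `s
  -- a` is a loop at `σ` on `Y`, and cancelling it against `h` gives a homotopy constant on `X`.
  obtain ⟨h, h₀, h₁⟩ := hi.injective C hC σ α ⟨tensorFst X coherentIso ≫ f, hσ.symm, hα.symm⟩
  let a : X.tensor coherentIso ⟶ C := tensorMap i (𝟙 _) ≫ h
  have ha₀ : tensorMap (𝟙 X) (SSet.const x₀) ≫ a = tensorFst X coherentIso ≫ f := by
    rw [← hσ, ← h₀]
    rfl
  have ha₁ : tensorMap (𝟙 X) (SSet.const x₁) ≫ a = tensorFst X coherentIso ≫ f := by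
    rw [← hα, ← h₁]
    rfl
  have hσ₀ : tensorι₀ Y ≫ s a = σ := by
    have := congrArg (tensorι₀ Y ≫ ·) (hs' (SSet.const x₀) a)
    rw [ha₀] at this
    exact this.symm
  have hσ₁ : tensorι₁ Y ≫ s a = σ := by
    have := congrArg (tensorι₀ Y ≫ ·) (hs' (SSet.const x₁) a)
    rw [ha₁] at this
    exact this.symm
  obtain ⟨H, h₂, h₃, h₄⟩ := hC.exists_rel_homotopy i h (s a) (hs a).symm (h₀.trans hσ₀.symm)
  exact ⟨H, h₂.trans (by rw [show tensorι₁ Y ≫ h = α from h₁, hα]), h₃.trans hσ₁, h₄.trans h₁⟩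

/-- Homotopy lifting with the constant homotopy on `X`: the other end of the lifted homotopy still
restricts to `u`. -/
lemma IsIsofibration.exists_transport (hp : IsIsofibration p) (i : X ⟶ Y) [Mono i.toHom]
    (u : X ⟶ E) (g : Y ⟶ E) (hg : i ≫ g = u) (v : Y.tensor coherentIso ⟶ B)
    (hv : tensorMap i (𝟙 _) ≫ v = tensorFst X _ ≫ u ≫ p) (hgv : g ≫ p = tensorι₀ Y ≫ v) :
    ∃ g' : Y ⟶ E, i ≫ g' = u ∧ g' ≫ p = tensorι₁ Y ≫ v := by
  obtain ⟨H, h₁, -, h₂⟩ := hp.exists_homotopy_lift i (tensorFst X _ ≫ u) g v hg.symm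
    ((Category.assoc _ _ _).trans hv.symm) hgv
  refine ⟨tensorι₁ Y ≫ H, congrArg (tensorι₁ X ≫ ·) h₁, ?_⟩
  rw [Category.assoc, h₂]

/-- Isofibrations between `∞`-bicategories are fibrations of the bicategorical model structure. -/
theorem IsIsofibration.bicategoricalFibrations (hp : IsIsofibration p)
    (hE : E.IsInftyBicategory) (hB : B.IsInftyBicategory) : bicategoricalFibrations p := by
  rintro X Y i ⟨_, hi⟩
  have := mono_toHom i
  refine ⟨fun {u v} sq => ?_⟩
  obtain ⟨σ, hσ⟩ := hi.exists_rel_homotopy hB (u ≫ p)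
  obtain ⟨g, hg⟩ := hi.exists_extension hE u
  obtain ⟨H, h₁, h₂, h₃⟩ := hσ (g ≫ p) (by rw [← hg, Category.assoc])
  -- `H` leads from `σ` to `g ≫ p`, so it is reversed by `swap` in order to move `g` to a lift of
  -- `σ`. The homotopy `K` then leads from `σ` to `v`.
  obtain ⟨g', hg', h₄⟩ := hp.exists_transport i u g hg (tensorMap (𝟙 Y) swap ≫ H)
    (by
      refine (congrArg (tensorMap (𝟙 X) swap ≫ ·) h₁).trans ?_
      rfl)
    (by
      rw [← h₃]
      refine hom_ext_app (fun k y => ?_)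
      exact congrArg (fun z => H.toHom.app k (show (Y.tensor coherentIso).toSSet.obj k from (y, z)))
        (swap_const_x₀ y).symm)
  have h₅ : g' ≫ p = σ := by
    rw [h₄, ← h₂]
    refine hom_ext_app (fun k y => ?_)
    exact congrArg (fun z => H.toHom.app k (show (Y.tensor coherentIso).toSSet.obj k from (y, z)))
      (swap_const_x₁ y)
  obtain ⟨K, k₁, k₂, k₃⟩ := hσ v sq.w.symm
  obtain ⟨l, hl, hl'⟩ := hp.exists_transport i u g' hg' K k₁ (h₅.trans k₂.symm)
  exact ⟨⟨l, hl, hl'.trans k₃⟩⟩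

end ScaledSSet

open ScaledSSet in
theorem lemma2p6 :
    -- weak fibrations: the core is an inner fibration, (co)cartesian edges stay (co)cartesian
    (∀ {E B : ScaledSSet.{u}} (p : E ⟶ B), ScaledSSet.IsWeakFibration p →
      HasLiftingProperty ScaledSSet.saturationMap p →
      InnerFibration (ScaledSSet.coreMap p) ∧
      (∀ e : E.toSSet _⦋1⦌, ScaledSSet.IsCartesianEdge p e →
        SSet.IsCartesianEdge (ScaledSSet.coreMap p) (E.coreEdge e)) ∧
      (∀ e : E.toSSet _⦋1⦌, ScaledSSet.IsCocartesianEdge p e →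
        SSet.IsCocartesianEdge (ScaledSSet.coreMap p) (E.coreEdge e))) ∧
    -- cores of 2-fibrations
    (∀ {E B : ScaledSSet.{u}} (p : E ⟶ B), HasLiftingProperty ScaledSSet.saturationMap p →
      (ScaledSSet.IsInnerCartesian2Fibration p ∨ ScaledSSet.IsOuterCartesian2Fibration p →
        SSet.IsCartesianFibration (ScaledSSet.coreMap p)) ∧
      (ScaledSSet.IsInnerCocartesian2Fibration p ∨ ScaledSSet.IsOuterCocartesian2Fibration p →
        SSet.IsCocartesianFibration (ScaledSSet.coreMap p))) ∧
    -- 2-fibrations between `∞`-bicategories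
    (∀ {E B : ScaledSSet.{u}} (p : E ⟶ B), E.IsInftyBicategory → B.IsInftyBicategory →
      (ScaledSSet.IsInnerCartesian2Fibration p ∨ ScaledSSet.IsOuterCartesian2Fibration p ∨
        ScaledSSet.IsInnerCocartesian2Fibration p ∨ ScaledSSet.IsOuterCocartesian2Fibration p) →
      ScaledSSet.bicategoricalFibrations p) := by
  refine ⟨fun {E B} p hp hs => ⟨innerFibration_coreMap hp.liftsInner hs,
    fun e he => isCartesianEdge_coreMap hp.liftsInner hs he.liftsRight,
    fun e he => isCocartesianEdge_coreMap hp.liftsInner hs he.liftsLeft⟩,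
    fun {E B} p hs => ⟨fun h => ?_, fun h => ?_⟩, fun {E B} p hE hB h => ?_⟩
  · rcases h with h | h
    · exact isCartesianFibration_coreMap h.weakFibration.liftsInner hs h.hasCartesianLifts
    · exact isCartesianFibration_coreMap h.weakFibration.liftsInner hs h.hasCartesianLifts
  · rcases h with h | h
    · exact isCocartesianFibration_coreMap (liftsInner_of_op h.weakFibration.liftsInner) hs
        h.hasCartesianLifts
    · exact isCocartesianFibration_coreMap (liftsInner_of_op h.weakFibration.liftsInner) hs
        h.hasCartesianLifts
  · exact (isIsofibration_of_2fibration hE h).bicategoricalFibrations hE hB
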